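/- Let $\alpha,\kappa\ge 0$, $L_R=1-\partial_x^2+\kappa\,\partial_x^4$, $L_D=1-\alpha\,\partial_x^2$, and consider on $\mathbb R$ the system form of the generalized Boussinesq equation $u_{tt}=(u-\alpha u_{xx}+u_{tt}-\kappa u_{xxtt}+f(u))_{xx}$, namely $$u_t=v_x,\qquad v_t=L_R^{-1}\big(L_D u+f(u)\big)_x. \tag{S}$$ Write $X_s=H^s(\mathbb R)\times H^{s+1}(\mathbb R)$ (real-valued functions), with norm $\|(u,v)\|_{X_s}=\|u\|_{H^s}+\|v\|_{H^{s+1}}$, and $\|v\|_{H^{1,1}}=\|(1-\partial_x^2)^{1/2}v\|_{L^1}$. Let $\ell=7$ if $\kappa=\alpha$ or $\alpha=0$, and $\ell=9$ otherwise, and for $s>\tfrac12$ put $$\mu=\frac1{2s+\ell-1}\ \text{ if } s\ge\tfrac32,\qquad \mu=\frac{2s-1}{2(2s+\ell-1)}\ \text{ if } s\le\tfrac32 .$$ **Theorem.** Let $m$ be an integer and $s,p\in\mathbb R$ with $m\ge s>\tfrac12$ and $p\mu>1$. Let $f\in C^m(\mathbb R)$ be real-valued with $|f(y)|\le B|y|^{p+1}$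 for all $y\in\mathbb R$ and some constant $B$. Assume that either $\alpha>0$ and $\kappa>0$, or $\alpha=\kappa=0$ and $f^{(j)}(y)=O(|y|^{p+1-j})$ as $y\to0$ for all integers $1\le j\le\lceil s\rceil$. Then there are constants $C>0$ and $\delta_0>0$, depending only on $\alpha,\kappa,p,s,m,f$, such that for every $0<\delta\le\delta_0$ and all $u_0\in H^s(\mathbb R)\cap L^1(\mathbb R)$, $v_0\in H^{s+1}(\mathbb R)\cap H^{1,1}(\mathbb R)$ with $$\|(u_0,v_0)\|_{X_s}+\|u_0\|_{L^1}+\|v_0\|_{H^{1,1}}<\delta$$ the following holds. The system (S) has a solution $(u,v)\in C^1([0,\infty);X_s)$ with $(u,v)(0)=(u_0,v_0)$, it is the only one in this class, and $$\sup_{t\ge0}\Big((1+t)^{\mu}\|u(t)\|_{L^\infty}+\|(u,v)(t)\|_{X_s}\Big)\le C\delta .$$ Moreover, with $F(y)=\int_0^y f(\tau)\,d\tau$, the function $F(u(t))$ is integrable for all $t\ge0$, and the energy $$E=\tfrac12\Big(\|v\|_{L^2}^2+\|v_x\|_{L^2}^2+\kappa\|v_{xx}\|_{L^2}^2+\|u\|_{L^2}^2+\alpha\|u_x\|_{L^2}^2\Big)+\int_{\mathbb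 R}F(u)\,dx\ \in(-\infty,\infty]$$ is conserved: $E(t)=E(0)$ for all $t\ge0$ (in particular, if it is finite at $t=0$, it stays finite). If $\kappa=0$ or $(u_0,v_0)\in X_{3/2}$ (which is automatic for $s\ge\tfrac32$), then the momentum $$Q=\int_{\mathbb R}\big(u\,v+u_xv_x+\kappa\,u_{xx}v_{xx}\big)\,dx$$ (defined through Plancherel's formula, by an absolutely convergent integral) is defined and conserved, $Q(t)=Q(0)$, for all $t\ge0$. -/

import Mathlib

open MeasureTheory Filter Topology FourierTransform
open scoped ENNReal

noncomputable section

namespace GBq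

/-- Real-valued square integrable functions on the line (as a.e. classes). -/
abbrev L2 : Type := Lp ℝ 2 (volume : Measure ℝ)

/-- The `L²` Fourier transform of a real-valued function. Mathlib's normalization is
`∫ exp (-2πi x ξ) g x dx`, so `∂ₓ` has the symbol `i (2πξ)`: everywhere below the frequency variable
of a symbol is `2 * π * ξ`. -/
def ft (g : L2) : Lp ℂ 2 (volume : Measure ℝ) :=
  𝓕 (Complex.ofRealCLM.compLp g)

/-- The norm of `H^s(ℝ)`, with value `⊤` outside of `H^s(ℝ)` (for `s ≥ 0`). -/
def hNorm (s : ℝ) (g : L2) : ℝ≥0∞ :=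
  (∫⁻ ξ : ℝ, ENNReal.ofReal ((1 + (2 * Real.pi * ξ) ^ 2) ^ s) * ‖ft g ξ‖ₑ ^ 2) ^ (1 / 2 : ℝ)

/-- The norm of `X_s = H^s(ℝ) × H^{s+1}(ℝ)`, with value `⊤` outside of `X_s`. -/
def xNorm (s : ℝ) (u v : L2) : ℝ≥0∞ := hNorm s u + hNorm (s + 1) v

/-- The norm `‖Λ g‖_{L¹}` of `H^{1,1}(ℝ)`, where `Λ` is the Fourier multiplier with symbol
`(1 + ξ²)^{1/2}`, for functions `g` with `Λ g ∈ L²(ℝ)` (the class `w = Λ g` is then unique). -/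
def h11Norm (g : L2) : ℝ≥0∞ :=
  ⨅ (w : L2) (_ : ∀ᵐ ξ : ℝ, ft w ξ = (Real.sqrt (1 + (2 * Real.pi * ξ) ^ 2) : ℂ) * ft g ξ),
    eLpNorm w 1 volume

/-- The curve `t ↦ (u t, v t)` belongs to `C¹([0,∞); X_s)` and has the derivative
`t ↦ (u' t, v' t)`, one-sided at `t = 0`. -/
structure IsC1 (s : ℝ) (u v u' v' : ℝ → L2) : Prop where
  mem : ∀ t : ℝ, 0 ≤ t → xNorm s (u t) (v t) < ⊤
  mem_deriv : ∀ t : ℝ, 0 ≤ t → xNorm s (u' t) (v' t) < ⊤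
  hasDeriv : ∀ t : ℝ, 0 ≤ t →
    Tendsto (fun τ : ℝ => xNorm s ((τ - t)⁻¹ • (u τ - u t) - u' t) ((τ - t)⁻¹ • (v τ - v t) - v' t))
      (𝓝[Set.Ici 0 \ {t}] t) (𝓝 0)
  continuous_deriv : ∀ t : ℝ, 0 ≤ t →
    Tendsto (fun τ : ℝ => xNorm s (u' τ - u' t) (v' τ - v' t)) (𝓝[Set.Ici 0] t) (𝓝 0)

/-- `w = ∂ₓ g`, in terms of Fourier transforms. -/
def IsDx (g w : L2) : Prop :=
  ∀ᵐ ξ : ℝ, ft w ξ = Complex.I * (2 * Real.pi * ξ : ℝ) * ft g ξ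

/-- `w = L_R⁻¹ ∂ₓ (L_D g + h)`, in terms of Fourier transforms, where
`L_R = 1 - ∂ₓ² + κ ∂ₓ⁴` and `L_D = 1 - α ∂ₓ²`. -/
def IsForce (α κ : ℝ) (g h w : L2) : Prop :=
  ∀ᵐ ξ : ℝ, ft w ξ =
    (Complex.I * (2 * Real.pi * ξ : ℝ)
      * ((1 + α * (2 * Real.pi * ξ) ^ 2 : ℝ) * ft g ξ + ft h ξ))
      / (1 + (2 * Real.pi * ξ) ^ 2 + κ * (2 * Real.pi * ξ) ^ 4 : ℝ)

/-- `(u, v) ∈ C¹([0,∞); X_s)` is a global solution, with initial value `(u₀, v₀)`, of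
`u_t = v_x`, `v_t = L_R⁻¹ (L_D u + f(u))_x`. -/
def IsSolution (α κ : ℝ) (f : ℝ → ℝ) (s : ℝ) (u₀ v₀ : L2) (u v : ℝ → L2) : Prop :=
  u 0 = u₀ ∧ v 0 = v₀ ∧ ∃ u' v' : ℝ → L2, IsC1 s u v u' v' ∧
    ∀ t : ℝ, 0 ≤ t → IsDx (v t) (u' t) ∧
      ∃ h : L2, (∀ᵐ x : ℝ, h x = f (u t x)) ∧ IsForce α κ (u t) h (v' t)

/-- `‖∂ₓ^k g‖²` in `L²(ℝ)`, with value `⊤` if `∂ₓ^k g` is not in `L²(ℝ)`. -/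
def derivSq (k : ℕ) (g : L2) : ℝ≥0∞ :=
  ∫⁻ ξ : ℝ, ENNReal.ofReal ((2 * Real.pi * ξ) ^ (2 * k)) * ‖ft g ξ‖ₑ ^ 2

/-- The primitive `F(y) = ∫₀^y f`. -/
def primitive (f : ℝ → ℝ) (y : ℝ) : ℝ := ∫ τ in (0 : ℝ)..y, f τ

/-- The energy
`E = ½ (‖v‖² + ‖v_x‖² + κ ‖v_xx‖² + ‖u‖² + α ‖u_x‖²) + ∫ F(u)`, with `L²` norms, in `(-∞, ∞]`.
Since `u_t = v_x`, one has `‖v‖ = ‖(-∂ₓ²)^{-1/2} u_t‖`, `‖v_x‖ = ‖u_t‖` and `‖v_xx‖ = ‖u_xt‖`. -/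
def energy (α κ : ℝ) (f : ℝ → ℝ) (u v : L2) : EReal :=
  (((derivSq 0 v + derivSq 1 v + ENNReal.ofReal κ * derivSq 2 v
      + derivSq 0 u + ENNReal.ofReal α * derivSq 1 u) / 2 : ℝ≥0∞) : EReal)
    + ((∫ x : ℝ, primitive f (u x) : ℝ) : EReal)

/-- The density, on the Fourier side, of the momentum
`Q = ∫ (u v + u_x v_x + κ u_xx v_xx) dx`. -/
def momentumDensity (κ : ℝ) (u v : L2) (ξ : ℝ) : ℝ :=
  (1 + (2 * Real.pi * ξ) ^ 2 + κ * (2 * Real.pi * ξ) ^ 4)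
    * (ft u ξ * (starRingEnd ℂ) (ft v ξ)).re

/-- The momentum `Q = ∫ (u v + u_x v_x + κ u_xx v_xx) dx`, by Plancherel's formula. Here
`v = ∂ₓ⁻¹ u_t`, `v_x = u_t` and `v_xx = u_xt`. -/
def momentum (κ : ℝ) (u v : L2) : ℝ := ∫ ξ : ℝ, momentumDensity κ u v ξ

/-- The exponent `ℓ` of the oscillatory integral estimate. -/
def ell (α κ : ℝ) : ℝ :=
  open scoped Classical in if κ = α ∨ α = 0 then 7 else 9

/-- The linear decay exponent `μ`. -/
def mu (α κ s : ℝ) : ℝ :=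
  open scoped Classical in
  if 3 / 2 ≤ s then 1 / (2 * s + ell α κ - 1) else (2 * s - 1) / (2 * (2 * s + ell α κ - 1))

end GBq

end

open MeasureTheory Filter Topology FourierTransform
open scoped ENNReal

noncomputable section

namespace GBq

/-! ### The Fourier transform of real L² functions, by duality with test functions -/

section
open scoped SchwartzMap ContDiff ComplexConjugate

/-! Put `z = T⁻¹ v`, where `T` has the symbol `(L_D / L_R)^{1/2}`. The system becomes `u' = P z`,
`z' = P u + S f(u)`, where `P` has the symbol `i φ`, with `φ(ζ) = ζ (L_D / L_R)^{1/2}`, and `S` has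
the symbol `i ζ (L_D L_R)^{-1/2}`. The combinations `a = u + z` and `b = u - z` then solve the
scalar equations `a' = P a + S f(u)` and `b' = -(P b + S f(u))`. If `α` and `κ` are both positive or
both zero, then `L_R` is comparable with `L_D (1 + ζ²)`. Hence `φ` is bounded, `P` is a bounded
operator and `T` gains exactly one derivative, so that `u` and `z` both live in `H^s`.

Linear decay. The second derivative `φ''` vanishes to order at most four at each point and is
bounded below by a multiple of `|ζ|⁻⁶` at infinity (`isPhase_phi`). Van der Corput's second
derivative test is applied below the frequency `|t|^{1/(2s+5)}`, and the tail of the `H^s` norm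
controls the rest. The result is the `L^∞` decay `|t|^{-ν}` with `ν = (2s-1)/(2(2s+5))`, for data in
`L¹ ∩ H^s` (`IsPhase.dispersive`, `Par.exists_decay`). For `s > 2` one uses the value `1/6` at `s =
2`, which is the rate allowed by a zero of order four. Always `ν ≥ μ`, and `p μ > 1` implies `(p -
1) ν > 1` (`mu_facts`).

Nonlinearity. If `‖u‖_∞ ≤ A` with `A` small, then `‖S f(u)‖_{H^s} ≤ C A^q ‖u‖_{H^s}` with `q ν > 1`
(`exists_smallNonlin`). The basis is a Moser estimate linear in the `H^s` norm (`exists_moser`),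
valid also for fractional `s`. It is obtained by comparing `f(u)` with `f` of a frequency cutoff of
`u`, to which the chain rule and Gagliardo–Nirenberg apply, and then integrating over the cutoff
frequency. When `α, κ > 0` the operator `S` gains two derivatives, so no Moser estimate is needed
for `s ≤ 2`. For `s > 2` the estimate is interpolated with the trivial `L²` bound of `f(u)`, which
carries the full power `A^p`.

Global existence. The set of curves with `‖u(t)‖_∞ ≤ ρ (1+t)^{-ν}` and `‖u(t)‖_{H^s} ≤ ρ` is
preserved by Duhamel's formula, because `A^q` with `A = ρ (1+t)^{-ν}` is integrable in time. The map
is contracted only in `L²`, with an exponential weight in time and with `f` truncated to a Lipschitz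
function. This suffices because the balls of the stronger norms are closed in `L²`; that property,
together with the seminorm inequalities, is isolated in `BallNorm`. The equation is thus an ordinary
differential equation in `L²`. Higher regularity in time follows from mean value inequalities for
`hNorm s` and from the continuity of composition in `H^s` (`compCont_of_contDiff`), and uniqueness
from that for Lipschitz equations.

Conservation laws. Frequency truncations make the formal computations legitimate. For the energy,
the error is the pairing of `f(u)` with the high frequencies of `P z`, which tends to zero in `L²`.
For the momentum, it is `⟨∂ₓ u_L, f(u)⟩` with `u_L` the part of `u` below frequency `L`. Since `⟨∂ₓ
u_L, f(u_L)⟩ = 0`, it is `O(L^{1-2s})` for `1/2 < s ≤ 1`, which tends to zero. -/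

/-- Complex-valued square integrable functions on the line. -/
abbrev CL2 : Type := Lp ℂ 2 (volume : Measure ℝ)

lemma locallyIntegrable_coe (f : CL2) : LocallyIntegrable f volume :=
  (Lp.memLp f).locallyIntegrable (by norm_num)

/-- A real test function, as a complex valued Schwartz function. -/
def testSchwartz (χ : ℝ → ℝ) (h1 : ContDiff ℝ ∞ χ) (h2 : HasCompactSupport χ) : 𝓢(ℝ, ℂ) :=
  HasCompactSupport.toSchwartzMap (f := fun x => (χ x : ℂ))
    (h2.comp_left (g := fun x : ℝ => (x : ℂ)) Complex.ofReal_zero)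
    (Complex.ofRealCLM.contDiff.comp h1)

lemma testSchwartz_apply (χ : ℝ → ℝ) (h1 : ContDiff ℝ ∞ χ) (h2 : HasCompactSupport χ) (x : ℝ) :
    testSchwartz χ h1 h2 x = (χ x : ℂ) := rfl

/-- The `L²` transform agrees with that of tempered distributions. Tested against Schwartz
functions, it reduces every later identity to classical transforms. -/
lemma integral_smul_fourier (f : CL2) (ψ : 𝓢(ℝ, ℂ)) :
    ∫ x, ψ x • (𝓕 f : CL2) x = ∫ x, (𝓕 ψ) x • f x := by
  have h := congrArg (fun T => T ψ) (Lp.fourier_toTemperedDistribution_eq f)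
  simp only [TemperedDistribution.fourier_apply, Lp.toTemperedDistribution_apply] at h
  exact h.symm

lemma integral_smul_fourierInv (f : CL2) (ψ : 𝓢(ℝ, ℂ)) :
    ∫ x, ψ x • (𝓕⁻ f : CL2) x = ∫ x, (𝓕⁻ ψ) x • f x := by
  have h := congrArg (fun T => T ψ) (Lp.fourierInv_toTemperedDistribution_eq f)
  simp only [TemperedDistribution.fourierInv_apply, Lp.toTemperedDistribution_apply] at h
  exact h.symm

lemma continuous_fourier_of_integrable {f : ℝ → ℂ} (hf : Integrable f) : Continuous (𝓕 f) :=
  VectorFourier.fourierIntegral_continuous Real.continuous_fourierChar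
    (by exact continuous_inner) hf

lemma integral_fourier_smul_flip {f g : ℝ → ℂ} (hf : Integrable f) (hg : Integrable g) :
    ∫ x, (𝓕 f) x • g x = ∫ x, f x • (𝓕 g) x := by
  have := VectorFourier.integral_fourierIntegral_smul_eq_flip (L := innerₗ ℝ)
    Real.continuous_fourierChar continuous_inner hf hg
  simpa using! this

/-- On `L¹ ∩ L²` the `L²` Fourier transform is the classical one. -/
theorem fourier_ae_eq (f : CL2) (hf : Integrable f) : (𝓕 f : CL2) =ᵐ[volume] 𝓕 (f : ℝ → ℂ) := by
  refine ae_eq_of_integral_contDiff_smul_eq (locallyIntegrable_coe _)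
    (continuous_fourier_of_integrable hf).locallyIntegrable fun χ h1 h2 => ?_
  have h := integral_smul_fourier f (testSchwartz χ h1 h2)
  have h3 := integral_fourier_smul_flip (testSchwartz χ h1 h2).integrable hf
  simp only [SchwartzMap.fourier_coe] at h
  rw [h3] at h
  simpa [testSchwartz_apply] using! h

/-- The inverse transform is the direct transform of the reflected function, so the same duality
argument applies after `x ↦ -x`. -/
theorem fourierInv_ae_eq (f : CL2) (hf : Integrable f) :
    (𝓕⁻ f : CL2) =ᵐ[volume] 𝓕⁻ (f : ℝ → ℂ) := by
  have hf' : Integrable (fun x => f (-x)) := hf.comp_neg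
  rw [Real.fourierInv_eq_fourier_comp_neg]
  refine ae_eq_of_integral_contDiff_smul_eq (locallyIntegrable_coe _)
    (continuous_fourier_of_integrable hf').locallyIntegrable fun χ h1 h2 => ?_
  have h := integral_smul_fourierInv f (testSchwartz χ h1 h2)
  have h3 := integral_fourier_smul_flip (testSchwartz χ h1 h2).integrable hf'
  simp only [SchwartzMap.fourierInv_coe, Real.fourierInv_eq_fourier_neg] at h
  have e := integral_neg_eq_self
    (fun x => (𝓕 (testSchwartz χ h1 h2 : ℝ → ℂ)) (-x) • f x) volume
  simp only [neg_neg] at e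
  rw [← e, h3] at h
  simpa [testSchwartz_apply] using! h

/-- Complex conjugation on `L²`. -/
def conjLp (f : CL2) : CL2 := (Complex.conjCLE : ℂ →L[ℝ] ℂ).compLp f

lemma conjLp_ae (f : CL2) : ∀ᵐ x, conjLp f x = conj (f x) := by
  filter_upwards [(Complex.conjCLE : ℂ →L[ℝ] ℂ).coeFn_compLp f] with x hx
  rw [conjLp, hx]; rfl

lemma fourier_ofReal_neg (χ : ℝ → ℝ) (w : ℝ) :
    conj (𝓕 (fun x => ((χ (-x) : ℝ) : ℂ)) w) = 𝓕 (fun x => (χ x : ℂ)) w := by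
  rw [Real.fourier_real_eq_integral_exp_smul, Real.fourier_real_eq_integral_exp_smul,
    ← integral_conj, ← integral_neg_eq_self]
  congr 1
  ext x
  simp only [smul_eq_mul, map_mul, neg_neg, Complex.conj_ofReal, ← Complex.exp_conj,
    Complex.conj_I]
  congr 2
  push_cast
  ring

/-- Against a real test function `χ`, conjugation passes through the integral and turns the
transform of `χ(-·)` into that of `χ`. -/
lemma fourier_conjLp (f : CL2) : ∀ᵐ ξ, (𝓕 (conjLp f) : CL2) ξ = conj ((𝓕 f : CL2) (-ξ)) := by
  have hm : MemLp (fun ξ => conj ((𝓕 f : CL2) (-ξ))) 2 volume := by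
    have h1 : MemLp (fun ξ => (𝓕 f : CL2) (-ξ)) 2 volume :=
      (Lp.memLp (𝓕 f : CL2)).comp_measurePreserving (Measure.measurePreserving_neg volume)
    exact h1.star
  refine ae_eq_of_integral_contDiff_smul_eq (locallyIntegrable_coe _)
    (hm.locallyIntegrable (by norm_num)) fun χ h1 h2 => ?_
  have h := integral_smul_fourier (conjLp f) (testSchwartz χ h1 h2)
  have h1' : ContDiff ℝ ∞ (fun x => χ (-x)) := h1.comp contDiff_neg
  have h2' : HasCompactSupport (fun x => χ (-x)) := h2.comp_homeomorph (Homeomorph.neg ℝ)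
  have h' := integral_smul_fourier f (testSchwartz _ h1' h2')
  have e1 : ∫ x, (testSchwartz χ h1 h2) x • (𝓕 (conjLp f) : CL2) x
      = ∫ x, χ x • (𝓕 (conjLp f) : CL2) x := by simp [testSchwartz_apply]
  rw [← e1, h]
  have e2 : ∫ x, χ x • conj ((𝓕 f : CL2) (-x))
      = conj (∫ x, (testSchwartz _ h1' h2') x • (𝓕 f : CL2) x) := by
    rw [← integral_conj, ← integral_neg_eq_self]
    simp [testSchwartz_apply]
  rw [e2, h', ← integral_conj]
  refine integral_congr_ae ?_
  filter_upwards [conjLp_ae f] with x hx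
  simp only [smul_eq_mul, map_mul, hx, SchwartzMap.fourier_coe]
  congr 1
  exact (fourier_ofReal_neg χ x).symm

/-- Complexification of a real `L²` function. -/
def toC (g : L2) : CL2 := Complex.ofRealCLM.compLp g

lemma toC_ae (g : L2) : ∀ᵐ x, toC g x = (g x : ℂ) := by
  filter_upwards [Complex.ofRealCLM.coeFn_compLp g] with x hx
  rw [toC, hx]; rfl

/-- Real part of a complex `L²` function. -/
def reL (f : CL2) : L2 := Complex.reCLM.compLp f

lemma reL_ae (f : CL2) : ∀ᵐ x, reL f x = (f x).re := by
  filter_upwards [Complex.reCLM.coeFn_compLp f] with x hx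
  rw [reL, hx]; rfl

lemma ft_eq (g : L2) : ft g = 𝓕 (toC g) := rfl

lemma toC_add (g h : L2) : toC (g + h) = toC g + toC h :=
  (Complex.ofRealCLM.compLpL 2 volume).map_add g h
lemma toC_smul (c : ℝ) (g : L2) : toC (c • g) = (c : ℂ) • toC g := by
  have := (Complex.ofRealCLM.compLpL 2 volume).map_smul c g
  change toC (c • g) = c • toC g at this
  rw [this]; exact (Complex.coe_smul c (toC g)).symm

lemma norm_toC (g : L2) : ‖toC g‖ = ‖g‖ := by
  rw [Lp.norm_def, Lp.norm_def]
  congr 1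
  refine eLpNorm_congr_norm_ae ?_
  filter_upwards [toC_ae g] with x hx
  rw [hx]; simp

lemma ft_add (g h : L2) : ft (g + h) = ft g + ft h := by
  rw [ft_eq, toC_add, FourierTransform.fourier_add]; rfl
lemma ft_smul (c : ℝ) (g : L2) : ft (c • g) = (c : ℂ) • ft g := by
  rw [ft_eq, toC_smul, FourierTransform.fourier_smul]; rfl
lemma ft_sub (g h : L2) : ft (g - h) = ft g - ft h := by
  rw [sub_eq_add_neg, ← neg_one_smul ℝ h, ft_add, ft_smul]; simp [sub_eq_add_neg]
lemma norm_ft (g : L2) : ‖ft g‖ = ‖g‖ := by rw [ft_eq, Lp.norm_fourier_eq, norm_toC]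

/-- The Fourier transform as a real-linear isometry. -/
def ftL : L2 →ₗᵢ[ℝ] CL2 where
  toFun := ft
  map_add' := ft_add
  map_smul' c g := by rw [ft_smul]; exact Complex.coe_smul c (ft g)
  norm_map' := norm_ft

lemma ft_injective : Function.Injective ft := ftL.injective
lemma ft_continuous : Continuous ft := ftL.continuous

lemma ft_ext {g h : L2} (H : ∀ᵐ ξ, ft g ξ = ft h ξ) : g = h := ft_injective (Lp.ext H)

lemma ft_add_ae (g h : L2) : ∀ᵐ ξ, ft (g + h) ξ = ft g ξ + ft h ξ := by
  rw [ft_add]; exact Lp.coeFn_add _ _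
lemma ft_sub_ae (g h : L2) : ∀ᵐ ξ, ft (g - h) ξ = ft g ξ - ft h ξ := by
  rw [ft_sub]; exact Lp.coeFn_sub _ _
lemma ft_smul_ae (c : ℝ) (g : L2) : ∀ᵐ ξ, ft (c • g) ξ = c * ft g ξ := by
  rw [ft_smul]; exact Lp.coeFn_smul _ _
lemma ft_zero_ae : ∀ᵐ ξ, ft 0 ξ = 0 := by
  have : ft 0 = 0 := ftL.map_zero
  rw [this]; exact Lp.coeFn_zero _ _ _

lemma inner_ft (g h : L2) : inner ℂ (ft g) (ft h) = ((inner ℝ g h : ℝ) : ℂ) := by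
  rw [ft_eq, ft_eq, Lp.inner_fourier_eq, L2.inner_def, L2.inner_def, ← integral_complex_ofReal]
  refine integral_congr_ae ?_
  filter_upwards [toC_ae g, toC_ae h] with x h1 h2
  rw [h1, h2]; simp

/-- A real function is fixed by conjugation. This symmetry decides which multipliers act on real
functions. -/
lemma ft_conj (g : L2) : ∀ᵐ ξ, ft g (-ξ) = conj (ft g ξ) := by
  have h : conjLp (toC g) = toC g := by
    refine Lp.ext ?_
    filter_upwards [conjLp_ae (toC g), toC_ae g] with x h1 h2
    rw [h1, h2, Complex.conj_ofReal]
  have h2 := fourier_conjLp (toC g)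
  rw [h, ← ft_eq] at h2
  filter_upwards [h2] with ξ hξ
  rw [hξ, Complex.conj_conj]

/-- A Hermitian multiplier acts on real functions. -/
theorem exists_mul {m : ℝ → ℂ} (herm : ∀ ξ, m (-ξ) = conj (m ξ)) (g : L2)
    (h : MemLp (fun ξ => m ξ * ft g ξ) 2 volume) : ∃ w : L2, ∀ᵐ ξ, ft w ξ = m ξ * ft g ξ := by
  set H : CL2 := h.toLp with hH
  set W : CL2 := 𝓕⁻ H with hW
  have hFW : 𝓕 W = H := by rw [hW]; exact FourierTransform.fourier_fourierInv_eq H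
  have hHae : ∀ᵐ ξ, H ξ = m ξ * ft g ξ := h.coeFn_toLp
  have hneg : ∀ᵐ ξ : ℝ, H (-ξ) = m (-ξ) * ft g (-ξ) :=
    (Measure.measurePreserving_neg (volume : Measure ℝ)).quasiMeasurePreserving.ae hHae
  -- The inverse transform `W` is a priori complex. The symmetries of `m` and of `ft g` make its
  -- transform Hermitian, hence `W` is real and equals its real part.
  have hc : conjLp W = W := by
    have : 𝓕 (conjLp W) = 𝓕 W := by
      refine Lp.ext ?_
      filter_upwards [fourier_conjLp W, hneg, hHae, ft_conj g] with ξ h1 h2 h3 h4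
      rw [h1, hFW, h2, herm, h4, h3]; simp
    have h3 := congrArg (fun x => (𝓕⁻ x : CL2)) this
    simpa only [FourierTransform.fourierInv_fourier_eq] using h3
  refine ⟨reL W, ?_⟩
  have : toC (reL W) = W := by
    refine Lp.ext ?_
    have h5 := conjLp_ae W
    rw [hc] at h5
    filter_upwards [toC_ae (reL W), reL_ae W, h5] with x h1 h2 h3
    rw [h1, h2]
    exact (Complex.conj_eq_iff_re.mp h3.symm)
  rw [ft_eq, this, hFW]
  exact hHae
end

/-! ### Sobolev norms, lower semicontinuous norms on L², and Fourier multipliers -/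

section
open scoped ComplexConjugate

/-- The square of the Japanese bracket of the frequency. -/
def jw (ξ : ℝ) : ℝ := 1 + (2 * Real.pi * ξ) ^ 2

lemma one_le_jw (ξ : ℝ) : 1 ≤ jw ξ := by unfold jw; nlinarith [sq_nonneg (2 * Real.pi * ξ)]
lemma jw_pos (ξ : ℝ) : 0 < jw ξ := lt_of_lt_of_le one_pos (one_le_jw ξ)
lemma jw_neg (ξ : ℝ) : jw (-ξ) = jw ξ := by unfold jw; ring
@[fun_prop] lemma continuous_jw : Continuous jw := by unfold jw; fun_prop

lemma continuous_jw_rpow (s : ℝ) : Continuous (fun ξ => jw ξ ^ s) :=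
  continuous_jw.rpow_const fun ξ => Or.inl (jw_pos ξ).ne'

/-- As an `L²` norm of a weighted transform, the Sobolev norm inherits Minkowski's inequality and
Fatou's lemma. -/
lemma hNorm_eq (s : ℝ) (g : L2) :
    hNorm s g = eLpNorm (fun ξ => ((jw ξ ^ (s / 2) : ℝ) : ℂ) * ft g ξ) 2 volume := by
  rw [hNorm, eLpNorm_eq_lintegral_rpow_enorm_toReal (by norm_num) (by norm_num)]
  simp only [ENNReal.toReal_ofNat, ENNReal.rpow_ofNat]
  congr 2
  ext ξ
  rw [enorm_mul, mul_pow ‖_‖ₑ]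
  congr 1
  have h0 := jw_pos ξ
  rw [← ofReal_norm ((jw ξ ^ (s / 2) : ℝ) : ℂ), Complex.norm_real, Real.norm_of_nonneg (by positivity),
    ← ENNReal.ofReal_pow (by positivity), ← Real.rpow_mul_natCast h0.le]
  congr 1
  rw [show s / 2 * ((2 : ℕ) : ℝ) = s by push_cast; ring]
  rfl

lemma aesm_ft (g : L2) : AEStronglyMeasurable (ft g) volume := Lp.aestronglyMeasurable _

lemma aesm_weight (s : ℝ) (g : L2) :
    AEStronglyMeasurable (fun ξ => ((jw ξ ^ (s / 2) : ℝ) : ℂ) * ft g ξ) volume :=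
  (Complex.continuous_ofReal.comp (continuous_jw_rpow _)).aestronglyMeasurable.mul (aesm_ft g)

lemma hNorm_zero (g : L2) : hNorm 0 g = ‖g‖ₑ := by
  rw [hNorm_eq]
  simp only [zero_div, Real.rpow_zero, Complex.ofReal_one, one_mul]
  rw [← ofReal_norm, ← norm_ft, Lp.norm_def, ENNReal.ofReal_toReal (Lp.eLpNorm_ne_top _)]

lemma hNorm_zero_right (s : ℝ) : hNorm s 0 = 0 := by
  rw [hNorm_eq]
  rw [eLpNorm_congr_ae (g := 0)]
  · simp
  · filter_upwards [ft_zero_ae] with ξ h; simp [h]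

/-- Comparison of Sobolev norms through a pointwise bound of the Fourier transforms. -/
lemma hNorm_le_of_ae {s s' C : ℝ} {w g : L2} (_ : 0 ≤ C)
    (h : ∀ᵐ ξ, jw ξ ^ (s / 2) * ‖ft w ξ‖ ≤ C * (jw ξ ^ (s' / 2) * ‖ft g ξ‖)) :
    hNorm s w ≤ ENNReal.ofReal C * hNorm s' g := by
  rw [hNorm_eq, hNorm_eq]
  refine eLpNorm_le_mul_eLpNorm_of_ae_le_mul ?_ 2
  filter_upwards [h] with ξ hξ
  have := jw_pos ξ
  rw [norm_mul, norm_mul, Complex.norm_real, Complex.norm_real,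
    Real.norm_of_nonneg (by positivity), Real.norm_of_nonneg (by positivity)]
  exact hξ

lemma hNorm_mono {s s' : ℝ} (h : s ≤ s') (g : L2) : hNorm s g ≤ hNorm s' g := by
  have := hNorm_le_of_ae (s := s) (s' := s') (C := 1) (w := g) (g := g) zero_le_one
    (Eventually.of_forall fun ξ => by
      rw [one_mul]
      exact mul_le_mul_of_nonneg_right
        (Real.rpow_le_rpow_of_exponent_le (one_le_jw ξ) (by linarith)) (norm_nonneg _))
  simpa using this

lemma enorm_le_hNorm {s : ℝ} (h : 0 ≤ s) (g : L2) : ‖g‖ₑ ≤ hNorm s g := by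
  rw [← hNorm_zero]; exact hNorm_mono h g

/-- Extended seminorms with closed balls. -/
structure BallNorm (N : L2 → ℝ≥0∞) : Prop where
  add_le : ∀ g h, N (g + h) ≤ N g + N h
  smul : ∀ (c : ℝ) g, N (c • g) = ‖c‖ₑ * N g
  closed : ∀ M, IsClosed {g | N g ≤ M}

lemma BallNorm.sub_le {N : L2 → ℝ≥0∞} (hN : BallNorm N) (g h : L2) : N (g - h) ≤ N g + N h := by
  rw [sub_eq_add_neg]
  refine (hN.add_le _ _).trans ?_
  rw [← neg_one_smul ℝ h, hN.smul]; simp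

lemma BallNorm.sub_comm {N : L2 → ℝ≥0∞} (hN : BallNorm N) (g h : L2) : N (g - h) = N (h - g) := by
  rw [← neg_sub, ← neg_one_smul ℝ, hN.smul]; simp

lemma BallNorm.convex {N : L2 → ℝ≥0∞} (hN : BallNorm N) (M : ℝ≥0∞) : Convex ℝ {g | N g ≤ M} := by
  intro g hg h hh a b ha hb hab
  simp only [Set.mem_ofPred_eq] at *
  calc N (a • g + b • h) ≤ ‖a‖ₑ * N g + ‖b‖ₑ * N h := by
        rw [← hN.smul, ← hN.smul]; exact hN.add_le _ _
    _ ≤ ‖a‖ₑ * M + ‖b‖ₑ * M := by gcongr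
    _ = M := by
        rw [← add_mul, ← ofReal_norm, ← ofReal_norm, Real.norm_of_nonneg ha,
          Real.norm_of_nonneg hb, ← ENNReal.ofReal_add ha hb, hab]; simp

/-- Minkowski's inequality for integrals. -/
theorem BallNorm.integral_le {N : L2 → ℝ≥0∞} (hN : BallNorm N) {a b : ℝ} (hab : a ≤ b)
    {G : ℝ → L2} {h : ℝ → ℝ} (hG : IntervalIntegrable G volume a b)
    (hh : ContinuousOn h (Set.Icc a b)) (hpos : ∀ τ ∈ Set.Icc a b, 0 < h τ)
    (hle : ∀ τ ∈ Set.Icc a b, N (G τ) ≤ ENNReal.ofReal (h τ)) :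
    N (∫ τ in a..b, G τ) ≤ ENNReal.ofReal (∫ τ in a..b, h τ) := by
  have N0 : N 0 = 0 := by have := hN.smul 0 0; simpa using this
  rcases hab.eq_or_lt with rfl | hab'
  · simp [N0]
  set H : ℝ := ∫ τ in a..b, h τ with hH
  have hint : IntervalIntegrable h volume a b := by
    apply ContinuousOn.intervalIntegrable; rwa [Set.uIcc_of_le hab]
  have hH0 : 0 < H := intervalIntegral.intervalIntegral_pos_of_pos_on hint
    (fun x hx => hpos x ⟨hx.1.le, hx.2.le⟩) hab'
  set ν : Measure ℝ := volume.restrict (Set.Ioc a b) with hν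
  have hintν : Integrable h ν := hint.1
  have haem : AEMeasurable (fun τ => ENNReal.ofReal (h τ / H)) ν :=
    (hintν.aemeasurable.div_const H).ennreal_ofReal
  have hlt : ∀ᵐ τ ∂ν, ENNReal.ofReal (h τ / H) < ∞ := by simp
  -- `P` is a probability measure, and the integral of `G` is the `P`-average of `(H / h) G`. All
  -- these values lie in the ball of radius `H`, which is closed and convex, so their average does
  -- too.
  set P : Measure ℝ := ν.withDensity (fun τ => ENNReal.ofReal (h τ / H)) with hP
  have hpos' : ∀ᵐ τ ∂ν, 0 < h τ := by
    refine (ae_restrict_iff' measurableSet_Ioc).2 (Eventually.of_forall fun τ hτ => ?_)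
    exact hpos τ ⟨hτ.1.le, hτ.2⟩
  have hprob : IsProbabilityMeasure P := by
    constructor
    rw [hP, withDensity_apply _ MeasurableSet.univ, Measure.restrict_univ,
      ← ofReal_integral_eq_lintegral_ofReal (hintν.div_const H)
        (by filter_upwards [hpos'] with τ hτ; exact (div_pos hτ hH0).le),
      integral_div, ← intervalIntegral.integral_of_le hab, ← hH, div_self hH0.ne']
    simp
  have hsm : ∀ᵐ τ ∂ν, (ENNReal.ofReal (h τ / H)).toReal • ((H / h τ) • G τ) = G τ := by
    filter_upwards [hpos'] with τ hτ
    rw [ENNReal.toReal_ofReal (div_pos hτ hH0).le, smul_smul]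
    rw [show h τ / H * (H / h τ) = 1 by field_simp, one_smul]
  have hGP : Integrable (fun τ => (H / h τ) • G τ) P := by
    rw [hP, integrable_withDensity_iff_integrable_smul₀' haem hlt]
    exact (integrable_congr hsm).2 hG.1
  have key := (hN.convex (ENNReal.ofReal H)).integral_mem (hN.closed _) (μ := P)
    (f := fun τ => (H / h τ) • G τ) ?_ hGP
  · rw [hP, integral_withDensity_eq_integral_toReal_smul₀ haem hlt, integral_congr_ae hsm] at key
    rw [intervalIntegral.integral_of_le hab]
    exact key
  · refine (withDensity_absolutelyContinuous ν _).ae_le ?_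
    refine (ae_restrict_iff' measurableSet_Ioc).2 (Eventually.of_forall fun τ hτ => ?_)
    have h1 := hpos τ ⟨hτ.1.le, hτ.2⟩
    simp only [Set.mem_ofPred_eq]
    rw [hN.smul, ← ofReal_norm, Real.norm_of_nonneg (div_pos hH0 h1).le]
    calc _ ≤ ENNReal.ofReal (H / h τ) * ENNReal.ofReal (h τ) := by
          gcongr; exact hle τ ⟨hτ.1.le, hτ.2⟩
      _ = ENNReal.ofReal H := by
          rw [← ENNReal.ofReal_mul (div_pos hH0 h1).le]; congr 1; field_simp

/-- Closedness of balls: the criterion along almost everywhere convergent sequences. -/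
lemma isClosed_of_seq {S : Set L2} (h : ∀ (g : ℕ → L2) (g₀ : L2), (∀ n, g n ∈ S) →
    Tendsto g atTop (𝓝 g₀) → (∀ᵐ x, Tendsto (fun n => g n x) atTop (𝓝 (g₀ x))) →
    (∀ᵐ x, Tendsto (fun n => ft (g n) x) atTop (𝓝 (ft g₀ x))) → g₀ ∈ S) : IsClosed S := by
  refine IsSeqClosed.isClosed fun g g₀ hg hlim => ?_
  obtain ⟨ns, hns, h1⟩ := (tendstoInMeasure_of_tendsto_Lp hlim).exists_seq_tendsto_ae
  have hlim' : Tendsto (fun n => ft (g (ns n))) atTop (𝓝 (ft g₀)) :=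
    (ft_continuous.tendsto g₀).comp (hlim.comp hns.tendsto_atTop)
  obtain ⟨ms, hms, h2⟩ := (tendstoInMeasure_of_tendsto_Lp hlim').exists_seq_tendsto_ae
  refine h (fun n => g (ns (ms n))) g₀ (fun n => hg _)
    (hlim.comp (hns.tendsto_atTop.comp hms.tendsto_atTop)) ?_ h2
  filter_upwards [h1] with x hx
  exact hx.comp hms.tendsto_atTop

/-- Closedness is Fatou's lemma along a subsequence whose Fourier transforms converge almost
everywhere. -/
theorem ballNorm_hNorm (s : ℝ) : BallNorm (hNorm s) where
  add_le g h := by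
    rw [hNorm_eq, hNorm_eq, hNorm_eq]
    refine le_trans (le_of_eq (eLpNorm_congr_ae ?_))
      (eLpNorm_add_le (aesm_weight s g) (aesm_weight s h) (by norm_num))
    filter_upwards [ft_add_ae g h] with ξ hξ
    simp [hξ, mul_add]
  smul c g := by
    rw [hNorm_eq, hNorm_eq, ← enorm_norm c, ← Complex.norm_real, enorm_norm, ← eLpNorm_const_smul]
    refine eLpNorm_congr_ae ?_
    filter_upwards [ft_smul_ae c g] with ξ hξ
    simp [hξ]; ring
  closed M := by
    refine isClosed_of_seq fun g g₀ hg _ _ hft => ?_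
    simp only [Set.mem_ofPred_eq] at *
    simp only [hNorm_eq] at *
    refine (Lp.eLpNorm_lim_le_liminf_eLpNorm (fun n => aesm_weight s (g n)) _ ?_).trans ?_
    · filter_upwards [hft] with ξ hξ
      exact hξ.const_mul _
    · exact (liminf_le_liminf (Eventually.of_forall hg)).trans (by simp)

theorem ballNorm_top : BallNorm (fun g : L2 => eLpNorm g ⊤ volume) where
  add_le g h := by
    rw [eLpNorm_congr_ae (Lp.coeFn_add g h)]
    exact eLpNorm_add_le (Lp.aestronglyMeasurable _) (Lp.aestronglyMeasurable _) le_top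
  smul c g := by
    rw [eLpNorm_congr_ae (Lp.coeFn_smul c g), eLpNorm_const_smul]
  closed M := by
    refine isClosed_of_seq fun g g₀ hg _ hae _ => ?_
    simp only [Set.mem_ofPred_eq] at *
    refine (Lp.eLpNorm_lim_le_liminf_eLpNorm (fun n => Lp.aestronglyMeasurable (g n)) _ hae).trans ?_
    exact (liminf_le_liminf (Eventually.of_forall hg)).trans (by simp)

/-- Bounded Hermitian symbols. -/
structure BSym where
  toFun : ℝ → ℂ
  meas : Measurable toFun
  herm : ∀ ξ, toFun (-ξ) = conj (toFun ξ)
  bdd : ∃ C, ∀ ξ, ‖toFun ξ‖ ≤ C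

instance : CoeFun BSym fun _ => ℝ → ℂ := ⟨BSym.toFun⟩

lemma BSym.exists_apply (m : BSym) (g : L2) : ∃ w : L2, ∀ᵐ ξ, ft w ξ = m ξ * ft g ξ := by
  obtain ⟨C, hC⟩ := m.bdd
  refine exists_mul m.herm g (MemLp.of_le_mul (Lp.memLp (ft g)) (c := C)
    (m.meas.aestronglyMeasurable.mul (aesm_ft g)) (Eventually.of_forall fun ξ => ?_))
  rw [norm_mul]
  exact mul_le_mul_of_nonneg_right (hC ξ) (norm_nonneg _)

lemma norm_le_of_ft {w g : L2} {C : ℝ} (_ : 0 ≤ C) (h : ∀ᵐ ξ, ‖ft w ξ‖ ≤ C * ‖ft g ξ‖) :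
    ‖w‖ ≤ C * ‖g‖ := by
  rw [← norm_ft, ← norm_ft]
  exact Lp.norm_le_mul_norm_of_ae_le_mul h

/-- The Fourier multiplier with a bounded Hermitian symbol. -/
def BSym.op (m : BSym) : L2 →L[ℝ] L2 :=
  LinearMap.mkContinuous
    { toFun := fun g => (m.exists_apply g).choose
      map_add' := fun g h => ft_ext <| by
        filter_upwards [(m.exists_apply (g + h)).choose_spec, ft_add_ae g h,
          (m.exists_apply g).choose_spec, (m.exists_apply h).choose_spec,
          ft_add_ae (m.exists_apply g).choose (m.exists_apply h).choose] with ξ h1 h2 h3 h4 h5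
        rw [h1, h2, h5, h3, h4, mul_add]
      map_smul' := fun c g => ft_ext <| by
        filter_upwards [(m.exists_apply (c • g)).choose_spec, ft_smul_ae c g,
          (m.exists_apply g).choose_spec,
          ft_smul_ae c (m.exists_apply g).choose] with ξ h1 h2 h3 h4
        rw [RingHom.id_apply, h1, h2, h4, h3]; ring }
    (max m.bdd.choose 0) (fun g => norm_le_of_ft (le_max_right _ _) (by
      filter_upwards [(m.exists_apply g).choose_spec] with ξ h
      simp only [LinearMap.coe_mk, AddHom.coe_mk]
      rw [h, norm_mul]
      gcongr
      exact (m.bdd.choose_spec ξ).trans (le_max_left _ _)))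

lemma BSym.ft_op (m : BSym) (g : L2) : ∀ᵐ ξ, ft (m.op g) ξ = m ξ * ft g ξ :=
  (m.exists_apply g).choose_spec

lemma BSym.hNorm_op_le (m : BSym) {s s' C : ℝ} (hC : 0 ≤ C)
    (h : ∀ ξ, jw ξ ^ (s / 2) * ‖m ξ‖ ≤ C * jw ξ ^ (s' / 2)) (g : L2) :
    hNorm s (m.op g) ≤ ENNReal.ofReal C * hNorm s' g := by
  refine hNorm_le_of_ae hC ?_
  filter_upwards [m.ft_op g] with ξ hξ
  rw [hξ, norm_mul, ← mul_assoc, ← mul_assoc]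
  exact mul_le_mul_of_nonneg_right (h ξ) (norm_nonneg _)

lemma BSym.hNorm_op_le' (m : BSym) {C : ℝ} (hC : 0 ≤ C) (h : ∀ ξ, ‖m ξ‖ ≤ C) (s : ℝ) (g : L2) :
    hNorm s (m.op g) ≤ ENNReal.ofReal C * hNorm s g :=
  m.hNorm_op_le hC (fun ξ => by
    rw [mul_comm]; exact mul_le_mul_of_nonneg_right (h ξ) (by have := jw_pos ξ; positivity)) g

lemma BSym.norm_op_le (m : BSym) {C : ℝ} (hC : 0 ≤ C) (h : ∀ ξ, ‖m ξ‖ ≤ C) (g : L2) :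
    ‖m.op g‖ ≤ C * ‖g‖ :=
  norm_le_of_ft hC (by
    filter_upwards [m.ft_op g] with ξ hξ
    rw [hξ, norm_mul]; exact mul_le_mul_of_nonneg_right (h ξ) (norm_nonneg _))

/-- Inversion formula for integrable Fourier transforms. -/
lemma ae_eq_fourierInv (g : L2) (hI : Integrable (ft g)) :
    ∀ᵐ x, (g x : ℂ) = 𝓕⁻ (ft g : ℝ → ℂ) x := by
  have h := fourierInv_ae_eq (ft g) hI
  have h2 : (𝓕⁻ (ft g) : CL2) = toC g := by rw [ft_eq]; exact FourierTransform.fourierInv_fourier_eq _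
  rw [h2] at h
  filter_upwards [h, toC_ae g] with x h1 h3
  rw [← h1, h3]

lemma eLpNorm_top_le_of_fourierInv (g : L2) (hI : Integrable (ft g)) {M : ℝ}
    (hM : ∀ x, ‖𝓕⁻ (ft g : ℝ → ℂ) x‖ ≤ M) : eLpNorm g ⊤ volume ≤ ENNReal.ofReal M := by
  rw [eLpNorm_exponent_top]
  refine eLpNormEssSup_le_of_ae_bound ?_
  filter_upwards [ae_eq_fourierInv g hI] with x hx
  have := hM x
  rwa [← hx, Complex.norm_real] at this

/-- Cauchy–Schwarz after inserting `jw ^ (-s/2) * jw ^ (s/2)`. The whole line gives the Sobolev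
embedding, the complement of an interval the decay of the high frequencies. -/
lemma lintegral_enorm_le (s : ℝ) (g : L2) (S : Set ℝ) :
    ∫⁻ ξ in S, ‖ft g ξ‖ₑ ≤
      (∫⁻ ξ in S, ENNReal.ofReal (jw ξ ^ (-s))) ^ (1 / 2 : ℝ) * hNorm s g := by
  have h1 : ∀ ξ, ‖ft g ξ‖ₑ
      = ENNReal.ofReal (jw ξ ^ (-s / 2)) * ‖((jw ξ ^ (s / 2) : ℝ) : ℂ) * ft g ξ‖ₑ := fun ξ => by
    have h0 := jw_pos ξ
    rw [enorm_mul, ← mul_assoc, ← ofReal_norm (((jw ξ ^ (s / 2) : ℝ) : ℂ)),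
      Complex.norm_real, Real.norm_of_nonneg (by positivity), ← ENNReal.ofReal_mul (by positivity),
      ← Real.rpow_add h0]
    simp [neg_div]
  calc ∫⁻ ξ in S, ‖ft g ξ‖ₑ
      = ∫⁻ ξ in S, ENNReal.ofReal (jw ξ ^ (-s / 2)) * ‖((jw ξ ^ (s / 2) : ℝ) : ℂ) * ft g ξ‖ₑ :=
        lintegral_congr fun ξ => h1 ξ
    _ ≤ (∫⁻ ξ in S, ENNReal.ofReal (jw ξ ^ (-s / 2)) ^ (2 : ℝ)) ^ (1 / 2 : ℝ)
        * (∫⁻ ξ in S, ‖((jw ξ ^ (s / 2) : ℝ) : ℂ) * ft g ξ‖ₑ ^ (2 : ℝ)) ^ (1 / 2 : ℝ) :=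
        ENNReal.lintegral_mul_le_Lp_mul_Lq _ Real.HolderConjugate.two_two
          (by have := continuous_jw_rpow (-s / 2); fun_prop) (aesm_weight s g).enorm.restrict
    _ ≤ _ := by
        refine mul_le_mul' (ENNReal.rpow_le_rpow (le_of_eq (lintegral_congr fun ξ => ?_))
          (by norm_num)) ?_
        · have h0 := jw_pos ξ
          rw [ENNReal.ofReal_rpow_of_nonneg (by positivity) (by norm_num), ← Real.rpow_mul h0.le]
          congr 2; ring
        · rw [hNorm_eq, eLpNorm_eq_lintegral_rpow_enorm_toReal (by norm_num) (by norm_num)]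
          simp only [ENNReal.toReal_ofNat]
          gcongr
          exact Measure.restrict_le_self

lemma integrable_jw_neg {s : ℝ} (hs : 1 / 2 < s) : Integrable (fun ξ => jw ξ ^ (-s)) := by
  have h := integrable_rpow_neg_one_add_norm_sq (E := ℝ) (μ := volume) (r := 2 * s)
    (by simp; linarith)
  have h2 := h.comp_mul_left' (R := 2 * Real.pi) (by positivity)
  refine h2.congr (Eventually.of_forall fun ξ => ?_)
  simp only [Real.norm_eq_abs, sq_abs, jw]
  congr 1; ring

/-- The Fourier transform of a function in `H^s`, `s > 1/2`, is integrable. -/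
theorem exists_lintegral_ft_le {s : ℝ} (hs : 1 / 2 < s) : ∃ C : ℝ, 0 < C ∧ ∀ g : L2,
    ∫⁻ ξ, ‖ft g ξ‖ₑ ≤ ENNReal.ofReal C * hNorm s g := by
  have hI := integrable_jw_neg hs
  have hnn : 0 ≤ ∫ ξ, jw ξ ^ (-s) := integral_nonneg fun ξ => by have := jw_pos ξ; positivity
  refine ⟨(∫ ξ, jw ξ ^ (-s)) ^ (1 / 2 : ℝ) + 1, by positivity, fun g => ?_⟩
  have h := lintegral_enorm_le s g Set.univ
  rw [Measure.restrict_univ] at h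
  refine h.trans ?_
  gcongr
  rw [← ofReal_integral_eq_lintegral_ofReal hI (Eventually.of_forall fun ξ => by
    have := jw_pos ξ; positivity), ENNReal.ofReal_rpow_of_nonneg hnn (by norm_num)]
  exact ENNReal.ofReal_le_ofReal (by linarith)

lemma integrable_ft {s : ℝ} (hs : 1 / 2 < s) {g : L2} (hg : hNorm s g < ⊤) : Integrable (ft g) := by
  obtain ⟨C, -, hC⟩ := exists_lintegral_ft_le hs
  exact ⟨aesm_ft g, (hC g).trans_lt (ENNReal.mul_lt_top (by simp) hg)⟩

lemma norm_fourierInv_le (h : ℝ → ℂ) (x : ℝ) : ‖𝓕⁻ h x‖ ≤ ∫ ξ, ‖h ξ‖ := by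
  rw [Real.fourierInv_eq']
  refine (norm_integral_le_integral_norm _).trans (le_of_eq ?_)
  congr 1; ext ξ
  rw [norm_smul, Complex.norm_exp_ofReal_mul_I, one_mul]

lemma integral_norm_le_of_lintegral {h : ℝ → ℂ} (hm : AEStronglyMeasurable h volume) {M : ℝ}
    (hM : 0 ≤ M) (hle : ∫⁻ ξ, ‖h ξ‖ₑ ≤ ENNReal.ofReal M) : ∫ ξ, ‖h ξ‖ ≤ M := by
  rw [integral_norm_eq_lintegral_enorm hm]
  exact ENNReal.toReal_le_of_le_ofReal hM hle

/-- Sobolev embedding `H^s ⊂ L^∞` for `s > 1/2`. -/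
theorem exists_sobolev {s : ℝ} (hs : 1 / 2 < s) : ∃ C : ℝ, 0 < C ∧ ∀ g : L2,
    eLpNorm g ⊤ volume ≤ ENNReal.ofReal C * hNorm s g := by
  obtain ⟨C, hC0, hC⟩ := exists_lintegral_ft_le hs
  refine ⟨C, hC0, fun g => ?_⟩
  by_cases hg : hNorm s g = ⊤
  · rw [hg, ENNReal.mul_top (by simpa using hC0)]; exact le_top
  have hfin : ENNReal.ofReal C * hNorm s g ≠ ⊤ := ENNReal.mul_ne_top (by simp) hg
  rw [← ENNReal.ofReal_toReal hfin]
  refine eLpNorm_top_le_of_fourierInv g (integrable_ft hs (lt_top_iff_ne_top.2 hg)) fun x => ?_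
  refine (norm_fourierInv_le _ x).trans (integral_norm_le_of_lintegral (aesm_ft g) (by positivity) ?_)
  rw [ENNReal.ofReal_toReal hfin]; exact hC g

/-- High frequency tails. -/
theorem exists_lintegral_tail_le {s : ℝ} (hs : 1 / 2 < s) : ∃ C : ℝ, 0 < C ∧ ∀ g : L2, ∀ N : ℝ,
    0 < N → ∫⁻ ξ in {ξ | N < |ξ|}, ‖ft g ξ‖ₑ
      ≤ ENNReal.ofReal (C * N ^ (1 / 2 - s)) * hNorm s g := by
  refine ⟨(2 / (2 * s - 1)) ^ (1 / 2 : ℝ), by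
    have : 0 < 2 * s - 1 := by linarith
    positivity, fun g N hN => ?_⟩
  have h21 : 0 < 2 * s - 1 := by linarith
  refine (lintegral_enorm_le s g _).trans ?_
  gcongr
  have hset : {ξ : ℝ | N < |ξ|} = Set.Iio (-N) ∪ Set.Ioi N := by
    ext ξ; simp only [Set.mem_ofPred_eq, lt_abs, Set.mem_union, Set.mem_Iio, Set.mem_Ioi]
    constructor <;> rintro (h | h)
    · exact Or.inr h
    · left; linarith
    · right; linarith
    · exact Or.inl h
  have hle : ∀ ξ ∈ Set.Ioi N, jw ξ ^ (-s) ≤ ξ ^ (-(2 * s)) := fun ξ hξ => by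
    have hξ0 : 0 < ξ := hN.trans hξ
    have h1 : ξ ^ (2 : ℝ) ≤ jw ξ := by
      rw [Real.rpow_two]; unfold jw
      nlinarith [Real.pi_gt_three, sq_nonneg ξ, mul_nonneg (sq_nonneg ξ) (sq_nonneg (Real.pi - 3)),
        mul_nonneg (sq_nonneg ξ) (by linarith [Real.pi_gt_three] : (0:ℝ) ≤ Real.pi - 3)]
    calc jw ξ ^ (-s) ≤ (ξ ^ (2 : ℝ)) ^ (-s) :=
          Real.rpow_le_rpow_of_nonpos (by positivity) h1 (by linarith)
      _ = ξ ^ (-(2 * s)) := by rw [← Real.rpow_mul hξ0.le]; congr 1; ring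
  have hpos : ∫⁻ ξ in Set.Ioi N, ENNReal.ofReal (jw ξ ^ (-s))
      ≤ ENNReal.ofReal (N ^ (1 - 2 * s) / (2 * s - 1)) := by
    have e : N ^ (1 - 2 * s) / (2 * s - 1) = ∫ ξ in Set.Ioi N, ξ ^ (-(2 * s)) := by
      rw [integral_Ioi_rpow_of_lt (by linarith) hN, neg_div, ← div_neg]; congr 1 <;> ring_nf
    rw [e, ofReal_integral_eq_lintegral_ofReal (integrableOn_Ioi_rpow_of_lt (by linarith) hN)
      ((ae_restrict_iff' measurableSet_Ioi).2 (Eventually.of_forall fun ξ hξ =>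
        Real.rpow_nonneg (hN.trans hξ).le _))]
    exact setLIntegral_mono' measurableSet_Ioi fun ξ hξ => ENNReal.ofReal_le_ofReal (hle ξ hξ)
  have hneg : ∫⁻ ξ in Set.Iio (-N), ENNReal.ofReal (jw ξ ^ (-s))
      = ∫⁻ ξ in Set.Ioi N, ENNReal.ofReal (jw ξ ^ (-s)) := by
    rw [← lintegral_indicator measurableSet_Iio, ← lintegral_indicator measurableSet_Ioi,
      ← lintegral_neg_eq_self]
    congr 1; ext ξ
    simp only [Set.indicator, Set.mem_Iio, Set.mem_Ioi, jw_neg, neg_lt_neg_iff]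
  have hsum : ∫⁻ ξ in {ξ | N < |ξ|}, ENNReal.ofReal (jw ξ ^ (-s))
      ≤ ENNReal.ofReal (2 / (2 * s - 1) * N ^ (1 - 2 * s)) := by
    rw [hset]
    refine (lintegral_union_le _ _ _).trans ?_
    rw [hneg]
    refine (add_le_add hpos hpos).trans ?_
    rw [← ENNReal.ofReal_add (by positivity) (by positivity)]
    exact ENNReal.ofReal_le_ofReal (le_of_eq (by ring))
  calc _ ≤ (ENNReal.ofReal (2 / (2 * s - 1) * N ^ (1 - 2 * s))) ^ (1 / 2 : ℝ) := by gcongr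
    _ = _ := by
      rw [ENNReal.ofReal_rpow_of_nonneg (by positivity) (by norm_num),
        Real.mul_rpow (by positivity) (by positivity), ← Real.rpow_mul hN.le]
      congr 3; ring
end

/-! ### Van der Corput's tests and the dispersive estimate -/

section
open scoped ComplexConjugate Interval

lemma norm_cexp_I (x : ℝ) : ‖Complex.exp (Complex.I * x)‖ = 1 := by
  rw [mul_comm]; exact Complex.norm_exp_ofReal_mul_I x

lemma hasDerivAt_cexp {Φ : ℝ → ℝ} {d x : ℝ} (h : HasDerivAt Φ d x) :
    HasDerivAt (fun y => Complex.exp (Complex.I * Φ y))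
      (Complex.exp (Complex.I * Φ x) * (Complex.I * d)) x :=
  ((h.ofReal_comp.const_mul Complex.I).cexp)

/-- First derivative test. -/
lemma vdc_first {Φ Φ' Φ'' : ℝ → ℝ} (h1 : ∀ x, HasDerivAt Φ (Φ' x) x)
    (h2 : ∀ x, HasDerivAt Φ' (Φ'' x) x) (hc : Continuous Φ'') {a b δ : ℝ} (hab : a ≤ b)
    (hδ : 0 < δ) (hΦ' : ∀ x ∈ Set.Icc a b, δ ≤ Φ' x) (hΦ'' : ∀ x ∈ Set.Icc a b, 0 ≤ Φ'' x) :
    ‖∫ x in a..b, Complex.exp (Complex.I * Φ x)‖ ≤ 2 / δ := by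
  have c1 : Continuous Φ' := continuous_iff_continuousAt.2 fun x => (h2 x).continuousAt
  have c0 : Continuous Φ := continuous_iff_continuousAt.2 fun x => (h1 x).continuousAt
  have hne : ∀ x ∈ Set.uIcc a b, Φ' x ≠ 0 := fun x hx => by
    rw [Set.uIcc_of_le hab] at hx; exact (hδ.trans_le (hΦ' x hx)).ne'
  have ce : Continuous fun x => Complex.exp (Complex.I * Φ x) := by fun_prop
  have hu : ∀ x ∈ Set.uIcc a b, HasDerivAt (fun y => ((Φ' y)⁻¹ : ℝ))
      (-(Φ'' x) / Φ' x ^ 2) x := fun x hx => (h2 x).inv (hne x hx)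
  have hcu' : ContinuousOn (fun x => -(Φ'' x) / Φ' x ^ 2) (Set.uIcc a b) :=
    (hc.neg.continuousOn).div (c1.pow 2).continuousOn fun x hx => pow_ne_zero 2 (hne x hx)
  have hv : ∀ x ∈ Set.uIcc a b, HasDerivAt (fun y => -Complex.I * Complex.exp (Complex.I * Φ y))
      (Complex.exp (Complex.I * Φ x) * Φ' x) x := fun x _ => by
    have := (hasDerivAt_cexp (h1 x)).const_mul (-Complex.I)
    have e0 : -Complex.I * (Complex.exp (Complex.I * Φ x) * (Complex.I * Φ' x))
        = Complex.exp (Complex.I * Φ x) * Φ' x := by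
      linear_combination (-(Complex.exp (Complex.I * Φ x) * Φ' x)) * Complex.I_sq
    rwa [e0] at this
  -- Write the exponential as `(1 / Φ') (-i exp(i Φ))'` and integrate by parts. As `1 / Φ'` is
  -- decreasing, the boundary terms and the total variation add up to `2 / Φ' a`.
  have key := intervalIntegral.integral_mul_deriv_eq_deriv_mul (fun x hx => (hu x hx).ofReal_comp) hv
    ((Complex.continuous_ofReal.comp_continuousOn hcu').intervalIntegrable)
    ((ce.mul (Complex.continuous_ofReal.comp c1)).intervalIntegrable a b)
  have e1 : ∫ x in a..b, ((Φ' x)⁻¹ : ℝ) * (Complex.exp (Complex.I * Φ x) * Φ' x)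
      = ∫ x in a..b, Complex.exp (Complex.I * Φ x) := by
    refine intervalIntegral.integral_congr fun x hx => ?_
    have : (Φ' x : ℂ) ≠ 0 := by exact_mod_cast hne x hx
    push_cast; field_simp
  rw [e1] at key
  rw [key]
  have hnb : 0 < Φ' b := hδ.trans_le (hΦ' b ⟨hab, le_rfl⟩)
  have hna : 0 < Φ' a := hδ.trans_le (hΦ' a ⟨le_rfl, hab⟩)
  have n1 : ∀ x, 0 < Φ' x →
      ‖(((Φ' x)⁻¹ : ℝ) : ℂ) * (-Complex.I * Complex.exp (Complex.I * Φ x))‖ = (Φ' x)⁻¹ := fun x hx => by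
    rw [norm_mul, norm_mul, norm_cexp_I, norm_neg, Complex.norm_I, Complex.norm_real,
      Real.norm_of_nonneg (by positivity)]; ring
  have n2 : ‖∫ x in a..b, ((-(Φ'' x) / Φ' x ^ 2 : ℝ) : ℂ) *
      (-Complex.I * Complex.exp (Complex.I * Φ x))‖ ≤ (Φ' a)⁻¹ - (Φ' b)⁻¹ := by
    have e2 : ∫ x in a..b, -(-(Φ'' x) / Φ' x ^ 2) = (Φ' a)⁻¹ - (Φ' b)⁻¹ := by
      rw [intervalIntegral.integral_neg, intervalIntegral.integral_eq_sub_of_hasDerivAt hu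
        hcu'.intervalIntegrable]; ring
    rw [← e2]
    refine intervalIntegral.norm_integral_le_of_norm_le hab (Eventually.of_forall fun x hx => ?_)
      hcu'.neg.intervalIntegrable
    rw [norm_mul, norm_mul, norm_cexp_I, norm_neg, Complex.norm_I, Complex.norm_real, Real.norm_eq_abs,
      abs_of_nonpos]
    · linarith
    · exact div_nonpos_of_nonpos_of_nonneg (by linarith [hΦ'' x ⟨hx.1.le, hx.2⟩]) (by positivity)
  calc _ ≤ (Φ' b)⁻¹ + (Φ' a)⁻¹ + ((Φ' a)⁻¹ - (Φ' b)⁻¹) := by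
        refine (norm_sub_le _ _).trans (add_le_add ((norm_sub_le _ _).trans ?_) n2)
        rw [n1 a hna, n1 b hnb]
    _ = 2 / Φ' a := by ring
    _ ≤ 2 / δ := by gcongr; exact hΦ' a ⟨le_rfl, hab⟩

/-- The reflection `x ↦ -x` changes the sign of `Φ'` and keeps the convexity of the phase. -/
lemma vdc_first_neg {Φ Φ' Φ'' : ℝ → ℝ} (h1 : ∀ x, HasDerivAt Φ (Φ' x) x)
    (h2 : ∀ x, HasDerivAt Φ' (Φ'' x) x) (hc : Continuous Φ'') {a b δ : ℝ} (hab : a ≤ b)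
    (hδ : 0 < δ) (hΦ' : ∀ x ∈ Set.Icc a b, Φ' x ≤ -δ) (hΦ'' : ∀ x ∈ Set.Icc a b, 0 ≤ Φ'' x) :
    ‖∫ x in a..b, Complex.exp (Complex.I * Φ x)‖ ≤ 2 / δ := by
  have := vdc_first (Φ := fun x => Φ (-x)) (Φ' := fun x => -Φ' (-x)) (Φ'' := fun x => Φ'' (-x))
    (a := -b) (b := -a) (δ := δ)
    (fun x => by simpa using! (h1 (-x)).comp x (hasDerivAt_neg x))
    (fun x => by simpa using! ((h2 (-x)).comp x (hasDerivAt_neg x)).neg)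
    (hc.comp continuous_neg) (by linarith) hδ
    (fun x hx => by have := hΦ' (-x) ⟨by linarith [hx.2], by linarith [hx.1]⟩; linarith)
    (fun x hx => hΦ'' (-x) ⟨by linarith [hx.2], by linarith [hx.1]⟩)
  rwa [intervalIntegral.integral_comp_neg (fun x => Complex.exp (Complex.I * Φ x)), neg_neg,
    neg_neg] at this

lemma norm_integral_cexp_le {Φ : ℝ → ℝ} {a b : ℝ} (hab : a ≤ b) :
    ‖∫ x in a..b, Complex.exp (Complex.I * Φ x)‖ ≤ b - a := by
  have := intervalIntegral.norm_integral_le_of_norm_le_const (a := a) (b := b) (C := 1)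
    (f := fun x => Complex.exp (Complex.I * Φ x)) (fun x _ => (norm_cexp_I _).le)
  rwa [abs_of_nonneg (by linarith), one_mul] at this

/-- Second derivative test, for convex phases. -/
lemma vdc_second_pos {Φ Φ' Φ'' : ℝ → ℝ} (h1 : ∀ x, HasDerivAt Φ (Φ' x) x)
    (h2 : ∀ x, HasDerivAt Φ' (Φ'' x) x) (hc : Continuous Φ'') {a b l : ℝ} (hab : a ≤ b)
    (hl : 0 < l) (hΦ'' : ∀ x ∈ Set.Icc a b, l ≤ Φ'' x) :
    ‖∫ x in a..b, Complex.exp (Complex.I * Φ x)‖ ≤ 6 / √l := by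
  have c1 : Continuous Φ' := continuous_iff_continuousAt.2 fun x => (h2 x).continuousAt
  have c0 : Continuous Φ := continuous_iff_continuousAt.2 fun x => (h1 x).continuousAt
  have ci : ∀ c d : ℝ, IntervalIntegrable (fun x => Complex.exp (Complex.I * Φ x)) volume c d :=
    fun c d => Continuous.intervalIntegrable (by fun_prop) c d
  have mono : ∀ x ∈ Set.Icc a b, ∀ y ∈ Set.Icc a b, x ≤ y → l * (y - x) ≤ Φ' y - Φ' x := by
    refine (convex_Icc a b).mul_sub_le_image_sub_of_le_deriv c1.continuousOn
      (fun x _ => (h2 x).differentiableAt.differentiableWithinAt) fun x hx => ?_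
    rw [(h2 x).deriv]; exact hΦ'' x (interior_subset hx)
  -- `x₀` is the zero of the increasing function `Φ'`, or the endpoint nearest to it if there is
  -- none in the interval. Then `|Φ'|` grows at least linearly away from `x₀`.
  obtain ⟨x₀, hx₀, hr, hl'⟩ : ∃ x₀ ∈ Set.Icc a b, (∀ x ∈ Set.Icc a b, x₀ < x → l * (x - x₀) ≤ Φ' x) ∧
      (∀ x ∈ Set.Icc a b, x < x₀ → Φ' x ≤ -(l * (x₀ - x))) := by
    have ha : a ∈ Set.Icc a b := ⟨le_rfl, hab⟩
    have hb : b ∈ Set.Icc a b := ⟨hab, le_rfl⟩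
    rcases le_total 0 (Φ' a) with h | h
    · exact ⟨a, ha, fun x hx hx' => by linarith [mono a ha x hx hx'.le],
        fun x hx hx' => absurd hx.1 (not_le.2 hx')⟩
    rcases le_total (Φ' b) 0 with h' | h'
    · exact ⟨b, hb, fun x hx hx' => absurd hx.2 (not_le.2 hx'),
        fun x hx hx' => by linarith [mono x hx b hb hx'.le]⟩
    · obtain ⟨x₀, hx₀, h0⟩ := intermediate_value_Icc hab c1.continuousOn ⟨h, h'⟩
      exact ⟨x₀, hx₀, fun x hx hx' => by linarith [mono x₀ hx₀ x hx hx'.le],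
        fun x hx hx' => by linarith [mono x hx x₀ hx₀ hx'.le]⟩
  have hs : 0 < √l := Real.sqrt_pos.2 hl
  have hss : √l * √l = l := Real.mul_self_sqrt hl.le
  -- This radius balances the two estimates: the central interval has length at most `2 h = 2 / √l`,
  -- and outside it `|Φ'| ≥ l h = √l`.
  set h := 1 / √l with hh
  have hh0 : 0 < h := by positivity
  have hlh : l * h = √l := by rw [hh, mul_one_div, div_eq_iff hs.ne', hss]
  set p := max a (x₀ - h) with hp
  set q := min b (x₀ + h) with hq
  have hap : a ≤ p := le_max_left _ _
  have hqb : q ≤ b := min_le_left _ _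
  have hpx : p ≤ x₀ := max_le hx₀.1 (by linarith)
  have hxq : x₀ ≤ q := le_min hx₀.2 (by linarith)
  have b1 : ‖∫ x in a..p, Complex.exp (Complex.I * Φ x)‖ ≤ 2 / √l := by
    rcases hap.eq_or_lt with h' | h'
    · rw [← h', intervalIntegral.integral_same, norm_zero]; positivity
    · have hpe : p = x₀ - h := by
        rcases max_choice a (x₀ - h) with h3 | h3
        · rw [← hp] at h3; linarith
        · exact h3
      refine vdc_first_neg h1 h2 hc hap hs (fun x hx => ?_) (fun x hx => ?_)
      · have := hl' x ⟨hx.1, by linarith [hx.2, hx₀.2]⟩ (by linarith [hx.2])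
        have : l * h ≤ l * (x₀ - x) := by gcongr; linarith [hx.2]
        linarith
      · exact hl.le.trans (hΦ'' x ⟨hx.1, by linarith [hx.2, hx₀.2]⟩)
  have b3 : ‖∫ x in q..b, Complex.exp (Complex.I * Φ x)‖ ≤ 2 / √l := by
    rcases hqb.eq_or_lt with h' | h'
    · rw [← h', intervalIntegral.integral_same, norm_zero]; positivity
    · have hqe : q = x₀ + h := by
        rcases min_choice b (x₀ + h) with h3 | h3
        · rw [← hq] at h3; linarith
        · exact h3
      refine vdc_first h1 h2 hc hqb hs (fun x hx => ?_) (fun x hx => ?_)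
      · have := hr x ⟨by linarith [hx.1, hx₀.1], hx.2⟩ (by linarith [hx.1])
        have : l * h ≤ l * (x - x₀) := by gcongr; linarith [hx.1]
        linarith
      · exact hl.le.trans (hΦ'' x ⟨by linarith [hx.1, hx₀.1], hx.2⟩)
  have b2 : ‖∫ x in p..q, Complex.exp (Complex.I * Φ x)‖ ≤ 2 / √l := by
    refine (norm_integral_cexp_le (hpx.trans hxq)).trans ?_
    have e1 : x₀ - h ≤ p := le_max_right _ _
    have e2 : q ≤ x₀ + h := min_le_right _ _
    have : 2 / √l = 2 * h := by rw [hh]; ring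
    linarith
  rw [← intervalIntegral.integral_add_adjacent_intervals (ci a p) (ci p b),
    ← intervalIntegral.integral_add_adjacent_intervals (ci p q) (ci q b)]
  refine (norm_add_le _ _).trans ((add_le_add b1 ((norm_add_le _ _).trans (add_le_add b2 b3))).trans ?_)
  rw [← add_div, ← add_div]; norm_num

/-- Second derivative test of van der Corput. -/
theorem vdc_second {Φ Φ' Φ'' : ℝ → ℝ} (h1 : ∀ x, HasDerivAt Φ (Φ' x) x)
    (h2 : ∀ x, HasDerivAt Φ' (Φ'' x) x) (hc : Continuous Φ'') {a b l : ℝ} (hab : a ≤ b)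
    (hl : 0 < l) (hΦ'' : ∀ x ∈ Set.Icc a b, l ≤ |Φ'' x|) :
    ‖∫ x in a..b, Complex.exp (Complex.I * Φ x)‖ ≤ 6 / √l := by
  have ha : a ∈ Set.Icc a b := ⟨le_rfl, hab⟩
  have hne : ∀ x ∈ Set.Icc a b, Φ'' x ≠ 0 := fun x hx h => by
    have := hΦ'' x hx; rw [h, abs_zero] at this; linarith
  have sgn : (∀ x ∈ Set.Icc a b, 0 < Φ'' x) ∨ (∀ x ∈ Set.Icc a b, Φ'' x < 0) := by
    by_contra hcon
    push Not at hcon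
    obtain ⟨⟨x, hx, hx0⟩, ⟨y, hy, hy0⟩⟩ := hcon
    obtain ⟨z, hz, hz0⟩ := isPreconnected_Icc.intermediate_value hx hy hc.continuousOn ⟨hx0, hy0⟩
    exact hne z hz hz0
  rcases sgn with h | h
  · exact vdc_second_pos h1 h2 hc hab hl fun x hx => by
      have := hΦ'' x hx; rwa [abs_of_pos (h x hx)] at this
  · have := vdc_second_pos (Φ := fun x => -Φ x) (Φ' := fun x => -Φ' x) (Φ'' := fun x => -Φ'' x)
      (fun x => (h1 x).neg) (fun x => (h2 x).neg) hc.neg hab hl fun x hx => by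
        have := hΦ'' x hx; rwa [abs_of_neg (h x hx)] at this
    have e : ∫ x in a..b, Complex.exp (Complex.I * (-Φ x : ℝ))
        = conj (∫ x in a..b, Complex.exp (Complex.I * Φ x)) := by
      rw [← intervalIntegral.intervalIntegral_conj]
      congr 1; ext x
      rw [← Complex.exp_conj]; simp
    rw [e, RCLike.norm_conj] at this
    exact this

/-- Van der Corput's test away from finitely many points. -/
theorem vdc_finset {Φ Φ' Φ'' : ℝ → ℝ} (h1 : ∀ x, HasDerivAt Φ (Φ' x) x)
    (h2 : ∀ x, HasDerivAt Φ' (Φ'' x) x) (hc : Continuous Φ'') {l ε : ℝ} (hl : 0 < l) (hε : 0 < ε)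
    (Z : Finset ℝ) : ∀ a b : ℝ, a ≤ b →
    (∀ x ∈ Set.Icc a b, (∀ z ∈ Z, ε ≤ |x - z|) → l ≤ |Φ'' x|) →
    ‖∫ x in a..b, Complex.exp (Complex.I * Φ x)‖ ≤ 3 ^ Z.card * (6 / √l + 2 * ε) := by
  have c0 : Continuous Φ := continuous_iff_continuousAt.2 fun x => (h1 x).continuousAt
  have ci : ∀ c d : ℝ, IntervalIntegrable (fun x => Complex.exp (Complex.I * Φ x)) volume c d :=
    fun c d => Continuous.intervalIntegrable (by fun_prop) c d
  have hs : 0 < √l := Real.sqrt_pos.2 hl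
  induction Z using Finset.induction_on with
  | empty =>
    intro a b hab h
    refine (vdc_second h1 h2 hc hab hl fun x hx => h x hx (by simp)).trans ?_
    simp; positivity
  | insert z Z hz ih =>
    intro a b hab h
    -- The interval `[p, q]` is the part of `[a, b]` within `ε` of `z`, clamped so as to stay
    -- inside; it is estimated by its length. The two outer pieces use the induction hypothesis,
    -- whence the factor `3` for each point.
    set p := min b (max a (z - ε)) with hp
    set q := max p (min b (z + ε)) with hq
    have hap : a ≤ p := le_min hab (le_max_left _ _)
    have hpq : p ≤ q := le_max_left _ _
    have hpb : p ≤ b := min_le_left _ _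
    have hqb : q ≤ b := max_le hpb (min_le_left _ _)
    have b0 : 0 ≤ 3 ^ Z.card * (6 / √l + 2 * ε) := by positivity
    have b1 : ‖∫ x in a..p, Complex.exp (Complex.I * Φ x)‖ ≤ 3 ^ Z.card * (6 / √l + 2 * ε) := by
      rcases le_total (z - ε) a with h' | h'
      · have : p = a := by rw [hp, max_eq_left h', min_eq_right hab]
        rw [this, intervalIntegral.integral_same, norm_zero]; exact b0
      · refine ih a p hap fun x hx hxZ => h x ⟨hx.1, hx.2.trans hpb⟩ fun w hw => ?_
        rcases Finset.mem_insert.1 hw with rfl | hw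
        · have : p ≤ w - ε := by rw [hp, max_eq_right h']; exact min_le_right _ _
          rw [abs_of_nonpos (by linarith [hx.2])]; linarith [hx.2]
        · exact hxZ w hw
    have b3 : ‖∫ x in q..b, Complex.exp (Complex.I * Φ x)‖ ≤ 3 ^ Z.card * (6 / √l + 2 * ε) := by
      rcases le_total b (z + ε) with h' | h'
      · have : q = b := by rw [hq, min_eq_left h', max_eq_right hpb]
        rw [this, intervalIntegral.integral_same, norm_zero]; exact b0
      · refine ih q b hqb fun x hx hxZ => h x ⟨by linarith [hx.1], hx.2⟩ fun w hw => ?_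
        rcases Finset.mem_insert.1 hw with rfl | hw
        · have : w + ε ≤ q := by rw [hq, min_eq_right h']; exact le_max_right _ _
          rw [abs_of_nonneg (by linarith [hx.1])]; linarith [hx.1]
        · exact hxZ w hw
    have b2 : ‖∫ x in p..q, Complex.exp (Complex.I * Φ x)‖ ≤ 3 ^ Z.card * (6 / √l + 2 * ε) := by
      refine (norm_integral_cexp_le hpq).trans ?_
      have e2 : q - p ≤ 2 * ε := by
        rcases le_total b (max a (z - ε)) with h3 | h3
        · have : p = b := min_eq_left h3
          linarith
        · have hpe : z - ε ≤ p := by rw [hp, min_eq_right h3]; exact le_max_right _ _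
          have : q ≤ p + 2 * ε := max_le (by linarith) ((min_le_right _ _).trans (by linarith))
          linarith
      have : (1 : ℝ) ≤ 3 ^ Z.card := one_le_pow₀ (by norm_num)
      have h6 : 0 < 6 / √l := by positivity
      nlinarith
    rw [← intervalIntegral.integral_add_adjacent_intervals (ci a p) (ci p b),
      ← intervalIntegral.integral_add_adjacent_intervals (ci p q) (ci q b),
      Finset.card_insert_of_notMem hz, pow_succ]
    refine (norm_add_le _ _).trans
      ((add_le_add b1 ((norm_add_le _ _).trans (add_le_add b2 b3))).trans (le_of_eq ?_))
    ring

/-- Phase functions whose second derivative degenerates at most to the fourth order at finitely many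
points and decays at most like `|x|⁻⁶` at infinity. -/
structure IsPhase (φ φ' φ'' : ℝ → ℝ) : Prop where
  d1 : ∀ x, HasDerivAt φ (φ' x) x
  d2 : ∀ x, HasDerivAt φ' (φ'' x) x
  cont : Continuous φ''
  lower : ∃ (Z : Finset ℝ) (c R : ℝ), 0 < c ∧ 0 < R ∧
    (∀ x, |x| ≤ R → ∃ z ∈ Z, c * |x - z| ^ 4 ≤ |φ'' x|) ∧
    (∀ x, R ≤ |x| → c * (|x| ^ 6)⁻¹ ≤ |φ'' x|)

/-- The decay rate of the linear flow on `H^s`, `1/2 < s ≤ 2`. -/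
def decay (s : ℝ) : ℝ := (2 * s - 1) / (2 * (2 * s + 5))

/-- The exponent of the frequency cut-off. -/
def cut (s : ℝ) : ℝ := 1 / (2 * s + 5)

/-- Let `t = |τ|` and remove intervals of radius `t^{-1/6}` around the degenerate points. In the
bounded region the phase then has second derivative at least `c t · t^{-4/6} = c t^{1/3}`; in the
outer region, up to frequency `t ^ cut s`, at least `c t^{1 - 6 cut s} = c t^{2 decay s}`. As `decay
s ≤ 1/6` for `s ≤ 2`, the outer lower bound is the weaker one, and the removed intervals are short
enough. The bound is uniform in the endpoints, as needed for inserting an amplitude. -/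
theorem IsPhase.oscillatory {φ φ' φ'' : ℝ → ℝ} (H : IsPhase φ φ' φ'') {s : ℝ} (hs : 1 / 2 < s)
    (hs2 : s ≤ 2) : ∃ C : ℝ, 0 < C ∧ ∀ τ x a b : ℝ, 1 ≤ |τ| → a ≤ b → -(|τ| ^ cut s) ≤ a →
      b ≤ |τ| ^ cut s →
      ‖∫ ζ in a..b, Complex.exp (Complex.I * (τ * φ ζ + x * ζ : ℝ))‖ ≤ C * |τ| ^ (-decay s) := by
  obtain ⟨Z, c, R, hc, hR, hZ, hinf⟩ := H.lower
  refine ⟨3 ^ Z.card * (6 / √c + 2), by positivity, fun τ x a b hτ hab ha hb => ?_⟩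
  set t := |τ| with ht
  have ht0 : 0 < t := by linarith
  have hd : decay s ≤ 1 / 6 := by
    unfold decay; rw [div_le_div_iff₀ (by linarith) (by norm_num)]; linarith
  have hcut : 1 - 6 * cut s = 2 * decay s := by
    unfold cut decay; field_simp; ring
  set ε := t ^ (-(1 / 6 : ℝ)) with hε
  have hε0 : 0 < ε := by positivity
  set l := c * t ^ (2 * decay s) with hl
  have hl0 : 0 < l := by positivity
  have key := vdc_finset (Φ := fun ζ => τ * φ ζ + x * ζ) (Φ' := fun ζ => τ * φ' ζ + x)
    (Φ'' := fun ζ => τ * φ'' ζ) (l := l) (ε := ε)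
    (fun ζ => by simpa using! ((H.d1 ζ).const_mul τ).add ((hasDerivAt_id ζ).const_mul x))
    (fun ζ => by simpa using! ((H.d2 ζ).const_mul τ).add_const x)
    (continuous_const.mul H.cont) hl0 hε0 Z a b hab (fun ζ hζ hsep => ?_)
  · refine key.trans ?_
    rw [mul_assoc]
    refine mul_le_mul_of_nonneg_left ?_ (by positivity)
    have e1 : √l = √c * t ^ decay s := by
      rw [hl, Real.sqrt_mul hc.le, Real.sqrt_eq_rpow (t ^ _), ← Real.rpow_mul ht0.le]
      congr 2; ring
    have e2 : ε ≤ t ^ (-decay s) := Real.rpow_le_rpow_of_exponent_le hτ (by linarith)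
    rw [e1, Real.rpow_neg ht0.le] at *
    have : 6 / (√c * t ^ decay s) = 6 / √c * (t ^ decay s)⁻¹ := by rw [div_mul_eq_div_div]; rfl
    rw [this]; linarith
  · rw [abs_mul, ← ht]
    rcases le_total |ζ| R with hζR | hζR
    · obtain ⟨z, hz, hle⟩ := hZ ζ hζR
      have h4 : ε ^ 4 ≤ |ζ - z| ^ 4 := by gcongr; exact hsep z hz
      have e4 : t * ε ^ 4 = t ^ (1 / 3 : ℝ) := by
        rw [hε, ← Real.rpow_mul_natCast ht0.le]
        nth_rewrite 1 [← Real.rpow_one t]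
        rw [← Real.rpow_add ht0]; norm_num
      calc l ≤ c * t ^ (1 / 3 : ℝ) := by
            rw [hl]; gcongr 1; exact Real.rpow_le_rpow_of_exponent_le hτ (by linarith)
        _ = t * (c * ε ^ 4) := by rw [← e4]; ring
        _ ≤ t * |φ'' ζ| := by gcongr; exact (by gcongr : c * ε ^ 4 ≤ c * |ζ - z| ^ 4).trans hle
    · have hζ0 : 0 < |ζ| := hR.trans_le hζR
      have hζt : |ζ| ≤ t ^ cut s := abs_le.2 ⟨by linarith [hζ.1], by linarith [hζ.2]⟩
      have e6 : t * ((t ^ cut s) ^ 6)⁻¹ = t ^ (2 * decay s) := by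
        rw [← Real.rpow_mul_natCast ht0.le, ← Real.rpow_neg ht0.le]
        nth_rewrite 1 [← Real.rpow_one t]
        rw [← Real.rpow_add ht0]; congr 1; push_cast; linarith
      calc l = t * (c * ((t ^ cut s) ^ 6)⁻¹) := by rw [hl, ← e6]; ring
        _ ≤ t * (c * (|ζ| ^ 6)⁻¹) := by gcongr
        _ ≤ t * |φ'' ζ| := by gcongr; exact hinf ζ hζR

/-- Amplitudes of bounded variation. -/
structure IsAmp (m m' : ℝ → ℂ) : Prop where
  d : ∀ x, HasDerivAt m (m' x) x
  cont : Continuous m'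
  bdd : ∃ C : ℝ, 0 < C ∧ (∀ x, ‖m x‖ ≤ C) ∧ ∀ x, ‖m' x‖ ≤ C * (1 + x ^ 2)⁻¹

/-- Integrate by parts against the primitive of the exponential, which is uniformly bounded by the
estimate without amplitude. The cost is the supremum and the total variation of the amplitude, both
finite. -/
theorem IsPhase.oscillatory_amp {φ φ' φ'' : ℝ → ℝ} (H : IsPhase φ φ' φ'') {m m' : ℝ → ℂ}
    (A : IsAmp m m') {s : ℝ} (hs : 1 / 2 < s)
    (hs2 : s ≤ 2) : ∃ C : ℝ, 0 < C ∧ ∀ τ x : ℝ, 1 ≤ |τ| →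
      ‖∫ ζ in -(|τ| ^ cut s)..(|τ| ^ cut s),
        Complex.exp (Complex.I * (τ * φ ζ + x * ζ : ℝ)) * m ζ‖ ≤ C * |τ| ^ (-decay s) := by
  obtain ⟨C, hC, hosc⟩ := H.oscillatory hs hs2
  obtain ⟨K, hK, hm, hm'⟩ := A.bdd
  have hpi := Real.pi_pos
  refine ⟨C * K + C * (K * Real.pi), by positivity, fun τ x hτ => ?_⟩
  set N := |τ| ^ cut s with hN
  have hN0 : 0 ≤ N := by positivity
  have hNN : -N ≤ N := by linarith
  set D := C * |τ| ^ (-decay s) with hD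
  have hD0 : 0 ≤ D := by positivity
  have cφ : Continuous φ := continuous_iff_continuousAt.2 fun x => (H.d1 x).continuousAt
  set e : ℝ → ℂ := fun ζ => Complex.exp (Complex.I * (τ * φ ζ + x * ζ : ℝ)) with he
  have ce : Continuous e := by rw [he]; fun_prop
  set I : ℝ → ℂ := fun ζ => ∫ y in -N..ζ, e y with hI
  have dI : ∀ ζ, HasDerivAt I (e ζ) ζ := fun ζ =>
    intervalIntegral.integral_hasDerivAt_right (ce.intervalIntegrable _ _)
      ce.aestronglyMeasurable.stronglyMeasurableAtFilter ce.continuousAt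
  have bI : ∀ ζ ∈ Set.Icc (-N) N, ‖I ζ‖ ≤ D := fun ζ hζ => hosc τ x (-N) ζ hτ hζ.1 le_rfl hζ.2
  have cI : Continuous I := continuous_iff_continuousAt.2 fun x => (dI x).continuousAt
  have key := intervalIntegral.integral_deriv_mul_eq_sub (a := -N) (b := N)
    (fun ζ _ => dI ζ) (fun ζ _ => A.d ζ) (ce.intervalIntegrable _ _) (A.cont.intervalIntegrable _ _)
  have cm : Continuous m := continuous_iff_continuousAt.2 fun x => (A.d x).continuousAt
  have hI0 : I (-N) = 0 := intervalIntegral.integral_same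
  have hadd : ∫ ζ in -N..N, (e ζ * m ζ + I ζ * m' ζ)
      = (∫ ζ in -N..N, e ζ * m ζ) + ∫ ζ in -N..N, I ζ * m' ζ :=
    intervalIntegral.integral_add ((ce.mul cm).intervalIntegrable _ _)
      ((cI.mul A.cont).intervalIntegrable _ _)
  rw [hadd, hI0, zero_mul, sub_zero] at key
  have e1 : ∫ ζ in -N..N, e ζ * m ζ = I N * m N - ∫ ζ in -N..N, I ζ * m' ζ := by
    rw [← key]; ring
  have i1 : Continuous fun ζ : ℝ => D * (K * (1 + ζ ^ 2)⁻¹) :=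
    continuous_const.mul (continuous_const.mul (Continuous.inv₀ (by fun_prop) fun x => by positivity))
  have b2 : ‖∫ ζ in -N..N, I ζ * m' ζ‖ ≤ D * (K * Real.pi) := by
    refine (intervalIntegral.norm_integral_le_of_norm_le (g := fun ζ => D * (K * (1 + ζ ^ 2)⁻¹)) hNN
      (Eventually.of_forall fun ζ hζ => ?_) (i1.intervalIntegrable _ _)).trans ?_
    · rw [norm_mul]
      exact mul_le_mul (bI ζ ⟨hζ.1.le, hζ.2⟩) (hm' ζ) (norm_nonneg _) hD0
    · rw [intervalIntegral.integral_const_mul, intervalIntegral.integral_const_mul,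
        integral_inv_one_add_sq]
      gcongr
      have := Real.arctan_lt_pi_div_two N
      have := Real.neg_pi_div_two_lt_arctan (-N)
      linarith
  rw [e1]
  refine (norm_sub_le _ _).trans ?_
  have b1 : ‖I N * m N‖ ≤ D * K := by
    rw [norm_mul]
    exact mul_le_mul (bI N ⟨hNN, le_rfl⟩) (hm N) (norm_nonneg _) hD0
  calc _ ≤ D * K + D * (K * Real.pi) := add_le_add b1 b2
    _ = _ := by rw [hD]; ring

/-- Dispersive estimate for multipliers `c₁ exp (i t φ) + c₂ exp (- i t φ)`. -/
theorem IsPhase.dispersive {φ φ' φ'' : ℝ → ℝ} (H : IsPhase φ φ' φ'') {m m' : ℝ → ℂ}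
    (A : IsAmp m m') {s : ℝ} (hs : 1 / 2 < s) (hs2 : s ≤ 2) : ∃ C : ℝ, 0 < C ∧
      ∀ (c₁ c₂ : ℂ), ‖c₁‖ ≤ 1 → ‖c₂‖ ≤ 1 → ∀ (t : ℝ), 0 ≤ t → ∀ g g₂ w : L2,
      (∀ᵐ ξ, ft g₂ ξ = m (2 * Real.pi * ξ) * ft g ξ) →
      (∀ᵐ ξ, ft w ξ = (c₁ * Complex.exp (Complex.I * (t * φ (2 * Real.pi * ξ) : ℝ))
        + c₂ * Complex.exp (Complex.I * (-t * φ (2 * Real.pi * ξ) : ℝ))) * ft g₂ ξ) →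
      eLpNorm w ⊤ volume ≤
        ENNReal.ofReal (C * (1 + t) ^ (-decay s)) * (eLpNorm g 1 volume + hNorm s g₂) := by
  obtain ⟨C₁, hC₁, hosc⟩ := H.oscillatory_amp A hs hs2
  obtain ⟨C₂, hC₂, htail⟩ := exists_lintegral_tail_le hs
  obtain ⟨C₃, hC₃, hall⟩ := exists_lintegral_ft_le hs
  have hpi := Real.pi_pos
  have hd0 : 0 < decay s := by unfold decay; apply div_pos <;> linarith
  set K := (2 * Real.pi) ^ (s - 1 / 2) with hK
  set C := 2 ^ decay s * (2 * C₁ + 2 * C₂ * K + 2 * C₃) with hC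
  refine ⟨C, by positivity, fun c₁ c₂ hc₁ hc₂ t ht g g₂ w hg₂ hw => ?_⟩
  have hCp : 0 < C * (1 + t) ^ (-decay s) := by positivity
  by_cases hS : hNorm s g₂ = ⊤
  · rw [hS, add_top, ENNReal.mul_top (by simpa using hCp)]; exact le_top
  by_cases hG : eLpNorm g 1 volume = ⊤
  · rw [hG, top_add, ENNReal.mul_top (by simpa using hCp)]; exact le_top
  set S := (hNorm s g₂).toReal with hSd
  set a := (eLpNorm g 1 volume).toReal with had
  have hSe : hNorm s g₂ = ENNReal.ofReal S := (ENNReal.ofReal_toReal hS).symm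
  have hS0 : 0 ≤ S := ENNReal.toReal_nonneg
  have ha0 : 0 ≤ a := ENNReal.toReal_nonneg
  rw [← ENNReal.ofReal_toReal hG, hSe, ← ENNReal.ofReal_add ha0 hS0, ← ENNReal.ofReal_mul hCp.le]
  set E : ℝ → ℂ := fun ξ => c₁ * Complex.exp (Complex.I * (t * φ (2 * Real.pi * ξ) : ℝ))
        + c₂ * Complex.exp (Complex.I * (-t * φ (2 * Real.pi * ξ) : ℝ)) with hE
  have hE2 : ∀ ξ, ‖E ξ‖ ≤ 2 := fun ξ => by
    refine (norm_add_le _ _).trans ?_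
    rw [norm_mul, norm_mul, norm_cexp_I, norm_cexp_I]; linarith
  have hwle : ∀ᵐ ξ, ‖ft w ξ‖ₑ ≤ 2 * ‖ft g₂ ξ‖ₑ := by
    filter_upwards [hw] with ξ hξ
    rw [hξ, enorm_mul]
    gcongr
    rw [← ofReal_norm, ← ENNReal.ofReal_ofNat]
    exact ENNReal.ofReal_le_ofReal (hE2 ξ)
  have hwL : ∀ A : Set ℝ, ∫⁻ ξ in A, ‖ft w ξ‖ₑ ≤ 2 * ∫⁻ ξ in A, ‖ft g₂ ξ‖ₑ := fun A => by
    rw [← lintegral_const_mul' _ _ (by simp)]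
    exact lintegral_mono_ae (ae_restrict_of_ae hwle)
  have hfin2 := hall g₂
  rw [hSe, ← ENNReal.ofReal_mul hC₃.le] at hfin2
  have hw1 : ∫⁻ ξ, ‖ft w ξ‖ₑ ≤ ENNReal.ofReal (2 * (C₃ * S)) := by
    have := hwL Set.univ
    rw [Measure.restrict_univ] at this
    refine this.trans ?_
    rw [ENNReal.ofReal_mul (by norm_num), ENNReal.ofReal_ofNat]; gcongr
  have hIw : Integrable (ft w) := ⟨aesm_ft w, hw1.trans_lt ENNReal.ofReal_lt_top⟩
  refine eLpNorm_top_le_of_fourierInv w hIw fun x => ?_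
  have h1t : 0 < 1 + t := by linarith
  rcases lt_or_ge t 1 with ht1 | ht1
  -- For `t < 1` no decay is needed: the Sobolev embedding suffices, and `1 + t < 2` is paid for by
  -- the factor `2 ^ decay s`.
  · refine (norm_fourierInv_le _ x).trans
      ((integral_norm_le_of_lintegral (aesm_ft w) (by positivity) hw1).trans ?_)
    have e1 : (1 : ℝ) ≤ 2 ^ decay s * (1 + t) ^ (-decay s) := by
      rw [Real.rpow_neg h1t.le, ← div_eq_mul_inv, one_le_div (by positivity)]
      exact Real.rpow_le_rpow h1t.le (by linarith) hd0.le
    have e2 : C * (1 + t) ^ (-decay s) * (a + S)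
        = (2 ^ decay s * (1 + t) ^ (-decay s)) * ((2 * C₁ + 2 * C₂ * K + 2 * C₃) * (a + S)) := by
      rw [hC]; ring
    rw [e2]
    refine le_trans ?_ (le_mul_of_one_le_left (by positivity) e1)
    nlinarith [mul_nonneg hC₁.le ha0, mul_nonneg hC₁.le hS0, mul_nonneg hC₃.le ha0,
      mul_nonneg (mul_nonneg hC₂.le (by positivity : 0 ≤ K)) ha0,
      mul_nonneg (mul_nonneg hC₂.le (by positivity : 0 ≤ K)) hS0]
  · have ht0 : 0 < t := by linarith
    set N := t ^ cut s with hN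
    have hN0 : 0 < N := by positivity
    -- The cutoff `N = t ^ cut s` in the variable `ζ = 2πξ`, expressed in `ξ`.
    set N₀ := N / (2 * Real.pi) with hN₀
    have hN₀0 : 0 < N₀ := by positivity
    have habs : |t| = t := abs_of_pos ht0
    have cφ : Continuous φ := continuous_iff_continuousAt.2 fun x => (H.d1 x).continuousAt
    have cm : Continuous m := continuous_iff_continuousAt.2 fun x => (A.d x).continuousAt
    set ex : ℝ → ℂ := fun ξ => Complex.exp ((2 * Real.pi * inner ℝ ξ x : ℝ) * Complex.I) with hex
    have cex : Continuous ex := by rw [hex]; simp only [RCLike.inner_apply, conj_trivial]; fun_prop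
    have cE : Continuous E := by rw [hE]; fun_prop
    set k : ℝ → ℂ := fun ξ => ex ξ * (E ξ * m (2 * Real.pi * ξ)) with hk
    have ck : Continuous k := by rw [hk]; fun_prop
    set h : ℝ → ℂ := (Set.Icc (-N₀) N₀).indicator k with hh
    have hhI : Integrable h :=
      (ck.continuousOn.integrableOn_compact isCompact_Icc).integrable_indicator measurableSet_Icc
    have hgI : Integrable (toC g) := by
      have : MemLp g 1 volume := ⟨Lp.aestronglyMeasurable _, lt_top_iff_ne_top.2 hG⟩
      refine (memLp_one_iff_integrable.1 this).ofReal.congr ?_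
      filter_upwards [toC_ae g] with y hy; rw [hy]; rfl
    have hga : ∫ y, ‖toC g y‖ = a := by
      rw [integral_norm_eq_lintegral_enorm hgI.1, had, eLpNorm_one_eq_lintegral_enorm]
      congr 1
      refine lintegral_congr_ae ?_
      filter_upwards [toC_ae g] with y hy
      rw [hy, ← ofReal_norm, ← ofReal_norm, Complex.norm_real]
    have hbound : ∀ y, ‖𝓕 h y‖ ≤ 2 * C₁ * t ^ (-decay s) := fun y => by
      have part : ∀ τ : ℝ, |τ| = t → ‖∫ ξ in -N₀..N₀, Complex.exp (Complex.I *
          (τ * φ (2 * Real.pi * ξ) + (x - y) * (2 * Real.pi * ξ) : ℝ)) * m (2 * Real.pi * ξ)‖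
          ≤ C₁ * t ^ (-decay s) := fun τ hτ => by
        have h1 := intervalIntegral.integral_comp_mul_left (a := -N₀) (b := N₀)
          (fun ζ => Complex.exp (Complex.I * (τ * φ ζ + (x - y) * ζ : ℝ)) * m ζ)
          (c := 2 * Real.pi) (by positivity)
        have e1 : 2 * Real.pi * N₀ = N := by rw [hN₀]; field_simp
        rw [mul_neg, e1] at h1
        rw [h1, norm_smul]
        have h2 := hosc τ (x - y) (by rw [hτ]; exact ht1)
        rw [hτ] at h2
        refine (mul_le_of_le_one_left (norm_nonneg _) ?_).trans h2
        rw [Real.norm_of_nonneg (by positivity)]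
        exact inv_le_one_of_one_le₀ (by linarith [Real.pi_gt_three])
      have cont : ∀ (c : ℂ) (τ : ℝ), Continuous fun ξ => c * (Complex.exp (Complex.I *
          (τ * φ (2 * Real.pi * ξ) + (x - y) * (2 * Real.pi * ξ) : ℝ)) * m (2 * Real.pi * ξ)) := by
        intro c τ; fun_prop
      have e2 : 𝓕 h y = c₁ * (∫ ξ in -N₀..N₀, Complex.exp (Complex.I *
          (t * φ (2 * Real.pi * ξ) + (x - y) * (2 * Real.pi * ξ) : ℝ)) * m (2 * Real.pi * ξ))
          + c₂ * (∫ ξ in -N₀..N₀, Complex.exp (Complex.I *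
          (-t * φ (2 * Real.pi * ξ) + (x - y) * (2 * Real.pi * ξ) : ℝ)) * m (2 * Real.pi * ξ)) := by
        rw [Real.fourier_real_eq_integral_exp_smul, ← intervalIntegral.integral_const_mul,
          ← intervalIntegral.integral_const_mul, ← intervalIntegral.integral_add
            ((cont c₁ t).intervalIntegrable _ _)
            ((cont c₂ (-t)).intervalIntegrable _ _),
          intervalIntegral.integral_of_le (by linarith), ← integral_Icc_eq_integral_Ioc,
          ← integral_indicator measurableSet_Icc]
        congr 1; ext ξ
        by_cases hξ : ξ ∈ Set.Icc (-N₀) N₀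
        · simp only [hh, Set.indicator_of_mem hξ, hk, hex, hE, smul_eq_mul]
          have : ∀ τ : ℝ, Complex.exp (Complex.I * (τ * φ (2 * Real.pi * ξ)
              + (x - y) * (2 * Real.pi * ξ) : ℝ))
              = Complex.exp ((-2 * Real.pi * ξ * y : ℝ) * Complex.I)
                * (Complex.exp ((2 * Real.pi * inner ℝ ξ x : ℝ) * Complex.I)
                * Complex.exp (Complex.I * (τ * φ (2 * Real.pi * ξ) : ℝ))) := fun τ => by
            rw [← Complex.exp_add, ← Complex.exp_add]
            congr 1
            simp only [RCLike.inner_apply, conj_trivial]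
            push_cast; ring
          rw [this, this]; ring
        · simp [hh, Set.indicator_of_notMem hξ]
      rw [e2]
      refine (norm_add_le _ _).trans ?_
      rw [norm_mul, norm_mul]
      have p1 := part t habs
      have p2 := part (-t) (by rw [abs_neg, habs])
      nlinarith [mul_le_mul hc₁ p1 (norm_nonneg _) zero_le_one,
        mul_le_mul hc₂ p2 (norm_nonneg _) zero_le_one]
    have hlow : ‖∫ ξ in Set.Icc (-N₀) N₀, ex ξ • ft w ξ‖ ≤ 2 * C₁ * t ^ (-decay s) * a := by
      -- Fourier duality moves the truncated multiplier onto its kernel `𝓕 h`, which is bounded by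
      -- `hbound`. The low frequencies thus cost only the `L¹` norm of `g`.
      have e3 : ∫ ξ in Set.Icc (-N₀) N₀, ex ξ • ft w ξ = ∫ y, toC g y • 𝓕 h y := by
        rw [← integral_fourier_smul_flip hgI hhI, ← integral_indicator measurableSet_Icc]
        refine integral_congr_ae ?_
        filter_upwards [hw, hg₂, fourier_ae_eq (toC g) hgI] with ξ h1 h2 h3
        by_cases hξ : ξ ∈ Set.Icc (-N₀) N₀
        · simp only [hh, Set.indicator_of_mem hξ, hk, smul_eq_mul]
          rw [h1, h2, ← h3, ← ft_eq]; ring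
        · simp [hh, Set.indicator_of_notMem hξ]
      rw [e3, ← hga, ← integral_const_mul]
      refine norm_integral_le_of_norm_le (hgI.norm.const_mul _) (Eventually.of_forall fun y => ?_)
      rw [norm_smul, mul_comm]
      exact mul_le_mul_of_nonneg_right (hbound y) (norm_nonneg _)
    have hcompl : (Set.Icc (-N₀) N₀)ᶜ = {ξ | N₀ < |ξ|} := by
      ext ξ
      rw [Set.mem_compl_iff, Set.mem_Icc, Set.mem_ofPred_eq, ← abs_le, not_le]
    have hhigh : ‖∫ ξ in (Set.Icc (-N₀) N₀)ᶜ, ex ξ • ft w ξ‖ ≤ 2 * (C₂ * K * t ^ (-decay s) * S) := by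
      -- The choice of `cut` makes `cut s * (1/2 - s) = -decay s`: the Sobolev tail decays exactly
      -- as the oscillatory part.
      have e4 : N₀ ^ (1 / 2 - s) = K * t ^ (-decay s) := by
        rw [hN₀, Real.div_rpow hN0.le (by positivity), hN, ← Real.rpow_mul ht0.le, hK,
          div_eq_mul_inv, ← Real.rpow_neg (by positivity), mul_comm]
        congr 2
        · ring
        · unfold cut decay; field_simp; ring
      have e5 := htail g₂ N₀ hN₀0
      rw [e4, hSe, ← ENNReal.ofReal_mul (by positivity)] at e5
      refine (norm_integral_le_lintegral_norm _).trans ?_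
      refine ENNReal.toReal_le_of_le_ofReal (by positivity) ?_
      have e6 : ∀ ξ, ENNReal.ofReal ‖ex ξ • ft w ξ‖ = ‖ft w ξ‖ₑ := fun ξ => by
        rw [norm_smul, hex]; simp only
        rw [Complex.norm_exp_ofReal_mul_I, one_mul, ofReal_norm]
      simp only [e6]
      refine (hwL _).trans ?_
      rw [hcompl, ENNReal.ofReal_mul (by norm_num), ENNReal.ofReal_ofNat]
      gcongr
      refine e5.trans (ENNReal.ofReal_le_ofReal (le_of_eq (by ring)))
    have e7 : 𝓕⁻ (ft w : ℝ → ℂ) x = (∫ ξ in Set.Icc (-N₀) N₀, ex ξ • ft w ξ)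
        + ∫ ξ in (Set.Icc (-N₀) N₀)ᶜ, ex ξ • ft w ξ := by
      rw [Real.fourierInv_eq', integral_add_compl measurableSet_Icc]
      refine hIw.bdd_mul cex.aestronglyMeasurable (c := 1) (Eventually.of_forall fun ξ => ?_)
      rw [hex]; simp only
      rw [Complex.norm_exp_ofReal_mul_I]
    rw [e7]
    refine (norm_add_le _ _).trans ((add_le_add hlow hhigh).trans ?_)
    have e8 : t ^ (-decay s) ≤ 2 ^ decay s * (1 + t) ^ (-decay s) := by
      rw [Real.rpow_neg h1t.le, Real.rpow_neg ht0.le, ← div_eq_mul_inv, inv_eq_one_div,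
        div_le_div_iff₀ (by positivity) (by positivity), one_mul,
        ← Real.mul_rpow (by norm_num) ht0.le]
      exact Real.rpow_le_rpow h1t.le (by linarith) hd0.le
    have e2 : C * (1 + t) ^ (-decay s) * (a + S)
        = (2 ^ decay s * (1 + t) ^ (-decay s)) * ((2 * C₁ + 2 * C₂ * K + 2 * C₃) * (a + S)) := by
      rw [hC]; ring
    rw [e2]
    have e9 : 2 * C₁ * t ^ (-decay s) * a + 2 * (C₂ * K * t ^ (-decay s) * S)
        = t ^ (-decay s) * (2 * C₁ * a + 2 * (C₂ * K * S)) := by ring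
    rw [e9]
    have hK0 : 0 ≤ K := by positivity
    have p1 : 0 ≤ C₁ * S := by positivity
    have p2 : 0 ≤ C₃ * a := by positivity
    have p3 : 0 ≤ C₃ * S := by positivity
    have p4 : 0 ≤ C₂ * K * a := by positivity
    gcongr
    nlinarith
end

/-! ### The dispersion relation: degeneracy of its second derivative and bounds of the symbols -/

section
/-- The admissible parameters. -/
def Par (α κ : ℝ) : Prop := (0 < α ∧ 0 < κ) ∨ (α = 0 ∧ κ = 0)

/-- Square root of the symbol of `L_D`. -/
def rD (α ζ : ℝ) : ℝ := √(1 + α * ζ ^ 2)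
/-- Square root of the symbol of `L_R`. -/
def rR (κ ζ : ℝ) : ℝ := √(1 + ζ ^ 2 + κ * ζ ^ 4)
/-- The dispersion relation. -/
def phi (α κ ζ : ℝ) : ℝ := ζ * rD α ζ / rR κ ζ
/-- The first derivative of the dispersion relation. -/
def phi' (α κ ζ : ℝ) : ℝ :=
  (1 + 2 * α * ζ ^ 2 + (α - κ) * ζ ^ 4) / (rD α ζ * rR κ ζ ^ 3)

open Polynomial in
/-- The polynomial which governs the zeros of the second derivative of the dispersion relation. -/
def phasePoly (α κ : ℝ) : Polynomial ℝ :=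
  C (-3 * α * κ * (α - κ)) * X ^ 4 + C (-10 * α ^ 2 * κ - 2 * (α - κ) * κ) * X ^ 3
    + C (-15 * α * κ - 4 * α ^ 2 + (α - κ) + 3 * α * (α - κ)) * X ^ 2
    + C (2 * α ^ 2 - 2 * α - 10 * κ) * X + C (3 * α - 3)

/-- The second derivative of the dispersion relation. -/
def phi'' (α κ ζ : ℝ) : ℝ :=
  ζ * (phasePoly α κ).eval (ζ ^ 2) / (rD α ζ ^ 3 * rR κ ζ ^ 5)

lemma phasePoly_coeff_zero (α κ : ℝ) : (phasePoly α κ).coeff 0 = 3 * α - 3 := by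
  simp only [phasePoly, Polynomial.coeff_add, Polynomial.coeff_C_mul, Polynomial.coeff_X_pow,
    Polynomial.coeff_C, Polynomial.coeff_X]
  norm_num
lemma phasePoly_coeff_one (α κ : ℝ) : (phasePoly α κ).coeff 1 = 2 * α ^ 2 - 2 * α - 10 * κ := by
  simp only [phasePoly, Polynomial.coeff_add, Polynomial.coeff_C_mul, Polynomial.coeff_X_pow,
    Polynomial.coeff_C, Polynomial.coeff_X]
  norm_num
lemma phasePoly_coeff_three (α κ : ℝ) :
    (phasePoly α κ).coeff 3 = -10 * α ^ 2 * κ - 2 * (α - κ) * κ := by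
  simp only [phasePoly, Polynomial.coeff_add, Polynomial.coeff_C_mul, Polynomial.coeff_X_pow,
    Polynomial.coeff_C, Polynomial.coeff_X]
  norm_num
lemma phasePoly_coeff_four (α κ : ℝ) : (phasePoly α κ).coeff 4 = -3 * α * κ * (α - κ) := by
  simp only [phasePoly, Polynomial.coeff_add, Polynomial.coeff_C_mul, Polynomial.coeff_X_pow,
    Polynomial.coeff_C, Polynomial.coeff_X]
  norm_num

lemma phasePoly_eval (α κ y : ℝ) : (phasePoly α κ).eval y = (-3 * α * κ * (α - κ)) * y ^ 4
    + (-10 * α ^ 2 * κ - 2 * (α - κ) * κ) * y ^ 3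
    + (-15 * α * κ - 4 * α ^ 2 + (α - κ) + 3 * α * (α - κ)) * y ^ 2
    + (2 * α ^ 2 - 2 * α - 10 * κ) * y + (3 * α - 3) := by
  simp [phasePoly]

section
variable {α κ : ℝ}

lemma Par.nonneg (h : Par α κ) : 0 ≤ α ∧ 0 ≤ κ := by
  rcases h with h | h
  · exact ⟨h.1.le, h.2.le⟩
  · exact ⟨h.1.ge, h.2.ge⟩

lemma rD_arg (hα : 0 ≤ α) (ζ : ℝ) : 1 ≤ 1 + α * ζ ^ 2 := by nlinarith [sq_nonneg ζ]
lemma rR_arg (hκ : 0 ≤ κ) (ζ : ℝ) : 1 ≤ 1 + ζ ^ 2 + κ * ζ ^ 4 := by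
  have : 0 ≤ κ * ζ ^ 4 := by positivity
  nlinarith [sq_nonneg ζ]
lemma one_le_rD (hα : 0 ≤ α) (ζ : ℝ) : 1 ≤ rD α ζ := Real.one_le_sqrt.2 (rD_arg hα ζ)
lemma one_le_rR (hκ : 0 ≤ κ) (ζ : ℝ) : 1 ≤ rR κ ζ := Real.one_le_sqrt.2 (rR_arg hκ ζ)
lemma rD_pos (hα : 0 ≤ α) (ζ : ℝ) : 0 < rD α ζ := one_pos.trans_le (one_le_rD hα ζ)
lemma rR_pos (hκ : 0 ≤ κ) (ζ : ℝ) : 0 < rR κ ζ := one_pos.trans_le (one_le_rR hκ ζ)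
lemma rD_sq (hα : 0 ≤ α) (ζ : ℝ) : rD α ζ ^ 2 = 1 + α * ζ ^ 2 :=
  Real.sq_sqrt (by linarith [rD_arg hα ζ])
lemma rR_sq (hκ : 0 ≤ κ) (ζ : ℝ) : rR κ ζ ^ 2 = 1 + ζ ^ 2 + κ * ζ ^ 4 :=
  Real.sq_sqrt (by linarith [rR_arg hκ ζ])
lemma rD_neg (ζ : ℝ) : rD α (-ζ) = rD α ζ := by simp [rD]
lemma rR_neg (ζ : ℝ) : rR κ (-ζ) = rR κ ζ := by
  simp only [rR, neg_sq, Even.neg_pow (by decide : Even 4)]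
@[fun_prop] lemma continuous_rD : Continuous (rD α) := by unfold rD; fun_prop
@[fun_prop] lemma continuous_rR : Continuous (rR κ) := by unfold rR; fun_prop

lemma hasDerivAt_rD (hα : 0 ≤ α) (ζ : ℝ) : HasDerivAt (rD α) (α * ζ / rD α ζ) ζ := by
  have h : HasDerivAt (fun ζ : ℝ => 1 + α * ζ ^ 2) (α * (2 * ζ)) ζ := by
    simpa using! ((hasDerivAt_pow 2 ζ).const_mul α).const_add 1
  have h2 := h.sqrt (by linarith [rD_arg hα ζ])
  have e : α * (2 * ζ) / (2 * √(1 + α * ζ ^ 2)) = α * ζ / rD α ζ := by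
    rw [← mul_assoc, mul_comm α 2, mul_assoc, mul_div_mul_left _ _ two_ne_zero]; rfl
  rw [e] at h2; exact h2

lemma hasDerivAt_rR (hκ : 0 ≤ κ) (ζ : ℝ) :
    HasDerivAt (rR κ) ((ζ + 2 * κ * ζ ^ 3) / rR κ ζ) ζ := by
  have h : HasDerivAt (fun ζ : ℝ => 1 + ζ ^ 2 + κ * ζ ^ 4) (2 * ζ + κ * (4 * ζ ^ 3)) ζ := by
    simpa using! ((hasDerivAt_pow 2 ζ).const_add 1).add ((hasDerivAt_pow 4 ζ).const_mul κ)
  have h2 := h.sqrt (by linarith [rR_arg hκ ζ])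
  have e : (2 * ζ + κ * (4 * ζ ^ 3)) / (2 * √(1 + ζ ^ 2 + κ * ζ ^ 4))
      = (ζ + 2 * κ * ζ ^ 3) / rR κ ζ := by
    rw [show 2 * ζ + κ * (4 * ζ ^ 3) = 2 * (ζ + 2 * κ * ζ ^ 3) by ring,
      mul_div_mul_left _ _ two_ne_zero]; rfl
  rw [e] at h2; exact h2

lemma hasDerivAt_phi (hα : 0 ≤ α) (hκ : 0 ≤ κ) (ζ : ℝ) :
    HasDerivAt (phi α κ) (phi' α κ ζ) ζ := by
  have h := ((hasDerivAt_id ζ).mul (hasDerivAt_rD hα ζ)).div (hasDerivAt_rR hκ ζ)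
    (rR_pos hκ ζ).ne'
  have ha := rD_sq hα ζ
  have hb := rR_sq hκ ζ
  have ha0 := rD_pos hα ζ
  have hb0 := rR_pos hκ ζ
  refine h.congr_deriv ?_
  simp only [phi', id, Pi.mul_apply]
  generalize rD α ζ = a at *
  generalize rR κ ζ = b at *
  field_simp
  linear_combination (b ^ 2 - ζ ^ 2 * (1 + 2 * κ * ζ ^ 2)) * ha + (1 + α * ζ ^ 2 + α * ζ ^ 2) * hb

lemma hasDerivAt_phi' (hα : 0 ≤ α) (hκ : 0 ≤ κ) (ζ : ℝ) :
    HasDerivAt (phi' α κ) (phi'' α κ ζ) ζ := by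
  have h0 : HasDerivAt (fun ζ : ℝ => 1 + 2 * α * ζ ^ 2 + (α - κ) * ζ ^ 4)
      (2 * α * (2 * ζ) + (α - κ) * (4 * ζ ^ 3)) ζ := by
    simpa using! (((hasDerivAt_pow 2 ζ).const_mul (2 * α)).const_add 1).add
      ((hasDerivAt_pow 4 ζ).const_mul (α - κ))
  have ha := rD_sq hα ζ
  have hb := rR_sq hκ ζ
  have ha0 := rD_pos hα ζ
  have hb0 := rR_pos hκ ζ
  have h := h0.div ((hasDerivAt_rD hα ζ).mul ((hasDerivAt_rR hκ ζ).pow 3)) (mul_pos ha0 (pow_pos hb0 3)).ne'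
  refine h.congr_deriv ?_
  simp only [phi'', Pi.mul_apply, Pi.pow_apply, phasePoly_eval]
  generalize rD α ζ = a at *
  generalize rR κ ζ = b at *
  push_cast
  field_simp
  linear_combination ζ * ((2 * α * 2 + (α - κ) * 4 * ζ ^ 2) * b ^ 2
      - 3 * (1 + 2 * α * ζ ^ 2 + (α - κ) * ζ ^ 4) * (1 + 2 * κ * ζ ^ 2)) * ha
    + ζ * ((2 * α * 2 + (α - κ) * 4 * ζ ^ 2) * (1 + α * ζ ^ 2)
      - (1 + 2 * α * ζ ^ 2 + (α - κ) * ζ ^ 4) * α) * hb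

/-- The constant coefficient `3α - 3` vanishes only for `α = 1`, and then the linear coefficient is
`-10κ ≠ 0`. -/
lemma phasePoly_ne_zero (h : Par α κ) : phasePoly α κ ≠ 0 := fun h0 => by
  have e : ∀ y, (phasePoly α κ).eval y = 0 := fun y => by rw [h0, Polynomial.eval_zero]
  simp only [phasePoly_eval] at e
  rcases h with ⟨hα, hκ⟩ | ⟨rfl, rfl⟩
  · have e0 := e 0
    have hα1 : α = 1 := by linarith
    subst hα1
    have e1 := e 1; have e2 := e (-1); have e3 := e 2; have e4 := e (-2)
    nlinarith
  · have e0 := e 0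
    norm_num at e0

/-- The function `φ''` contains `x Q(x²)` with `deg Q ≤ 4`. At `x₀ ≠ 0` the order of the zero is the
multiplicity of `x₀²` in `Q`. At the origin a multiplicity `n` of `Q` gives the order `1 + 2n`, but
the two lowest coefficients of `Q` do not vanish together, so `n ≤ 1` and the order is at most
three. -/
lemma phasePoly_factor (h : Par α κ) (x₀ : ℝ) : ∃ (N : ℕ) (r : ℝ → ℝ), N ≤ 4 ∧ Continuous r ∧
    r x₀ ≠ 0 ∧ ∀ x, x * (phasePoly α κ).eval (x ^ 2) = (x - x₀) ^ N * r x := by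
  obtain ⟨q, hq, hnd⟩ := Polynomial.exists_eq_pow_rootMultiplicity_mul_and_not_dvd
    (phasePoly α κ) (phasePoly_ne_zero h) (x₀ ^ 2)
  set n := (phasePoly α κ).rootMultiplicity (x₀ ^ 2) with hn
  have hqe : q.eval (x₀ ^ 2) ≠ 0 := fun h0 => hnd (Polynomial.dvd_iff_isRoot.2 h0)
  have hn4 : n ≤ 4 := by
    have hdvd := Polynomial.natDegree_le_of_dvd
      (Polynomial.pow_rootMultiplicity_dvd (phasePoly α κ) (x₀ ^ 2)) (phasePoly_ne_zero h)
    rw [Polynomial.natDegree_pow, Polynomial.natDegree_X_sub_C, mul_one] at hdvd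
    refine hdvd.trans ?_
    unfold phasePoly
    compute_degree
  have ev : ∀ x : ℝ, (phasePoly α κ).eval (x ^ 2) = (x ^ 2 - x₀ ^ 2) ^ n * q.eval (x ^ 2) := fun x => by
    conv_lhs => rw [hq]
    simp
  have hqc : Continuous fun x : ℝ => q.eval (x ^ 2) := q.continuous.comp (continuous_pow 2)
  by_cases hx : x₀ = 0
  · subst hx
    have hn1 : n ≤ 1 := by
      by_contra hcon
      have hdvd : Polynomial.X ^ 2 ∣ phasePoly α κ := by
        refine (pow_dvd_pow _ (not_le.1 hcon)).trans ?_
        have := Polynomial.pow_rootMultiplicity_dvd (phasePoly α κ) ((0 : ℝ) ^ 2)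
        simpa [hn] using! this
      have c0 := Polynomial.X_pow_dvd_iff.1 hdvd 0 (by norm_num)
      have c1 := Polynomial.X_pow_dvd_iff.1 hdvd 1 (by norm_num)
      rw [phasePoly_coeff_zero] at c0
      rw [phasePoly_coeff_one] at c1
      rcases h with ⟨hα, hκ⟩ | ⟨rfl, rfl⟩
      · have : α = 1 := by linarith
        subst this
        linarith
      · norm_num at c0
    refine ⟨1 + 2 * n, fun x => q.eval (x ^ 2), by omega, hqc, hqe, fun x => ?_⟩
    rw [ev]; ring
  · refine ⟨n, fun x => x * (x + x₀) ^ n * q.eval (x ^ 2), hn4, by fun_prop, ?_, fun x => ?_⟩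
    · refine mul_ne_zero (mul_ne_zero hx (pow_ne_zero _ ?_)) hqe
      rw [← two_mul]; exact mul_ne_zero two_ne_zero hx
    · rw [ev, show x ^ 2 - x₀ ^ 2 = (x - x₀) * (x + x₀) by ring, mul_pow]; ring

lemma continuous_phi'' (hα : 0 ≤ α) (hκ : 0 ≤ κ) : Continuous (phi'' α κ) := by
  unfold phi''
  refine Continuous.div ?_ (by fun_prop) fun x => ?_
  · exact continuous_id.mul ((phasePoly α κ).continuous.comp (continuous_pow 2))
  · have := rD_pos hα x; have := rR_pos hκ x; positivity

/-- Near `x₀`, `φ''` is `(x - x₀)^N` with `N ≤ 4` times a continuous function that does not vanish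
at `x₀`. Within distance one, the fourth power is the smallest admissible one. This covers all
points, degenerate or not. -/
lemma phi''_lower_local (h : Par α κ) (x₀ : ℝ) : ∃ U ∈ 𝓝 x₀, ∃ c : ℝ, 0 < c ∧
    ∀ x ∈ U, c * |x - x₀| ^ 4 ≤ |phi'' α κ x| := by
  obtain ⟨hα, hκ⟩ := h.nonneg
  obtain ⟨N, r, hN, hr, hr0, he⟩ := phasePoly_factor h x₀
  set g : ℝ → ℝ := fun x => |r x / (rD α x ^ 3 * rR κ x ^ 5)| with hg
  have hd : ∀ x, 0 < rD α x ^ 3 * rR κ x ^ 5 := fun x => by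
    have := rD_pos hα x; have := rR_pos hκ x; positivity
  have hgc : Continuous g := (hr.div (by fun_prop) fun x => (hd x).ne').abs
  have hg0 : 0 < g x₀ := abs_pos.2 (div_ne_zero hr0 (hd x₀).ne')
  refine ⟨{x | g x₀ / 2 < g x} ∩ Metric.ball x₀ 1, Filter.inter_mem
    (hgc.continuousAt.eventually_const_lt (by linarith)) (Metric.ball_mem_nhds _ one_pos),
    g x₀ / 2, by positivity, fun x hx => ?_⟩
  have h1 : |phi'' α κ x| = |x - x₀| ^ N * g x := by
    rw [phi'', he, hg, ← abs_pow, ← abs_mul, mul_div_assoc]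
  rw [h1, mul_comm]
  have h2 : |x - x₀| ≤ 1 := by
    have := hx.2; rw [Metric.mem_ball, Real.dist_eq] at this; exact this.le
  have h3 : |x - x₀| ^ 4 ≤ |x - x₀| ^ N := pow_le_pow_of_le_one (abs_nonneg _) h2 hN
  exact mul_le_mul h3 (le_of_lt hx.1) (by positivity) (by positivity)

lemma phi''_lower_compact (h : Par α κ) (K : Set ℝ) (hK : IsCompact K) :
    ∃ (Z : Finset ℝ) (c : ℝ), 0 < c ∧ ∀ x ∈ K, ∃ z ∈ Z, c * |x - z| ^ 4 ≤ |phi'' α κ x| := by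
  refine IsCompact.induction_on hK (p := fun K => ∃ (Z : Finset ℝ) (c : ℝ), 0 < c ∧
    ∀ x ∈ K, ∃ z ∈ Z, c * |x - z| ^ 4 ≤ |phi'' α κ x|) ?_ ?_ ?_ ?_
  · exact ⟨∅, 1, one_pos, by simp⟩
  · rintro s t hst ⟨Z, c, hc, H⟩
    exact ⟨Z, c, hc, fun x hx => H x (hst hx)⟩
  · rintro s t ⟨Z, c, hc, H⟩ ⟨Z', c', hc', H'⟩
    classical
    refine ⟨Z ∪ Z', min c c', lt_min hc hc', fun x hx => ?_⟩
    rcases hx with hx | hx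
    · obtain ⟨z, hz, hle⟩ := H x hx
      exact ⟨z, Finset.mem_union_left _ hz, le_trans (by gcongr; exact min_le_left _ _) hle⟩
    · obtain ⟨z, hz, hle⟩ := H' x hx
      exact ⟨z, Finset.mem_union_right _ hz, le_trans (by gcongr; exact min_le_right _ _) hle⟩
  · intro x hx
    obtain ⟨U, hU, c, hc, H⟩ := phi''_lower_local h x
    exact ⟨U, mem_nhdsWithin_of_mem_nhds hU, {x}, c, hc, fun y hy => ⟨x, by simp, H y hy⟩⟩

/-- For `α, κ > 0` the polynomial has degree at least three: its quartic coefficient is nonzero if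
`α ≠ κ`, and for `α = κ` the cubic one is `-10α³`. The numerator of `φ''` is thus at least of order
`|x|⁷`, while the denominator is `O(|x|³ · |x|¹⁰)`. For `α = κ = 0` one even has the order `|x|⁻⁴`.
-/
lemma phi''_lower_infinity (h : Par α κ) : ∃ R c : ℝ, 0 < R ∧ 0 < c ∧
    ∀ x, R ≤ |x| → c * (|x| ^ 6)⁻¹ ≤ |phi'' α κ x| := by
  obtain ⟨hα0, hκ0⟩ := h.nonneg
  have hb5 : ∀ x : ℝ, 1 ≤ |x| → rR κ x ^ 2 ≤ (2 + κ) * |x| ^ 4 := fun x hx => by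
    have h2 : (1 : ℝ) ≤ |x| ^ 2 := one_le_pow₀ hx
    rw [rR_sq hκ0, ← sq_abs x, show x ^ 4 = |x| ^ 4 by rw [← abs_pow, abs_of_nonneg (by positivity)]]
    nlinarith
  rcases h with ⟨hα, hκ⟩ | ⟨rfl, rfl⟩
  · have hO : (fun y : ℝ => (Polynomial.X ^ 3 : Polynomial ℝ).eval y) =O[atTop]
        fun y => (phasePoly α κ).eval y := by
      refine Polynomial.isBigO_atTop_of_degree_le _ _ ?_
      rw [Polynomial.degree_X_pow]
      by_cases hd : α = κ
      · refine Polynomial.le_degree_of_ne_zero ?_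
        subst hd
        rw [phasePoly_coeff_three, sub_self, mul_zero, zero_mul, sub_zero]
        exact mul_ne_zero (mul_ne_zero (by norm_num) (pow_ne_zero _ hα.ne')) hα.ne'
      · refine le_trans (by norm_num : ((3 : ℕ) : WithBot ℕ) ≤ (4 : ℕ))
          (Polynomial.le_degree_of_ne_zero ?_)
        rw [phasePoly_coeff_four]
        exact mul_ne_zero (mul_ne_zero (mul_ne_zero (by norm_num) hα.ne') hκ.ne') (sub_ne_zero.2 hd)
    obtain ⟨K, hK, hb⟩ := hO.exists_pos
    obtain ⟨Y, hY⟩ := eventually_atTop.1 hb.bound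
    set A := √(1 + α) with hA
    set B := √(2 + κ) with hB
    have hA0 : 0 < A := Real.sqrt_pos.2 (by linarith)
    have hB0 : 0 < B := Real.sqrt_pos.2 (by linarith)
    refine ⟨max 1 Y, (K * (A ^ 3 * B ^ 5))⁻¹, by positivity, by positivity, fun x hx => ?_⟩
    have hx1 : 1 ≤ |x| := (le_max_left _ _).trans hx
    have hx0 : 0 < |x| := by linarith
    have hxY : Y ≤ x ^ 2 := by
      have := (le_max_right 1 Y).trans hx
      rw [← sq_abs]; nlinarith
    have hG := hY _ hxY
    simp only [Polynomial.eval_pow, Polynomial.eval_X, norm_pow, Real.norm_eq_abs, sq_abs] at hG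
    have ha : rD α x ≤ A * |x| := by
      refine abs_le_of_sq_le_sq' ?_ (by positivity) |>.2
      rw [rD_sq hα0, mul_pow, hA, Real.sq_sqrt (by linarith), sq_abs]
      have : (1 : ℝ) ≤ |x| ^ 2 := one_le_pow₀ hx1
      rw [sq_abs] at this; nlinarith
    have hbb : rR κ x ≤ B * |x| ^ 2 := by
      refine abs_le_of_sq_le_sq' ?_ (by positivity) |>.2
      rw [mul_pow, hB, Real.sq_sqrt (by linarith), ← pow_mul]
      exact hb5 x hx1
    have ha0 := rD_pos hα0 x
    have hb0 := rR_pos hκ0 x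
    rw [phi'', abs_div, abs_of_pos (by positivity : 0 < rD α x ^ 3 * rR κ x ^ 5), abs_mul]
    have hden : rD α x ^ 3 * rR κ x ^ 5 ≤ (A * |x|) ^ 3 * (B * |x| ^ 2) ^ 5 := by gcongr
    have hG' : |x| ^ 6 / K ≤ |(phasePoly α κ).eval (x ^ 2)| := by
      rw [div_le_iff₀ hK]
      calc |x| ^ 6 = (x ^ 2) ^ 3 := by rw [← sq_abs]; ring
        _ ≤ |x ^ 2| ^ 3 := by gcongr; exact le_abs_self _
        _ ≤ _ := by rw [mul_comm]; simpa using! hG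
    calc (K * (A ^ 3 * B ^ 5))⁻¹ * (|x| ^ 6)⁻¹
        = |x| * (|x| ^ 6 / K) / ((A * |x|) ^ 3 * (B * |x| ^ 2) ^ 5) := by field_simp
      _ ≤ _ := by gcongr
  · refine ⟨1, 3 / 2 ^ 5, one_pos, by norm_num, fun x hx => ?_⟩
    have hx0 : 0 < |x| := by linarith
    have hb : rR 0 x ≤ 2 * |x| := by
      refine abs_le_of_sq_le_sq' ?_ (by positivity) |>.2
      rw [rR_sq le_rfl, mul_pow, sq_abs]
      have : (1 : ℝ) ≤ |x| ^ 2 := one_le_pow₀ hx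
      rw [sq_abs] at this; nlinarith
    have hb0 := rR_pos (le_refl (0 : ℝ)) x
    have ha : rD 0 x = 1 := by simp [rD]
    rw [phi'', ha, phasePoly_eval, abs_div, abs_of_pos (by positivity : 0 < 1 ^ 3 * rR 0 x ^ 5), abs_mul]
    have e : |-3 * (0:ℝ) * 0 * (0 - 0) * (x ^ 2) ^ 4 + (-10 * 0 ^ 2 * 0 - 2 * (0 - 0) * 0) * (x ^ 2) ^ 3 +
      (-15 * 0 * 0 - 4 * 0 ^ 2 + (0 - 0) + 3 * 0 * (0 - 0)) * (x ^ 2) ^ 2 +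
      (2 * 0 ^ 2 - 2 * 0 - 10 * 0) * x ^ 2 + (3 * 0 - 3)| = 3 := by norm_num
    rw [e, one_pow, one_mul]
    calc (3 / 2 ^ 5) * (|x| ^ 6)⁻¹ ≤ (3 / 2 ^ 5) * (|x| ^ 4)⁻¹ := by
          gcongr 2
          exact pow_le_pow_right₀ hx (by norm_num)
      _ = |x| * 3 / (2 * |x|) ^ 5 := by field_simp
      _ ≤ _ := by gcongr

theorem isPhase_phi (h : Par α κ) : IsPhase (phi α κ) (phi' α κ) (phi'' α κ) := by
  obtain ⟨hα, hκ⟩ := h.nonneg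
  obtain ⟨R, c, hR, hc, H⟩ := phi''_lower_infinity h
  obtain ⟨Z, c', hc', H'⟩ := phi''_lower_compact h (Set.Icc (-R) R) isCompact_Icc
  refine ⟨hasDerivAt_phi hα hκ, hasDerivAt_phi' hα hκ, continuous_phi'' hα hκ,
    Z, min c c', R, lt_min hc hc', hR, fun x hx => ?_, fun x hx => ?_⟩
  · obtain ⟨z, hz, hle⟩ := H' x (abs_le.1 hx)
    exact ⟨z, hz, le_trans (by gcongr; exact min_le_right _ _) hle⟩
  · exact le_trans (by gcongr; exact min_le_left _ _) (H x hx)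

/-! ### Size of the symbols -/

/-- After squaring, the point is `κ ≤ C α`, which fails in the mixed case `α = 0 < κ`. With the
reverse inequality `rD_le`, this makes `T` an isomorphism from `H^s` onto `H^{s+1}`. -/
lemma rR_le (h : Par α κ) : ∃ C : ℝ, 0 < C ∧ ∀ ζ, rR κ ζ ≤ C * (rD α ζ * √(1 + ζ ^ 2)) := by
  obtain ⟨hα, hκ⟩ := h.nonneg
  have key : ∃ C : ℝ, 1 ≤ C ∧ κ ≤ C * α := by
    rcases h with ⟨hα, hκ⟩ | ⟨rfl, rfl⟩
    · refine ⟨1 + κ / α, by have : 0 ≤ κ / α := by positivity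
                            linarith, ?_⟩
      rw [add_mul, div_mul_cancel₀ _ hα.ne']; linarith
    · exact ⟨1, le_rfl, by simp⟩
  obtain ⟨C, hC, hCκ⟩ := key
  refine ⟨√C, Real.sqrt_pos.2 (by linarith), fun ζ => ?_⟩
  unfold rR rD
  rw [← Real.sqrt_mul (by linarith [rD_arg hα ζ]), ← Real.sqrt_mul (by linarith)]
  refine Real.sqrt_le_sqrt ?_
  have h2 := sq_nonneg ζ
  have h4 : 0 ≤ ζ ^ 4 := by positivity
  have : 0 ≤ α * ζ ^ 2 := by positivity
  nlinarith [mul_le_mul_of_nonneg_right hCκ h4, mul_nonneg (sub_nonneg.2 hC) h2,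
    mul_nonneg (sub_nonneg.2 hC) this]

lemma rD_le (h : Par α κ) : ∃ C : ℝ, 0 < C ∧ ∀ ζ, rD α ζ * √(1 + ζ ^ 2) ≤ C * rR κ ζ := by
  obtain ⟨hα, hκ⟩ := h.nonneg
  have key : ∃ C : ℝ, 1 + α ≤ C ∧ α ≤ C * κ := by
    rcases h with ⟨hα, hκ⟩ | ⟨rfl, rfl⟩
    · refine ⟨1 + α + α / κ, by have : 0 ≤ α / κ := by positivity
                                linarith, ?_⟩
      rw [add_mul, div_mul_cancel₀ _ hκ.ne']; nlinarith
    · exact ⟨1, by simp, by simp⟩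
  obtain ⟨C, hC, hCκ⟩ := key
  refine ⟨√C, Real.sqrt_pos.2 (by linarith), fun ζ => ?_⟩
  unfold rR rD
  rw [← Real.sqrt_mul (by linarith [rD_arg hα ζ]), ← Real.sqrt_mul (by linarith)]
  refine Real.sqrt_le_sqrt ?_
  have h2 := sq_nonneg ζ
  have h4 : 0 ≤ ζ ^ 4 := by positivity
  nlinarith [mul_le_mul_of_nonneg_right hCκ h4, mul_le_mul_of_nonneg_right hC h2]

lemma sqrt_le_rD (hα : 0 < α) : ∃ k : ℝ, 0 < k ∧ ∀ ζ, k * √(1 + ζ ^ 2) ≤ rD α ζ := by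
  refine ⟨√(min 1 α), Real.sqrt_pos.2 (by positivity), fun ζ => ?_⟩
  unfold rD
  rw [← Real.sqrt_mul (by positivity)]
  refine Real.sqrt_le_sqrt ?_
  have h2 := sq_nonneg ζ
  nlinarith [min_le_left 1 α, mul_le_mul_of_nonneg_right (min_le_right 1 α) h2]

lemma le_rR (hκ : 0 < κ) : ∃ k : ℝ, 0 < k ∧ ∀ ζ, k * (1 + ζ ^ 2) ≤ rR κ ζ := by
  refine ⟨√(min (1 / 2) κ), Real.sqrt_pos.2 (by positivity), fun ζ => ?_⟩
  unfold rR
  have e : √(min (1 / 2) κ) * (1 + ζ ^ 2) = √(min (1 / 2) κ * (1 + ζ ^ 2) ^ 2) := by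
    rw [Real.sqrt_mul (by positivity), Real.sqrt_sq (by positivity)]
  rw [e]
  refine Real.sqrt_le_sqrt ?_
  have h2 := sq_nonneg ζ
  have h4 : 0 ≤ ζ ^ 4 := by positivity
  nlinarith [mul_le_mul_of_nonneg_right (min_le_left (1/2) κ) h2, min_le_left (1/2) κ,
    mul_le_mul_of_nonneg_right (min_le_right (1/2) κ) h4]

lemma isAmp_one : IsAmp (fun _ => 1) (fun _ => 0) where
  d x := hasDerivAt_const x 1
  cont := continuous_const
  bdd := ⟨1, one_pos, by simp, fun x => by simp; positivity⟩

/-- The amplitude `(1 + ζ²)^{-1/2} L_R^{1/2} L_D^{-1/2}`. -/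
def ampV (α κ ζ : ℝ) : ℝ := rR κ ζ / (rD α ζ * √(1 + ζ ^ 2))

/-- The symbol of `-i ∂ₓ (L_R L_D)^{-1/2}`. -/
def sig (α κ ζ : ℝ) : ℝ := ζ / (rD α ζ * rR κ ζ)

lemma hasDerivAt_ampV (hα : 0 ≤ α) (hκ : 0 ≤ κ) (ζ : ℝ) : HasDerivAt (ampV α κ)
    (ζ * (-α + (2 * κ - 2 * α) * ζ ^ 2 + (κ * (1 + α) - α) * ζ ^ 4)
      / (rR κ ζ * rD α ζ ^ 3 * √(1 + ζ ^ 2) ^ 3)) ζ := by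
  have hc := hasDerivAt_rD (zero_le_one) ζ
  have hc1 : ∀ ζ, rD 1 ζ = √(1 + ζ ^ 2) := fun ζ => by simp [rD]
  have ha := rD_sq hα ζ
  have hb := rR_sq hκ ζ
  have hcs := rD_sq zero_le_one ζ
  have ha0 := rD_pos hα ζ
  have hb0 := rR_pos hκ ζ
  have hc0 := rD_pos zero_le_one ζ
  have h := (hasDerivAt_rR hκ ζ).div ((hasDerivAt_rD hα ζ).mul hc) (mul_pos ha0 hc0).ne'
  have e : ampV α κ = rR κ / (rD α * rD 1) := by
    ext ζ; simp only [ampV, Pi.div_apply, Pi.mul_apply, hc1]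
  rw [e]
  refine h.congr_deriv ?_
  rw [← hc1]
  simp only [Pi.mul_apply]
  generalize rD α ζ = a at *
  generalize rR κ ζ = b at *
  generalize rD 1 ζ = c at *
  field_simp
  have hcs' : c ^ 2 = 1 + ζ ^ 2 := by rw [hcs]; ring
  have ha2 : a ^ 2 = 1 + α * ζ ^ 2 := ha
  have e1 : (1 + 2 * ζ ^ 2 * κ) * a ^ 2 * c ^ 2 - b ^ 2 * (α * c ^ 2 + a ^ 2)
      = -α + (2 * κ - 2 * α) * ζ ^ 2 + (κ * (1 + α) - α) * ζ ^ 4 := by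
    rw [ha2, hcs', hb]; ring
  linear_combination ζ * e1

lemma hasDerivAt_sig (hα : 0 ≤ α) (hκ : 0 ≤ κ) (ζ : ℝ) : HasDerivAt (sig α κ)
    ((1 - (α + κ) * ζ ^ 4 - 2 * α * κ * ζ ^ 6) / (rD α ζ ^ 3 * rR κ ζ ^ 3)) ζ := by
  have ha := rD_sq hα ζ
  have hb := rR_sq hκ ζ
  have ha0 := rD_pos hα ζ
  have hb0 := rR_pos hκ ζ
  have h := (hasDerivAt_id ζ).div ((hasDerivAt_rD hα ζ).mul (hasDerivAt_rR hκ ζ)) (mul_pos ha0 hb0).ne'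
  refine h.congr_deriv ?_
  simp only [Pi.mul_apply, id]
  generalize rD α ζ = a at *
  generalize rR κ ζ = b at *
  field_simp
  have e1 : a ^ 2 * b ^ 2 - ζ ^ 2 * (α * b ^ 2 + a ^ 2 * (1 + 2 * ζ ^ 2 * κ))
      = 1 - (α + κ) * ζ ^ 4 - 2 * α * κ * ζ ^ 6 := by
    rw [ha, hb]; ring
  linear_combination e1

/-! ### Bounds -/

lemma ampV_nonneg (hα : 0 ≤ α) (hκ : 0 ≤ κ) (ζ : ℝ) : 0 < ampV α κ ζ := by
  have := rD_pos hα ζ; have := rR_pos hκ ζ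
  unfold ampV; positivity

lemma ampV_le (h : Par α κ) : ∃ C : ℝ, 0 < C ∧ ∀ ζ, ampV α κ ζ ≤ C := by
  obtain ⟨hα, hκ⟩ := h.nonneg
  obtain ⟨C, hC, H⟩ := rR_le h
  refine ⟨C, hC, fun ζ => ?_⟩
  have := rD_pos hα ζ
  unfold ampV
  rw [div_le_iff₀ (by positivity)]
  exact H ζ

lemma abs_phi_le (h : Par α κ) : ∃ C : ℝ, 0 < C ∧ ∀ ζ, |phi α κ ζ| ≤ C := by
  obtain ⟨hα, hκ⟩ := h.nonneg
  obtain ⟨C, hC, H⟩ := rD_le h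
  refine ⟨C, hC, fun ζ => ?_⟩
  have := rD_pos hα ζ
  have hb := rR_pos hκ ζ
  unfold phi
  rw [abs_div, abs_of_pos hb, div_le_iff₀ hb, abs_mul, abs_of_pos this]
  refine le_trans ?_ (H ζ)
  rw [mul_comm]
  gcongr
  exact Real.abs_le_sqrt (by linarith)

lemma abs_sig_le (hα : 0 ≤ α) (hκ : 0 ≤ κ) (ζ : ℝ) : |sig α κ ζ| ≤ 1 := by
  have ha := rD_pos hα ζ
  have hb := rR_pos hκ ζ
  unfold sig
  rw [abs_div, abs_of_pos (mul_pos ha hb), div_le_one (mul_pos ha hb)]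
  have h1 : |ζ| ≤ rR κ ζ := by
    refine Real.abs_le_sqrt ?_
    have : 0 ≤ κ * ζ ^ 4 := by positivity
    linarith
  nlinarith [one_le_rD hα ζ]

/-- The symbol `ζ / (rD rR)` is of order `|ζ| / (|ζ| · ζ²)`, so `S` gains two derivatives when both
parameters are positive. -/
lemma abs_sig_mul_le (hα : 0 < α) (hκ : 0 < κ) : ∃ C : ℝ, 0 < C ∧
    ∀ ζ, |sig α κ ζ| * (1 + ζ ^ 2) ≤ C := by
  obtain ⟨k, hk, H⟩ := sqrt_le_rD hα
  obtain ⟨k', hk', H'⟩ := le_rR hκ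
  refine ⟨(k * k')⁻¹, by positivity, fun ζ => ?_⟩
  have ha := rD_pos hα.le ζ
  have hb := rR_pos hκ.le ζ
  unfold sig
  rw [abs_div, abs_of_pos (mul_pos ha hb), div_mul_eq_mul_div, div_le_iff₀ (mul_pos ha hb),
    ← div_eq_inv_mul, le_div_iff₀ (by positivity)]
  have h1 : |ζ| ≤ √(1 + ζ ^ 2) := Real.abs_le_sqrt (by linarith)
  calc |ζ| * (1 + ζ ^ 2) * (k * k') = (k * |ζ|) * (k' * (1 + ζ ^ 2)) := by ring
    _ ≤ (k * √(1 + ζ ^ 2)) * (k' * (1 + ζ ^ 2)) := by gcongr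
    _ ≤ rD α ζ * rR κ ζ := by gcongr; exacts [H ζ, H' ζ]

lemma abs_le_one_add_sq_pow (x y z ζ : ℝ) {j k l n : ℕ} (hj : j ≤ n) (hk : k ≤ n) (hl : l ≤ n) :
    |x * (ζ ^ 2) ^ j + y * (ζ ^ 2) ^ k + z * (ζ ^ 2) ^ l| ≤ (|x| + |y| + |z|) * (1 + ζ ^ 2) ^ n := by
  have hp : ∀ i : ℕ, i ≤ n → |(ζ ^ 2) ^ i| ≤ (1 + ζ ^ 2) ^ n := fun i hi => by
    rw [abs_of_nonneg (by positivity)]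
    calc (ζ ^ 2) ^ i ≤ (1 + ζ ^ 2) ^ i := by gcongr; linarith
      _ ≤ _ := pow_le_pow_right₀ (by nlinarith [sq_nonneg ζ]) hi
  calc _ ≤ |x * (ζ ^ 2) ^ j| + |y * (ζ ^ 2) ^ k| + |z * (ζ ^ 2) ^ l| := abs_add_three _ _ _
    _ ≤ |x| * (1 + ζ ^ 2) ^ n + |y| * (1 + ζ ^ 2) ^ n + |z| * (1 + ζ ^ 2) ^ n := by
      simp only [abs_mul x, abs_mul y, abs_mul z]
      gcongr <;> [exact hp _ hj; exact hp _ hk; exact hp _ hl]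
    _ = _ := by ring

lemma IsAmp.of_real {a a' : ℝ → ℝ} (hd : ∀ x, HasDerivAt a (a' x) x) (hc : Continuous a')
    {C C' : ℝ} (hC : ∀ x, |a x| ≤ C) (hC' : ∀ x, |a' x| ≤ C' * (1 + x ^ 2)⁻¹) (z : ℂ)
    (hz : ‖z‖ = 1) : IsAmp (fun x => z * a x) (fun x => z * a' x) where
  d x := (hd x).ofReal_comp.const_mul z
  cont := by fun_prop
  bdd := by
    refine ⟨max 1 (max C C'), by positivity, fun x => ?_, fun x => ?_⟩
    · rw [norm_mul, hz, one_mul, Complex.norm_real]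
      exact (hC x).trans ((le_max_left _ _).trans (le_max_right _ _))
    · rw [norm_mul, hz, one_mul, Complex.norm_real]
      refine (hC' x).trans ?_
      gcongr
      exact (le_max_right _ _).trans (le_max_right _ _)

lemma continuous_ampV (hα : 0 ≤ α) (hκ : 0 ≤ κ) : Continuous (ampV α κ) :=
  continuous_iff_continuousAt.2 fun ζ => (hasDerivAt_ampV hα hκ ζ).continuousAt
lemma continuous_phi (hα : 0 ≤ α) (hκ : 0 ≤ κ) : Continuous (phi α κ) :=
  continuous_iff_continuousAt.2 fun ζ => (hasDerivAt_phi hα hκ ζ).continuousAt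
lemma continuous_sig (hα : 0 ≤ α) (hκ : 0 ≤ κ) : Continuous (sig α κ) :=
  continuous_iff_continuousAt.2 fun ζ => (hasDerivAt_sig hα hκ ζ).continuousAt

/-- With `c = (1 + ζ²)^{1/2}`, the numerator of the derivative is `O(c⁵)` and the denominator at
least of order `c⁸`, which leaves the integrable rate `c⁻³`. For `α = κ = 0` the amplitude is
constant. -/
lemma isAmp_ampV (h : Par α κ) : ∃ m', IsAmp (fun ζ => (ampV α κ ζ : ℂ)) m' := by
  obtain ⟨hα, hκ⟩ := h.nonneg
  obtain ⟨C, hC, hCb⟩ := ampV_le h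
  have hb : ∀ x, |ampV α κ x| ≤ C := fun x => by
    rw [abs_of_pos (ampV_nonneg hα hκ x)]; exact hCb x
  set m' : ℝ → ℝ := fun ζ => ζ * (-α + (2 * κ - 2 * α) * ζ ^ 2 + (κ * (1 + α) - α) * ζ ^ 4)
      / (rR κ ζ * rD α ζ ^ 3 * √(1 + ζ ^ 2) ^ 3) with hm'
  have hden : ∀ ζ, 0 < rR κ ζ * rD α ζ ^ 3 * √(1 + ζ ^ 2) ^ 3 := fun ζ => by
    have := rD_pos hα ζ; have := rR_pos hκ ζ; positivity
  have hcont : Continuous m' := Continuous.div (by fun_prop) (by fun_prop) fun ζ => (hden ζ).ne'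
  suffices hs : ∃ C', ∀ x, |m' x| ≤ C' * (1 + x ^ 2)⁻¹ by
    obtain ⟨C', hC'⟩ := hs
    have := IsAmp.of_real (hasDerivAt_ampV hα hκ) hcont hb hC' 1 (by simp)
    exact ⟨_, by simpa using! this⟩
  rcases h with ⟨hα', hκ'⟩ | ⟨rfl, rfl⟩
  · obtain ⟨k, hk, H⟩ := sqrt_le_rD hα'
    obtain ⟨k', hk', H'⟩ := le_rR hκ'
    refine ⟨(|-α| + |2 * κ - 2 * α| + |κ * (1 + α) - α|) / (k' * k ^ 3), fun ζ => ?_⟩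
    set c := √(1 + ζ ^ 2) with hc
    have hc2 : c ^ 2 = 1 + ζ ^ 2 := Real.sq_sqrt (by positivity)
    have hcp : 0 < c := Real.sqrt_pos.2 (by positivity)
    have h1 : |ζ| ≤ c := Real.abs_le_sqrt (by linarith)
    have h2 := abs_le_one_add_sq_pow (-α) (2 * κ - 2 * α) (κ * (1 + α) - α) ζ (j := 0) (k := 1)
      (l := 2) (n := 2) (by norm_num) (by norm_num) le_rfl
    rw [show (-α) * (ζ ^ 2) ^ 0 + (2 * κ - 2 * α) * (ζ ^ 2) ^ 1 + (κ * (1 + α) - α) * (ζ ^ 2) ^ 2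
      = -α + (2 * κ - 2 * α) * ζ ^ 2 + (κ * (1 + α) - α) * ζ ^ 4 by ring] at h2
    have ha := rD_pos hα ζ
    have hb := rR_pos hκ ζ
    have hH := H ζ; have hH' := H' ζ
    rw [hm', abs_div, abs_of_pos (hden ζ), abs_mul, ← hc]
    calc _ ≤ c * ((|-α| + |2 * κ - 2 * α| + |κ * (1 + α) - α|) * (1 + ζ ^ 2) ^ 2)
          / (k' * (1 + ζ ^ 2) * (k * c) ^ 3 * c ^ 3) := by gcongr
      _ = (|-α| + |2 * κ - 2 * α| + |κ * (1 + α) - α|) / (k' * k ^ 3) * (c ^ 3)⁻¹ := by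
        rw [← hc2]; field_simp
      _ ≤ _ := by
        have hc1 : 1 ≤ c := Real.one_le_sqrt.2 (by nlinarith [sq_nonneg ζ])
        rw [← hc2]
        gcongr ?_ * ?_
        exact inv_anti₀ (by positivity) (pow_le_pow_right₀ hc1 (by norm_num))
  · exact ⟨0, fun ζ => by simp [hm']⟩

/-- The derivative is `O(c⁶ / c⁹)` with `c = (1 + ζ²)^{1/2}` if `α, κ > 0`, and exactly `c⁻³` if
both vanish. This lets the decay estimate use the `L¹` norm of `f(u)` rather than of `S f(u)`. -/
lemma isAmp_sig (h : Par α κ) : ∃ m', IsAmp (fun ζ => Complex.I * (sig α κ ζ : ℂ)) m' := by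
  obtain ⟨hα, hκ⟩ := h.nonneg
  set m' : ℝ → ℝ := fun ζ => (1 - (α + κ) * ζ ^ 4 - 2 * α * κ * ζ ^ 6) / (rD α ζ ^ 3 * rR κ ζ ^ 3)
    with hm'
  have hden : ∀ ζ, 0 < rD α ζ ^ 3 * rR κ ζ ^ 3 := fun ζ => by
    have := rD_pos hα ζ; have := rR_pos hκ ζ; positivity
  have hcont : Continuous m' := Continuous.div (by fun_prop) (by fun_prop) fun ζ => (hden ζ).ne'
  suffices hs : ∃ C', ∀ x, |m' x| ≤ C' * (1 + x ^ 2)⁻¹ by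
    obtain ⟨C', hC'⟩ := hs
    exact ⟨_, IsAmp.of_real (hasDerivAt_sig hα hκ) hcont (abs_sig_le hα hκ) hC' Complex.I (by simp)⟩
  rcases h with ⟨hα', hκ'⟩ | ⟨rfl, rfl⟩
  · obtain ⟨k, hk, H⟩ := sqrt_le_rD hα'
    obtain ⟨k', hk', H'⟩ := le_rR hκ'
    refine ⟨(|1| + |-(α + κ)| + |-(2 * α * κ)|) / (k ^ 3 * k' ^ 3), fun ζ => ?_⟩
    set c := √(1 + ζ ^ 2) with hc
    have hc2 : c ^ 2 = 1 + ζ ^ 2 := Real.sq_sqrt (by positivity)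
    have hc1 : 1 ≤ c := Real.one_le_sqrt.2 (by nlinarith [sq_nonneg ζ])
    have hcp : 0 < c := by linarith
    have h2 := abs_le_one_add_sq_pow 1 (-(α + κ)) (-(2 * α * κ)) ζ (j := 0) (k := 2) (l := 3)
      (by norm_num) (by norm_num) le_rfl
    rw [show 1 * (ζ ^ 2) ^ 0 + -(α + κ) * (ζ ^ 2) ^ 2 + -(2 * α * κ) * (ζ ^ 2) ^ 3
      = 1 - (α + κ) * ζ ^ 4 - 2 * α * κ * ζ ^ 6 by ring] at h2
    have ha := rD_pos hα ζ
    have hb := rR_pos hκ ζ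
    have hH := H ζ; have hH' := H' ζ
    rw [hm', abs_div, abs_of_pos (hden ζ)]
    calc _ ≤ (|1| + |-(α + κ)| + |-(2 * α * κ)|) * (1 + ζ ^ 2) ^ 3
          / ((k * c) ^ 3 * (k' * (1 + ζ ^ 2)) ^ 3) := by
          gcongr
      _ = (|1| + |-(α + κ)| + |-(2 * α * κ)|) / (k ^ 3 * k' ^ 3) * (c ^ 3)⁻¹ := by
        rw [← hc2]; field_simp
      _ ≤ _ := by
        rw [← hc2]
        gcongr ?_ * ?_
        exact inv_anti₀ (by positivity) (pow_le_pow_right₀ hc1 (by norm_num))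
  · refine ⟨1, fun ζ => ?_⟩
    have hb := rR_pos (le_refl (0:ℝ)) ζ
    have hb1 := one_le_rR (le_refl (0:ℝ)) ζ
    have e : rR 0 ζ ^ 2 = 1 + ζ ^ 2 := by rw [rR_sq le_rfl]; ring
    have e1 : rD 0 ζ = 1 := by simp [rD]
    simp only [hm', e1, ← e, one_mul, one_pow]
    rw [show (1 - (0 + 0) * ζ ^ 4 - 2 * 0 * 0 * ζ ^ 6 : ℝ) = 1 by ring, abs_of_pos (by positivity),
      one_div]
    exact inv_anti₀ (by positivity) (pow_le_pow_right₀ hb1 (by norm_num))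

end
end

section
open scoped ComplexConjugate ContDiff SchwartzMap

/-! ### Smooth frequency cutoffs -/

/-- A smooth cutoff function. -/
def chi : ContDiffBump (0 : ℝ) := ⟨1, 2, one_pos, one_lt_two⟩

lemma chi_neg (x : ℝ) : chi (-x) = chi x := chi.neg x
lemma chi_one {x : ℝ} (hx : |x| ≤ 1) : chi x = 1 :=
  chi.one_of_mem_closedBall (by simpa [Real.dist_eq] using! hx)
lemma chi_zero {x : ℝ} (hx : 2 ≤ |x|) : chi x = 0 :=
  chi.zero_of_le_dist (by simpa [Real.dist_eq] using! hx)
lemma chi_contDiff : ContDiff ℝ ∞ (chi : ℝ → ℝ) := chi.contDiff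
lemma chi_supp : HasCompactSupport (chi : ℝ → ℝ) := chi.hasCompactSupport
lemma chi_mem (x : ℝ) : 0 ≤ chi x ∧ chi x ≤ 1 := ⟨chi.nonneg, chi.le_one⟩

lemma chi_scaled_supp {L : ℝ} (hL : 0 < L) : HasCompactSupport (fun ξ : ℝ => chi (ξ / L)) :=
  HasCompactSupport.intro (isCompact_Icc (a := -(2 * L)) (b := 2 * L)) fun x hx => chi_zero <| by
    rw [abs_div, abs_of_pos hL, le_div_iff₀ hL]
    by_contra hc
    exact hx (abs_le.1 (not_le.1 hc).le)

/-- The symbol of the `j`-th derivative of the frequency cutoff at `L`. -/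
def cutSym (L : ℝ) (hL : 0 < L) (j : ℕ) : BSym where
  toFun ξ := (2 * Real.pi * Complex.I * ξ) ^ j * (chi (ξ / L) : ℝ)
  meas := by
    have := chi_contDiff.continuous
    exact Continuous.measurable (by fun_prop)
  herm ξ := by
    rw [neg_div, chi_neg, map_mul, map_pow, Complex.conj_ofReal]
    congr 2
    simp [map_ofNat]
  bdd := by
    have h0 := chi_contDiff.continuous
    have hc : HasCompactSupport (fun ξ : ℝ => (2 * Real.pi * Complex.I * ξ) ^ j
        * ((chi (ξ / L) : ℝ) : ℂ)) :=
      HasCompactSupport.mul_left ((chi_scaled_supp hL).comp_left (g := fun x : ℝ => (x : ℂ)) (by simp))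
    exact hc.exists_bound_of_continuous (by fun_prop)

lemma cutSym_apply (L : ℝ) (hL : 0 < L) (j : ℕ) (ξ : ℝ) :
    cutSym L hL j ξ = (2 * Real.pi * Complex.I * ξ) ^ j * (chi (ξ / L) : ℝ) := rfl

lemma cutSym_zero_of_le {L : ℝ} (hL : 0 < L) (j : ℕ) {ξ : ℝ} (h : 2 * L ≤ |ξ|) :
    cutSym L hL j ξ = 0 := by
  rw [cutSym_apply, chi_zero, Complex.ofReal_zero, mul_zero]
  rwa [abs_div, abs_of_pos hL, le_div_iff₀ hL]

lemma integrable_cut {L : ℝ} (hL : 0 < L) (j : ℕ) (u : L2) :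
    Integrable (fun ξ => cutSym L hL j ξ * ft u ξ) := by
  obtain ⟨C, hC⟩ := (cutSym L hL j).bdd
  have h1 : IntegrableOn (fun ξ => cutSym L hL j ξ * ft u ξ) (Set.Icc (-(2 * L)) (2 * L)) := by
    have h2 : IntegrableOn (ft u) (Set.Icc (-(2 * L)) (2 * L)) := by
      have : MemLp (ft u) 1 (volume.restrict (Set.Icc (-(2 * L)) (2 * L))) :=
        ((Lp.memLp (ft u)).restrict _).mono_exponent (by norm_num)
      exact memLp_one_iff_integrable.1 this
    exact h2.bdd_mul (cutSym L hL j).meas.aestronglyMeasurable (Eventually.of_forall hC)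
  refine (integrableOn_iff_integrable_of_support_subset fun ξ hξ => ?_).1 h1
  by_contra hcon
  refine hξ ?_
  change cutSym L hL j ξ * ft u ξ = 0
  rw [cutSym_zero_of_le hL j, zero_mul]
  by_contra hc
  exact hcon (abs_le.1 (not_le.1 hc).le)

/-- The derivatives of the frequency cutoff at `L` of `u`, as functions. -/
def cutFun (L : ℝ) (hL : 0 < L) (u : L2) (j : ℕ) (x : ℝ) : ℝ :=
  (𝓕⁻ (fun ξ => cutSym L hL j ξ * ft u ξ) x).re

lemma cutFun_ae {L : ℝ} (hL : 0 < L) (u : L2) (j : ℕ) :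
    ∀ᵐ x, (cutSym L hL j).op u x = cutFun L hL u j x := by
  have h := (cutSym L hL j).ft_op u
  filter_upwards [ae_eq_fourierInv _ ((integrable_cut hL j u).congr
    (h.mono fun ξ hξ => hξ.symm))] with x hx
  have e : 𝓕⁻ (ft ((cutSym L hL j).op u) : ℝ → ℂ) x = 𝓕⁻ (fun ξ => cutSym L hL j ξ * ft u ξ) x := by
    rw [Real.fourierInv_eq, Real.fourierInv_eq]
    refine integral_congr_ae ?_
    filter_upwards [h] with ξ hξ
    rw [hξ]
  rw [cutFun, ← e, ← hx, Complex.ofReal_re]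

/-- A sequence of successive derivatives of a smooth function, all bounded and square integrable. -/
structure Tower (W : ℕ → ℝ → ℝ) : Prop where
  deriv : ∀ j x, HasDerivAt (W j) (W (j + 1) x) x
  bdd : ∀ j, ∃ C, ∀ x, |W j x| ≤ C
  memLp : ∀ j, MemLp (W j) 2 volume

/-- The transform has compact support, so one may differentiate any number of times under the
Fourier integral. -/
lemma tower_cutFun {L : ℝ} (hL : 0 < L) (u : L2) : Tower (cutFun L hL u) where
  deriv j x := by
    have h1 := integrable_cut hL j u
    have h2 : Integrable (fun ξ : ℝ => ξ • (cutSym L hL j ξ * ft u ξ)) := by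
      have := (integrable_cut hL (j + 1) u).const_mul ((2 * Real.pi * Complex.I)⁻¹)
      refine this.congr (Eventually.of_forall fun ξ => ?_)
      simp only [cutSym_apply, Complex.real_smul]
      have : (2 * (Real.pi : ℂ) * Complex.I) ≠ 0 := by simp [Real.pi_ne_zero]
      field_simp
      ring
    have h3 := (Real.hasDerivAt_fourier h1 h2 (-x)).scomp x (hasDerivAt_neg x)
    have e : (fun y => 𝓕⁻ (fun ξ => cutSym L hL j ξ * ft u ξ) y)
        = 𝓕 (fun ξ => cutSym L hL j ξ * ft u ξ) ∘ Neg.neg := by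
      ext y; rw [Real.fourierInv_eq_fourier_neg]; rfl
    have h4 : HasDerivAt (fun y => 𝓕⁻ (fun ξ => cutSym L hL j ξ * ft u ξ) y)
        (𝓕⁻ (fun ξ => cutSym L hL (j + 1) ξ * ft u ξ) x) x := by
      rw [e]
      convert! h3 using 1
      rw [Real.fourierInv_eq_fourier_neg, neg_one_smul, Real.fourier_eq, Real.fourier_eq,
        ← integral_neg]
      congr 1; ext ξ
      rw [← smul_neg]
      congr 1
      simp only [cutSym_apply, smul_eq_mul]; ring
    exact Complex.reCLM.hasFDerivAt.comp_hasDerivAt x h4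
  bdd j := ⟨∫ ξ, ‖cutSym L hL j ξ * ft u ξ‖, fun x =>
    (Complex.abs_re_le_norm _).trans (norm_fourierInv_le _ x)⟩
  memLp j := (Lp.memLp ((cutSym L hL j).op u)).ae_eq (cutFun_ae hL u j)

/-- The cutoff is integration against the rescaled Schwartz kernel `L k(L(y - x))`, whose `L¹` norm
does not depend on `L`. It can exceed the bound of `u` by the factor `K`, which is why hypotheses on
`f` are later made on `|y| ≤ K A`. -/
lemma cutFun_bound : ∃ K : ℝ, 1 ≤ K ∧ ∀ (L : ℝ) (hL : 0 < L) (u : L2) (A : ℝ), 0 ≤ A →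
    eLpNorm u ⊤ volume ≤ ENNReal.ofReal A → ∀ x, |cutFun L hL u 0 x| ≤ K * A := by
  set k : ℝ → ℂ := 𝓕 (fun ξ => ((chi ξ : ℝ) : ℂ)) with hk
  have hkS : k = 𝓕 (testSchwartz chi chi_contDiff chi_supp) := by
    rw [hk, SchwartzMap.fourier_coe]; rfl
  have hki : Integrable k := by rw [hkS]; exact (𝓕 (testSchwartz chi chi_contDiff chi_supp)).integrable
  refine ⟨max 1 (∫ y, ‖k y‖), le_max_left _ _, fun L hL u A hA hu x => ?_⟩
  have hsup : HasCompactSupport (fun ξ : ℝ => Complex.exp (2 * Real.pi * Complex.I * x * ξ)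
      * ((chi (ξ / L) : ℝ) : ℂ)) :=
    HasCompactSupport.mul_left ((chi_scaled_supp hL).comp_left (g := fun x : ℝ => (x : ℂ)) (by simp))
  have hsm : ContDiff ℝ ∞ (fun ξ : ℝ => Complex.exp (2 * Real.pi * Complex.I * x * ξ)
      * ((chi (ξ / L) : ℝ) : ℂ)) := by
    refine ContDiff.mul ?_ ?_
    · exact (contDiff_const.mul Complex.ofRealCLM.contDiff).cexp
    · exact Complex.ofRealCLM.contDiff.comp (chi_contDiff.comp (contDiff_id.div_const L))
  set ψ : 𝓢(ℝ, ℂ) := hsup.toSchwartzMap hsm with hψ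
  have hψa : ∀ ξ, ψ ξ = Complex.exp (2 * Real.pi * Complex.I * x * ξ)
      * ((chi (ξ / L) : ℝ) : ℂ) := fun ξ => rfl
  have hF : ∀ y, (𝓕 ψ) y = (L : ℂ) * k (L * (y - x)) := fun y => by
    rw [SchwartzMap.fourier_coe, hk, Real.fourier_real_eq_integral_exp_smul,
      Real.fourier_real_eq_integral_exp_smul]
    have h := Measure.integral_comp_div (fun v : ℝ =>
      Complex.exp (↑(-2 * Real.pi * v * (L * (y - x))) * Complex.I) • ((chi v : ℝ) : ℂ)) L
    rw [abs_of_pos hL, ← Complex.coe_smul, smul_eq_mul] at h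
    rw [← h]
    congr 1; ext ξ
    rw [hψa, smul_eq_mul, smul_eq_mul, ← mul_assoc, ← Complex.exp_add]
    congr 2
    have : (L : ℂ) ≠ 0 := by exact_mod_cast hL.ne'
    push_cast
    field_simp
    ring
  have e1 : 𝓕⁻ (fun ξ => cutSym L hL 0 ξ * ft u ξ) x = ∫ y, (𝓕 ψ) y • toC u y := by
    rw [← integral_smul_fourier, Real.fourierInv_eq']
    refine integral_congr_ae (Eventually.of_forall fun ξ => ?_)
    simp only [hψa, cutSym_apply, pow_zero, one_mul, smul_eq_mul, ft_eq, ← mul_assoc]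
    congr 3
    simp
    ring
  have hb : ∀ᵐ y, ‖(𝓕 ψ) y • toC u y‖ ≤ L * ‖k (L * (y - x))‖ * A := by
    rw [eLpNorm_exponent_top] at hu
    filter_upwards [ae_le_eLpNormEssSup (f := u) (μ := volume), toC_ae u] with y h1 h2
    rw [norm_smul, hF, norm_mul, h2, Complex.norm_real, Complex.norm_real, Real.norm_of_nonneg hL.le]
    have : ‖u y‖ ≤ A := by
      have := h1.trans hu
      rw [← ofReal_norm] at this
      exact (ENNReal.ofReal_le_ofReal_iff hA).1 this
    gcongr
  have hki2 : Integrable (fun y => k (L * (y - x))) :=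
    (hki.comp_mul_left' hL.ne').comp_sub_right x
  have e2 : ∫ y, L * ‖k (L * (y - x))‖ * A = (∫ y, ‖k y‖) * A := by
    rw [integral_mul_const, integral_const_mul,
      integral_sub_right_eq_self (fun y => ‖k (L * y)‖) x,
      Measure.integral_comp_mul_left (fun y => ‖k y‖) L, abs_of_pos (inv_pos.2 hL), smul_eq_mul,
      ← mul_assoc, mul_inv_cancel₀ hL.ne', one_mul]
  calc |cutFun L hL u 0 x| ≤ ‖𝓕⁻ (fun ξ => cutSym L hL 0 ξ * ft u ξ) x‖ := Complex.abs_re_le_norm _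
    _ ≤ ∫ y, L * ‖k (L * (y - x))‖ * A := by
      rw [e1]
      exact norm_integral_le_of_norm_le ((hki2.norm.const_mul L).mul_const A) hb
    _ ≤ _ := by rw [e2]; gcongr; exact le_max_right _ _
end

section
open scoped ComplexConjugate ContDiff

/-! ### Gagliardo–Nirenberg inequalities and the chain rule -/

/-- The arithmetic-geometric mean inequality with rescaled factors: the first two terms become small
enough to be absorbed, at the price of the third. -/
lemma exists_young {a b c ε : ℝ} (ha : 0 ≤ a) (hb : 0 ≤ b) (hc : 0 < c) (h1 : a + b + c = 1)
    (hε : 0 < ε) : ∃ C : ℝ, 0 < C ∧ ∀ X Y Z : ℝ, 0 ≤ X → 0 ≤ Y → 0 ≤ Z →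
      X ^ a * Y ^ b * Z ^ c ≤ ε * (a * X + b * Y) + C * Z := by
  refine ⟨c * ε ^ (-(a + b) / c), by positivity, fun X Y Z hX hY hZ => ?_⟩
  have h := Real.geom_mean_le_arith_mean3_weighted ha hb hc.le (mul_nonneg hε.le hX)
    (mul_nonneg hε.le hY) (mul_nonneg (Real.rpow_nonneg hε.le (-(a + b) / c)) hZ) h1
  rw [Real.mul_rpow hε.le hX, Real.mul_rpow hε.le hY, Real.mul_rpow (by positivity) hZ,
    ← Real.rpow_mul hε.le, div_mul_cancel₀ _ hc.ne'] at h
  have e : ε ^ a * X ^ a * (ε ^ b * Y ^ b) * (ε ^ (-(a + b)) * Z ^ c) = X ^ a * Y ^ b * Z ^ c := by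
    have : ε ^ a * ε ^ b * ε ^ (-(a + b)) = 1 := by
      rw [← Real.rpow_add hε, ← Real.rpow_add hε, add_neg_cancel, Real.rpow_zero]
    linear_combination (X ^ a * Y ^ b * Z ^ c) * this
  rw [e] at h
  linarith

lemma hasDerivAt_mul_abs_rpow {r : ℝ} (hr : 0 < r) (y : ℝ) :
    HasDerivAt (fun y : ℝ => y * |y| ^ r) ((r + 1) * |y| ^ r) y := by
  have hc : Continuous fun y : ℝ => |y| ^ r := continuous_abs.rpow_const fun _ => Or.inr hr.le
  refine hasDerivAt_of_hasDerivAt_of_ne' (x := 0) (g := fun y => (r + 1) * |y| ^ r)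
    (fun x hx => ?_) (continuous_id.mul hc).continuousAt (continuous_const.mul hc).continuousAt y
  have hx0 : |x| ≠ 0 := abs_ne_zero.2 hx
  have h := (hasDerivAt_id x).mul ((hasDerivAt_abs hx).rpow_const (p := r) (Or.inl hx0))
  refine h.congr_deriv ?_
  rw [Real.rpow_sub_one hx0]
  have : (SignType.sign x : ℝ) * x = |x| := by rw [sign_mul_self]
  simp only [id]
  field_simp
  linear_combination r * this

namespace Tower
variable {W : ℕ → ℝ → ℝ}

lemma cont (T : Tower W) (j : ℕ) : Continuous (W j) :=
  continuous_iff_continuousAt.2 fun x => (T.deriv j x).continuousAt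

lemma contDiff (T : Tower W) : ∀ (n : ℕ) (j : ℕ), ContDiff ℝ n (W j)
  | 0, j => contDiff_zero.2 (T.cont j)
  | n + 1, j => by
    have hd : _root_.deriv (W j) = W (j + 1) := funext fun x => (T.deriv j x).deriv
    refine (contDiff_succ_iff_deriv (n := (n : ℕ∞ω))).2
      ⟨fun x => (T.deriv j x).differentiableAt, by simp, ?_⟩
    rw [hd]; exact contDiff T n (j + 1)

lemma iteratedDeriv_eq (T : Tower W) (j : ℕ) : iteratedDeriv j (W 0) = W j := by
  induction j with
  | zero => simp
  | succ j ih =>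
    rw [iteratedDeriv_succ, ih]
    exact funext fun x => (T.deriv j x).deriv

lemma const_mul (T : Tower W) (c : ℝ) : Tower (fun j x => c * W j x) where
  deriv j x := (T.deriv j x).const_mul c
  bdd j := by
    obtain ⟨C, hC⟩ := T.bdd j
    exact ⟨|c| * C, fun x => by rw [abs_mul]; gcongr; exact hC x⟩
  memLp j := (T.memLp j).const_mul c

lemma integrable_sq (T : Tower W) (j : ℕ) : Integrable (fun x => |W j x| ^ (2 : ℝ)) := by
  have := (T.memLp j).integrable_sq
  refine this.congr (Eventually.of_forall fun x => ?_)
  simp only [Real.rpow_two, sq_abs]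

lemma integrable_rpow (T : Tower W) (j : ℕ) {r : ℝ} (hr : 2 ≤ r) :
    Integrable (fun x => |W j x| ^ r) := by
  obtain ⟨C, hC⟩ := T.bdd j
  have hW := T.cont j
  refine ((T.integrable_sq j).const_mul (C ^ (r - 2))).mono'
    ((hW.abs.rpow_const fun _ => Or.inr (by linarith)).aestronglyMeasurable)
    (Eventually.of_forall fun x => ?_)
  rw [Real.norm_of_nonneg (by positivity)]
  calc |W j x| ^ r = |W j x| ^ ((r - 2) + 2) := by congr 1; ring
    _ = |W j x| ^ (r - 2) * |W j x| ^ (2 : ℝ) :=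
      Real.rpow_add_of_nonneg (abs_nonneg _) (by linarith) (by norm_num)
    _ ≤ _ := by
      gcongr
      exact hC x

lemma integrable_mul (T : Tower W) (i j : ℕ) : Integrable (fun x => W i x * W j x) :=
  (T.memLp i).integrable_mul (T.memLp j)

lemma integrable_bdd_mul (T : Tower W) (i j : ℕ) {h : ℝ → ℝ} (hh : Continuous h) :
    Integrable (fun x => h (W i x) * (W i x * W j x)) ∧
    ∀ l, Integrable (fun x => h (W l x) * (W i x * W j x)) := by
  have key : ∀ l, Integrable (fun x => h (W l x) * (W i x * W j x)) := fun l => by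
    obtain ⟨C, hC⟩ := T.bdd l
    obtain ⟨M, hM⟩ := (isCompact_Icc (a := -C) (b := C)).exists_bound_of_continuousOn hh.continuousOn
    exact (T.integrable_mul i j).bdd_mul (c := M) (hh.comp (T.cont l)).aestronglyMeasurable
      (Eventually.of_forall fun x => hM _ (abs_le.1 (hC x)))
  exact ⟨key i, key⟩

end Tower

/-- The three exponents on the right add up to one, as Young's inequality requires. For `n = 0` the
division by zero makes the first factor `1`, and `X` is replaced by its bound `M`. -/
lemma gn_pointwise {k n : ℕ} (hn : n + 1 < k) {M : ℝ} (hM : 1 ≤ M) {X Y Z : ℝ}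
    (hX : 0 ≤ X) (hY : 0 ≤ Y) (hZ : 0 ≤ Z) (hXM : n = 0 → X ≤ M) :
    X * Y ^ (2 * (k : ℝ) / (n + 1) - 2) * Z ≤
      M * ((X ^ (2 * (k : ℝ) / n)) ^ ((n : ℝ) / (2 * k))
        * (Y ^ (2 * (k : ℝ) / (n + 1))) ^ (((k : ℝ) - (n + 1)) / k)
        * (Z ^ (2 * (k : ℝ) / (n + 2))) ^ (((n : ℝ) + 2) / (2 * k))) := by
  have hk : (0 : ℝ) < k := by exact_mod_cast (by omega : 0 < k)
  have hn0 : (0 : ℝ) ≤ n := Nat.cast_nonneg n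
  have e2 : (Y ^ (2 * (k : ℝ) / (n + 1))) ^ (((k : ℝ) - (n + 1)) / k)
      = Y ^ (2 * (k : ℝ) / (n + 1) - 2) := by
    rw [← Real.rpow_mul hY]; congr 1; field_simp
  have e3 : (Z ^ (2 * (k : ℝ) / (n + 2))) ^ (((n : ℝ) + 2) / (2 * k)) = Z := by
    rw [← Real.rpow_mul hZ]
    convert! Real.rpow_one Z using 2
    field_simp
  rw [e2, e3, ← mul_assoc, ← mul_assoc]
  gcongr
  rcases Nat.eq_zero_or_pos n with rfl | hpos
  · simpa using! hXM rfl
  · have hn1 : (0 : ℝ) < n := by exact_mod_cast hpos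
    rw [← Real.rpow_mul hX, show 2 * (k : ℝ) / n * (n / (2 * k)) = 1 by field_simp, Real.rpow_one]
    nlinarith

/-- Writing `|W_{n+1}|^q = W_{n+1} |W_{n+1}|^{q-2} W_n'` and integrating by parts produces the
product `|W_n| |W_{n+1}|^{q-2} |W_{n+2}|`. Young's inequality splits it; the terms of order `n` (by
induction) and `n + 1` are absorbed. The factor `n` on the left makes the case `n = 0`, where the
exponent degenerates, trivial. -/
lemma gn_step (k : ℕ) {M : ℝ} (hM : 1 ≤ M) : ∀ n : ℕ, n < k → ∃ C : ℝ, 0 ≤ C ∧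
    ∀ W : ℕ → ℝ → ℝ, Tower W → (∀ x, |W 0 x| ≤ M) →
      (n : ℝ) * ∫ x, |W n x| ^ (2 * (k : ℝ) / n)
        ≤ C * ∫ x, |W (n + 1) x| ^ (2 * (k : ℝ) / (n + 1)) := by
  intro n
  induction n with
  | zero => exact fun _ => ⟨0, le_rfl, fun W _ _ => by simp⟩
  | succ n ih =>
    intro hn
    obtain ⟨C', hC', H⟩ := ih (by omega)
    have hk : (0 : ℝ) < k := by exact_mod_cast (by omega : 0 < k)
    have hn0 : (0 : ℝ) ≤ n := Nat.cast_nonneg n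
    have hnk : (n : ℝ) + 1 < k := by exact_mod_cast hn
    set q : ℝ := 2 * (k : ℝ) / (n + 1) with hq
    have hq2 : 2 < q := by rw [hq, lt_div_iff₀ (by positivity)]; linarith
    -- Chosen so that the terms of orders `n` and `n + 1` together amount to half of the left-hand
    -- side.
    set ε : ℝ := ((q - 1) * M * (C' / (2 * k) + 1) * 2)⁻¹ with hε
    have hD : 0 < (q - 1) * M * (C' / (2 * k) + 1) := by
      have : 0 < q - 1 := by linarith
      positivity
    have hε0 : 0 < ε := by rw [hε]; positivity
    obtain ⟨C, hC, HY⟩ := exists_young (a := (n : ℝ) / (2 * k)) (b := ((k : ℝ) - (n + 1)) / k)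
      (c := ((n : ℝ) + 2) / (2 * k)) (by positivity)
      (div_nonneg (by linarith) hk.le) (by positivity) (by field_simp; ring) hε0
    have hq1 : 0 < q - 1 := by linarith
    refine ⟨(n + 1) * (2 * ((q - 1) * M * C)), by positivity, fun W T hW => ?_⟩
    have hH := H W T hW
    push_cast
    have ibp : ∫ x, |W (n + 1) x| ^ q
        = - ∫ x, (q - 1) * |W (n + 1) x| ^ (q - 2) * W (n + 1 + 1) x * W n x := by
      have hcr : Continuous fun y : ℝ => |y| ^ (q - 2) :=
        continuous_abs.rpow_const fun _ => Or.inr (by linarith)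
      have i1 := (T.integrable_bdd_mul (n + 1) (n + 1) hcr).1
      have i2 := (T.integrable_bdd_mul (n + 1 + 1) n hcr).2 (n + 1)
      have i3 := (T.integrable_bdd_mul (n + 1) n hcr).1
      have h := integral_mul_deriv_eq_deriv_mul_of_integrable
        (u := fun x => W (n + 1) x * |W (n + 1) x| ^ (q - 2)) (v := W n)
        (u' := fun x => (q - 1) * |W (n + 1) x| ^ (q - 2) * W (n + 1 + 1) x) (v' := W (n + 1))
        (fun x _ => by
          have := (hasDerivAt_mul_abs_rpow (r := q - 2) (by linarith) (W (n + 1) x)).comp x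
            (T.deriv (n + 1) x)
          rw [show q - 2 + 1 = q - 1 by ring] at this
          exact this)
        (fun x _ => T.deriv n x)
        (i1.congr (Eventually.of_forall fun x => by simp only [Pi.mul_apply]; ring))
        ((i2.const_mul (q - 1)).congr (Eventually.of_forall fun x => by simp only [Pi.mul_apply]; ring))
        (i3.congr (Eventually.of_forall fun x => by simp only [Pi.mul_apply]; ring))
      rw [← h]
      congr 1; ext x
      rw [mul_right_comm, ← pow_two, ← sq_abs, ← Real.rpow_two,
        ← Real.rpow_add_of_nonneg (abs_nonneg _) (by norm_num) (by linarith)]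
      congr 1; ring
    have I1 := T.integrable_rpow (n + 1) hq2.le
    have I2 : Integrable fun x => |W (n + 1 + 1) x| ^ (2 * (k : ℝ) / (n + 2)) :=
      T.integrable_rpow _ (by
        rw [le_div_iff₀ (by positivity)]
        have : (n : ℝ) + 2 ≤ k := by exact_mod_cast hn
        linarith)
    have I0 : Integrable fun x => (n : ℝ) / (2 * k) * |W n x| ^ (2 * (k : ℝ) / n) := by
      rcases Nat.eq_zero_or_pos n with h0 | hpos
      · subst h0; simp
      · have hn1 : (0 : ℝ) < n := by exact_mod_cast hpos
        exact (T.integrable_rpow n (by rw [le_div_iff₀ hn1]; linarith)).const_mul _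
    have hpt : ∀ x, ‖(q - 1) * |W (n + 1) x| ^ (q - 2) * W (n + 1 + 1) x * W n x‖
        ≤ (q - 1) * (M * (ε * ((n : ℝ) / (2 * k) * |W n x| ^ (2 * (k : ℝ) / n)
          + ((k : ℝ) - (n + 1)) / k * |W (n + 1) x| ^ q)
          + C * |W (n + 1 + 1) x| ^ (2 * (k : ℝ) / (n + 2)))) := fun x => by
      have h1 := gn_pointwise hn hM (abs_nonneg (W n x)) (abs_nonneg (W (n + 1) x))
        (abs_nonneg (W (n + 1 + 1) x)) (fun h0 => by subst h0; exact hW x)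
      have h2 := HY (|W n x| ^ (2 * (k : ℝ) / n)) (|W (n + 1) x| ^ q)
        (|W (n + 1 + 1) x| ^ (2 * (k : ℝ) / (n + 2))) (by positivity) (by positivity) (by positivity)
      rw [norm_mul, norm_mul, norm_mul, Real.norm_of_nonneg hq1.le,
        Real.norm_of_nonneg (by positivity : 0 ≤ |W (n + 1) x| ^ (q - 2)), Real.norm_eq_abs,
        Real.norm_eq_abs]
      calc (q - 1) * |W (n + 1) x| ^ (q - 2) * |W (n + 1 + 1) x| * |W n x|
          = (q - 1) * (|W n x| * |W (n + 1) x| ^ (q - 2) * |W (n + 1 + 1) x|) := by ring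
        _ ≤ _ := by
          exact mul_le_mul_of_nonneg_left (h1.trans (mul_le_mul_of_nonneg_left h2 (by linarith))) hq1.le
    have hint : ∫ x, |W (n + 1) x| ^ q ≤ (q - 1) * (M * (ε * ((n : ℝ) / (2 * k)
          * (∫ x, |W n x| ^ (2 * (k : ℝ) / n)) + ((k : ℝ) - (n + 1)) / k * ∫ x, |W (n + 1) x| ^ q)
          + C * ∫ x, |W (n + 1 + 1) x| ^ (2 * (k : ℝ) / (n + 2)))) := by
      have h1 : Integrable fun x => ε * ((n : ℝ) / (2 * k) * |W n x| ^ (2 * (k : ℝ) / n)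
          + ((k : ℝ) - (n + 1)) / k * |W (n + 1) x| ^ q) := (I0.add (I1.const_mul _)).const_mul ε
      have h2 := h1.add (I2.const_mul C)
      simp only [Pi.add_def] at h2
      have h3 := I0.add (I1.const_mul (((k : ℝ) - (n + 1)) / k))
      simp only [Pi.add_def] at h3
      calc _ ≤ ‖∫ x, (q - 1) * |W (n + 1) x| ^ (q - 2) * W (n + 1 + 1) x * W n x‖ := by
            rw [ibp, ← norm_neg]; exact le_abs_self _
        _ ≤ _ := norm_integral_le_of_norm_le
            ((h2.const_mul M).const_mul (q - 1)) (Eventually.of_forall hpt)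
        _ = _ := by
          rw [integral_const_mul, integral_const_mul, integral_add h1 (I2.const_mul C),
            integral_const_mul, integral_add I0 (I1.const_mul _), integral_const_mul,
            integral_const_mul, integral_const_mul]
    set b0 := ∫ x, |W n x| ^ (2 * (k : ℝ) / n)
    set b1 := ∫ x, |W (n + 1) x| ^ q
    rw [show (n : ℝ) + 1 + 1 = n + 2 by ring]
    set b2 := ∫ x, |W (n + 1 + 1) x| ^ (2 * (k : ℝ) / (n + 2))
    have hb1 : 0 ≤ b1 := integral_nonneg fun x => by positivity
    have hb2 : 0 ≤ b2 := integral_nonneg fun x => by positivity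
    have h3 : (n : ℝ) / (2 * k) * b0 + ((k : ℝ) - (n + 1)) / k * b1 ≤ (C' / (2 * k) + 1) * b1 := by
      have : (n : ℝ) / (2 * k) * b0 ≤ C' / (2 * k) * b1 := by
        rw [div_mul_eq_mul_div, div_mul_eq_mul_div]
        gcongr
      have h5 : ((k : ℝ) - (n + 1)) / k ≤ 1 := by rw [div_le_one hk]; linarith
      nlinarith
    have h4 : b1 ≤ (q - 1) * (M * (ε * ((C' / (2 * k) + 1) * b1) + C * b2)) := by
      refine hint.trans ?_
      gcongr
    have h5 : (q - 1) * (M * (ε * ((C' / (2 * k) + 1) * b1))) = b1 / 2 := by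
      have : (q - 1) * M * (C' / (2 * k) + 1) * ε = 1 / 2 := by
        rw [hε, mul_inv, ← mul_assoc, mul_inv_cancel₀ hD.ne']; norm_num
      linear_combination b1 * this
    have h6 : b1 ≤ 2 * ((q - 1) * M * C) * b2 := by nlinarith
    calc ((n : ℝ) + 1) * b1 ≤ (n + 1) * (2 * ((q - 1) * M * C) * b2) := by gcongr
      _ = _ := by ring

/-- The one-step inequalities are chained from order `i` up to order `k`, where the exponent `2k/i`
becomes `2`. -/
theorem gagliardo_nirenberg (k : ℕ) {M : ℝ} (hM : 1 ≤ M) : ∃ C : ℝ, 0 < C ∧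
    ∀ i, 1 ≤ i → i ≤ k → ∀ W : ℕ → ℝ → ℝ, Tower W → (∀ x, |W 0 x| ≤ M) →
      ∫ x, |W i x| ^ (2 * (k : ℝ) / i) ≤ C * ∫ x, (W k x) ^ 2 := by
  choose! c hc0 hc using gn_step k hM
  have key : ∀ d i, i + d = k → 1 ≤ i → ∃ C : ℝ, 0 < C ∧ ∀ W : ℕ → ℝ → ℝ, Tower W →
      (∀ x, |W 0 x| ≤ M) → ∫ x, |W i x| ^ (2 * (k : ℝ) / i) ≤ C * ∫ x, (W k x) ^ 2 := by
    intro d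
    induction d with
    | zero =>
      intro i hi h1
      obtain rfl : i = k := by omega
      refine ⟨1, one_pos, fun W T hW => ?_⟩
      have hk : (i : ℝ) ≠ 0 := by exact_mod_cast (by omega : i ≠ 0)
      simp only [mul_div_assoc, div_self hk, mul_one, one_mul, Real.rpow_two, sq_abs, le_refl]
    | succ d ih =>
      intro i hi h1
      obtain ⟨C, hC, H⟩ := ih (i + 1) (by omega) (by omega)
      refine ⟨(c i + 1) * C, by have := hc0 i (by omega); positivity, fun W T hW => ?_⟩
      have h2 := hc i (by omega) W T hW
      have h3 := H W T hW
      push_cast at h3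
      have hnn : 0 ≤ ∫ x, |W i x| ^ (2 * (k : ℝ) / i) := integral_nonneg fun x => by positivity
      have hnn2 : 0 ≤ ∫ x, |W (i + 1) x| ^ (2 * (k : ℝ) / (i + 1)) :=
        integral_nonneg fun x => by positivity
      have hi1 : (1 : ℝ) ≤ i := by exact_mod_cast h1
      calc _ ≤ (i : ℝ) * ∫ x, |W i x| ^ (2 * (k : ℝ) / i) := by nlinarith
        _ ≤ _ := h2
        _ ≤ (c i + 1) * ∫ x, |W (i + 1) x| ^ (2 * (k : ℝ) / (i + 1)) := by gcongr; linarith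
        _ ≤ (c i + 1) * (C * ∫ x, (W k x) ^ 2) := by
          have := hc0 i (by omega); gcongr
        _ = _ := by ring
  have key2 : ∀ i, 1 ≤ i → i ≤ k → ∃ C : ℝ, 0 < C ∧ ∀ W : ℕ → ℝ → ℝ, Tower W →
      (∀ x, |W 0 x| ≤ M) → ∫ x, |W i x| ^ (2 * (k : ℝ) / i) ≤ C * ∫ x, (W k x) ^ 2 :=
    fun i h1 h2 => key (k - i) i (by omega) h1
  choose! C hC0 hC using key2
  refine ⟨∑ i ∈ Finset.Icc 1 k, C i + 1, add_pos_of_nonneg_of_pos (Finset.sum_nonneg fun i hi =>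
    (hC0 i (Finset.mem_Icc.1 hi).1 (Finset.mem_Icc.1 hi).2).le) one_pos, fun i h1 h2 W T hW =>
    (hC i h1 h2 W T hW).trans (mul_le_mul_of_nonneg_right ?_ (integral_nonneg fun x => sq_nonneg _))⟩
  have := Finset.single_le_sum (f := C) (fun j hj => (hC0 j (Finset.mem_Icc.1 hj).1
    (Finset.mem_Icc.1 hj).2).le) (Finset.mem_Icc.2 ⟨h1, h2⟩)
  linarith

/-- The chain rule in `L²`, with a bound which is linear in the highest derivative. -/
theorem Tower.exists_comp_bound (k : ℕ) (hk : 1 ≤ k) {R : ℝ} (hR : 1 ≤ R) : ∃ C : ℝ, 0 < C ∧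
    ∀ f : ℝ → ℝ, ContDiff ℝ k f → f 0 = 0 → ∀ A G : ℝ, 0 < A → 0 ≤ G →
    (∀ j, 1 ≤ j → j ≤ k → ∀ y, |y| ≤ R * A → |iteratedDeriv j f y| * A ^ j ≤ G * A) →
    ∀ W : ℕ → ℝ → ℝ, Tower W → (∀ x, |W 0 x| ≤ R * A) →
      Integrable (fun x => (iteratedDeriv k (f ∘ W 0) x) ^ 2) ∧
      ∫ x, (iteratedDeriv k (f ∘ W 0) x) ^ 2 ≤ (C * G) ^ 2 * ∫ x, (W k x) ^ 2 := by
  obtain ⟨C, hC, H⟩ := gagliardo_nirenberg k hR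
  set D : ℝ := ((k.factorial : ℝ) * R) ^ 2 * ((k : ℝ) ^ (2 * k - 1) * (k * C)) with hD
  have hk0 : (0 : ℝ) < k := by exact_mod_cast hk
  have hD0 : 0 < D := by
    have : (0 : ℝ) < k.factorial := by exact_mod_cast k.factorial_pos
    positivity
  refine ⟨√D, Real.sqrt_pos.2 hD0, fun f hf hf0 A G hA hG hfj W T hW => ?_⟩
  -- Normalising the height by `A`, and correspondingly `g(y) = f(A y)`, leaves Gagliardo–Nirenberg
  -- to be used at the fixed height `R`, so its constant does not depend on `A`.
  set V : ℕ → ℝ → ℝ := fun j x => A⁻¹ * W j x with hV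
  have TV : Tower V := T.const_mul A⁻¹
  set g : ℝ → ℝ := fun y => f (A * y) with hg
  have hgc : ContDiff ℝ k g := hf.comp (contDiff_const.mul contDiff_id)
  have hcomp : f ∘ W 0 = g ∘ V 0 := by
    ext x; simp only [hg, hV, Function.comp]; rw [mul_inv_cancel_left₀ hA.ne']
  have hV0 : ∀ x, |V 0 x| ≤ R := fun x => by
    rw [hV, abs_mul, abs_of_pos (inv_pos.2 hA), inv_mul_le_iff₀ hA, mul_comm]; exact hW x
  have hAy : ∀ y, |y| ≤ R → |A * y| ≤ R * A := fun y hy => by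
    rw [abs_mul, abs_of_pos hA, mul_comm]; gcongr
  have hgj : ∀ j, 1 ≤ j → j ≤ k → ∀ y, |y| ≤ R → |iteratedDeriv j g y| ≤ G * A := fun j h1 h2 y hy => by
    rw [hg, iteratedDeriv_comp_const_mul (hf.of_le (by exact_mod_cast h2)), abs_mul,
      abs_pow, abs_of_pos hA, mul_comm]
    exact hfj j h1 h2 _ (hAy y hy)
  have hg0 : ∀ y, |y| ≤ R → |g y| ≤ G * A * R := fun y hy => by
    have h := (convex_Icc (-R) R).norm_image_sub_le_of_norm_deriv_le (f := g) (C := G * A)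
      (fun x _ => (hgc.differentiable (by exact_mod_cast (by omega : k ≠ 0))) x)
      (fun x hx => by
        rw [Real.norm_eq_abs, ← iteratedDeriv_one]; exact hgj 1 le_rfl hk x (abs_le.2 hx))
      (x := 0) (y := y) ⟨by linarith, by linarith⟩ (abs_le.1 hy)
    have e : g 0 = 0 := by simp [hg, hf0]
    rw [e, sub_zero, sub_zero, Real.norm_eq_abs, Real.norm_eq_abs] at h
    exact h.trans (by gcongr)
  have hgall : ∀ j, j ≤ k → ∀ y, |y| ≤ R → |iteratedDeriv j g y| ≤ G * A * R := fun j hj y hy => by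
    rcases Nat.eq_zero_or_pos j with rfl | hpos
    · simpa using! hg0 y hy
    · have : 0 ≤ G * A := by positivity
      exact (hgj j hpos hj y hy).trans (by nlinarith)
  have hpt : ∀ x, (iteratedDeriv k (f ∘ W 0) x) ^ 2 ≤ ((k.factorial : ℝ) * (G * A * R)) ^ 2
      * ((k : ℝ) ^ (2 * k - 1) * ∑ i ∈ Finset.Icc 1 k, |V i x| ^ (2 * (k : ℝ) / i)) := fun x => by
    -- A common `d` with `|V i x| ≤ d ^ i` for all `i`, as the Faà di Bruno bound demands. Then `d ^
    -- (2k)` is controlled, by convexity, by the sum of the integrands `|V i x| ^ (2k/i)`.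
    set d := ∑ i ∈ Finset.Icc 1 k, |V i x| ^ ((i : ℝ)⁻¹) with hd
    have hd0 : 0 ≤ d := Finset.sum_nonneg fun i _ => by positivity
    have h1 := norm_iteratedFDeriv_comp_le hgc (TV.contDiff k 0) le_rfl x (C := G * A * R) (D := d)
      (fun i hi => by
        rw [norm_iteratedFDeriv_eq_norm_iteratedDeriv]; exact hgall i hi _ (hV0 x))
      (fun i h1 h2 => by
        rw [norm_iteratedFDeriv_eq_norm_iteratedDeriv, TV.iteratedDeriv_eq, Real.norm_eq_abs]
        have := Finset.single_le_sum (f := fun i : ℕ => |V i x| ^ ((i : ℝ)⁻¹))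
          (fun j _ => by positivity) (Finset.mem_Icc.2 ⟨h1, h2⟩)
        calc |V i x| = (|V i x| ^ ((i : ℝ)⁻¹)) ^ i :=
              (Real.rpow_inv_natCast_pow (abs_nonneg _) (by omega)).symm
          _ ≤ _ := by gcongr)
    rw [norm_iteratedFDeriv_eq_norm_iteratedDeriv, Real.norm_eq_abs] at h1
    have h2 := pow_sum_div_card_le_sum_pow (s := Finset.Icc 1 k)
      (f := fun i : ℕ => |V i x| ^ ((i : ℝ)⁻¹)) (fun i _ => by positivity) (2 * k - 1)
    rw [Nat.sub_add_cancel (by omega), Nat.card_Icc, Nat.add_sub_cancel, div_le_iff₀ (by positivity)] at h2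
    have e : ∀ i ∈ Finset.Icc 1 k, (|V i x| ^ ((i : ℝ)⁻¹)) ^ (2 * k) = |V i x| ^ (2 * (k : ℝ) / i) :=
      fun i _ => by
        rw [← Real.rpow_natCast, ← Real.rpow_mul (abs_nonneg _)]
        congr 1; push_cast; ring
    rw [Finset.sum_congr rfl e] at h2
    rw [hcomp, ← sq_abs]
    calc |iteratedDeriv k (g ∘ V 0) x| ^ 2 ≤ ((k.factorial : ℝ) * (G * A * R) * d ^ k) ^ 2 := by
          gcongr
      _ = ((k.factorial : ℝ) * (G * A * R)) ^ 2 * d ^ (2 * k) := by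
        rw [mul_pow _ (d ^ k), ← pow_mul, mul_comm k 2]
      _ ≤ _ := by gcongr; linarith
  have hi1 : ∀ i ∈ Finset.Icc 1 k, Integrable fun x => |V i x| ^ (2 * (k : ℝ) / i) := fun i hi => by
    obtain ⟨h1, h2⟩ := Finset.mem_Icc.1 hi
    have h1' : (0 : ℝ) < i := by exact_mod_cast h1
    have h2' : (i : ℝ) ≤ k := by exact_mod_cast h2
    exact TV.integrable_rpow i (by rw [le_div_iff₀ h1']; linarith)
  have hI := ((integrable_finsetSum _ hi1).const_mul ((k : ℝ) ^ (2 * k - 1))).const_mul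
    (((k.factorial : ℝ) * (G * A * R)) ^ 2)
  have hcont : Continuous (iteratedDeriv k (f ∘ W 0)) :=
    (hf.comp (T.contDiff k 0)).continuous_iteratedDeriv k le_rfl
  have hint : Integrable (fun x => (iteratedDeriv k (f ∘ W 0) x) ^ 2) :=
    hI.mono' (by fun_prop) (Eventually.of_forall fun x => by
      rw [Real.norm_of_nonneg (sq_nonneg _)]; exact hpt x)
  refine ⟨hint, ?_⟩
  have hVk : ∫ x, (V k x) ^ 2 = (A⁻¹) ^ 2 * ∫ x, (W k x) ^ 2 := by
    rw [← integral_const_mul]; congr 1; ext x; rw [hV]; ring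
  have hWk : 0 ≤ ∫ x, (W k x) ^ 2 := integral_nonneg fun x => sq_nonneg _
  calc ∫ x, (iteratedDeriv k (f ∘ W 0) x) ^ 2 ≤ _ := integral_mono hint hI hpt
    _ = ((k.factorial : ℝ) * (G * A * R)) ^ 2
      * ((k : ℝ) ^ (2 * k - 1) * ∑ i ∈ Finset.Icc 1 k, ∫ x, |V i x| ^ (2 * (k : ℝ) / i)) := by
      rw [integral_const_mul, integral_const_mul, integral_finsetSum _ hi1]
    _ ≤ ((k.factorial : ℝ) * (G * A * R)) ^ 2
      * ((k : ℝ) ^ (2 * k - 1) * ∑ i ∈ Finset.Icc 1 k, C * ∫ x, (V k x) ^ 2) := by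
      gcongr with i hi
      exact H i (Finset.mem_Icc.1 hi).1 (Finset.mem_Icc.1 hi).2 V TV hV0
    _ = (√D * G) ^ 2 * ∫ x, (W k x) ^ 2 := by
      rw [mul_pow (√D), Real.sq_sqrt hD0.le, Finset.sum_const, Nat.card_Icc, Nat.add_sub_cancel, hVk, hD,
        nsmul_eq_mul]
      field_simp
end

section
open scoped ComplexConjugate ContDiff SchwartzMap

/-! ### The Fourier transform of a classical derivative -/

/-- Testing against `χ` moves the transform onto the test function; then one integrates by parts,
with no boundary terms since all products are integrable. -/
theorem ft_deriv {g g' : ℝ → ℝ} (hd : ∀ x, HasDerivAt g (g' x) x) {a b : L2}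
    (ha : ∀ᵐ x, a x = g x) (hb : ∀ᵐ x, b x = g' x) :
    ∀ᵐ ξ, ft b ξ = (2 * Real.pi * Complex.I * ξ) * ft a ξ := by
  have hloc : LocallyIntegrable (fun ξ => ft a ξ) volume := locallyIntegrable_coe _
  have hcm : Continuous (fun ξ : ℝ => 2 * (Real.pi : ℂ) * Complex.I * ξ) := by fun_prop
  refine ae_eq_of_integral_contDiff_smul_eq (locallyIntegrable_coe _)
    (hloc.continuous_mul hcm) fun χ h1 h2 => ?_
  set ψ := testSchwartz χ h1 h2 with hψ
  have hsup : HasCompactSupport (fun ξ : ℝ => (-2 * Real.pi * Complex.I * ξ : ℂ) * (χ ξ : ℂ)) :=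
    HasCompactSupport.mul_left (h2.comp_left (g := fun x : ℝ => (x : ℂ)) (by simp))
  have hsm : ContDiff ℝ ∞ (fun ξ : ℝ => (-2 * Real.pi * Complex.I * ξ : ℂ) * (χ ξ : ℂ)) :=
    (contDiff_const.mul Complex.ofRealCLM.contDiff).mul (Complex.ofRealCLM.contDiff.comp h1)
  set ψ2 : 𝓢(ℝ, ℂ) := hsup.toSchwartzMap hsm with hψ2
  have hψ2a : ∀ ξ, ψ2 ξ = (-2 * Real.pi * Complex.I * ξ : ℂ) * (χ ξ : ℂ) := fun ξ => rfl
  have hψa : ∀ ξ, ψ ξ = (χ ξ : ℂ) := fun ξ => rfl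
  have hder : ∀ x, HasDerivAt (𝓕 ψ : 𝓢(ℝ, ℂ)) ((𝓕 ψ2) x) x := fun x => by
    have hi2 : Integrable (fun ξ : ℝ => ξ • ψ ξ) := by
      refine (ψ2.integrable (μ := volume).const_mul ((-2 * Real.pi * Complex.I)⁻¹)).congr
        (Eventually.of_forall fun ξ => ?_)
      have : (-2 * (Real.pi : ℂ) * Complex.I) ≠ 0 := by simp [Real.pi_ne_zero]
      simp only [hψ2a, hψa, Complex.real_smul]
      field_simp
    have h := Real.hasDerivAt_fourier (ψ.integrable (μ := volume)) hi2 x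
    rw [SchwartzMap.fourier_coe, SchwartzMap.fourier_coe]
    convert! h using 2
  have hA : ∀ᵐ x, toC a x = (g x : ℂ) := by
    filter_upwards [toC_ae a, ha] with x h3 h4; rw [h3, h4]
  have hB : ∀ᵐ x, toC b x = (g' x : ℂ) := by
    filter_upwards [toC_ae b, hb] with x h3 h4; rw [h3, h4]
  have mA : MemLp (fun x => (g x : ℂ)) 2 volume := (Lp.memLp (toC a)).ae_eq hA
  have mB : MemLp (fun x => (g' x : ℂ)) 2 volume := (Lp.memLp (toC b)).ae_eq hB
  have mψ : MemLp (𝓕 ψ : 𝓢(ℝ, ℂ)) 2 volume := (𝓕 ψ).memLp 2 volume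
  have mψ2 : MemLp (𝓕 ψ2 : 𝓢(ℝ, ℂ)) 2 volume := (𝓕 ψ2).memLp 2 volume
  have ibp := integral_mul_deriv_eq_deriv_mul_of_integrable (u := (𝓕 ψ : 𝓢(ℝ, ℂ)))
    (v := fun x => (g x : ℂ)) (u' := (𝓕 ψ2 : 𝓢(ℝ, ℂ))) (v' := fun x => (g' x : ℂ))
    (fun x _ => hder x) (fun x _ => (hd x).ofReal_comp) (mψ.integrable_mul mB)
    (mψ2.integrable_mul mA) (mψ.integrable_mul mA)
  calc ∫ ξ, χ ξ • ft b ξ = ∫ ξ, ψ ξ • (𝓕 (toC b) : CL2) ξ := by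
        refine integral_congr_ae (Eventually.of_forall fun ξ => ?_)
        simp only [hψa, ft_eq]; exact (Complex.coe_smul _ _).symm
    _ = ∫ x, (𝓕 ψ) x * (g' x : ℂ) := by
        rw [integral_smul_fourier]
        refine integral_congr_ae ?_
        filter_upwards [hB] with x hx; rw [hx, smul_eq_mul]
    _ = - ∫ x, (𝓕 ψ2) x • toC a x := by
        rw [ibp]; congr 1
        refine integral_congr_ae ?_
        filter_upwards [hA] with x hx; rw [hx, smul_eq_mul]
    _ = ∫ ξ, χ ξ • (2 * Real.pi * Complex.I * ξ * ft a ξ) := by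
        rw [← integral_smul_fourier, ← integral_neg]
        refine integral_congr_ae (Eventually.of_forall fun ξ => ?_)
        simp only [hψ2a, ft_eq, smul_eq_mul, Complex.real_smul]; ring

/-! ### Layer cake -/

lemma lintegral_Ioi_rpow_le {s c : ℝ} (hs : 0 < s) (hc : 0 ≤ c) :
    ∫⁻ L in Set.Ioi (0 : ℝ), Set.indicator (Set.Iic c) (fun L => ENNReal.ofReal (L ^ (2 * s - 1))) L
      = ENNReal.ofReal (c ^ (2 * s) / (2 * s)) := by
  rw [← lintegral_indicator measurableSet_Ioi]
  have e : ∀ L, (Set.Ioi (0 : ℝ)).indicator (fun L => (Set.Iic c).indicator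
      (fun L => ENNReal.ofReal (L ^ (2 * s - 1))) L) L
      = (Set.Ioc 0 c).indicator (fun L => ENNReal.ofReal (L ^ (2 * s - 1))) L := fun L => by
    rw [Set.indicator_indicator]; rfl
  simp only [e]
  rw [lintegral_indicator measurableSet_Ioc, ← ofReal_integral_eq_lintegral_ofReal]
  · rw [← intervalIntegral.integral_of_le hc, integral_rpow (Or.inl (by linarith)),
      Real.zero_rpow (by linarith)]
    congr 1; ring_nf
  · exact (intervalIntegrable_iff_integrableOn_Ioc_of_le hc).1
      (intervalIntegral.intervalIntegrable_rpow' (by linarith))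
  · exact (ae_restrict_iff' measurableSet_Ioc).2 (Eventually.of_forall fun L hL => by
      have := hL.1; positivity)

lemma lintegral_Ioi_rpow_ge {r c : ℝ} (hr : 0 < r) (hc : 0 < c) :
    ∫⁻ L in Set.Ioi (0 : ℝ), Set.indicator (Set.Ici c) (fun L => ENNReal.ofReal (L ^ (-r - 1))) L
      = ENNReal.ofReal (c ^ (-r) / r) := by
  rw [lintegral_indicator measurableSet_Ici, Measure.restrict_restrict measurableSet_Ici,
    Set.inter_eq_left.2 (Set.Ici_subset_Ioi.2 hc),
    setLIntegral_congr Ioi_ae_eq_Ici.symm, ← ofReal_integral_eq_lintegral_ofReal]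
  · rw [integral_Ioi_rpow_of_lt (by linarith) hc]
    congr 1
    rw [show -r - 1 + 1 = -r by ring, div_neg, neg_div, neg_neg]
  · exact integrableOn_Ioi_rpow_of_lt (by linarith) hc
  · exact (ae_restrict_iff' measurableSet_Ioi).2 (Eventually.of_forall fun L hL => by
      have : 0 < L := hc.trans hL
      positivity)

/-- Tonelli's theorem on the set `S` of pairs of a level and a frequency. -/
lemma lintegral_layer {a φ : ℝ → ℝ≥0∞} (ha : Measurable a) (hφ : Measurable φ) {S : Set (ℝ × ℝ)}
    (hS : MeasurableSet S) :
    ∫⁻ L in Set.Ioi (0 : ℝ), a L * ∫⁻ ξ, S.indicator (fun p => φ p.2) (L, ξ)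
      = ∫⁻ ξ, φ ξ * ∫⁻ L in Set.Ioi (0 : ℝ), S.indicator (fun p => a p.1) (L, ξ) := by
  have hm : Measurable fun p : ℝ × ℝ => S.indicator (fun p => a p.1 * φ p.2) p :=
    ((ha.comp measurable_fst).mul (hφ.comp measurable_snd)).indicator hS
  have e1 : ∀ L, a L * ∫⁻ ξ, S.indicator (fun p => φ p.2) (L, ξ)
      = ∫⁻ ξ, S.indicator (fun p => a p.1 * φ p.2) (L, ξ) := fun L => by
    have hm1 : Measurable fun ξ => S.indicator (fun p => φ p.2) (L, ξ) :=
      ((hφ.comp measurable_snd).indicator hS).comp measurable_prodMk_left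
    rw [← lintegral_const_mul _ hm1]
    congr 1; ext ξ
    by_cases h : (L, ξ) ∈ S <;> simp [h]
  have e2 : ∀ ξ, φ ξ * ∫⁻ L in Set.Ioi (0 : ℝ), S.indicator (fun p => a p.1) (L, ξ)
      = ∫⁻ L in Set.Ioi (0 : ℝ), S.indicator (fun p => a p.1 * φ p.2) (L, ξ) := fun ξ => by
    have hm1 : Measurable fun L => S.indicator (fun p => a p.1) (L, ξ) :=
      ((ha.comp measurable_fst).indicator hS).comp measurable_prodMk_right
    rw [← lintegral_const_mul _ hm1]
    congr 1; ext L
    by_cases h : (L, ξ) ∈ S <;> simp [h, mul_comm]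
  simp only [e1, e2]
  exact lintegral_lintegral_swap hm.aemeasurable

/-- Integrate the hypothesis against `L^{2s-1} dL`. The tails reproduce the weight `|ξ|^{2s}`, and
the low frequency term leads to `∫ L^{2s-1-2k} dL` over `L ≥ |ξ|/2`, which converges because `s <
k`. This replaces interpolation, which is unavailable because composition is nonlinear. -/
theorem layer_cake {s : ℝ} {k : ℕ} (hs : 0 < s) (hsk : s < k) : ∃ C : ℝ, 0 < C ∧
    ∀ (φ ψ : ℝ → ℝ≥0∞) (D : ℝ≥0∞), Measurable φ → Measurable ψ →
      (∀ L : ℝ, 0 < L → ∫⁻ ξ in {ξ | L ≤ |ξ|}, φ ξ ≤ D * ((∫⁻ ξ in {ξ | L ≤ |ξ|}, ψ ξ)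
        + ENNReal.ofReal (L ^ (-(2 * k : ℝ))) *
          ∫⁻ ξ in {ξ | |ξ| ≤ 2 * L}, ENNReal.ofReal (|ξ| ^ (2 * k : ℝ)) * ψ ξ)) →
      ∫⁻ ξ, ENNReal.ofReal (|ξ| ^ (2 * s)) * φ ξ
        ≤ ENNReal.ofReal C * D * ∫⁻ ξ, ENNReal.ofReal (|ξ| ^ (2 * s)) * ψ ξ := by
  set r : ℝ := 2 * k - 2 * s with hr
  have hr0 : 0 < r := by rw [hr]; linarith
  have hk0 : (0 : ℝ) < k := by linarith
  refine ⟨1 + 2 * s * (2 ^ r / r), by positivity, fun φ ψ D hφ hψ H => ?_⟩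
  have habs : Measurable fun ξ : ℝ => |ξ| := measurable_norm
  set S : Set (ℝ × ℝ) := {p | p.1 ≤ |p.2|} with hS
  have mS : MeasurableSet S := measurableSet_le measurable_fst (habs.comp measurable_snd)
  set S' : Set (ℝ × ℝ) := {p | |p.2| ≤ 2 * p.1} with hS'
  have mS' : MeasurableSet S' := measurableSet_le (habs.comp measurable_snd)
    (measurable_fst.const_mul 2)
  have mp : ∀ q : ℝ, Measurable fun L : ℝ => ENNReal.ofReal (L ^ q) := fun q =>
    (measurable_id.pow_const q).ennreal_ofReal
  have lay : ∀ χ : ℝ → ℝ≥0∞, Measurable χ → ∫⁻ ξ, ENNReal.ofReal (|ξ| ^ (2 * s)) * χ ξ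
      = ENNReal.ofReal (2 * s) * ∫⁻ L in Set.Ioi (0 : ℝ), ENNReal.ofReal (L ^ (2 * s - 1))
        * ∫⁻ ξ in {ξ | L ≤ |ξ|}, χ ξ := fun χ hχ => by
    have e0 : ∀ L : ℝ, ∫⁻ ξ in {ξ | L ≤ |ξ|}, χ ξ = ∫⁻ ξ, S.indicator (fun p => χ p.2) (L, ξ) :=
      fun L => by
        rw [← lintegral_indicator (measurableSet_le measurable_const habs)]; rfl
    simp only [e0]
    rw [lintegral_layer (mp _) hχ mS, ← lintegral_const_mul' _ _ ENNReal.ofReal_ne_top]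
    congr 1; ext ξ
    have e1 : ∫⁻ L in Set.Ioi (0 : ℝ), S.indicator (fun p => ENNReal.ofReal (p.1 ^ (2 * s - 1))) (L, ξ)
        = ENNReal.ofReal (|ξ| ^ (2 * s) / (2 * s)) := by
      rw [← lintegral_Ioi_rpow_le hs (abs_nonneg ξ)]; rfl
    rw [e1, mul_left_comm, ← ENNReal.ofReal_mul (by positivity), mul_div_cancel₀ _ (by positivity),
      mul_comm]
  have lay2 : ∫⁻ L in Set.Ioi (0 : ℝ), ENNReal.ofReal (L ^ (-r - 1)) *
      ∫⁻ ξ in {ξ | |ξ| ≤ 2 * L}, ENNReal.ofReal (|ξ| ^ (2 * k : ℝ)) * ψ ξ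
      = ENNReal.ofReal (2 ^ r / r) * ∫⁻ ξ, ENNReal.ofReal (|ξ| ^ (2 * s)) * ψ ξ := by
    have e0 : ∀ L : ℝ, ∫⁻ ξ in {ξ | |ξ| ≤ 2 * L}, ENNReal.ofReal (|ξ| ^ (2 * k : ℝ)) * ψ ξ
        = ∫⁻ ξ, S'.indicator (fun p => ENNReal.ofReal (|p.2| ^ (2 * k : ℝ)) * ψ p.2) (L, ξ) :=
      fun L => by
        rw [← lintegral_indicator (measurableSet_le habs measurable_const)]; rfl
    simp only [e0]
    rw [lintegral_layer (mp _) (φ := fun ξ => ENNReal.ofReal (|ξ| ^ (2 * k : ℝ)) * ψ ξ)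
      ((habs.pow_const _).ennreal_ofReal.mul hψ) mS', ← lintegral_const_mul' _ _ ENNReal.ofReal_ne_top]
    refine lintegral_congr_ae ?_
    have hne : ∀ᵐ ξ : ℝ, ξ ≠ 0 := by simp [ae_iff]
    filter_upwards [hne] with ξ hξ
    have hξ0 : 0 < |ξ| := abs_pos.2 hξ
    have e1 : ∫⁻ L in Set.Ioi (0 : ℝ), S'.indicator (fun p => ENNReal.ofReal (p.1 ^ (-r - 1))) (L, ξ)
        = ENNReal.ofReal ((|ξ| / 2) ^ (-r) / r) := by
      rw [← lintegral_Ioi_rpow_ge hr0 (half_pos hξ0)]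
      congr 1; ext L
      have : (L, ξ) ∈ S' ↔ L ∈ Set.Ici (|ξ| / 2) := by
        simp only [hS', Set.mem_ofPred_eq, Set.mem_Ici]
        rw [div_le_iff₀ two_pos, mul_comm L 2]
      by_cases h : L ∈ Set.Ici (|ξ| / 2)
      · rw [Set.indicator_of_mem (this.2 h), Set.indicator_of_mem h]
      · rw [Set.indicator_of_notMem (fun h' => h (this.1 h')), Set.indicator_of_notMem h]
    rw [e1, mul_right_comm, ← mul_assoc, ← ENNReal.ofReal_mul (by positivity),
      ← ENNReal.ofReal_mul (by positivity)]
    congr 2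
    rw [Real.div_rpow hξ0.le two_pos.le, Real.rpow_neg two_pos.le, Real.rpow_neg hξ0.le,
      show (2 * s : ℝ) = 2 * k - r by rw [hr]; ring, Real.rpow_sub hξ0]
    field_simp
    rw [hr, sub_sub_cancel]
  rw [lay φ hφ]
  calc _ ≤ ENNReal.ofReal (2 * s) * ∫⁻ L in Set.Ioi (0 : ℝ), (D * (ENNReal.ofReal (L ^ (2 * s - 1))
        * ∫⁻ ξ in {ξ | L ≤ |ξ|}, ψ ξ) + D * (ENNReal.ofReal (L ^ (-r - 1)) *
          ∫⁻ ξ in {ξ | |ξ| ≤ 2 * L}, ENNReal.ofReal (|ξ| ^ (2 * k : ℝ)) * ψ ξ)) := by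
        refine mul_le_mul_right ?_ _
        refine setLIntegral_mono' measurableSet_Ioi fun L hL => ?_
        have hL0 : (0 : ℝ) < L := hL
        refine (mul_le_mul_right (H L hL) _).trans (le_of_eq ?_)
        have : ENNReal.ofReal (L ^ (2 * s - 1)) * ENNReal.ofReal (L ^ (-(2 * k : ℝ)))
            = ENNReal.ofReal (L ^ (-r - 1)) := by
          rw [← ENNReal.ofReal_mul (by positivity), ← Real.rpow_add hL0]
          congr 2; rw [hr]; ring
        rw [← this]; ring
    _ = (D * (ENNReal.ofReal (2 * s) * ∫⁻ L in Set.Ioi (0 : ℝ), ENNReal.ofReal (L ^ (2 * s - 1))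
        * ∫⁻ ξ in {ξ | L ≤ |ξ|}, ψ ξ)) + ENNReal.ofReal (2 * s) * D *
        ∫⁻ L in Set.Ioi (0 : ℝ), ENNReal.ofReal (L ^ (-r - 1)) *
          ∫⁻ ξ in {ξ | |ξ| ≤ 2 * L}, ENNReal.ofReal (|ξ| ^ (2 * k : ℝ)) * ψ ξ := by
        have m1 : Measurable fun L : ℝ => ENNReal.ofReal (L ^ (2 * s - 1))
            * ∫⁻ ξ in {ξ | L ≤ |ξ|}, ψ ξ := by
          refine (mp _).mul (Antitone.measurable fun a b hab => ?_)
          exact lintegral_mono_set fun ξ (hξ : b ≤ |ξ|) => hab.trans hξ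
        have m2 : Measurable fun L : ℝ => ENNReal.ofReal (L ^ (-r - 1))
            * ∫⁻ ξ in {ξ | |ξ| ≤ 2 * L}, ENNReal.ofReal (|ξ| ^ (2 * k : ℝ)) * ψ ξ := by
          refine (mp _).mul (Monotone.measurable fun a b hab => ?_)
          exact lintegral_mono_set fun ξ (hξ : |ξ| ≤ 2 * a) =>
            (hξ.trans (by linarith) : |ξ| ≤ 2 * b)
        rw [lintegral_add_left (m1.const_mul D), lintegral_const_mul _ m1, lintegral_const_mul _ m2]
        ring
    _ = (D * ∫⁻ ξ, ENNReal.ofReal (|ξ| ^ (2 * s)) * ψ ξ) + ENNReal.ofReal (2 * s) * D *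
        (ENNReal.ofReal (2 ^ r / r) * ∫⁻ ξ, ENNReal.ofReal (|ξ| ^ (2 * s)) * ψ ξ) := by
        rw [← lay ψ hψ, lay2]
    _ = _ := by
        rw [ENNReal.ofReal_add zero_le_one (by positivity),
          ENNReal.ofReal_mul (p := 2 * s) (by positivity),
          ENNReal.ofReal_one]
        ring
end

section
open scoped ComplexConjugate ContDiff

/-! ### Moser estimates in fractional Sobolev spaces -/

lemma hNorm_sq (s : ℝ) (g : L2) :
    hNorm s g ^ 2 = ∫⁻ ξ, ENNReal.ofReal (jw ξ ^ s) * ‖ft g ξ‖ₑ ^ 2 := by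
  rw [hNorm, ← ENNReal.rpow_natCast, ← ENNReal.rpow_mul]
  norm_num
  rfl

lemma enorm_sq_eq (g : L2) : ‖g‖ₑ ^ 2 = ∫⁻ ξ, ‖ft g ξ‖ₑ ^ 2 := by
  rw [← hNorm_zero, hNorm_sq]; simp

lemma measurable_ft_sq (g : L2) : Measurable fun ξ => ‖ft g ξ‖ₑ ^ 2 :=
  (Lp.stronglyMeasurable (ft g)).measurable.enorm.pow_const 2

lemma enorm_le_of_ae {a b : L2} {C : ℝ} (h : ∀ᵐ x, |a x| ≤ C * |b x|) :
    ‖a‖ₑ ≤ ENNReal.ofReal C * ‖b‖ₑ := by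
  rw [Lp.enorm_def, Lp.enorm_def]
  exact eLpNorm_le_mul_eLpNorm_of_ae_le_mul (by simpa using! h) 2

lemma enorm_sq_eq_integral {a : L2} {g : ℝ → ℝ} (h : ∀ᵐ x, a x = g x) :
    ‖a‖ₑ ^ 2 = ENNReal.ofReal (∫ x, g x ^ 2) := by
  have h1 : ‖a‖ ^ 2 = ∫ x, g x ^ 2 := by
    rw [← real_inner_self_eq_norm_sq, L2.inner_def]
    refine integral_congr_ae ?_
    filter_upwards [h] with x hx
    rw [hx]; simp [pow_two]
  rw [← h1, ENNReal.ofReal_pow (norm_nonneg _), ofReal_norm]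

lemma abs_le_of_eLpNorm_top {u : L2} {A : ℝ} (hA : 0 ≤ A)
    (hu : eLpNorm u ⊤ volume ≤ ENNReal.ofReal A) : ∀ᵐ x, |u x| ≤ A := by
  rw [eLpNorm_exponent_top] at hu
  filter_upwards [ae_le_eLpNormEssSup (f := u) (μ := volume)] with x hx
  have h := hx.trans hu
  rw [← ofReal_norm] at h
  exact (ENNReal.ofReal_le_ofReal_iff hA).1 h

/-- The hypothesis of the Moser estimates: the derivatives of `f` have the size of those of
`G * y` at the scale `A`. -/
structure MoserBound (k : ℕ) (K : ℝ) (f : ℝ → ℝ) (A G : ℝ) : Prop where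
  contDiff : ContDiff ℝ k f
  zero : f 0 = 0
  pos : 0 < A
  nonneg : 0 ≤ G
  bound : ∀ j, 1 ≤ j → j ≤ k → ∀ y, |y| ≤ K * A → |iteratedDeriv j f y| * A ^ j ≤ G * A

/-- The case `j = 1` of the bound says that `|f'| ≤ G` on the range in question. -/
lemma MoserBound.lipschitz {k : ℕ} (hk : 1 ≤ k) {K A G : ℝ} {f : ℝ → ℝ} (H : MoserBound k K f A G)
    {y z : ℝ} (hy : |y| ≤ K * A) (hz : |z| ≤ K * A) : |f y - f z| ≤ G * |y - z| :=
  (convex_Icc (-(K * A)) (K * A)).norm_image_sub_le_of_norm_deriv_le (f := f) (C := G)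
    (fun x _ => (H.contDiff.differentiable (by exact_mod_cast (by omega : k ≠ 0))) x)
    (fun x hx => by
      have := H.bound 1 le_rfl hk x (abs_le.2 hx)
      rw [pow_one, iteratedDeriv_one] at this
      exact le_of_mul_le_mul_right this H.pos) (abs_le.1 hz) (abs_le.1 hy)

lemma MoserBound.abs_le {k : ℕ} (hk : 1 ≤ k) {K A G : ℝ} {f : ℝ → ℝ} (H : MoserBound k K f A G)
    {y : ℝ} (hy : |y| ≤ K * A) : |f y| ≤ G * |y| := by
  have := H.lipschitz hk hy (z := 0) (by rw [abs_zero]; exact (abs_nonneg y).trans hy)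
  simpa [H.zero] using! this

lemma measurableSet_le_abs (L : ℝ) : MeasurableSet {ξ : ℝ | L ≤ |ξ|} :=
  measurableSet_le measurable_const measurable_norm
lemma measurableSet_abs_le (L : ℝ) : MeasurableSet {ξ : ℝ | |ξ| ≤ L} :=
  measurableSet_le measurable_norm measurable_const

/-- Here `a` is `f` composed with the smooth frequency cutoff of `u` at `L`. The difference `h - a`
is controlled by the Lipschitz constant and the frequencies of `u` above `L`; the `k`-th derivative
of `a` by the chain rule and the frequencies below `2L`. These are the two terms in the hypothesis
of `layer_cake`. -/
theorem exists_cut_comp (k : ℕ) (hk : 1 ≤ k) : ∃ C K : ℝ, 0 < C ∧ 1 ≤ K ∧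
    ∀ (f : ℝ → ℝ) (A G : ℝ), MoserBound k K f A G → ∀ u h : L2,
      eLpNorm u ⊤ volume ≤ ENNReal.ofReal A → (∀ᵐ x, h x = f (u x)) → ∀ L : ℝ, 0 < L →
      ∃ a : L2, ‖h - a‖ₑ ^ 2 ≤ ENNReal.ofReal (G ^ 2) * ∫⁻ ξ in {ξ | L ≤ |ξ|}, ‖ft u ξ‖ₑ ^ 2 ∧
        ‖a‖ₑ ≤ ENNReal.ofReal G * ‖u‖ₑ ∧
        ∫⁻ ξ, ENNReal.ofReal (|ξ| ^ (2 * k : ℝ)) * ‖ft a ξ‖ₑ ^ 2 ≤ ENNReal.ofReal ((C * G) ^ 2) *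
          ∫⁻ ξ in {ξ | |ξ| ≤ 2 * L}, ENNReal.ofReal (|ξ| ^ (2 * k : ℝ)) * ‖ft u ξ‖ₑ ^ 2 := by
  obtain ⟨K, hK, HK⟩ := cutFun_bound
  obtain ⟨C, hC, HC⟩ := Tower.exists_comp_bound k hk hK
  refine ⟨C, K, hC, hK, fun f A G H u h hu hh L hL => ?_⟩
  set W := cutFun L hL u with hWdef
  have T : Tower W := tower_cutFun hL u
  have hW0 : ∀ x, |W 0 x| ≤ K * A := HK L hL u A H.pos.le hu
  have hWae : ∀ j, ∀ᵐ x, (cutSym L hL j).op u x = W j x := cutFun_ae hL u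
  set g : ℕ → ℝ → ℝ := fun j => iteratedDeriv j (f ∘ W 0) with hg
  have hgc : ContDiff ℝ k (f ∘ W 0) := H.contDiff.comp (T.contDiff k 0)
  have hgcont : ∀ j, j ≤ k → Continuous (g j) := fun j hj =>
    hgc.continuous_iteratedDeriv j (by exact_mod_cast hj)
  have hgd : ∀ j, j < k → ∀ x, HasDerivAt (g j) (g (j + 1) x) x := fun j hj x => by
    have := (hgc.differentiable_iteratedDeriv j (by exact_mod_cast hj)) x
    rw [hg]; simp only [iteratedDeriv_succ]; exact this.hasDerivAt
  have hgm : ∀ j, j ≤ k → MemLp (g j) 2 volume := fun j hj => by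
    rcases Nat.eq_zero_or_pos j with rfl | hpos
    · refine (T.memLp 0).of_le_mul (c := G) (hgcont 0 hj).aestronglyMeasurable
        (Eventually.of_forall fun x => ?_)
      simp only [hg, iteratedDeriv_zero]
      exact H.abs_le hk (hW0 x)
    · obtain ⟨C', -, HC'⟩ := Tower.exists_comp_bound j hpos hK
      exact (memLp_two_iff_integrable_sq (hgcont j hj).aestronglyMeasurable).2
        (HC' f (H.contDiff.of_le (by exact_mod_cast hj)) H.zero A G H.pos H.nonneg
          (fun i h1 h2 => H.bound i h1 (h2.trans hj)) W T hW0).1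
  have ha : ∀ j, ∃ a : L2, j ≤ k → ∀ᵐ x, a x = g j x := fun j => by
    by_cases hj : j ≤ k
    · exact ⟨(hgm j hj).toLp, fun _ => (hgm j hj).coeFn_toLp⟩
    · exact ⟨0, fun h => absurd h hj⟩
  choose a ha using ha
  have hfta : ∀ j, j ≤ k → ∀ᵐ ξ, ft (a j) ξ = (2 * Real.pi * Complex.I * ξ) ^ j * ft (a 0) ξ := by
    intro j
    induction j with
    | zero => intro _; simp
    | succ j ih =>
      intro hj
      filter_upwards [ih (by omega), ft_deriv (hgd j hj) (ha j (by omega)) (ha (j + 1) hj)] with ξ h1 h2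
      rw [h2, h1]; ring
  have hnorm : ∀ ξ : ℝ, ‖(2 * Real.pi * Complex.I * ξ : ℂ) ^ k‖ₑ ^ 2
      = ENNReal.ofReal ((2 * Real.pi) ^ (2 * k)) * ENNReal.ofReal (|ξ| ^ (2 * k : ℝ)) := fun ξ => by
    rw [← ofReal_norm, ← ENNReal.ofReal_pow (norm_nonneg _), ← ENNReal.ofReal_mul (by positivity)]
    congr 1
    rw [norm_pow, ← pow_mul, mul_comm k 2]
    simp only [norm_mul, Complex.norm_ofNat, Complex.norm_real, Complex.norm_I, mul_one,
      Real.norm_of_nonneg Real.pi_pos.le, Real.norm_eq_abs]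
    rw [mul_pow]
    congr 1
    exact_mod_cast (Real.rpow_natCast |ξ| (2 * k)).symm
  refine ⟨a 0, ?_, ?_, ?_⟩
  · have h1 : ‖h - a 0‖ₑ ≤ ENNReal.ofReal G * ‖u - (cutSym L hL 0).op u‖ₑ := by
      refine enorm_le_of_ae ?_
      filter_upwards [Lp.coeFn_sub h (a 0), Lp.coeFn_sub u ((cutSym L hL 0).op u), hh,
        ha 0 (Nat.zero_le _), hWae 0, abs_le_of_eLpNorm_top H.pos.le hu] with x e1 e2 e3 e4 e5 e6
      rw [e1, e2, Pi.sub_apply, Pi.sub_apply, e3, e4, e5]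
      simp only [hg, iteratedDeriv_zero, Function.comp]
      refine H.lipschitz hk (e6.trans ?_) (hW0 x)
      have := H.pos; nlinarith
    calc ‖h - a 0‖ₑ ^ 2 ≤ (ENNReal.ofReal G * ‖u - (cutSym L hL 0).op u‖ₑ) ^ 2 := by gcongr
      _ = ENNReal.ofReal (G ^ 2) * ∫⁻ ξ, ‖ft (u - (cutSym L hL 0).op u) ξ‖ₑ ^ 2 := by
        rw [mul_pow, ENNReal.ofReal_pow H.nonneg, enorm_sq_eq]
      _ ≤ _ := by
        refine mul_le_mul_right ?_ _
        rw [← lintegral_indicator (measurableSet_le_abs L)]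
        refine lintegral_mono_ae ?_
        filter_upwards [ft_sub_ae u ((cutSym L hL 0).op u), (cutSym L hL 0).ft_op u] with ξ e1 e2
        rw [e1, e2, cutSym_apply, pow_zero, one_mul]
        by_cases hξ : L ≤ |ξ|
        · rw [Set.indicator_of_mem (show ξ ∈ {ξ | L ≤ |ξ|} from hξ)]
          gcongr
          rw [show ft u ξ - (chi (ξ / L) : ℂ) * ft u ξ = ((1 - chi (ξ / L) : ℝ) : ℂ) * ft u ξ by
            push_cast; ring, enorm_mul]
          refine mul_le_of_le_one_left' ?_
          rw [← ofReal_norm, Complex.norm_real, Real.norm_of_nonneg (by linarith [(chi_mem (ξ / L)).2])]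
          exact ENNReal.ofReal_le_one.2 (by linarith [(chi_mem (ξ / L)).1])
        · rw [chi_one, Complex.ofReal_one, one_mul, sub_self]
          · simp
          · rw [abs_div, abs_of_pos hL, div_le_one hL]; exact (not_le.1 hξ).le
  · have h1 : ‖a 0‖ₑ ≤ ENNReal.ofReal G * ‖(cutSym L hL 0).op u‖ₑ := by
      refine enorm_le_of_ae ?_
      filter_upwards [ha 0 (Nat.zero_le _), hWae 0] with x e4 e5
      rw [e4, e5]
      exact H.abs_le hk (hW0 x)
    refine h1.trans (mul_le_mul_right ?_ _)
    have := (cutSym L hL 0).norm_op_le zero_le_one (fun ξ => by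
      rw [cutSym_apply, pow_zero, one_mul, Complex.norm_real, Real.norm_of_nonneg (chi_mem _).1]
      exact (chi_mem _).2) u
    rw [one_mul] at this
    exact enorm_le_iff_norm_le.2 this
  · have hc0 : ENNReal.ofReal ((2 * Real.pi) ^ (2 * k)) ≠ 0 := by
      rw [Ne, ENNReal.ofReal_eq_zero, not_le]; positivity
    refine (ENNReal.mul_le_mul_iff_right hc0 ENNReal.ofReal_ne_top).1 ?_
    have h1 : ENNReal.ofReal ((2 * Real.pi) ^ (2 * k)) *
        ∫⁻ ξ, ENNReal.ofReal (|ξ| ^ (2 * k : ℝ)) * ‖ft (a 0) ξ‖ₑ ^ 2 = ‖a k‖ₑ ^ 2 := by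
      rw [enorm_sq_eq, ← lintegral_const_mul' _ _ ENNReal.ofReal_ne_top]
      refine lintegral_congr_ae ?_
      filter_upwards [hfta k le_rfl] with ξ e
      rw [e, enorm_mul, mul_pow (‖(2 * Real.pi * Complex.I * ξ : ℂ) ^ k‖ₑ), hnorm, mul_assoc]
    have h2 : ‖(cutSym L hL k).op u‖ₑ ^ 2 ≤ ENNReal.ofReal ((2 * Real.pi) ^ (2 * k)) *
        ∫⁻ ξ in {ξ | |ξ| ≤ 2 * L}, ENNReal.ofReal (|ξ| ^ (2 * k : ℝ)) * ‖ft u ξ‖ₑ ^ 2 := by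
      rw [enorm_sq_eq, ← lintegral_const_mul' _ _ ENNReal.ofReal_ne_top,
        ← lintegral_indicator (measurableSet_abs_le (2 * L))]
      refine lintegral_mono_ae ?_
      filter_upwards [(cutSym L hL k).ft_op u] with ξ e
      rw [e]
      by_cases hξ : |ξ| ≤ 2 * L
      · rw [Set.indicator_of_mem (show ξ ∈ {ξ | |ξ| ≤ 2 * L} from hξ), enorm_mul, mul_pow,
          ← mul_assoc, ← hnorm]
        gcongr
        rw [cutSym_apply, enorm_mul]
        refine mul_le_of_le_one_right' ?_
        rw [← ofReal_norm, Complex.norm_real, Real.norm_of_nonneg (chi_mem _).1]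
        exact ENNReal.ofReal_le_one.2 (chi_mem _).2
      · rw [cutSym_zero_of_le hL k (not_le.1 hξ).le]; simp
    have h3 : ‖a k‖ₑ ^ 2 ≤ ENNReal.ofReal ((C * G) ^ 2) * ‖(cutSym L hL k).op u‖ₑ ^ 2 := by
      rw [enorm_sq_eq_integral (ha k le_rfl), enorm_sq_eq_integral (hWae k),
        ← ENNReal.ofReal_mul (sq_nonneg _)]
      exact ENNReal.ofReal_le_ofReal
        (HC f H.contDiff H.zero A G H.pos H.nonneg H.bound W T hW0).2
    rw [h1]
    refine h3.trans ((mul_le_mul_right h2 _).trans (le_of_eq ?_))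
    ring

lemma jw_rpow_le {s : ℝ} (hs : 0 < s) (ξ : ℝ) :
    jw ξ ^ s ≤ (4 * (2 * Real.pi) ^ 2) ^ s * (1 + |ξ| ^ (2 * s)) := by
  have hpi := Real.pi_gt_three
  have e : |ξ| ^ (2 * s) = (ξ ^ 2) ^ s := by
    rw [Real.rpow_mul (abs_nonneg _), Real.rpow_two, sq_abs]
  have hle : jw ξ ≤ 4 * (2 * Real.pi) ^ 2 * max 1 (ξ ^ 2) := by
    unfold jw
    rw [mul_pow]
    have h1 := le_max_left 1 (ξ ^ 2); have h2 := le_max_right 1 (ξ ^ 2)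
    have h3 : 1 ≤ (2 * Real.pi) ^ 2 := by nlinarith
    nlinarith [mul_le_mul_of_nonneg_left h2 (by linarith : 0 ≤ (2 * Real.pi) ^ 2),
      mul_le_mul h3 h1 zero_le_one (by linarith)]
  calc jw ξ ^ s ≤ (4 * (2 * Real.pi) ^ 2 * max 1 (ξ ^ 2)) ^ s :=
        Real.rpow_le_rpow (jw_pos ξ).le hle hs.le
    _ = (4 * (2 * Real.pi) ^ 2) ^ s * max 1 (ξ ^ 2) ^ s := Real.mul_rpow (by positivity) (by positivity)
    _ ≤ _ := by
      rw [e]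
      gcongr
      rcases max_choice 1 (ξ ^ 2) with h | h
      · rw [h, Real.one_rpow]
        have : 0 ≤ (ξ ^ 2) ^ s := by positivity
        linarith
      · rw [h]; linarith

lemma abs_rpow_le_jw {s : ℝ} (hs : 0 < s) (ξ : ℝ) : |ξ| ^ (2 * s) ≤ jw ξ ^ s := by
  rw [Real.rpow_mul (abs_nonneg _), Real.rpow_two, sq_abs]
  refine Real.rpow_le_rpow (sq_nonneg _) ?_ hs.le
  unfold jw
  have hpi := Real.pi_gt_three
  have : 1 ≤ (2 * Real.pi) ^ 2 := by nlinarith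
  nlinarith [mul_le_mul_of_nonneg_right this (sq_nonneg ξ)]

lemma hNorm_le_of_sq {s : ℝ} {h u : L2} {C : ℝ}
    (H : hNorm s h ^ 2 ≤ ENNReal.ofReal C ^ 2 * hNorm s u ^ 2) :
    hNorm s h ≤ ENNReal.ofReal C * hNorm s u := by
  rw [← mul_pow] at H
  exact (ENNReal.pow_le_pow_left_iff two_ne_zero).1 H

/-- The inhomogeneous weight `jw ^ s` is comparable with `1 + |ξ|^{2s}`, so the `L²` bound and the
homogeneous bound add up. -/
lemma hNorm_sq_le {s : ℝ} (hs : 0 < s) {h u : L2} {D G : ℝ} (hD : 0 ≤ D)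
    (h0 : ‖h‖ₑ ≤ ENNReal.ofReal G * ‖u‖ₑ)
    (h1 : ∫⁻ ξ, ENNReal.ofReal (|ξ| ^ (2 * s)) * ‖ft h ξ‖ₑ ^ 2
      ≤ ENNReal.ofReal (D * G ^ 2) * ∫⁻ ξ, ENNReal.ofReal (|ξ| ^ (2 * s)) * ‖ft u ξ‖ₑ ^ 2) (hG : 0 ≤ G) :
    hNorm s h ≤ ENNReal.ofReal (√((4 * (2 * Real.pi) ^ 2) ^ s * (1 + D)) * G) * hNorm s u := by
  set c := (4 * (2 * Real.pi) ^ 2) ^ s with hc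
  have hc0 : 0 ≤ c := by positivity
  refine hNorm_le_of_sq ?_
  rw [← ENNReal.ofReal_pow (by positivity), mul_pow, Real.sq_sqrt (by positivity)]
  have hu1 : ‖u‖ₑ ^ 2 ≤ hNorm s u ^ 2 := by gcongr; exact enorm_le_hNorm hs.le u
  have hu2 : ∫⁻ ξ, ENNReal.ofReal (|ξ| ^ (2 * s)) * ‖ft u ξ‖ₑ ^ 2 ≤ hNorm s u ^ 2 := by
    rw [hNorm_sq]
    exact lintegral_mono fun ξ => by gcongr; exact abs_rpow_le_jw hs ξ
  have hm : Measurable fun ξ : ℝ => ENNReal.ofReal (|ξ| ^ (2 * s)) * ‖ft h ξ‖ₑ ^ 2 := by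
    have := measurable_ft_sq h
    have : Measurable fun ξ : ℝ => |ξ| := measurable_norm
    fun_prop
  calc hNorm s h ^ 2 ≤ ∫⁻ ξ, ENNReal.ofReal c * (‖ft h ξ‖ₑ ^ 2
        + ENNReal.ofReal (|ξ| ^ (2 * s)) * ‖ft h ξ‖ₑ ^ 2) := by
        rw [hNorm_sq]
        refine lintegral_mono fun ξ => ?_
        have := ENNReal.ofReal_le_ofReal (jw_rpow_le hs ξ)
        rw [ENNReal.ofReal_mul hc0, ENNReal.ofReal_add zero_le_one (by positivity),
          ENNReal.ofReal_one] at this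
        refine (mul_le_mul_left this _).trans (le_of_eq ?_)
        ring
    _ = ENNReal.ofReal c * (‖h‖ₑ ^ 2 + ∫⁻ ξ, ENNReal.ofReal (|ξ| ^ (2 * s)) * ‖ft h ξ‖ₑ ^ 2) := by
        rw [lintegral_const_mul' _ _ ENNReal.ofReal_ne_top, lintegral_add_right _ hm, enorm_sq_eq]
    _ ≤ ENNReal.ofReal c * ((ENNReal.ofReal G * ‖u‖ₑ) ^ 2 + ENNReal.ofReal (D * G ^ 2) *
        ∫⁻ ξ, ENNReal.ofReal (|ξ| ^ (2 * s)) * ‖ft u ξ‖ₑ ^ 2) := by gcongr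
    _ ≤ ENNReal.ofReal c * (ENNReal.ofReal (G ^ 2) * hNorm s u ^ 2 + ENNReal.ofReal (D * G ^ 2) *
        hNorm s u ^ 2) := by
        rw [mul_pow, ENNReal.ofReal_pow hG]
        gcongr
    _ = _ := by
        rw [← add_mul, ← ENNReal.ofReal_add (by positivity) (by positivity), ← mul_assoc,
          ← ENNReal.ofReal_mul hc0]
        congr 2; ring

lemma enorm_tail_tendsto (u : L2) : Tendsto (fun n : ℕ => ∫⁻ ξ in {ξ | ((n : ℝ) + 1) ≤ |ξ|},
    ‖ft u ξ‖ₑ ^ 2) atTop (𝓝 0) := by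
  have hfin : ∫⁻ ξ, ‖ft u ξ‖ₑ ^ 2 ≠ ⊤ := by rw [← enorm_sq_eq]; finiteness
  have h := tendsto_lintegral_of_dominated_convergence (μ := volume)
    (F := fun (n : ℕ) (ξ : ℝ) => {ξ : ℝ | ((n : ℝ) + 1) ≤ |ξ|}.indicator (fun ξ => ‖ft u ξ‖ₑ ^ 2) ξ)
    (f := fun _ => 0) (fun ξ => ‖ft u ξ‖ₑ ^ 2)
    (fun n => (measurable_ft_sq u).indicator (measurableSet_le_abs _))
    (fun n => Eventually.of_forall fun ξ => Set.indicator_le_self _ _ _) hfin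
    (Eventually.of_forall fun ξ => by
      obtain ⟨N, hN⟩ := exists_nat_gt |ξ|
      refine tendsto_const_nhds.congr' ?_
      filter_upwards [eventually_ge_atTop N] with n hn
      rw [Set.indicator_of_notMem]
      intro (hc : (n : ℝ) + 1 ≤ |ξ|)
      have : (N : ℝ) ≤ n := by exact_mod_cast hn
      linarith)
  simp only [lintegral_zero] at h
  exact h.congr fun n => lintegral_indicator (measurableSet_le_abs _) _

/-- Moser's estimate: composition with a function which vanishes at `0` acts on bounded functions
in `H^s`, with an estimate that is linear in the norm of `H^s`. -/
theorem exists_moser {s : ℝ} {k : ℕ} (hs : 0 < s) (hsk : s ≤ k) : ∃ C K : ℝ, 0 < C ∧ 1 ≤ K ∧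
    ∀ (f : ℝ → ℝ) (A G : ℝ), MoserBound k K f A G → ∀ u h : L2,
      eLpNorm u ⊤ volume ≤ ENNReal.ofReal A → (∀ᵐ x, h x = f (u x)) →
      hNorm s h ≤ ENNReal.ofReal (C * G) * hNorm s u := by
  have hk : 1 ≤ k := by
    have : (0 : ℝ) < k := hs.trans_le hsk
    exact_mod_cast this
  obtain ⟨C, K, hC, hK, H⟩ := exists_cut_comp k hk
  have hb : ∀ (f : ℝ → ℝ) (A G : ℝ), MoserBound k K f A G → ∀ u h : L2,
      eLpNorm u ⊤ volume ≤ ENNReal.ofReal A → (∀ᵐ x, h x = f (u x)) →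
      ‖h‖ₑ ≤ ENNReal.ofReal G * ‖u‖ₑ := fun f A G HM u h hu hh => by
    refine enorm_le_of_ae ?_
    filter_upwards [hh, abs_le_of_eLpNorm_top HM.pos.le hu] with x e1 e2
    rw [e1]
    exact HM.abs_le hk (e2.trans (by have := HM.pos; nlinarith))
  rcases hsk.lt_or_eq with hlt | heq
  -- For `s < k`: split `h = (h - a) + a` above each level `L`. For `s = k` the layer integral
  -- diverges, but then the bound for `a` is already uniform in `L`, and one lets `L → ∞`.
  · obtain ⟨C', hC', HL⟩ := layer_cake hs hlt
    have hCC : 0 ≤ C' * (2 + 2 * C ^ 2) := by positivity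
    refine ⟨_, K, ?_, hK, fun f A G HM u h hu hh =>
      hNorm_sq_le hs hCC (hb f A G HM u h hu hh) ?_ HM.nonneg⟩
    · exact Real.sqrt_pos.2 (by positivity)
    refine (HL _ _ (ENNReal.ofReal ((2 + 2 * C ^ 2) * G ^ 2)) (measurable_ft_sq h) (measurable_ft_sq u)
      fun L hL => ?_).trans (le_of_eq ?_)
    · obtain ⟨a, h1, -, h2⟩ := H f A G HM u h hu hh L hL
      set X := ∫⁻ ξ in {ξ | L ≤ |ξ|}, ‖ft u ξ‖ₑ ^ 2
      set Y := ∫⁻ ξ in {ξ | |ξ| ≤ 2 * L}, ENNReal.ofReal (|ξ| ^ (2 * k : ℝ)) * ‖ft u ξ‖ₑ ^ 2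
      have hmS : MeasurableSet {ξ : ℝ | L ≤ |ξ|} := measurableSet_le measurable_const measurable_norm
      have h3 : ∫⁻ ξ in {ξ | L ≤ |ξ|}, ‖ft a ξ‖ₑ ^ 2 ≤ ENNReal.ofReal (L ^ (-(2 * k : ℝ))) *
          ∫⁻ ξ, ENNReal.ofReal (|ξ| ^ (2 * k : ℝ)) * ‖ft a ξ‖ₑ ^ 2 := by
        rw [← lintegral_const_mul' _ _ ENNReal.ofReal_ne_top]
        refine (setLIntegral_mono' hmS fun ξ hξ => ?_).trans (setLIntegral_le_lintegral _ _)
        rw [← mul_assoc, ← ENNReal.ofReal_mul (by positivity)]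
        refine le_mul_of_one_le_left' ?_
        rw [ENNReal.one_le_ofReal, Real.rpow_neg hL.le, ← div_eq_inv_mul,
          one_le_div (by positivity)]
        exact Real.rpow_le_rpow hL.le hξ (by positivity)
      have h4 : ∀ᵐ ξ, ‖ft h ξ‖ₑ ^ 2 ≤ 2 * ‖ft (h - a) ξ‖ₑ ^ 2 + 2 * ‖ft a ξ‖ₑ ^ 2 := by
        filter_upwards [ft_sub_ae h a] with ξ e
        rw [e]
        have : ‖ft h ξ‖ₑ ≤ ‖ft h ξ - ft a ξ‖ₑ + ‖ft a ξ‖ₑ := by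
          simpa using! enorm_add_le (ft h ξ - ft a ξ) (ft a ξ)
        calc ‖ft h ξ‖ₑ ^ 2 ≤ (‖ft h ξ - ft a ξ‖ₑ + ‖ft a ξ‖ₑ) ^ 2 := by gcongr
          _ ≤ _ := by
            have := ENNReal.rpow_add_le_mul_rpow_add_rpow (‖ft h ξ - ft a ξ‖ₑ) (‖ft a ξ‖ₑ)
              (p := 2) (by norm_num)
            norm_num at this
            rwa [mul_add] at this
      calc ∫⁻ ξ in {ξ | L ≤ |ξ|}, ‖ft h ξ‖ₑ ^ 2
          ≤ ∫⁻ ξ in {ξ | L ≤ |ξ|}, (2 * ‖ft (h - a) ξ‖ₑ ^ 2 + 2 * ‖ft a ξ‖ₑ ^ 2) :=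
            setLIntegral_mono_ae' hmS (h4.mono fun ξ e _ => e)
        _ = (2 * ∫⁻ ξ in {ξ | L ≤ |ξ|}, ‖ft (h - a) ξ‖ₑ ^ 2)
            + 2 * ∫⁻ ξ in {ξ | L ≤ |ξ|}, ‖ft a ξ‖ₑ ^ 2 := by
            rw [lintegral_add_left ((measurable_ft_sq _).const_mul 2),
              lintegral_const_mul _ (measurable_ft_sq _), lintegral_const_mul _ (measurable_ft_sq _)]
        _ ≤ 2 * (ENNReal.ofReal (G ^ 2) * X) + 2 * (ENNReal.ofReal (L ^ (-(2 * k : ℝ))) *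
            (ENNReal.ofReal ((C * G) ^ 2) * Y)) := by
            gcongr
            · refine (setLIntegral_le_lintegral _ _).trans ?_
              rw [← enorm_sq_eq]; exact h1
            · exact h3.trans (mul_le_mul_right h2 _)
        _ ≤ _ := by
            have e : ENNReal.ofReal ((2 + 2 * C ^ 2) * G ^ 2)
                = 2 * ENNReal.ofReal (G ^ 2) + 2 * ENNReal.ofReal ((C * G) ^ 2) := by
              rw [← ENNReal.ofReal_ofNat 2, ← ENNReal.ofReal_mul (by norm_num),
                ← ENNReal.ofReal_mul (by norm_num), ← ENNReal.ofReal_add (by positivity) (by positivity)]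
              congr 1; ring
            rw [e, add_mul]
            set g := ENNReal.ofReal (G ^ 2)
            set c := ENNReal.ofReal ((C * G) ^ 2)
            set l := ENNReal.ofReal (L ^ (-(2 * k : ℝ)))
            calc 2 * (g * X) + 2 * (l * (c * Y)) = 2 * g * X + 2 * c * (l * Y) := by ring
              _ ≤ _ := by gcongr <;> simp
    · rw [← ENNReal.ofReal_mul hC'.le, mul_assoc]
  · refine ⟨√((4 * (2 * Real.pi) ^ 2) ^ s * (1 + C ^ 2)), K, Real.sqrt_pos.2 (by positivity), hK,
      fun f A G HM u h hu hh => ?_⟩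
    choose a h1 h2 h3 using fun n : ℕ => H f A G HM u h hu hh ((n : ℝ) + 1) (by positivity)
    have hlim : Tendsto a atTop (𝓝 h) := by
      rw [tendsto_iff_edist_tendsto_0]
      have h4 : Tendsto (fun n => ‖h - a n‖ₑ ^ 2) atTop (𝓝 0) := by
        refine tendsto_of_tendsto_of_tendsto_of_le_of_le tendsto_const_nhds ?_ (fun _ => zero_le) h1
        have := ENNReal.Tendsto.const_mul (a := ENNReal.ofReal (G ^ 2)) (enorm_tail_tendsto u)
          (Or.inr ENNReal.ofReal_ne_top)
        rwa [mul_zero] at this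
      have h5 := h4.ennrpow_const (1 / 2)
      simp only [← ENNReal.rpow_natCast, ← ENNReal.rpow_mul] at h5
      norm_num at h5
      refine h5.congr fun n => ?_
      rw [edist_comm, edist_eq_enorm_sub]
    refine ((ballNorm_hNorm s).closed (ENNReal.ofReal (√((4 * (2 * Real.pi) ^ 2) ^ s * (1 + C ^ 2))
      * G) * hNorm s u)).mem_of_tendsto hlim (Eventually.of_forall fun n => ?_)
    refine hNorm_sq_le hs (sq_nonneg C) (h2 n) ?_ HM.nonneg
    rw [← mul_pow]
    subst heq
    exact (h3 n).trans (mul_le_mul_right (setLIntegral_le_lintegral _ _) _)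
end

section
open scoped ComplexConjugate ContDiff

/-! ### Continuity of composition operators in `H^s` -/

lemma exists_poly_derivative (P : Polynomial ℝ) : ∃ Q : Polynomial ℝ, Q.derivative = P := by
  induction P using Polynomial.induction_on' with
  | add p q hp hq =>
    obtain ⟨P, hP⟩ := hp; obtain ⟨Q, hQ⟩ := hq
    exact ⟨P + Q, by rw [Polynomial.derivative_add, hP, hQ]⟩
  | monomial n a =>
    refine ⟨Polynomial.monomial (n + 1) (a / (n + 1)), ?_⟩
    rw [Polynomial.derivative_monomial]
    have : (n : ℝ) + 1 ≠ 0 := by positivity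
    simp [div_mul_cancel₀ _ this]

/-- Weierstrass' theorem for the `k`-th derivative, followed by `k` integrations with the constants
matched at the origin. For `k = 0` there is nothing to match, hence the proviso `1 ≤ k`. -/
lemma exists_poly_near (k : ℕ) : ∀ f : ℝ → ℝ, ContDiff ℝ k f → ∀ R ε : ℝ, 0 ≤ R → 0 < ε →
    ∃ P : Polynomial ℝ, (1 ≤ k → P.eval 0 = f 0) ∧ ∀ j, j ≤ k → ∀ y, |y| ≤ R →
      |iteratedDeriv j (fun y => f y - P.eval y) y| ≤ ε := by
  induction k with
  | zero =>
    intro f hf R ε hR hε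
    obtain ⟨P, hP⟩ := exists_polynomial_near_of_continuousOn (-R) R f
      (contDiff_zero.1 hf).continuousOn ε hε
    refine ⟨P, fun h => by omega, fun j hj y hy => ?_⟩
    obtain rfl : j = 0 := by omega
    rw [iteratedDeriv_zero, abs_sub_comm]
    exact (hP y (abs_le.1 hy)).le
  | succ k ih =>
    intro f hf R ε hR hε
    have hf' : ContDiff ℝ k (deriv f) := by
      have : ContDiff ℝ ((k : ℕ∞ω) + 1) f := by exact_mod_cast hf
      exact (contDiff_succ_iff_deriv.1 this).2.2
    have hfd : Differentiable ℝ f := hf.differentiable (by simp)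
    obtain ⟨P, -, hP⟩ := ih (deriv f) hf' R (ε / (R + 1)) hR (by positivity)
    obtain ⟨Q, hQ⟩ := exists_poly_derivative P
    have hd : deriv (fun y => f y - (Q + Polynomial.C (f 0 - Q.eval 0)).eval y)
        = fun y => deriv f y - P.eval y := funext fun y => by
      rw [deriv_fun_sub (hfd y) (Polynomial.differentiable _ y), Polynomial.deriv]
      simp [hQ]
    have hle : ε / (R + 1) ≤ ε := div_le_self hε.le (by linarith)
    refine ⟨Q + Polynomial.C (f 0 - Q.eval 0), fun _ => by simp, fun j hj y hy => ?_⟩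
    rcases j with _ | j
    · have hdiff : Differentiable ℝ fun y => f y - (Q + Polynomial.C (f 0 - Q.eval 0)).eval y :=
        hfd.sub (Polynomial.differentiable _)
      have h := (convex_Icc (-R) R).norm_image_sub_le_of_norm_deriv_le
        (f := fun y => f y - (Q + Polynomial.C (f 0 - Q.eval 0)).eval y) (C := ε / (R + 1))
        (fun x _ => hdiff x)
        (fun x hx => by
          rw [hd]; simpa using! hP 0 (Nat.zero_le _) x (abs_le.2 hx))
        (x := 0) (y := y) ⟨by linarith, by linarith⟩ (abs_le.1 hy)
      simp only [Polynomial.eval_add, Polynomial.eval_C, add_sub_cancel, sub_self, sub_zero,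
        Real.norm_eq_abs] at h
      simp only [iteratedDeriv_zero, Polynomial.eval_add, Polynomial.eval_C]
      refine h.trans ?_
      rw [div_mul_eq_mul_div, div_le_iff₀ (by linarith)]
      nlinarith
    · rw [iteratedDeriv_succ', hd]
      exact (hP j (by omega) y hy).trans hle

lemma moserBound_sq (k : ℕ) {K A : ℝ} (hK : 1 ≤ K) (hA : 0 < A) :
    MoserBound k K (fun y => y ^ 2) A (2 * K * A) where
  contDiff := contDiff_id.pow 2
  zero := by simp
  pos := hA
  nonneg := by positivity
  bound j h1 _ y hy := by
    have h2 : deriv (fun y : ℝ => y ^ 2) = fun y => 2 * y := by ext y; simp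
    have h3 : deriv (fun y : ℝ => 2 * y) = fun _ => 2 := by
      ext y; simp
    match j, h1 with
    | 1, _ =>
      rw [iteratedDeriv_one, h2, abs_mul, abs_two, pow_one]
      nlinarith
    | 2, _ =>
      rw [iteratedDeriv_succ', h2, iteratedDeriv_one, h3, abs_two]
      nlinarith [mul_pos hA hA]
    | j + 3, _ =>
      rw [iteratedDeriv_succ', h2, iteratedDeriv_succ', h3, iteratedDeriv_const]
      simp only [Nat.add_eq_zero_iff, one_ne_zero, and_false, if_false, abs_zero, zero_mul]
      positivity

lemma exists_comp_of_abs_le {f : ℝ → ℝ} (hf : Continuous f) {u : L2} {C : ℝ}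
    (h : ∀ᵐ x, |f (u x)| ≤ C * |u x|) : ∃ w : L2, ∀ᵐ x, w x = f (u x) := by
  have : MemLp (fun x => f (u x)) 2 volume := (Lp.memLp u).of_le_mul
    (hf.comp_aestronglyMeasurable (Lp.aestronglyMeasurable u)) h
  exact ⟨this.toLp, this.coeFn_toLp⟩

lemma exists_mul_of_abs_le {a b : L2} {C : ℝ} (h : ∀ᵐ x, |a x| ≤ C) :
    ∃ w : L2, ∀ᵐ x, w x = a x * b x := by
  have : MemLp (fun x => a x * b x) 2 volume := (Lp.memLp b).of_le_mul (c := C)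
    ((Lp.aestronglyMeasurable a).mul (Lp.aestronglyMeasurable b)) (by
      filter_upwards [h] with x hx
      rw [norm_mul]; exact mul_le_mul_of_nonneg_right hx (norm_nonneg _))
  exact ⟨this.toLp, this.coeFn_toLp⟩

lemma exists_abs_le {s : ℝ} (hs : 1 / 2 < s) {u : L2} (hu : hNorm s u < ⊤) :
    ∃ A : ℝ, 0 < A ∧ eLpNorm u ⊤ volume ≤ ENNReal.ofReal A := by
  obtain ⟨C, hC, H⟩ := exists_sobolev hs
  have h1 : eLpNorm u ⊤ volume < ⊤ := (H u).trans_lt (ENNReal.mul_lt_top (by simp) hu)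
  refine ⟨(eLpNorm u ⊤ volume).toReal + 1, by positivity, ?_⟩
  rw [← ENNReal.ofReal_toReal h1.ne]
  exact ENNReal.ofReal_le_ofReal (by rw [ENNReal.toReal_ofReal (by positivity)]; linarith)

/-- `H^s` is an algebra for `s > 1/2`. -/
theorem exists_hNorm_mul_le {s : ℝ} (hs : 1 / 2 < s) : ∃ C : ℝ, 0 < C ∧ ∀ a b c : L2,
    hNorm s a < ⊤ → hNorm s b < ⊤ → (∀ᵐ x, c x = a x * b x) →
      hNorm s c ≤ ENNReal.ofReal C * (hNorm s a * hNorm s b) := by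
  obtain ⟨C₁, hC₁, H₁⟩ := exists_sobolev hs
  obtain ⟨C, K, hC, hK, H⟩ := exists_moser (k := ⌈s⌉₊) (by linarith) (Nat.le_ceil s)
  set G : ℝ := C * (2 * K * (C₁ * 2)) * 2 with hG
  have hG0 : 0 < G := by positivity
  -- Polarisation, `4ab = (a+b)² - (a-b)²`, reduces the product to Moser's estimate for `y ↦ y²`.
  -- The estimate is not bilinear by construction, so it is proved for unit vectors and then scaled.
  have unit : ∀ a b c : L2, hNorm s a ≤ 1 → hNorm s b ≤ 1 → (∀ᵐ x, c x = a x * b x) →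
      hNorm s c ≤ ENNReal.ofReal G := fun a b c ha hb hc => by
    have hsq : ∀ w : L2, hNorm s w ≤ 2 → ∃ q : L2, (∀ᵐ x, q x = w x ^ 2) ∧
        hNorm s q ≤ ENNReal.ofReal G := fun w hw => by
      have hw2 : eLpNorm w ⊤ volume ≤ ENNReal.ofReal (C₁ * 2) := by
        refine (H₁ w).trans ?_
        rw [ENNReal.ofReal_mul hC₁.le, ENNReal.ofReal_ofNat]
        gcongr
      obtain ⟨q, hq⟩ := exists_mul_of_abs_le (b := w) (abs_le_of_eLpNorm_top (by positivity) hw2)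
      have hq' : ∀ᵐ x, q x = w x ^ 2 := hq.mono fun x hx => by rw [hx, pow_two]
      refine ⟨q, hq', (H _ _ _ (moserBound_sq _ hK (by positivity)) w q hw2 hq').trans ?_⟩
      rw [hG, ENNReal.ofReal_mul (p := C * (2 * K * (C₁ * 2))) (by positivity), ENNReal.ofReal_ofNat]
      gcongr
    have B := ballNorm_hNorm s
    obtain ⟨q1, h1, h1'⟩ := hsq (a + b) ((B.add_le a b).trans
      ((add_le_add ha hb).trans (by norm_num)))
    obtain ⟨q2, h2, h2'⟩ := hsq (a - b) ((B.sub_le a b).trans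
      ((add_le_add ha hb).trans (by norm_num)))
    have e : c = (1 / 4 : ℝ) • (q1 - q2) := by
      refine Lp.ext ?_
      filter_upwards [hc, h1, h2, Lp.coeFn_add a b, Lp.coeFn_sub a b, Lp.coeFn_sub q1 q2,
        Lp.coeFn_smul (1 / 4 : ℝ) (q1 - q2)] with x e1 e2 e3 e4 e5 e6 e7
      rw [e7, Pi.smul_apply, e6, Pi.sub_apply, e1, e2, e3, e4, e5, Pi.add_apply, Pi.sub_apply,
        smul_eq_mul]
      ring
    rw [e, B.smul]
    calc ‖(1 / 4 : ℝ)‖ₑ * hNorm s (q1 - q2) ≤ ‖(1 / 4 : ℝ)‖ₑ * (ENNReal.ofReal G + ENNReal.ofReal G) := by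
          gcongr; exact (B.sub_le _ _).trans (add_le_add h1' h2')
      _ ≤ ENNReal.ofReal G := by
        rw [← ENNReal.ofReal_add hG0.le hG0.le, Real.enorm_eq_ofReal (by norm_num),
          ← ENNReal.ofReal_mul (by norm_num)]
        exact ENNReal.ofReal_le_ofReal (by linarith)
  refine ⟨G, hG0, fun a b c ha hb hc => ?_⟩
  have B := ballNorm_hNorm s
  have zero : ∀ a : L2, hNorm s a = 0 → a = 0 := fun a h => by
    have := enorm_le_hNorm (by linarith : 0 ≤ s) a
    rw [h] at this
    exact enorm_eq_zero.1 (le_antisymm this zero_le)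
  have czero : (a = 0 ∨ b = 0) → c = 0 := fun h => by
    refine Lp.ext ?_
    rcases h with rfl | rfl <;>
    · filter_upwards [hc, Lp.coeFn_zero ℝ 2 (volume : Measure ℝ)] with x e1 e2
      rw [e1, e2]; simp
  by_cases h0 : hNorm s a = 0 ∨ hNorm s b = 0
  · rw [czero (h0.imp (zero a) (zero b)), hNorm_zero_right]; exact zero_le
  push Not at h0
  have hn : ∀ w : L2, hNorm s w ≠ 0 → hNorm s w < ⊤ → 0 < (hNorm s w).toReal ∧
      hNorm s ((hNorm s w).toReal⁻¹ • w) ≤ 1 := fun w h1 h2 => by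
    have hp := ENNReal.toReal_pos h1 h2.ne
    refine ⟨hp, ?_⟩
    rw [B.smul, Real.enorm_eq_ofReal (by positivity), ENNReal.ofReal_inv_of_pos hp,
      ENNReal.ofReal_toReal h2.ne, ENNReal.inv_mul_cancel h1 h2.ne]
  obtain ⟨pa, ha'⟩ := hn a h0.1 ha
  obtain ⟨pb, hb'⟩ := hn b h0.2 hb
  have hu := unit _ _ (((hNorm s a).toReal⁻¹ * (hNorm s b).toReal⁻¹) • c) ha' hb' (by
    filter_upwards [hc, Lp.coeFn_smul ((hNorm s a).toReal⁻¹ * (hNorm s b).toReal⁻¹) c,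
      Lp.coeFn_smul ((hNorm s a).toReal⁻¹) a, Lp.coeFn_smul ((hNorm s b).toReal⁻¹) b] with x e1 e2 e3 e4
    rw [e2, e3, e4, Pi.smul_apply, Pi.smul_apply, Pi.smul_apply, e1]
    simp only [smul_eq_mul]; ring)
  have e : c = ((hNorm s a).toReal * (hNorm s b).toReal) •
      (((hNorm s a).toReal⁻¹ * (hNorm s b).toReal⁻¹) • c) := by
    rw [smul_smul, ← mul_inv, mul_inv_cancel₀ (by positivity), one_smul]
  rw [e, B.smul, Real.enorm_eq_ofReal (by positivity), ENNReal.ofReal_mul pa.le,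
    ENNReal.ofReal_toReal ha.ne, ENNReal.ofReal_toReal hb.ne, mul_comm]
  gcongr

/-- Functions whose composition operator is defined and continuous on `H^s`. -/
structure CompCont (s : ℝ) (f : ℝ → ℝ) : Prop where
  exists_comp : ∀ u : L2, hNorm s u < ⊤ → ∃ h : L2, (∀ᵐ x, h x = f (u x)) ∧ hNorm s h < ⊤
  tendsto : ∀ (u₀ h₀ : L2) (u h : ℕ → L2), hNorm s u₀ < ⊤ → (∀ n, hNorm s (u n) < ⊤) →
    (∀ᵐ x, h₀ x = f (u₀ x)) → (∀ n, ∀ᵐ x, h n x = f (u n x)) →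
    Tendsto (fun n => hNorm s (u n - u₀)) atTop (𝓝 0) →
    Tendsto (fun n => hNorm s (h n - h₀)) atTop (𝓝 0)

section
variable {s : ℝ} {f g : ℝ → ℝ}

lemma ae_unique {a b : L2} {F : ℝ → ℝ} (ha : ∀ᵐ x, a x = F x) (hb : ∀ᵐ x, b x = F x) : a = b :=
  Lp.ext (by filter_upwards [ha, hb] with x h1 h2; rw [h1, h2])

lemma compCont_id : CompCont s (fun y => y) where
  exists_comp u hu := ⟨u, by simp, hu⟩
  tendsto u₀ h₀ u h _ _ e0 e H := by
    obtain rfl : h₀ = u₀ := Lp.ext e0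
    obtain rfl : h = u := funext fun n => Lp.ext (e n)
    exact H

lemma CompCont.const_mul (hf : CompCont s f) (c : ℝ) : CompCont s (fun y => c * f y) where
  exists_comp u hu := by
    obtain ⟨h, h1, h2⟩ := hf.exists_comp u hu
    refine ⟨c • h, ?_, ?_⟩
    · filter_upwards [h1, Lp.coeFn_smul c h] with x e1 e2
      rw [e2, Pi.smul_apply, e1, smul_eq_mul]
    · rw [(ballNorm_hNorm s).smul]; exact ENNReal.mul_lt_top (by simp) h2
  tendsto u₀ h₀ u h hu₀ hu e0 e H := by
    obtain ⟨k₀, k1, -⟩ := hf.exists_comp u₀ hu₀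
    choose k k2 _ using fun n => hf.exists_comp (u n) (hu n)
    have E : ∀ (w q a : L2), (∀ᵐ x, w x = c * f (a x)) → (∀ᵐ x, q x = f (a x)) → w = c • q :=
      fun w q a h1 h2 => Lp.ext (by
        filter_upwards [h1, h2, Lp.coeFn_smul c q] with x e1 e2 e3
        rw [e1, e3, Pi.smul_apply, e2, smul_eq_mul])
    have := ENNReal.Tendsto.const_mul (a := ‖c‖ₑ) (hf.tendsto u₀ k₀ u k hu₀ hu k1 k2 H) (Or.inr (by simp))
    rw [mul_zero] at this
    refine this.congr fun n => ?_
    rw [E h₀ k₀ u₀ e0 k1, E (h n) (k n) (u n) (e n) (k2 n), ← smul_sub, (ballNorm_hNorm s).smul]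

lemma CompCont.add (hf : CompCont s f) (hg : CompCont s g) : CompCont s (fun y => f y + g y) where
  exists_comp u hu := by
    obtain ⟨h, h1, h2⟩ := hf.exists_comp u hu
    obtain ⟨k, k1, k2⟩ := hg.exists_comp u hu
    refine ⟨h + k, ?_, ((ballNorm_hNorm s).add_le h k).trans_lt (ENNReal.add_lt_top.2 ⟨h2, k2⟩)⟩
    filter_upwards [h1, k1, Lp.coeFn_add h k] with x e1 e2 e3
    rw [e3, Pi.add_apply, e1, e2]
  tendsto u₀ h₀ u h hu₀ hu e0 e H := by
    obtain ⟨a₀, a1, -⟩ := hf.exists_comp u₀ hu₀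
    choose a a2 _ using fun n => hf.exists_comp (u n) (hu n)
    obtain ⟨b₀, b1, -⟩ := hg.exists_comp u₀ hu₀
    choose b b2 _ using fun n => hg.exists_comp (u n) (hu n)
    have E : ∀ (w p q v : L2), (∀ᵐ x, w x = f (v x) + g (v x)) → (∀ᵐ x, p x = f (v x)) →
        (∀ᵐ x, q x = g (v x)) → w = p + q := fun w p q v h1 h2 h3 => Lp.ext (by
      filter_upwards [h1, h2, h3, Lp.coeFn_add p q] with x e1 e2 e3 e4
      rw [e1, e4, Pi.add_apply, e2, e3])
    have := (hf.tendsto u₀ a₀ u a hu₀ hu a1 a2 H).add (hg.tendsto u₀ b₀ u b hu₀ hu b1 b2 H)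
    rw [add_zero] at this
    refine tendsto_of_tendsto_of_tendsto_of_le_of_le tendsto_const_nhds this (fun _ => zero_le)
      fun n => ?_
    simp only
    rw [E h₀ a₀ b₀ u₀ e0 a1 b1, E (h n) (a n) (b n) (u n) (e n) (a2 n) (b2 n), add_sub_add_comm]
    exact (ballNorm_hNorm s).add_le _ _

lemma tendsto_hNorm_bdd {u₀ : L2} {u : ℕ → L2}
    (H : Tendsto (fun n => hNorm s (u n - u₀)) atTop (𝓝 0)) :
    ∀ᶠ n in atTop, hNorm s (u n) ≤ hNorm s u₀ + 1 := by
  filter_upwards [H.eventually_le_const (by norm_num : (0 : ℝ≥0∞) < 1)] with n hn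
  calc hNorm s (u n) = hNorm s (u₀ + (u n - u₀)) := by rw [add_sub_cancel]
    _ ≤ _ := ((ballNorm_hNorm s).add_le _ _).trans (by gcongr)

lemma CompCont.mul (hs : 1 / 2 < s) (hf : CompCont s f) (hg : CompCont s g) :
    CompCont s (fun y => f y * g y) := by
  obtain ⟨C, hC, HC⟩ := exists_hNorm_mul_le hs
  have prod : ∀ a b : L2, hNorm s a < ⊤ → hNorm s b < ⊤ → ∃ c : L2, (∀ᵐ x, c x = a x * b x) ∧
      hNorm s c ≤ ENNReal.ofReal C * (hNorm s a * hNorm s b) := fun a b ha hb => by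
    obtain ⟨A, hA, hA'⟩ := exists_abs_le hs ha
    obtain ⟨c, hc⟩ := exists_mul_of_abs_le (b := b) (abs_le_of_eLpNorm_top hA.le hA')
    exact ⟨c, hc, HC a b c ha hb hc⟩
  refine ⟨fun u hu => ?_, fun u₀ h₀ u h hu₀ hu e0 e H => ?_⟩
  · obtain ⟨h, h1, h2⟩ := hf.exists_comp u hu
    obtain ⟨k, k1, k2⟩ := hg.exists_comp u hu
    obtain ⟨c, hc, hc'⟩ := prod h k h2 k2
    refine ⟨c, ?_, hc'.trans_lt (ENNReal.mul_lt_top (by simp) (ENNReal.mul_lt_top h2 k2))⟩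
    filter_upwards [h1, k1, hc] with x e1 e2 e3
    rw [e3, e1, e2]
  · obtain ⟨a₀, a1, a0⟩ := hf.exists_comp u₀ hu₀
    choose a a2 a3 using fun n => hf.exists_comp (u n) (hu n)
    obtain ⟨b₀, b1, b0⟩ := hg.exists_comp u₀ hu₀
    choose b b2 b3 using fun n => hg.exists_comp (u n) (hu n)
    have ta := hf.tendsto u₀ a₀ u a hu₀ hu a1 a2 H
    have tb := hg.tendsto u₀ b₀ u b hu₀ hu b1 b2 H
    have B := ballNorm_hNorm s
    have key : ∀ n, hNorm s (h n - h₀) ≤ ENNReal.ofReal C * (hNorm s (a n - a₀) * hNorm s (b n))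
        + ENNReal.ofReal C * (hNorm s a₀ * hNorm s (b n - b₀)) := fun n => by
      have l1 : hNorm s (a n - a₀) < ⊤ := (B.sub_le _ _).trans_lt (ENNReal.add_lt_top.2 ⟨a3 n, a0⟩)
      have l2 : hNorm s (b n - b₀) < ⊤ := (B.sub_le _ _).trans_lt (ENNReal.add_lt_top.2 ⟨b3 n, b0⟩)
      obtain ⟨c, hc, hc'⟩ := prod (a n - a₀) (b n) l1 (b3 n)
      obtain ⟨d, hd, hd'⟩ := prod a₀ (b n - b₀) a0 l2
      have : h n - h₀ = c + d := Lp.ext (by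
        filter_upwards [Lp.coeFn_sub (h n) h₀, Lp.coeFn_add c d, hc, hd, e n, e0, a1, a2 n, b1, b2 n,
          Lp.coeFn_sub (a n) a₀, Lp.coeFn_sub (b n) b₀] with x e1 e2 e3 e4 e5 e6 e7 e8 e9 e10 e11 e12
        rw [e1, e2, Pi.sub_apply, Pi.add_apply, e3, e4, e5, e6, e11, e12, Pi.sub_apply, Pi.sub_apply,
          e7, e8, e9, e10]
        ring)
      rw [this]
      exact (B.add_le _ _).trans (add_le_add hc' hd')
    have lim : Tendsto (fun n => ENNReal.ofReal C * (hNorm s (a n - a₀) * (hNorm s b₀ + 1))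
        + ENNReal.ofReal C * (hNorm s a₀ * hNorm s (b n - b₀))) atTop (𝓝 0) := by
      have l1 := ENNReal.Tendsto.const_mul (a := ENNReal.ofReal C)
        (ENNReal.Tendsto.mul_const (b := hNorm s b₀ + 1) ta
          (Or.inr (by simpa using! b0.ne))) (Or.inr (by simp))
      have l2 := ENNReal.Tendsto.const_mul (a := ENNReal.ofReal C)
        (ENNReal.Tendsto.const_mul (a := hNorm s a₀) tb (Or.inr a0.ne)) (Or.inr (by simp))
      simpa using! l1.add l2
    refine tendsto_of_tendsto_of_tendsto_of_le_of_le' tendsto_const_nhds lim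
      (Eventually.of_forall fun _ => zero_le) ?_
    filter_upwards [tendsto_hNorm_bdd tb] with n hn
    exact (key n).trans (by gcongr)

lemma compCont_poly (hs : 1 / 2 < s) (Q : Polynomial ℝ) : CompCont s (fun y => y * Q.eval y) := by
  induction Q using Polynomial.induction_on with
  | C a => simpa [mul_comm] using! (compCont_id (s := s)).const_mul a
  | add p q hp hq => simpa [mul_add] using! hp.add hq
  | monomial n a h =>
    have := h.mul hs (compCont_id (s := s))
    convert! this using 2 with y
    simp; ring

/-- Composition with a smooth function that vanishes at `0` is continuous on `H^s`. -/
theorem compCont_of_contDiff (hs : 1 / 2 < s) {k : ℕ} (hsk : s ≤ k) (hf : ContDiff ℝ k f)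
    (hf0 : f 0 = 0) : CompCont s f := by
  have hk : 1 ≤ k := by
    have : (0 : ℝ) < k := by linarith
    exact_mod_cast this
  obtain ⟨C, K, hC, hK, H⟩ := exists_moser (by linarith) hsk
  -- Polynomials vanishing at `0` compose continuously since `H^s` is an algebra. The remainder has
  -- Moser constant `ε`, so it contributes at most `C ε ‖u‖`, uniformly on bounded sets. The
  -- accuracy `ε A / A^k` absorbs the factors `A^j`, as `A ≥ 1`.
  have appr : ∀ A ε : ℝ, 1 ≤ A → 0 < ε → ∃ Q : Polynomial ℝ,
      MoserBound k K (fun y => f y - y * Q.eval y) A ε := fun A ε hA hε => by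
    obtain ⟨P, hP0, hP⟩ := exists_poly_near k f hf (K * A) (ε * A / A ^ k) (by positivity) (by positivity)
    have h0 : P.coeff 0 = 0 := by
      rw [Polynomial.coeff_zero_eq_eval_zero, hP0 hk, hf0]
    obtain ⟨Q, rfl⟩ := Polynomial.X_dvd_iff.2 h0
    refine ⟨Q, ?_, by simp [hf0], by linarith, hε.le, fun j h1 h2 y hy => ?_⟩
    · have : ContDiff ℝ k fun y : ℝ => Q.eval y := by
        simpa [Polynomial.aeval_def, Polynomial.eval₂_eq_eval_map] using! Q.contDiff_aeval (𝕜 := ℝ) k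
      exact hf.sub (contDiff_id.mul this)
    · have := hP j h2 y hy
      simp only [Polynomial.eval_mul, Polynomial.eval_X] at this
      rw [le_div_iff₀ (by positivity)] at this
      refine le_trans ?_ this
      gcongr
  have B := ballNorm_hNorm s
  have dec : ∀ (u h : L2) (Q : Polynomial ℝ) (A ε : ℝ), hNorm s u < ⊤ → eLpNorm u ⊤ volume ≤ ENNReal.ofReal A →
      MoserBound k K (fun y => f y - y * Q.eval y) A ε → (∀ᵐ x, h x = f (u x)) →
      ∀ q : L2, (∀ᵐ x, q x = u x * Q.eval (u x)) → hNorm s (h - q) ≤ ENNReal.ofReal (C * ε) * hNorm s u :=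
    fun u h Q A ε hu hA hM hh q hq => H _ A ε hM u (h - q) hA (by
      filter_upwards [Lp.coeFn_sub h q, hh, hq] with x e1 e2 e3
      rw [e1, Pi.sub_apply, e2, e3])
  have ex : ∀ u : L2, hNorm s u < ⊤ → ∃ h : L2, (∀ᵐ x, h x = f (u x)) ∧ hNorm s h < ⊤ := fun u hu => by
    obtain ⟨A, hA, hA'⟩ := exists_abs_le hs hu
    have hA1 : eLpNorm u ⊤ volume ≤ ENNReal.ofReal (max 1 A) :=
      hA'.trans (ENNReal.ofReal_le_ofReal (le_max_right _ _))
    obtain ⟨Q, hQ⟩ := appr (max 1 A) 1 (le_max_left _ _) one_pos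
    obtain ⟨q, q1, q2⟩ := (compCont_poly hs Q).exists_comp u hu
    obtain ⟨w, hw⟩ := exists_comp_of_abs_le (f := fun y => f y - y * Q.eval y) (u := u) (C := 1)
      hQ.contDiff.continuous (by
        filter_upwards [abs_le_of_eLpNorm_top (by positivity) hA1] with x hx
        exact hQ.abs_le hk (hx.trans (by have : 0 < max 1 A := by positivity
                                         nlinarith)))
    have hwq : ∀ᵐ x, (w + q) x = f (u x) := by
      filter_upwards [hw, q1, Lp.coeFn_add w q] with x e1 e2 e3
      rw [e3, Pi.add_apply, e1, e2]; ring
    refine ⟨w + q, hwq, (B.add_le _ _).trans_lt (ENNReal.add_lt_top.2 ⟨?_, q2⟩)⟩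
    exact (H _ _ 1 hQ u w hA1 hw).trans_lt (ENNReal.mul_lt_top (by simp) hu)
  refine ⟨ex, fun u₀ h₀ u h hu₀ hu e0 e Hu => ?_⟩
  set M := hNorm s u₀ + 1 with hM
  have hMtop : M < ⊤ := ENNReal.add_lt_top.2 ⟨hu₀, by simp⟩
  obtain ⟨C₁, hC₁, HS⟩ := exists_sobolev hs
  set A := max 1 (C₁ * M.toReal) with hA
  have hA1 : ∀ v : L2, hNorm s v ≤ M → eLpNorm v ⊤ volume ≤ ENNReal.ofReal A := fun v hv => by
    refine (HS v).trans ((mul_le_mul_right hv _).trans ?_)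
    rw [← ENNReal.ofReal_toReal hMtop.ne, ← ENNReal.ofReal_mul hC₁.le]
    exact ENNReal.ofReal_le_ofReal (le_max_right _ _)
  rw [ENNReal.tendsto_atTop_zero]
  intro ε hε
  rcases eq_or_ne ε ⊤ with rfl | hεt
  · exact ⟨0, fun n _ => le_top⟩
  set η : ℝ := (ε / 3 / (ENNReal.ofReal C * M)).toReal with hη
  have hM0 : M ≠ 0 := by rw [hM]; simp
  have hCM : ENNReal.ofReal C * M ≠ 0 := mul_ne_zero (by simpa using! hC) hM0
  have hCMt : ENNReal.ofReal C * M ≠ ⊤ := ENNReal.mul_ne_top (by simp) hMtop.ne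
  have hε3 : ε / 3 ≠ 0 := (ENNReal.div_pos hε.ne' (by simp)).ne'
  have hε3t : ε / 3 ≠ ⊤ := ENNReal.div_ne_top hεt (by simp)
  have hη0 : 0 < η := ENNReal.toReal_pos (ENNReal.div_pos hε3 hCMt).ne' (ENNReal.div_ne_top hε3t hCM)
  have hηM : ENNReal.ofReal (C * η) * M = ε / 3 := by
    rw [ENNReal.ofReal_mul hC.le, hη, ENNReal.ofReal_toReal (ENNReal.div_ne_top hε3t hCM),
      mul_right_comm, ENNReal.mul_div_cancel hCM hCMt]
  obtain ⟨Q, hQ⟩ := appr A η (le_max_left _ _) hη0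
  have hP := compCont_poly hs Q
  obtain ⟨q₀, q1, -⟩ := hP.exists_comp u₀ hu₀
  choose q q2 _ using fun n => hP.exists_comp (u n) (hu n)
  have tq := hP.tendsto u₀ q₀ u q hu₀ hu q1 q2 Hu
  have ev := (tendsto_hNorm_bdd Hu).and (tq.eventually_le_const (pos_iff_ne_zero.2 hε3))
  obtain ⟨N, hN⟩ := eventually_atTop.1 ev
  refine ⟨N, fun n hn => ?_⟩
  obtain ⟨n1, n2⟩ := hN n hn
  have d0 := dec u₀ h₀ Q A η hu₀ (hA1 u₀ (by rw [hM]; simp)) hQ e0 q₀ q1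
  have d1 := dec (u n) (h n) Q A η (hu n) (hA1 _ n1) hQ (e n) (q n) (q2 n)
  calc hNorm s (h n - h₀) = hNorm s ((h n - q n) + ((q n - q₀) - (h₀ - q₀))) := by congr 1; abel
    _ ≤ hNorm s (h n - q n) + (hNorm s (q n - q₀) + hNorm s (h₀ - q₀)) :=
      (B.add_le _ _).trans (add_le_add le_rfl (B.sub_le _ _))
    _ ≤ ε / 3 + (ε / 3 + ε / 3) := by
      gcongr
      · exact d1.trans ((mul_le_mul_right n1 _).trans hηM.le)
      · exact d0.trans ((mul_le_mul_right (by rw [hM]; simp) _).trans hηM.le)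
    _ = ε := by rw [← add_assoc, ENNReal.add_thirds]

end
end

section
open scoped ComplexConjugate

/-! ### The linear evolution -/

/-- The Fourier multiplier whose symbol is the even real function `m` of the frequency. -/
def BSym.ofEven (m : ℝ → ℝ) (hm : Measurable m) (he : ∀ x, m (-x) = m x)
    (hb : ∃ C, ∀ x, |m x| ≤ C) : BSym where
  toFun ξ := (m (2 * Real.pi * ξ) : ℝ)
  meas := Complex.measurable_ofReal.comp (hm.comp (measurable_const_mul _))
  herm ξ := by rw [mul_neg, he, Complex.conj_ofReal]
  bdd := by
    obtain ⟨C, hC⟩ := hb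
    exact ⟨C, fun ξ => by rw [Complex.norm_real]; exact hC _⟩

/-- The Fourier multiplier whose symbol is `i` times the odd real function `m` of the frequency. -/
def BSym.ofOdd (m : ℝ → ℝ) (hm : Measurable m) (he : ∀ x, m (-x) = -m x)
    (hb : ∃ C, ∀ x, |m x| ≤ C) : BSym where
  toFun ξ := Complex.I * (m (2 * Real.pi * ξ) : ℝ)
  meas := (Complex.measurable_ofReal.comp (hm.comp (measurable_const_mul _))).const_mul _
  herm ξ := by rw [mul_neg, he, map_mul, Complex.conj_ofReal, Complex.conj_I]; push_cast; ring
  bdd := by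
    obtain ⟨C, hC⟩ := hb
    exact ⟨C, fun ξ => by
      rw [norm_mul, Complex.norm_I, one_mul, Complex.norm_real]; exact hC _⟩

/-- The symbol of `L_D^{1/2} L_R^{-1/2}`. -/
def omg (α κ ζ : ℝ) : ℝ := rD α ζ / rR κ ζ

section
variable {α κ : ℝ}

lemma phi_neg (ζ : ℝ) : phi α κ (-ζ) = - phi α κ ζ := by
  simp only [phi, rD_neg, rR_neg]; ring
lemma sig_neg (ζ : ℝ) : sig α κ (-ζ) = - sig α κ ζ := by
  simp only [sig, rD_neg, rR_neg]; ring
lemma ampV_neg (ζ : ℝ) : ampV α κ (-ζ) = ampV α κ ζ := by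
  simp only [ampV, rD_neg, rR_neg, neg_sq]
lemma omg_neg (ζ : ℝ) : omg α κ (-ζ) = omg α κ ζ := by
  simp only [omg, rD_neg, rR_neg]
lemma continuous_omg (hκ : 0 ≤ κ) : Continuous (omg α κ) :=
  continuous_rD.div continuous_rR fun x => (rR_pos hκ x).ne'
lemma omg_pos (hα : 0 ≤ α) (hκ : 0 ≤ κ) (ζ : ℝ) : 0 < omg α κ ζ :=
  div_pos (rD_pos hα ζ) (rR_pos hκ ζ)

lemma omg_mul_le (h : Par α κ) : ∃ C : ℝ, 0 < C ∧ ∀ ζ, omg α κ ζ * √(1 + ζ ^ 2) ≤ C := by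
  obtain ⟨C, hC, H⟩ := rD_le h
  refine ⟨C, hC, fun ζ => ?_⟩
  rw [omg, div_mul_eq_mul_div, div_le_iff₀ (rR_pos h.nonneg.2 ζ)]
  exact H ζ

lemma omg_le (h : Par α κ) : ∃ C : ℝ, ∀ ζ, |omg α κ ζ| ≤ C := by
  obtain ⟨C, hC, H⟩ := omg_mul_le h
  refine ⟨C, fun ζ => ?_⟩
  have := omg_pos h.nonneg.1 h.nonneg.2 ζ
  rw [abs_of_pos this]
  refine le_trans ?_ (H ζ)
  exact le_mul_of_one_le_right this.le (Real.one_le_sqrt.2 (by nlinarith [sq_nonneg ζ]))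

lemma sqrt_jw (ξ : ℝ) : √(1 + (2 * Real.pi * ξ) ^ 2) = jw ξ ^ (1 / 2 : ℝ) := by
  rw [Real.sqrt_eq_rpow]; rfl

namespace Par
variable (h : Par α κ)

/-- The operator with symbol `i φ`. -/
def P : L2 →L[ℝ] L2 := (BSym.ofOdd (phi α κ) (continuous_phi h.nonneg.1 h.nonneg.2).measurable phi_neg
  (let ⟨C, _, H⟩ := abs_phi_le h; ⟨C, H⟩)).op
/-- The operator `∂ₓ (L_R L_D)^{-1/2}`. -/
def S : L2 →L[ℝ] L2 := (BSym.ofOdd (sig α κ) (continuous_sig h.nonneg.1 h.nonneg.2).measurable sig_neg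
  ⟨1, abs_sig_le h.nonneg.1 h.nonneg.2⟩).op
/-- The operator `(1 - ∂ₓ²)^{-1/2} L_R^{1/2} L_D^{-1/2}`. -/
def M : L2 →L[ℝ] L2 := (BSym.ofEven (ampV α κ) (continuous_ampV h.nonneg.1 h.nonneg.2).measurable
  ampV_neg (let ⟨C, _, H⟩ := ampV_le h
    ⟨C, fun x => by rw [abs_of_pos (ampV_nonneg h.nonneg.1 h.nonneg.2 x)]; exact H x⟩)).op
/-- The operator `L_D^{1/2} L_R^{-1/2}`. -/
def T : L2 →L[ℝ] L2 := (BSym.ofEven (omg α κ) (continuous_omg h.nonneg.2).measurable omg_neg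
  (omg_le h)).op

lemma ft_P (g : L2) : ∀ᵐ ξ, ft (h.P g) ξ = Complex.I * (phi α κ (2 * Real.pi * ξ) : ℝ) * ft g ξ :=
  BSym.ft_op _ g
lemma ft_S (g : L2) : ∀ᵐ ξ, ft (h.S g) ξ = Complex.I * (sig α κ (2 * Real.pi * ξ) : ℝ) * ft g ξ :=
  BSym.ft_op _ g
lemma ft_M (g : L2) : ∀ᵐ ξ, ft (h.M g) ξ = (ampV α κ (2 * Real.pi * ξ) : ℝ) * ft g ξ :=
  BSym.ft_op _ g
lemma ft_T (g : L2) : ∀ᵐ ξ, ft (h.T g) ξ = (omg α κ (2 * Real.pi * ξ) : ℝ) * ft g ξ :=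
  BSym.ft_op _ g

/-- The symbol of the linear evolution. -/
def evo (t : ℝ) : BSym where
  toFun ξ := Complex.exp (Complex.I * (t * phi α κ (2 * Real.pi * ξ) : ℝ))
  meas := by
    have := continuous_phi h.nonneg.1 h.nonneg.2
    exact Continuous.measurable (by fun_prop)
  herm ξ := by
    rw [mul_neg, phi_neg, ← Complex.exp_conj, map_mul, Complex.conj_ofReal, Complex.conj_I]
    push_cast; ring_nf
  bdd := ⟨1, fun ξ => by rw [mul_comm, Complex.norm_exp_ofReal_mul_I]⟩

/-- The linear evolution `exp (t P)`. -/
def U (t : ℝ) : L2 →L[ℝ] L2 := (h.evo t).op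

lemma ft_U (t : ℝ) (g : L2) : ∀ᵐ ξ, ft (h.U t g) ξ
    = Complex.exp (Complex.I * (t * phi α κ (2 * Real.pi * ξ) : ℝ)) * ft g ξ :=
  BSym.ft_op _ g

lemma norm_exp_phi (t : ℝ) (ξ : ℝ) :
    ‖Complex.exp (Complex.I * (t * phi α κ (2 * Real.pi * ξ) : ℝ))‖ = 1 := by
  rw [mul_comm, Complex.norm_exp_ofReal_mul_I]

lemma hNorm_U_le (s t : ℝ) (g : L2) : hNorm s (h.U t g) ≤ hNorm s g := by
  have := (h.evo t).hNorm_op_le' zero_le_one (fun ξ => (norm_exp_phi t ξ).le) s g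
  simpa using! this

lemma norm_U_le (t : ℝ) : ‖h.U t‖ ≤ 1 :=
  ContinuousLinearMap.opNorm_le_bound _ zero_le_one
    ((h.evo t).norm_op_le zero_le_one fun ξ => (norm_exp_phi t ξ).le)

lemma norm_U_apply_le (t : ℝ) (g : L2) : ‖h.U t g‖ ≤ ‖g‖ := by
  simpa using! (h.U t).le_of_opNorm_le (h.norm_U_le t) g

lemma U_zero (g : L2) : h.U 0 g = g := ft_ext (by
  filter_upwards [h.ft_U 0 g] with ξ hξ
  rw [hξ]; simp)

lemma U_add (t r : ℝ) (g : L2) : h.U (t + r) g = h.U t (h.U r g) := ft_ext (by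
  filter_upwards [h.ft_U (t + r) g, h.ft_U t (h.U r g), h.ft_U r g] with ξ h1 h2 h3
  rw [h1, h2, h3, ← mul_assoc, ← Complex.exp_add]
  congr 2; push_cast; ring)

lemma P_U (t : ℝ) (g : L2) : h.P (h.U t g) = h.U t (h.P g) := ft_ext (by
  filter_upwards [h.ft_P (h.U t g), h.ft_U t g, h.ft_U t (h.P g), h.ft_P g] with ξ h1 h2 h3 h4
  rw [h1, h2, h3, h4]; ring)

/-- The phase is bounded, so the second order Taylor remainder of the exponential is uniform in the
frequency. The group is differentiable in operator norm, and no domain questions arise. -/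
lemma hasDerivAt_U (t : ℝ) : HasDerivAt h.U (h.P ∘L h.U t) t := by
  obtain ⟨C, hC, hφ⟩ := abs_phi_le h
  rw [hasDerivAt_iff_isLittleO_nhds_zero]
  have hO : (fun r : ℝ => h.U (t + r) - h.U t - r • (h.P ∘L h.U t)) =O[𝓝 0] fun r : ℝ => r ^ 2 := by
    refine Asymptotics.IsBigO.of_bound (C ^ 2) ?_
    filter_upwards [Metric.ball_mem_nhds (0 : ℝ) (inv_pos.2 hC)] with r hr
    rw [Metric.mem_ball, Real.dist_eq, sub_zero, ← one_div, lt_div_iff₀ hC] at hr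
    refine ContinuousLinearMap.opNorm_le_bound _ (by positivity) fun g => ?_
    refine norm_le_of_ft (by positivity) ?_
    filter_upwards [h.ft_U (t + r) g, h.ft_U t g, h.ft_P (h.U t g),
      ft_sub_ae (h.U (t + r) g - h.U t g) (r • h.P (h.U t g)), ft_sub_ae (h.U (t + r) g) (h.U t g),
      ft_smul_ae r (h.P (h.U t g))] with ξ h1 h2 h3 h4 h5 h6
    have e : ft ((h.U (t + r) - h.U t - r • (h.P ∘L h.U t)) g) ξ
        = (Complex.exp (Complex.I * (r * phi α κ (2 * Real.pi * ξ) : ℝ)) - 1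
          - Complex.I * (r * phi α κ (2 * Real.pi * ξ) : ℝ))
          * (Complex.exp (Complex.I * (t * phi α κ (2 * Real.pi * ξ) : ℝ)) * ft g ξ) := by
      change ft (h.U (t + r) g - h.U t g - r • h.P (h.U t g)) ξ = _
      rw [h4, h5, h6, h1, h2, h3, h2, add_mul, Complex.ofReal_add, mul_add, Complex.exp_add]
      push_cast; ring
    have hle : ‖Complex.I * (r * phi α κ (2 * Real.pi * ξ) : ℝ)‖ ≤ |r| * C := by
      rw [norm_mul, Complex.norm_I, one_mul, Complex.norm_real, Real.norm_eq_abs, abs_mul]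
      gcongr; exact hφ _
    rw [e, norm_mul, norm_mul, norm_exp_phi, one_mul]
    gcongr
    refine (Complex.norm_exp_sub_one_sub_id_le (hle.trans hr.le)).trans ?_
    calc _ ≤ (|r| * C) ^ 2 := by gcongr
      _ = _ := by rw [mul_pow, mul_comm, Real.norm_of_nonneg (sq_nonneg r), sq_abs]
  exact hO.trans_isLittleO (by simpa using! Asymptotics.isLittleO_pow_id (𝕜 := ℝ) one_lt_two)

lemma continuous_U : Continuous h.U :=
  continuous_iff_continuousAt.2 fun t => (h.hasDerivAt_U t).continuousAt

/-- The dispersive estimate holds for regularity at most `2`, so it is used at `min s 2`. Negative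
times correspond to the other exponential, that is, to `c₁ = 0`, `c₂ = 1`. -/
lemma eLpNorm_U_le {m m' : ℝ → ℂ} (A : IsAmp m m') {s : ℝ} (hs : 1 / 2 < s) : ∃ C : ℝ, 0 < C ∧
    ∀ (t : ℝ) (g g₂ : L2), (∀ᵐ ξ : ℝ, ft g₂ ξ = m (2 * Real.pi * ξ) * ft g ξ) →
      eLpNorm (h.U t g₂) ⊤ volume ≤ ENNReal.ofReal (C * (1 + |t|) ^ (-decay (min s 2)))
        * (eLpNorm g 1 volume + hNorm s g₂) := by
  obtain ⟨C, hC, H⟩ := (isPhase_phi h).dispersive A (s := min s 2) (lt_min hs (by norm_num))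
    (min_le_right _ _)
  refine ⟨C, hC, fun t g g₂ hg => ?_⟩
  have hm : hNorm (min s 2) g₂ ≤ hNorm s g₂ := hNorm_mono (min_le_left _ _) g₂
  refine le_trans ?_ (mul_le_mul_right (add_le_add_right hm _) _)
  rcases le_total 0 t with ht | ht
  · rw [abs_of_nonneg ht]
    refine H 1 0 (by simp) (by simp) t ht g g₂ _ hg ?_
    filter_upwards [h.ft_U t g₂] with ξ hξ
    rw [hξ]; simp
  · rw [abs_of_nonpos ht]
    refine H 0 1 (by simp) (by simp) (-t) (by linarith) g g₂ _ hg ?_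
    filter_upwards [h.ft_U t g₂] with ξ hξ
    rw [hξ]; simp

/-- The decay of solutions of the linear equation. -/
theorem exists_decay {s : ℝ} (hs : 1 / 2 < s) : ∃ C : ℝ, 0 < C ∧ ∀ (t : ℝ) (g : L2),
    eLpNorm (h.U t g) ⊤ volume ≤ ENNReal.ofReal (C * (1 + |t|) ^ (-decay (min s 2)))
        * (eLpNorm g 1 volume + hNorm s g) ∧
    eLpNorm (h.U t (h.M g)) ⊤ volume ≤ ENNReal.ofReal (C * (1 + |t|) ^ (-decay (min s 2)))
        * (eLpNorm g 1 volume + hNorm s (h.M g)) ∧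
    eLpNorm (h.U t (h.S g)) ⊤ volume ≤ ENNReal.ofReal (C * (1 + |t|) ^ (-decay (min s 2)))
        * (eLpNorm g 1 volume + hNorm s (h.S g)) := by
  obtain ⟨m2, A2⟩ := isAmp_ampV h
  obtain ⟨m3, A3⟩ := isAmp_sig h
  obtain ⟨C1, h1, H1⟩ := h.eLpNorm_U_le isAmp_one hs
  obtain ⟨C2, h2, H2⟩ := h.eLpNorm_U_le A2 hs
  obtain ⟨C3, h3, H3⟩ := h.eLpNorm_U_le A3 hs
  refine ⟨C1 + C2 + C3, by positivity, fun t g => ⟨?_, ?_, ?_⟩⟩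
  · refine (H1 t g g (by simp)).trans ?_
    gcongr; linarith
  · refine (H2 t g (h.M g) (h.ft_M g)).trans ?_
    gcongr; linarith
  · refine (H3 t g (h.S g) (h.ft_S g)).trans ?_
    gcongr; linarith

lemma exists_hNorm_P_le (s : ℝ) : ∃ C : ℝ, 0 < C ∧ ∀ g, hNorm s (h.P g) ≤ ENNReal.ofReal C * hNorm s g := by
  obtain ⟨C, hC, H⟩ := abs_phi_le h
  refine ⟨C, hC, fun g => BSym.hNorm_op_le' _ hC.le (fun ξ => ?_) s g⟩
  change ‖Complex.I * (phi α κ (2 * Real.pi * ξ) : ℝ)‖ ≤ C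
  rw [norm_mul, Complex.norm_I, one_mul, Complex.norm_real]; exact H _

lemma hNorm_S_le (s : ℝ) (g : L2) : hNorm s (h.S g) ≤ hNorm s g := by
  have := BSym.hNorm_op_le' (BSym.ofOdd (sig α κ) (continuous_sig h.nonneg.1 h.nonneg.2).measurable
    sig_neg ⟨1, abs_sig_le h.nonneg.1 h.nonneg.2⟩) zero_le_one (fun ξ => by
      change ‖Complex.I * (sig α κ (2 * Real.pi * ξ) : ℝ)‖ ≤ 1
      rw [norm_mul, Complex.norm_I, one_mul, Complex.norm_real]
      exact abs_sig_le h.nonneg.1 h.nonneg.2 _) s g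
  simpa using! this

lemma exists_hNorm_S_le_of_pos (hα : 0 < α) (hκ : 0 < κ) : ∃ C : ℝ, 0 < C ∧ ∀ s g,
    hNorm s (h.S g) ≤ ENNReal.ofReal C * hNorm (s - 2) g := by
  obtain ⟨C, hC, H⟩ := abs_sig_mul_le hα hκ
  refine ⟨C, hC, fun s g => BSym.hNorm_op_le _ hC.le (fun ξ => ?_) g⟩
  change jw ξ ^ (s / 2) * ‖Complex.I * (sig α κ (2 * Real.pi * ξ) : ℝ)‖ ≤ _
  rw [norm_mul, Complex.norm_I, one_mul, Complex.norm_real, Real.norm_eq_abs,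
    show s / 2 = (s - 2) / 2 + 1 by ring, Real.rpow_add (jw_pos ξ), Real.rpow_one]
  have := H (2 * Real.pi * ξ)
  have h0 : 0 ≤ jw ξ ^ ((s - 2) / 2) := by have := jw_pos ξ; positivity
  calc jw ξ ^ ((s - 2) / 2) * jw ξ * |sig α κ (2 * Real.pi * ξ)|
      = jw ξ ^ ((s - 2) / 2) * (|sig α κ (2 * Real.pi * ξ)| * (1 + (2 * Real.pi * ξ) ^ 2)) := by
        unfold jw; ring
    _ ≤ jw ξ ^ ((s - 2) / 2) * C := by gcongr
    _ = _ := mul_comm _ _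

lemma exists_hNorm_T_le : ∃ C : ℝ, 0 < C ∧ ∀ s g,
    hNorm (s + 1) (h.T g) ≤ ENNReal.ofReal C * hNorm s g := by
  obtain ⟨C, hC, H⟩ := omg_mul_le h
  refine ⟨C, hC, fun s g => BSym.hNorm_op_le _ hC.le (fun ξ => ?_) g⟩
  change jw ξ ^ ((s + 1) / 2) * ‖((omg α κ (2 * Real.pi * ξ) : ℝ) : ℂ)‖ ≤ _
  have h1 := H (2 * Real.pi * ξ)
  rw [sqrt_jw] at h1
  have h0 : 0 ≤ jw ξ ^ (s / 2) := by have := jw_pos ξ; positivity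
  rw [Complex.norm_real, Real.norm_of_nonneg (omg_pos h.nonneg.1 h.nonneg.2 _).le,
    show (s + 1) / 2 = s / 2 + 1 / 2 by ring, Real.rpow_add (jw_pos ξ)]
  nlinarith

/-- The inverse of `L_D^{1/2} L_R^{-1/2}`, on `H^1`. -/
lemma exists_inv_T : ∃ C : ℝ, 0 < C ∧ ∀ v : L2, hNorm 1 v < ⊤ → ∃ z : L2, h.T z = v ∧
    ∀ s, hNorm s z ≤ ENNReal.ofReal C * hNorm (s + 1) v := by
  obtain ⟨C, hC, H⟩ := ampV_le h
  have hom := fun ζ => omg_pos h.nonneg.1 h.nonneg.2 ζ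
  have key : ∀ ξ : ℝ, (omg α κ (2 * Real.pi * ξ))⁻¹ ≤ C * jw ξ ^ (1 / 2 : ℝ) := fun ξ => by
    have h1 := H (2 * Real.pi * ξ)
    have ha := rD_pos h.nonneg.1 (2 * Real.pi * ξ)
    rw [ampV, div_le_iff₀ (by positivity)] at h1
    rw [omg, inv_div, div_le_iff₀ ha, ← sqrt_jw]
    linarith
  refine ⟨C, hC, fun v hv => ?_⟩
  have hcont : Continuous fun ξ : ℝ => (((omg α κ (2 * Real.pi * ξ))⁻¹ : ℝ) : ℂ) := by
    have := continuous_omg (α := α) h.nonneg.2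
    exact Complex.continuous_ofReal.comp (Continuous.inv₀ (by fun_prop) fun ξ => (hom _).ne')
  obtain ⟨z, hz⟩ := exists_mul (m := fun ξ => (((omg α κ (2 * Real.pi * ξ))⁻¹ : ℝ) : ℂ))
    (fun ξ => by rw [mul_neg, omg_neg, Complex.conj_ofReal]) v (by
      have hm : MemLp (fun ξ => ((jw ξ ^ ((1 : ℝ) / 2) : ℝ) : ℂ) * ft v ξ) 2 volume :=
        ⟨aesm_weight 1 v, by rw [← hNorm_eq]; exact hv⟩
      refine hm.of_le_mul (c := C) (hcont.aestronglyMeasurable.mul (aesm_ft v))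
        (Eventually.of_forall fun ξ => ?_)
      rw [norm_mul, norm_mul, ← mul_assoc, Complex.norm_real, Complex.norm_real,
        Real.norm_of_nonneg (inv_pos.2 (hom _)).le,
        Real.norm_of_nonneg (by have := jw_pos ξ; positivity)]
      gcongr
      exact key ξ)
  refine ⟨z, ft_ext ?_, fun s => hNorm_le_of_ae hC.le ?_⟩
  · filter_upwards [h.ft_T z, hz] with ξ h1 h2
    rw [h1, h2, ← mul_assoc, ← Complex.ofReal_mul, mul_inv_cancel₀ (hom _).ne', Complex.ofReal_one,
      one_mul]
  · filter_upwards [hz] with ξ h2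
    rw [h2, norm_mul, Complex.norm_real, Real.norm_of_nonneg (inv_pos.2 (hom _)).le,
      show (s + 1) / 2 = s / 2 + 1 / 2 by ring, Real.rpow_add (jw_pos ξ)]
    have h0 : 0 < jw ξ ^ (s / 2) := by have := jw_pos ξ; positivity
    calc jw ξ ^ (s / 2) * ((omg α κ (2 * Real.pi * ξ))⁻¹ * ‖ft v ξ‖)
        ≤ jw ξ ^ (s / 2) * ((C * jw ξ ^ (1 / 2 : ℝ)) * ‖ft v ξ‖) := by gcongr; exact key ξ
      _ = _ := by ring

lemma T_injective : Function.Injective h.T := fun a b hab => ft_ext (by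
  have hom := fun ζ => omg_pos h.nonneg.1 h.nonneg.2 ζ
  filter_upwards [h.ft_T a, h.ft_T b] with ξ h1 h2
  rw [hab, h2] at h1
  exact (mul_left_cancel₀ (by exact_mod_cast (hom _).ne') h1).symm)

end Par
end
end

section
/-! ### Estimates of the nonlinearity -/

lemma nonneg_of_abs_le {f : ℝ → ℝ} {B p : ℝ} (hfp : ∀ y : ℝ, |f y| ≤ B * |y| ^ (p + 1)) : 0 ≤ B := by
  have := (abs_nonneg _).trans (hfp 1); simpa using this

lemma map_zero_of_abs_le {f : ℝ → ℝ} {B p : ℝ} (hp : 0 < p)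
    (hfp : ∀ y : ℝ, |f y| ≤ B * |y| ^ (p + 1)) : f 0 = 0 := by
  have := hfp 0
  rw [abs_zero, Real.zero_rpow (by linarith), mul_zero] at this
  exact abs_nonpos_iff.1 this

lemma abs_le_mul_of_abs_le {f : ℝ → ℝ} {B p : ℝ} (hp : 0 < p)
    (hfp : ∀ y : ℝ, |f y| ≤ B * |y| ^ (p + 1)) {y A : ℝ} (hy : |y| ≤ A) :
    |f y| ≤ B * A ^ p * |y| := by
  have hB := nonneg_of_abs_le hfp
  rcases eq_or_ne y 0 with rfl | h0
  · simp [map_zero_of_abs_le hp hfp]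
  · have : 0 < |y| := abs_pos.2 h0
    refine (hfp y).trans ?_
    rw [Real.rpow_add_one this.ne', ← mul_assoc]
    gcongr

/-- By induction on `j` the Taylor polynomial of order `j` is a single monomial. It is `o(y^j)`
because `f = O(|y|^r)` with `r > j`, so its coefficient vanishes. -/
lemma iteratedDeriv_zero_of_isBigO (k : ℕ) {f : ℝ → ℝ} {r : ℝ} (hf : ContDiff ℝ k f)
    (hr : k < r) (hO : f =O[𝓝 0] fun y => |y| ^ r) : ∀ j, j ≤ k → iteratedDeriv j f 0 = 0 := by
  intro j
  induction j using Nat.strong_induction_on with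
  | _ j ih =>
    intro hj
    have hT := taylor_isLittleO_univ (x₀ := 0) (n := j) (hf.of_le (by exact_mod_cast hj))
    have hlo : f =o[𝓝 0] fun y : ℝ => y ^ j := by
      refine hO.trans_isLittleO ?_
      have hrj : (0 : ℝ) < r - j := by
        have : (j : ℝ) ≤ k := by exact_mod_cast hj
        linarith
      refine Asymptotics.IsLittleO.of_norm_right ?_
      have e : (fun y : ℝ => |y| ^ r) =ᶠ[𝓝 0] fun y => |y| ^ (r - j) * ‖y ^ j‖ := by
        refine Eventually.of_forall fun y => ?_
        have h1 : r = (r - j) + j := by ring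
        change |y| ^ r = |y| ^ (r - j) * ‖y ^ j‖
        rw [norm_pow, Real.norm_eq_abs]
        rcases eq_or_ne y 0 with rfl | h0
        · have h2 : r ≠ 0 := by
            have : (0 : ℝ) ≤ k := by positivity
            linarith
          simp [Real.zero_rpow h2, Real.zero_rpow hrj.ne']
        · nth_rw 1 [h1]
          rw [Real.rpow_add (abs_pos.2 h0), Real.rpow_natCast]
      refine e.trans_isLittleO ?_
      have h0 : Tendsto (fun y : ℝ => |y| ^ (r - j)) (𝓝 0) (𝓝 0) := by
        have : Continuous fun y : ℝ => |y| ^ (r - j) :=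
          (Real.continuous_rpow_const hrj.le).comp continuous_abs
        simpa [Real.zero_rpow hrj.ne'] using this.tendsto 0
      simpa using ((Asymptotics.isLittleO_one_iff ℝ).2 h0).mul_isBigO
        (Asymptotics.isBigO_refl (fun y : ℝ => ‖y ^ j‖) (𝓝 0))
    have hpoly : ∀ y, taylorWithinEval f j Set.univ 0 y
        = (iteratedDeriv j f 0 / j.factorial) * y ^ j := by
      intro y
      rw [taylor_within_apply, Finset.sum_range_succ, Finset.sum_eq_zero, zero_add]
      · rw [iteratedDerivWithin_univ, sub_zero, smul_eq_mul]; ring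
      · intro i hi
        have hi' := Finset.mem_range.1 hi
        rw [iteratedDerivWithin_univ, ih i hi' (by omega), smul_zero]
    have hlo2 : (fun y : ℝ => (iteratedDeriv j f 0 / j.factorial) * y ^ j)
        =o[𝓝 0] fun y : ℝ => y ^ j := by
      have := hlo.sub (by simpa using hT)
      simpa [hpoly] using this
    by_contra hne
    have hc : iteratedDeriv j f 0 / j.factorial ≠ 0 := by positivity
    have h3 := (Asymptotics.isLittleO_const_mul_left_iff hc).1 hlo2
    have h4 : (fun y : ℝ => y ^ j) =o[𝓝[≠] 0] fun y : ℝ => y ^ j := h3.mono nhdsWithin_le_nhds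
    refine (Asymptotics.isLittleO_irrefl ?_) h4
    refine (eventually_mem_nhdsWithin.mono fun y hy => ?_).frequently
    exact pow_ne_zero _ hy

/-- The `k`-th derivative is merely bounded; integrating downwards from the vanishing values at `0`
gains one power of `|y|` each time. Without further assumptions on the derivatives this is the only
smallness they provide. -/
lemma exists_iteratedDeriv_bound (k : ℕ) {f : ℝ → ℝ} {r : ℝ} (hf : ContDiff ℝ k f)
    (hr : k < r) (hO : f =O[𝓝 0] fun y => |y| ^ r) : ∃ G : ℝ, 0 < G ∧ ∀ j, j ≤ k → ∀ y, |y| ≤ 1 →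
      |iteratedDeriv j f y| ≤ G * |y| ^ (k - j) := by
  have h0 := iteratedDeriv_zero_of_isBigO k hf hr hO
  obtain ⟨G, hG⟩ := (isCompact_Icc (a := (-1 : ℝ)) (b := 1)).exists_bound_of_continuousOn
    (f := iteratedDeriv k f) (hf.continuous_iteratedDeriv k le_rfl).continuousOn
  have key : ∀ i, i ≤ k → ∀ y, |y| ≤ 1 → |iteratedDeriv (k - i) f y| ≤ (|G| + 1) * |y| ^ i := by
    intro i
    induction i with
    | zero =>
      intro _ y hy
      have := hG y (abs_le.1 hy)
      rw [Nat.sub_zero, pow_zero, mul_one]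
      exact this.trans ((le_abs_self G).trans (by linarith))
    | succ i ih =>
      intro hi y hy
      have e : k - i = k - (i + 1) + 1 := by omega
      have hd : Differentiable ℝ (iteratedDeriv (k - (i + 1)) f) :=
        hf.differentiable_iteratedDeriv _ (by exact_mod_cast (by omega : k - (i + 1) < k))
      have := (convex_Icc (-|y|) |y|).norm_image_sub_le_of_norm_deriv_le
        (f := iteratedDeriv (k - (i + 1)) f) (C := (|G| + 1) * |y| ^ i) (x := 0) (y := y)
        (fun x _ => hd x) (fun x hx => by
          rw [← iteratedDeriv_succ, ← e]
          have hx' : |x| ≤ |y| := abs_le.2 hx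
          refine (ih (by omega) x (hx'.trans hy)).trans ?_
          gcongr) (by constructor <;> simp) (abs_le.1 le_rfl)
      rw [h0 _ (by omega), sub_zero, sub_zero] at this
      rw [pow_succ, ← mul_assoc]; exact this
  refine ⟨|G| + 1, by positivity, fun j hj y hy => ?_⟩
  have := key (k - j) (by omega) y hy
  rwa [Nat.sub_sub_self hj] at this

/-- All the arithmetic of the exponents, from `ℓ ≥ 7`. The rate `decay` has the denominator `2s + 5`
instead of `2s + ℓ - 1`, which leaves room for `(p - 1) decay > 1`. The loss of one power comes from
the `L¹` bound of `f(u)`. -/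
lemma mu_facts {α κ s p : ℝ} (hs : 1 / 2 < s) (hμ : 1 < p * mu α κ s) :
    0 < mu α κ s ∧ 6 < p ∧ 2 * s + 6 < p ∧ mu α κ s ≤ decay (min s 2) ∧
      1 < (p - 1) * decay (min s 2) ∧ (2 ≤ s → decay (min s 2) = 1 / 6) := by
  have hl : 7 ≤ ell α κ := by unfold ell; split_ifs <;> norm_num
  have h2s : 0 < 2 * s + ell α κ - 1 := by linarith
  by_cases h32 : 3 / 2 ≤ s
  · have hm : mu α κ s = 1 / (2 * s + ell α κ - 1) := by rw [mu, if_pos h32]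
    rw [hm, mul_one_div, lt_div_iff₀ h2s, one_mul] at hμ
    have hd : ∀ s' : ℝ, 3 / 2 ≤ s' → 1 / 8 ≤ decay s' := fun s' hs' => by
      rw [decay, div_le_div_iff₀ (by norm_num) (by linarith)]; linarith
    have h8 := hd (min s 2) (le_min h32 (by norm_num))
    refine ⟨by rw [hm]; positivity, by linarith, by linarith, ?_, ?_, fun h2 => ?_⟩
    · rw [hm, div_le_iff₀ h2s]; nlinarith
    · nlinarith
    · rw [min_eq_right h2, decay]; norm_num
  · push Not at h32
    have hm : mu α κ s = (2 * s - 1) / (2 * (2 * s + ell α κ - 1)) := by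
      rw [mu, if_neg (by linarith)]
    have hn : 0 < 2 * s - 1 := by linarith
    have hmin : min s 2 = s := min_eq_left (by linarith)
    rw [hm, ← mul_div_assoc, lt_div_iff₀ (by linarith), one_mul] at hμ
    have hp : 2 * s + 6 < p := by nlinarith
    refine ⟨by rw [hm]; positivity, by linarith, hp, ?_, ?_, fun h2 => by linarith⟩
    · rw [hmin, hm, decay]; gcongr; linarith
    · rw [hmin, decay, ← mul_div_assoc, lt_div_iff₀ (by linarith)]; nlinarith

/-- With `x = jw ^ (s/2)`, the weight on the left is `x^{1-2/s}`. It is at most `T^{-2/s} x` where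
`x ≥ T`, and at most `T^{1-2/s}` elsewhere. -/
lemma hNorm_interpolate {s T : ℝ} (hs : 2 < s) (hT : 0 < T) (g : L2) :
    hNorm (s - 2) g ≤ ENNReal.ofReal (T ^ (-(2 / s))) * hNorm s g
      + ENNReal.ofReal (T ^ (1 - 2 / s)) * ‖g‖ₑ := by
  rw [← hNorm_zero, hNorm_eq, hNorm_eq, hNorm_eq]
  have e : ∀ (c : ℝ) (r : ℝ), 0 ≤ c → ENNReal.ofReal c
      * eLpNorm (fun ξ => ((jw ξ ^ (r / 2) : ℝ) : ℂ) * ft g ξ) 2 volume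
      = eLpNorm (fun ξ => ((c * (jw ξ ^ (r / 2) * ‖ft g ξ‖) : ℝ))) 2 volume := by
    intro c r hc
    have : (fun ξ => ((c * (jw ξ ^ (r / 2) * ‖ft g ξ‖) : ℝ)))
        = c • fun ξ => ‖((jw ξ ^ (r / 2) : ℝ) : ℂ) * ft g ξ‖ := by
      ext ξ
      have := jw_pos ξ
      rw [Pi.smul_apply, smul_eq_mul, norm_mul, Complex.norm_real,
        Real.norm_of_nonneg (by positivity)]
    rw [this, eLpNorm_const_smul, eLpNorm_norm, ← ofReal_norm, Real.norm_of_nonneg hc]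
  have meas : ∀ c r : ℝ, AEStronglyMeasurable
      (fun ξ => ((c * (jw ξ ^ (r / 2) * ‖ft g ξ‖) : ℝ))) volume := fun c r =>
    (((continuous_jw_rpow (r / 2)).aestronglyMeasurable).mul (aesm_ft g).norm).const_mul c
  rw [e _ _ (by positivity), e _ _ (by positivity)]
  refine le_trans (eLpNorm_mono_real fun ξ => ?_) (eLpNorm_add_le (meas _ _) (meas _ _) (by norm_num))
  have hj := jw_pos ξ
  rw [norm_mul, Complex.norm_real, Real.norm_of_nonneg (by positivity), Pi.add_apply, ← mul_assoc,
    ← mul_assoc, ← add_mul]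
  refine mul_le_mul_of_nonneg_right ?_ (norm_nonneg _)
  rw [zero_div, Real.rpow_zero, mul_one]
  set x := jw ξ ^ (s / 2) with hx
  have hxp : 0 < x := by positivity
  have e2 : jw ξ ^ ((s - 2) / 2) = x ^ (1 - 2 / s) := by
    rw [hx, ← Real.rpow_mul hj.le]; congr 1; field_simp
  have h2s : 2 / s < 1 := by rw [div_lt_one (by linarith)]; exact hs
  rw [e2]
  rcases le_total T x with hTx | hTx
  · have : x ^ (1 - 2 / s) ≤ T ^ (-(2 / s)) * x := by
      rw [sub_eq_add_neg, add_comm, Real.rpow_add_one hxp.ne']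
      gcongr ?_ * _
      exact Real.rpow_le_rpow_of_nonpos hT hTx (by
        have : 0 < 2 / s := by positivity
        linarith)
    have h3 : 0 ≤ T ^ (1 - 2 / s) := by positivity
    linarith
  · have : x ^ (1 - 2 / s) ≤ T ^ (1 - 2 / s) := by gcongr
    have h3 : 0 ≤ T ^ (-(2 / s)) * x := by positivity
    linarith

section
variable {α κ s p B : ℝ} {f : ℝ → ℝ}

lemma eLpNorm_one_le {u w : L2} {C : ℝ} (h : ∀ᵐ x, |w x| ≤ C * |u x| ^ 2) :
    eLpNorm w 1 volume ≤ ENNReal.ofReal C * ‖u‖ₑ ^ 2 := by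
  rw [eLpNorm_one_eq_lintegral_enorm, Lp.enorm_def,
    eLpNorm_eq_lintegral_rpow_enorm_toReal (by norm_num) (by norm_num)]
  simp only [ENNReal.toReal_ofNat, ENNReal.rpow_ofNat]
  rw [← ENNReal.rpow_natCast (_ ^ _), ← ENNReal.rpow_mul]
  norm_num
  rw [← lintegral_const_mul'' _ ((Lp.aestronglyMeasurable u).enorm.pow_const 2)]
  refine lintegral_mono_ae ?_
  filter_upwards [h] with x hx
  rcases le_or_gt 0 C with hC | hC
  · rw [← ofReal_norm, ← ofReal_norm, ← ENNReal.ofReal_pow (norm_nonneg _),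
      ← ENNReal.ofReal_mul hC]
    exact ENNReal.ofReal_le_ofReal hx
  · have : |w x| ≤ 0 := hx.trans (by nlinarith [sq_nonneg |u x|])
    rw [abs_nonpos_iff.1 this]; simp

/-- The power of the amplitude gained by the nonlinearity beats the linear decay. -/
structure SmallNonlin (h : Par α κ) (s : ℝ) (f : ℝ → ℝ) (q C A₀ : ℝ) : Prop where
  pos_C : 0 < C
  pos_A : 0 < A₀
  bound : ∀ A, 0 < A → A ≤ A₀ → ∀ u w : L2, eLpNorm u ⊤ volume ≤ ENNReal.ofReal A →
    (∀ᵐ x, w x = f (u x)) → hNorm s (h.S w) ≤ ENNReal.ofReal (C * A ^ q) * hNorm s u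

lemma SmallNonlin.mono {h : Par α κ} {q q' C A₀ : ℝ} (H : SmallNonlin h s f q C A₀) (hq : q' ≤ q) :
    SmallNonlin h s f q' C (min A₀ 1) where
  pos_C := H.pos_C
  pos_A := lt_min H.pos_A one_pos
  bound A hA hA' u w hu hw := by
    refine (H.bound A hA (hA'.trans (min_le_left _ _)) u w hu hw).trans ?_
    have hA1 := hA'.trans (min_le_right _ _)
    have := H.pos_C
    gcongr ENNReal.ofReal (C * ?_) * _
    exact Real.rpow_le_rpow_of_exponent_ge hA hA1 hq

lemma enorm_comp_le (hp : 0 < p) (hfp : ∀ y : ℝ, |f y| ≤ B * |y| ^ (p + 1)) {A : ℝ} (hA : 0 < A)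
    {u w : L2} (hu : eLpNorm u ⊤ volume ≤ ENNReal.ofReal A) (hw : ∀ᵐ x, w x = f (u x)) :
    ‖w‖ₑ ≤ ENNReal.ofReal (B * A ^ p) * ‖u‖ₑ := by
  refine enorm_le_of_ae ?_
  filter_upwards [hw, abs_le_of_eLpNorm_top hA.le hu] with x h1 h2
  rw [h1]; exact abs_le_mul_of_abs_le hp hfp h2

/-- The case `α = κ = 0`, where the forcing has the regularity of the nonlinearity. -/
lemma smallNonlin_of_isBigO (h : Par α κ) (hs : 0 < s) (hp : (⌈s⌉₊ : ℝ) ≤ p + 1)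
    (hf : ContDiff ℝ (⌈s⌉₊ : ℕ) f) (hf0 : f 0 = 0)
    (hO : ∀ j : ℕ, 1 ≤ j → j ≤ ⌈s⌉₊ →
        (iteratedDeriv j f) =O[𝓝 0] (fun y : ℝ => |y| ^ (p + 1 - j))) :
    ∃ C A₀, SmallNonlin h s f p C A₀ := by
  obtain ⟨C, K, hC, hK, H⟩ := exists_moser hs (Nat.le_ceil s)
  choose! c hc using fun j h1 h2 => (hO j h1 h2).exists_pos
  have hev : ∀ᶠ y in 𝓝 (0 : ℝ), ∀ j ∈ Finset.Icc 1 ⌈s⌉₊,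
      ‖iteratedDeriv j f y‖ ≤ c j * ‖|y| ^ (p + 1 - j)‖ := by
    rw [Filter.eventually_all_finset]
    intro j hj
    rw [Finset.mem_Icc] at hj
    exact (hc j hj.1 hj.2).2.bound
  obtain ⟨r, hr, hev⟩ := Metric.eventually_nhds_iff_ball.1 hev
  set G := ∑ j ∈ Finset.Icc 1 ⌈s⌉₊, c j * K ^ (p + 1 - j) with hG
  have hterm : ∀ j ∈ Finset.Icc 1 ⌈s⌉₊, 0 ≤ c j * K ^ (p + 1 - j) := fun j hj => by
    rw [Finset.mem_Icc] at hj
    have := (hc j hj.1 hj.2).1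
    positivity
  have hG0 : 0 ≤ G := Finset.sum_nonneg hterm
  refine ⟨C * (G + 1), r / (2 * K), by positivity, by positivity, fun A hA hA' u w hu hw => ?_⟩
  have hKA : K * A < r := by
    rw [le_div_iff₀ (by positivity)] at hA'; nlinarith
  have hM : MoserBound ⌈s⌉₊ K f A ((G + 1) * A ^ p) :=
    { contDiff := hf
      zero := hf0
      pos := hA
      nonneg := by positivity
      bound := fun j h1 h2 y hy => by
        have hj : j ∈ Finset.Icc 1 ⌈s⌉₊ := Finset.mem_Icc.2 ⟨h1, h2⟩
        have hb := hev y (by rw [Metric.mem_ball, Real.dist_eq, sub_zero]; linarith) j hj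
        have hjp : 0 ≤ p + 1 - j := by
          have : (j : ℝ) ≤ (⌈s⌉₊ : ℕ) := by exact_mod_cast h2
          linarith
        have hcj := (hc j h1 h2).1
        rw [Real.norm_eq_abs, Real.norm_of_nonneg (by positivity)] at hb
        calc |iteratedDeriv j f y| * A ^ j ≤ (c j * (K * A) ^ (p + 1 - j)) * A ^ j := by
              gcongr; exact hb.trans (by gcongr)
          _ = (c j * K ^ (p + 1 - j)) * (A ^ (p + 1 - j) * A ^ (j : ℝ)) := by
              rw [Real.mul_rpow (by positivity) hA.le, Real.rpow_natCast]; ring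
          _ = (c j * K ^ (p + 1 - j)) * (A ^ p * A) := by
              rw [← Real.rpow_add hA, ← Real.rpow_add_one hA.ne']; congr 2; ring
          _ ≤ G * (A ^ p * A) := by
              gcongr; exact Finset.single_le_sum hterm hj
          _ ≤ _ := by
              have : 0 ≤ A ^ p * A := by positivity
              nlinarith }
  refine (h.hNorm_S_le s w).trans ((H f A _ hM u w hu hw).trans (le_of_eq ?_))
  rw [mul_assoc]

/-- The case `α, κ > 0` and `s ≤ 2`. -/
lemma smallNonlin_of_le_two (h : Par α κ) (hα : 0 < α) (hκ : 0 < κ) (hs : 0 < s) (hs2 : s ≤ 2)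
    (hp : 0 < p) (hfp : ∀ y : ℝ, |f y| ≤ B * |y| ^ (p + 1)) :
    ∃ C A₀, SmallNonlin h s f p C A₀ := by
  obtain ⟨C, hC, H⟩ := h.exists_hNorm_S_le_of_pos hα hκ
  have hB := nonneg_of_abs_le hfp
  refine ⟨C * (B + 1), 1, by positivity, one_pos, fun A hA _ u w hu hw => ?_⟩
  have h1 : hNorm (s - 2) w ≤ ‖w‖ₑ := by rw [← hNorm_zero]; exact hNorm_mono (by linarith) w
  calc hNorm s (h.S w) ≤ ENNReal.ofReal C * (ENNReal.ofReal ((B + 1) * A ^ p) * hNorm s u) := by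
        refine (H s w).trans (mul_le_mul_right (h1.trans ?_) _)
        refine (enorm_comp_le hp hfp hA hu hw).trans ?_
        gcongr
        · linarith
        · exact enorm_le_hNorm hs.le u
    _ = _ := by rw [← mul_assoc, ← ENNReal.ofReal_mul hC.le, mul_assoc C]

/-- The case `α, κ > 0` and `s > 2`. -/
lemma smallNonlin_of_two_lt (h : Par α κ) (hα : 0 < α) (hκ : 0 < κ) (hs2 : 2 < s)
    (hp : (⌈s⌉₊ : ℝ) < p + 1) (hf : ContDiff ℝ (⌈s⌉₊ : ℕ) f)
    (hfp : ∀ y : ℝ, |f y| ≤ B * |y| ^ (p + 1)) :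
    ∃ C A₀, SmallNonlin h s f (2 / s * p + (1 - 2 / s) * (⌈s⌉₊ - 1)) C A₀ := by
  set k := ⌈s⌉₊ with hk
  have hsk : s ≤ k := Nat.le_ceil s
  have hk1 : 1 ≤ k := by
    have : (1 : ℝ) ≤ k := by linarith
    exact_mod_cast this
  have hp0 : 0 < p := by linarith
  obtain ⟨C, hC, H⟩ := h.exists_hNorm_S_le_of_pos hα hκ
  obtain ⟨C', K, hC', hK, H'⟩ := exists_moser (by linarith) hsk
  have hB := nonneg_of_abs_le hfp
  obtain ⟨G, hG, HG⟩ := exists_iteratedDeriv_bound k hf hp (Asymptotics.IsBigO.of_bound B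
    (Eventually.of_forall fun y => by
      rw [Real.norm_eq_abs, Real.norm_of_nonneg (by positivity)]; exact hfp y))
  -- Moser's estimate only yields the power `A^{k-1}`, the `L²` estimate the power `A^p`. The
  -- interpolation parameter `T = A^{k-1-p}` below equalises the two contributions and produces the
  -- exponent of `A` in the statement.
  set D := C' * (G * K ^ k) with hD
  refine ⟨C * (D + B), 1 / K, by positivity, by positivity, fun A hA hA' u w hu hw => ?_⟩
  have hKA : K * A ≤ 1 := by
    rw [le_div_iff₀ (by positivity)] at hA'; linarith
  have hM : MoserBound k K f A (G * K ^ k * A ^ (k - 1)) :=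
    { contDiff := hf
      zero := map_zero_of_abs_le hp0 hfp
      pos := hA
      nonneg := by positivity
      bound := fun j h1 h2 y hy => by
        calc |iteratedDeriv j f y| * A ^ j ≤ (G * (K * A) ^ (k - j)) * A ^ j := by
              gcongr; exact (HG j h2 y (hy.trans hKA)).trans (by gcongr)
          _ = G * K ^ (k - j) * (A ^ (k - j) * A ^ j) := by rw [mul_pow]; ring
          _ = G * K ^ (k - j) * (A ^ (k - 1) * A) := by
              rw [← pow_add, ← pow_succ]; congr 2; omega
          _ ≤ G * K ^ k * (A ^ (k - 1) * A) := by
              gcongr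
              omega
          _ = _ := by ring }
  have h1 := H' f A _ hM u w hu hw
  have h2 : ‖w‖ₑ ≤ ENNReal.ofReal (B * A ^ p) * hNorm s u :=
    (enorm_comp_le hp0 hfp hA hu hw).trans
      (mul_le_mul_right (enorm_le_hNorm (by linarith) u) _)
  set q := 2 / s * p + (1 - 2 / s) * ((k : ℝ) - 1) with hq
  set T := A ^ ((k : ℝ) - 1 - p) with hT
  have hTp : 0 < T := by positivity
  have e1 : T ^ (-(2 / s)) * (C' * (G * K ^ k * A ^ (k - 1))) = D * A ^ q := by
    rw [hT, ← Real.rpow_mul hA.le, ← Real.rpow_natCast A (k - 1), Nat.cast_sub hk1, Nat.cast_one]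
    have : A ^ q = A ^ (((k : ℝ) - 1 - p) * -(2 / s)) * A ^ ((k : ℝ) - 1) := by
      rw [← Real.rpow_add hA]; congr 1; rw [hq]; ring
    rw [this]; ring
  have e2 : T ^ (1 - 2 / s) * (B * A ^ p) = B * A ^ q := by
    rw [hT, ← Real.rpow_mul hA.le]
    have : A ^ q = A ^ (((k : ℝ) - 1 - p) * (1 - 2 / s)) * A ^ p := by
      rw [← Real.rpow_add hA]; congr 1; rw [hq]; ring
    rw [this]; ring
  calc hNorm s (h.S w) ≤ ENNReal.ofReal C * (ENNReal.ofReal (D * A ^ q) * hNorm s u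
        + ENNReal.ofReal (B * A ^ q) * hNorm s u) := by
        refine (H s w).trans (mul_le_mul_right ((hNorm_interpolate hs2 hTp w).trans ?_) _)
        rw [← e1, ← e2, ENNReal.ofReal_mul (by positivity),
          ENNReal.ofReal_mul (p := T ^ (1 - 2 / s)) (by positivity), mul_assoc (ENNReal.ofReal _),
          mul_assoc (ENNReal.ofReal _)]
        exact add_le_add (mul_le_mul_right h1 _) (mul_le_mul_right h2 _)
    _ = _ := by
        rw [← add_mul, ← ENNReal.ofReal_add (by positivity) (by positivity), ← add_mul,
          ← mul_assoc, ← ENNReal.ofReal_mul hC.le, mul_assoc C]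

/-- When the full power `p` is available, `q = p - 1` already satisfies `q · decay > 1`. For `s > 2`
with `α, κ > 0` the decay rate is `1/6`, and `p > 2s + 6` makes the interpolated exponent exceed `s
+ 1 + 14/s ≥ 6`. The cap `q ≤ p - 1` allows one exponent to serve both the `H^s` and the `L¹` bound.
-/
theorem exists_smallNonlin {m : ℕ} (h : Par α κ) (hs : 1 / 2 < s) (hsm : s ≤ m)
    (hf : ContDiff ℝ m f) (hfp : ∀ y : ℝ, |f y| ≤ B * |y| ^ (p + 1)) (hμ : 1 < p * mu α κ s)
    (hpar : (0 < α ∧ 0 < κ) ∨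
      (α = 0 ∧ κ = 0 ∧ ∀ j : ℕ, 1 ≤ j → j ≤ ⌈s⌉₊ →
        (iteratedDeriv j f) =O[𝓝 0] (fun y : ℝ => |y| ^ (p + 1 - j)))) :
    ∃ q C A₀ : ℝ, 0 < q ∧ q ≤ p - 1 ∧ 1 < q * decay (min s 2) ∧ A₀ ≤ 1 ∧
      SmallNonlin h s f q C A₀ := by
  obtain ⟨h0, hp6, hps, h1, h2, h3⟩ := mu_facts hs hμ
  have hceil : (⌈s⌉₊ : ℝ) < p + 1 := by
    have := Nat.ceil_lt_add_one (a := s) (by linarith)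
    linarith
  have hf' : ContDiff ℝ (⌈s⌉₊ : ℕ) f := hf.of_le (by exact_mod_cast Nat.ceil_le.2 hsm)
  have of_p : (∃ C A₀, SmallNonlin h s f p C A₀) → ∃ q C A₀ : ℝ, 0 < q ∧ q ≤ p - 1 ∧
      1 < q * decay (min s 2) ∧ A₀ ≤ 1 ∧ SmallNonlin h s f q C A₀ := by
    rintro ⟨C, A₀, H⟩
    exact ⟨p - 1, C, _, by linarith, le_rfl, h2, min_le_right _ _, H.mono (by linarith)⟩
  rcases hpar with ⟨hα, hκ⟩ | ⟨hα, hκ, hO⟩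
  · rcases le_or_gt s 2 with hs2 | hs2
    · exact of_p (smallNonlin_of_le_two h hα hκ (by linarith) hs2 (by linarith) hfp)
    · obtain ⟨C, A₀, H⟩ := smallNonlin_of_two_lt h hα hκ hs2 hceil hf' hfp
      set q := 2 / s * p + (1 - 2 / s) * ((⌈s⌉₊ : ℝ) - 1) with hq
      have hq6 : 6 < q := by
        have hc := Nat.le_ceil s
        have h4 : 2 / s < 1 := by rw [div_lt_one (by linarith)]; exact hs2
        have h5 : 2 / s * (2 * s + 6) < 2 / s * p := by gcongr
        have h6 : (1 - 2 / s) * (s - 1) ≤ (1 - 2 / s) * ((⌈s⌉₊ : ℝ) - 1) := by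
          gcongr
        have h7 : 6 ≤ 2 / s * (2 * s + 6) + (1 - 2 / s) * (s - 1) := by
          have : 2 / s * (2 * s + 6) + (1 - 2 / s) * (s - 1) = s + 1 + 14 / s := by
            field_simp; ring
          rw [this]
          have : 5 ≤ s + 14 / s := by
            rw [← sub_nonneg, show s + 14 / s - 5 = (s ^ 2 - 5 * s + 14) / s by field_simp; ring]
            refine div_nonneg ?_ (by linarith)
            nlinarith [sq_nonneg (s - 5 / 2)]
          linarith
        linarith
      refine ⟨min q (p - 1), C, _, lt_min (by linarith) (by linarith), min_le_right _ _, ?_,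
        min_le_right _ _, H.mono (min_le_left _ _)⟩
      have h7 : 6 < min q (p - 1) := lt_min hq6 (by linarith)
      rw [h3 hs2.le]; linarith
  · exact of_p (smallNonlin_of_isBigO h (by linarith) hceil.le hf'
      (map_zero_of_abs_le (by linarith) hfp) hO)

/-- Two of the `p + 1` powers of `u` are integrated by the `L²` norm; the other `p - 1` are bounded
by the amplitude. -/
lemma eLpNorm_one_comp_le (hp : 1 ≤ p) {q : ℝ} (hq : q ≤ p - 1)
    (hfp : ∀ y : ℝ, |f y| ≤ B * |y| ^ (p + 1)) {A : ℝ} (hA : 0 < A) (hA1 : A ≤ 1)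
    {u w : L2} (hu : eLpNorm u ⊤ volume ≤ ENNReal.ofReal A) (hw : ∀ᵐ x, w x = f (u x)) :
    eLpNorm w 1 volume ≤ ENNReal.ofReal (B * A ^ q) * ‖u‖ₑ ^ 2 := by
  have hB := nonneg_of_abs_le hfp
  have hp0 : 0 < p := by linarith
  refine eLpNorm_one_le ?_
  filter_upwards [hw, abs_le_of_eLpNorm_top hA.le hu] with x h1 h2
  rw [h1]
  rcases eq_or_ne (u x) 0 with h0 | h0
  · simp [h0, map_zero_of_abs_le hp0 hfp]
  · have hpos : 0 < |u x| := abs_pos.2 h0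
    calc |f (u x)| ≤ B * |u x| ^ (p + 1) := hfp _
      _ = B * |u x| ^ (p - 1) * |u x| ^ 2 := by
          rw [mul_assoc, ← Real.rpow_natCast, ← Real.rpow_add hpos]; congr 2; push_cast; ring
      _ ≤ B * A ^ q * |u x| ^ 2 := by
          gcongr
          calc |u x| ^ (p - 1) ≤ A ^ (p - 1) := by gcongr
            _ ≤ A ^ q := Real.rpow_le_rpow_of_exponent_ge hA hA1 hq

end
end

section
open scoped BoundedContinuousFunction

/-! ### Duhamel's formula and the global solution -/

lemma integral_exp_mul_le {c : ℝ} (hc : 0 < c) (t : ℝ) :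
    ∫ τ in (0 : ℝ)..t, Real.exp (c * τ) ≤ Real.exp (c * t) / c := by
  rw [intervalIntegral.integral_comp_mul_left (fun x => Real.exp x) hc.ne', integral_exp, mul_zero,
    Real.exp_zero, smul_eq_mul, div_eq_inv_mul]
  gcongr; linarith

/-- A fixed point theorem for Volterra type maps on curves. -/
theorem exists_fixed_curve {E : Type*} [NormedAddCommGroup E] [CompleteSpace E] [NormedSpace ℝ E]
    (Φ : (ℝ → E) → ℝ → E) (S : ℝ → Set E) {K K' : ℝ} (hK : 0 ≤ K)
    (hcont : ∀ u, Continuous u → Continuous (Φ u))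
    (hlip : ∀ u w, Continuous u → Continuous w → ∀ t, 0 ≤ t →
      ‖Φ u t - Φ w t‖ ≤ K * ∫ τ in (0 : ℝ)..t, ‖u τ - w τ‖)
    (hzero : ∀ t, 0 ≤ t → ‖Φ 0 t‖ ≤ K')
    (hS : ∀ t, 0 ≤ t → IsClosed (S t)) (hS0 : ∀ t, 0 ≤ t → 0 ∈ S t)
    (hmaps : ∀ u, Continuous u → (∀ t, 0 ≤ t → u t ∈ S t) → ∀ t, 0 ≤ t → Φ u t ∈ S t) :
    ∃ u, Continuous u ∧ (∀ t, 0 ≤ t → u t ∈ S t) ∧ ∀ t, 0 ≤ t → Φ u t = u t := by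
  -- The weight `exp(c t)` turns the Volterra bound into a contraction, since `K / c ≤ 1/2`. Curves
  -- on the half-line are coded by bounded functions `v` on the whole line through `exp(c|t|)
  -- v(|t|)`, so that one works in a Banach space.
  set c : ℝ := 2 * K + 1 with hc
  have hc0 : 0 < c := by positivity
  let ex : (ℝ →ᵇ E) → ℝ → E := fun v t => Real.exp (c * |t|) • v |t|
  have exc : ∀ v, Continuous (ex v) := fun v => by
    have := v.continuous
    exact Continuous.smul (by fun_prop) (by fun_prop)
  have exd : ∀ v w : ℝ →ᵇ E, ∀ t, 0 ≤ t → ‖Φ (ex v) t - Φ (ex w) t‖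
      ≤ 1 / 2 * ‖v - w‖ * Real.exp (c * t) := fun v w t ht => by
    refine (hlip _ _ (exc v) (exc w) t ht).trans ?_
    have h1 : ∫ τ in (0 : ℝ)..t, ‖ex v τ - ex w τ‖
        ≤ ∫ τ in (0 : ℝ)..t, ‖v - w‖ * Real.exp (c * τ) := by
      refine intervalIntegral.integral_mono_on ht
        (((exc v).sub (exc w)).norm.intervalIntegrable _ _)
        (Continuous.intervalIntegrable (by fun_prop) _ _) fun τ hτ => ?_
      change ‖Real.exp (c * |τ|) • v |τ| - Real.exp (c * |τ|) • w |τ|‖ ≤ _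
      rw [abs_of_nonneg hτ.1, ← smul_sub, norm_smul, Real.norm_of_nonneg (Real.exp_pos _).le,
        mul_comm]
      gcongr
      exact (v - w).norm_coe_le_norm τ
    rw [intervalIntegral.integral_const_mul] at h1
    have h2 := integral_exp_mul_le hc0 t
    calc _ ≤ K * (‖v - w‖ * (Real.exp (c * t) / c)) := by
          gcongr; exact h1.trans (by gcongr)
      _ = K / c * ‖v - w‖ * Real.exp (c * t) := by ring
      _ ≤ _ := by
          have h3 : K / c ≤ 1 / 2 := by rw [div_le_div_iff₀ hc0 (by norm_num)]; linarith
          gcongr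
  have hex0 : ex 0 = 0 := by ext t; simp [ex]
  let Ψ : (ℝ →ᵇ E) → (ℝ →ᵇ E) := fun v => BoundedContinuousFunction.ofNormedAddCommGroup
    (fun t => Real.exp (-(c * |t|)) • Φ (ex v) |t|)
    (Continuous.smul (by fun_prop) ((hcont _ (exc v)).comp continuous_abs))
    (1 / 2 * ‖v‖ + K') (fun t => by
      have h1 := exd v 0 |t| (abs_nonneg t)
      have h2 := hzero |t| (abs_nonneg t)
      rw [hex0, sub_zero] at h1
      have h3 : ‖Φ (ex v) |t|‖ ≤ 1 / 2 * ‖v‖ * Real.exp (c * |t|) + K' := by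
        calc _ = ‖(Φ (ex v) |t| - Φ 0 |t|) + Φ 0 |t|‖ := by rw [sub_add_cancel]
          _ ≤ _ := (norm_add_le _ _).trans (add_le_add h1 h2)
      have h4 : 0 ≤ K' := (norm_nonneg _).trans h2
      have h5 : Real.exp (-(c * |t|)) ≤ 1 := Real.exp_le_one_iff.2 (by
        have := abs_nonneg t
        have : 0 ≤ c * |t| := by positivity
        linarith)
      rw [norm_smul, Real.norm_of_nonneg (Real.exp_pos _).le]
      calc _ ≤ Real.exp (-(c * |t|)) * (1 / 2 * ‖v‖ * Real.exp (c * |t|) + K') := by gcongr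
        _ = 1 / 2 * ‖v‖ * (Real.exp (-(c * |t|)) * Real.exp (c * |t|))
            + Real.exp (-(c * |t|)) * K' := by ring
        _ ≤ _ := by
          rw [← Real.exp_add, neg_add_cancel, Real.exp_zero, mul_one]
          gcongr
          exact mul_le_of_le_one_left h4 h5)
  have hΨ : ∀ v t, Ψ v t = Real.exp (-(c * |t|)) • Φ (ex v) |t| := fun v t => rfl
  have hΨd : ∀ v w, dist (Ψ v) (Ψ w) ≤ 1 / 2 * dist v w := fun v w => by
    refine (BoundedContinuousFunction.dist_le (by positivity)).2 fun t => ?_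
    rw [hΨ, hΨ, dist_eq_norm, ← smul_sub, norm_smul, Real.norm_of_nonneg (Real.exp_pos _).le,
      dist_eq_norm]
    calc _ ≤ Real.exp (-(c * |t|)) * (1 / 2 * ‖v - w‖ * Real.exp (c * |t|)) := by
          gcongr; exact exd v w _ (abs_nonneg t)
      _ = 1 / 2 * ‖v - w‖ * (Real.exp (-(c * |t|)) * Real.exp (c * |t|)) := by ring
      _ = _ := by rw [← Real.exp_add, neg_add_cancel, Real.exp_zero, mul_one]
  let 𝒮 : Set (ℝ →ᵇ E) := {v | ∀ t, 0 ≤ t → ex v t ∈ S t}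
  have hcl : IsClosed 𝒮 := by
    have : 𝒮 = ⋂ (t : ℝ) (_ : 0 ≤ t), (fun v => ex v t) ⁻¹' S t := by ext v; simp [𝒮]
    rw [this]
    refine isClosed_iInter fun t => isClosed_iInter fun ht => (hS t ht).preimage ?_
    exact (continuous_eval_const (F := ℝ →ᵇ E) |t|).const_smul _
  have hexΨ : ∀ v t, 0 ≤ t → ex (Ψ v) t = Φ (ex v) t := fun v t ht => by
    change Real.exp (c * |t|) • Ψ v |t| = _
    rw [hΨ, abs_abs, abs_of_nonneg ht, smul_smul, ← Real.exp_add, add_neg_cancel, Real.exp_zero,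
      one_smul]
  have hM : Set.MapsTo Ψ 𝒮 𝒮 := fun v hv t ht => by
    rw [hexΨ v t ht]; exact hmaps _ (exc v) hv t ht
  have hcontr : ContractingWith (1 / 2) (hM.restrict Ψ 𝒮 𝒮) := by
    refine ⟨by rw [← NNReal.coe_lt_coe]; norm_num, LipschitzWith.of_dist_le_mul fun v w => ?_⟩
    have := hΨd v w
    simpa using! this
  obtain ⟨v, hv, hfix, -⟩ := hcontr.exists_fixedPoint' hcl.isComplete hM (x := 0) (by
    intro t ht; rw [hex0]; exact hS0 t ht) (edist_ne_top _ _)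
  refine ⟨ex v, exc v, hv, fun t ht => ?_⟩
  rw [← hexΨ v t ht, hfix]

/-- A convolution estimate. -/
lemma rpow_mul_rpow_le {ν r t τ : ℝ} (hν : 0 < ν) (hν1 : ν ≤ 1) (hr : ν ≤ r) (h0 : 0 ≤ τ) (ht : τ ≤ t) :
    (1 + (t - τ)) ^ (-ν) * (1 + τ) ^ (-r)
      ≤ 2 * (1 + t) ^ (-ν) * ((1 + τ) ^ (-r) + (1 + (t - τ)) ^ (-r)) := by
  have ht0 := h0.trans ht
  -- The larger of `1 + τ` and `1 + (t - τ)` is at least `(1 + t)/2`. The rate `ν` is put on it, and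
  -- the smaller one keeps the integrable rate `r`.
  have key : ∀ a b : ℝ, 1 ≤ a → a ≤ b → 1 + t ≤ 2 * b → b ^ (-ν) * a ^ (-r)
      ≤ 2 * (1 + t) ^ (-ν) * a ^ (-r) := fun a b ha hab hb => by
    have : b ^ (-ν) ≤ 2 * (1 + t) ^ (-ν) := by
      calc b ^ (-ν) ≤ ((1 + t) / 2) ^ (-ν) :=
            Real.rpow_le_rpow_of_nonpos (by linarith) (by linarith) (by linarith)
        _ = 2 ^ ν * (1 + t) ^ (-ν) := by
            rw [Real.div_rpow (by linarith) (by norm_num), Real.rpow_neg (x := 2) (by norm_num)]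
            field_simp
        _ ≤ _ := by
            refine mul_le_mul_of_nonneg_right ?_ (by positivity)
            calc (2 : ℝ) ^ ν ≤ 2 ^ (1 : ℝ) := Real.rpow_le_rpow_of_exponent_le (by norm_num) hν1
              _ = 2 := Real.rpow_one 2
    gcongr
  have hA : 0 < 1 + τ := by linarith
  have hB : 0 < 1 + (t - τ) := by linarith
  have p1 : 0 < (1 + t) ^ (-ν) := by positivity
  have p2 : 0 < (1 + τ) ^ (-r) := by positivity
  have p3 : 0 < (1 + (t - τ)) ^ (-r) := by positivity
  rcases le_total τ (t - τ) with hh | hh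
  · have := key (1 + τ) (1 + (t - τ)) (by linarith) (by linarith) (by linarith)
    nlinarith [mul_pos p1 p3]
  · have h1 := key (1 + (t - τ)) (1 + τ) (by linarith) (by linarith) (by linarith)
    have h2 : (1 + (t - τ)) ^ (-ν) * (1 + τ) ^ (-r) ≤ (1 + τ) ^ (-ν) * (1 + (t - τ)) ^ (-r) := by
      have e : ∀ x : ℝ, 0 < x → x ^ (-r) = x ^ (-ν) * x ^ (-(r - ν)) := fun x hx => by
        rw [← Real.rpow_add hx]; congr 1; ring
      rw [e _ hA, e _ hB]
      have : (1 + τ) ^ (-(r - ν)) ≤ (1 + (t - τ)) ^ (-(r - ν)) :=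
        Real.rpow_le_rpow_of_nonpos hB (by linarith) (by linarith)
      have q1 : 0 < (1 + τ) ^ (-ν) := by positivity
      have q2 : 0 < (1 + (t - τ)) ^ (-ν) := by positivity
      calc _ = (1 + (t - τ)) ^ (-ν) * (1 + τ) ^ (-ν) * (1 + τ) ^ (-(r - ν)) := by ring
        _ ≤ (1 + (t - τ)) ^ (-ν) * (1 + τ) ^ (-ν) * (1 + (t - τ)) ^ (-(r - ν)) := by gcongr
        _ = _ := by ring
    nlinarith [mul_pos p1 p2]

lemma integral_rpow_neg_le {r t : ℝ} (hr : 1 < r) (ht : 0 ≤ t) :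
    ∫ τ in (0 : ℝ)..t, (1 + τ) ^ (-r) ≤ 1 / (r - 1) := by
  rw [intervalIntegral.integral_comp_add_left (fun x => x ^ (-r)) 1,
    integral_rpow (Or.inr ⟨by linarith, by
      rw [Set.uIcc_of_le (by linarith)]; intro h; linarith [h.1]⟩)]
  have h1 : 0 < (1 + t) ^ (-r + 1) := by positivity
  rw [add_zero, Real.one_rpow, show ((1 + t) ^ (-r + 1) - 1) / (-r + 1)
    = (1 - (1 + t) ^ (-r + 1)) / (r - 1) by
      rw [div_eq_div_iff (by linarith) (by linarith)]; ring]
  gcongr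
  linarith

/-- The upper bound of the convolution of two decaying functions. -/
lemma integral_conv_le {ν r t : ℝ} (hr : 1 < r) (ht : 0 ≤ t) :
    ∫ τ in (0 : ℝ)..t, 2 * (1 + t) ^ (-ν) * ((1 + τ) ^ (-r) + (1 + (t - τ)) ^ (-r))
      ≤ 4 / (r - 1) * (1 + t) ^ (-ν) := by
  have c1 : ContinuousOn (fun τ : ℝ => (1 + τ) ^ (-r)) (Set.uIcc 0 t) := by
    rw [Set.uIcc_of_le ht]
    exact ContinuousOn.rpow_const (by fun_prop) fun x hx => Or.inl (by linarith [hx.1])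
  have c2 : ContinuousOn (fun τ : ℝ => (1 + (t - τ)) ^ (-r)) (Set.uIcc 0 t) := by
    rw [Set.uIcc_of_le ht]
    exact ContinuousOn.rpow_const (by fun_prop) fun x hx => Or.inl (by linarith [hx.2])
  rw [intervalIntegral.integral_const_mul,
    intervalIntegral.integral_add c1.intervalIntegrable c2.intervalIntegrable,
    intervalIntegral.integral_comp_sub_left (fun x => (1 + x) ^ (-r)) t, sub_self, sub_zero]
  have := integral_rpow_neg_le hr ht
  have h1 : 0 < (1 + t) ^ (-ν) := by positivity
  calc _ ≤ 2 * (1 + t) ^ (-ν) * (1 / (r - 1) + 1 / (r - 1)) := by gcongr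
    _ = _ := by ring

section
variable {α κ : ℝ} (h : Par α κ)

/-- Duhamel's formula for `a' = σ (P a + g)`, where `σ = ±1`. -/
def Par.duhamel (a₀ : L2) (σ : ℝ) (g : ℝ → L2) (t : ℝ) : L2 :=
  h.U (σ * t) (a₀ + σ • ∫ τ in (0 : ℝ)..t, h.U (-(σ * τ)) (g τ))

variable {a₀ : L2} {σ : ℝ} {g g₁ : ℝ → L2}

include h in
lemma Par.continuous_U_apply (hg : Continuous g) : Continuous fun τ => h.U (-(σ * τ)) (g τ) :=
  (h.continuous_U.comp (by fun_prop : Continuous fun τ : ℝ => -(σ * τ))).clm_apply hg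

/-- Product rule: the group is differentiable in norm, and the integral in its integrand's upper
limit; the two group factors cancel at time `t`. -/
lemma Par.hasDerivAt_duhamel (hg : Continuous g) (t : ℝ) :
    HasDerivAt (h.duhamel a₀ σ g) (σ • (h.P (h.duhamel a₀ σ g t) + g t)) t := by
  have h1 : HasDerivAt (fun τ => a₀ + σ • ∫ τ in (0 : ℝ)..τ, h.U (-(σ * τ)) (g τ))
      (σ • h.U (-(σ * t)) (g t)) t :=
    ((h.continuous_U_apply hg).integral_hasStrictDerivAt 0 t).hasDerivAt.const_smul σ |>.const_add a₀
  have h2 : HasDerivAt (fun τ => h.U (σ * τ)) (σ • (h.P ∘L h.U (σ * t))) t := by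
    have := (h.hasDerivAt_U (σ * t)).scomp t ((hasDerivAt_id t).const_mul σ)
    simpa using! this
  have h3 := h2.clm_apply h1
  refine h3.congr_deriv ?_
  rw [map_smul, ← h.U_add, add_neg_cancel, h.U_zero, smul_add]
  rfl

lemma Par.duhamel_zero : h.duhamel a₀ σ g 0 = a₀ := by
  rw [duhamel, mul_zero, h.U_zero, intervalIntegral.integral_same, smul_zero, add_zero]

lemma Par.duhamel_eq (hg : Continuous g) (t : ℝ) : h.duhamel a₀ σ g t
    = h.U (σ * t) a₀ + σ • ∫ τ in (0 : ℝ)..t, h.U (σ * (t - τ)) (g τ) := by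
  rw [duhamel, map_add, map_smul, ← ContinuousLinearMap.intervalIntegral_comp_comm _
    ((h.continuous_U_apply hg).intervalIntegrable _ _)]
  congr 3
  ext1 τ
  rw [← h.U_add]; congr 2; ring

lemma Par.norm_duhamel_sub_le (hg : Continuous g) (hg₁ : Continuous g₁) (hσ : |σ| = 1) {t : ℝ}
    (ht : 0 ≤ t) :
    ‖h.duhamel a₀ σ g t - h.duhamel a₀ σ g₁ t‖ ≤ ∫ τ in (0 : ℝ)..t, ‖g τ - g₁ τ‖ := by
  rw [duhamel, duhamel, ← map_sub, add_sub_add_left_eq_sub, ← smul_sub,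
    ← intervalIntegral.integral_sub ((h.continuous_U_apply hg).intervalIntegrable _ _)
      ((h.continuous_U_apply hg₁).intervalIntegrable _ _)]
  refine (h.norm_U_apply_le _ _).trans ?_
  rw [norm_smul, Real.norm_eq_abs, hσ, one_mul]
  refine (intervalIntegral.norm_integral_le_integral_norm ht).trans ?_
  refine intervalIntegral.integral_mono_on ht
    (((h.continuous_U_apply hg).sub (h.continuous_U_apply hg₁)).norm.intervalIntegrable _ _)
    ((hg.sub hg₁).norm.intervalIntegrable _ _) fun τ _ => ?_
  rw [← map_sub]; exact h.norm_U_apply_le _ _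

lemma Par.ballNorm_duhamel_le {N : L2 → ℝ≥0∞} (hN : BallNorm N) (hg : Continuous g) (hσ : |σ| = 1)
    {t : ℝ} (ht : 0 ≤ t) {k : ℝ → ℝ} (hk : ContinuousOn k (Set.Icc 0 t))
    (hpos : ∀ τ ∈ Set.Icc 0 t, 0 < k τ)
    (hle : ∀ τ ∈ Set.Icc 0 t, N (h.U (σ * (t - τ)) (g τ)) ≤ ENNReal.ofReal (k τ)) :
    N (h.duhamel a₀ σ g t) ≤ N (h.U (σ * t) a₀) + ENNReal.ofReal (∫ τ in (0 : ℝ)..t, k τ) := by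
  rw [h.duhamel_eq hg]
  refine (hN.add_le _ _).trans (add_le_add_right ?_ _)
  rw [hN.smul, ← ofReal_norm, Real.norm_eq_abs, hσ, ENNReal.ofReal_one, one_mul]
  refine hN.integral_le ht (Continuous.intervalIntegrable ?_ _ _) hk hpos hle
  exact (h.continuous_U.comp (by fun_prop : Continuous fun τ : ℝ => σ * (t - τ))).clm_apply hg

end
end

/-! ### Truncation of the nonlinearity and the global solution -/

section
open scoped NNReal

/-- The truncation of `y` to `[-A, A]`. -/
def clamp (A y : ℝ) : ℝ := max (-A) (min A y)

lemma abs_clamp_le {A : ℝ} (hA : 0 ≤ A) (y : ℝ) : |clamp A y| ≤ A :=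
  abs_le.2 ⟨le_max_left _ _, max_le (by linarith) (min_le_left _ _)⟩
lemma clamp_eq {A y : ℝ} (h : |y| ≤ A) : clamp A y = y := by
  rw [clamp, min_eq_right (abs_le.1 h).2, max_eq_right (abs_le.1 h).1]
lemma lipschitzWith_clamp (A : ℝ) : LipschitzWith 1 (clamp A) :=
  (LipschitzWith.id.const_min A).const_max (-A)

lemma exists_lipschitz_clamp {f : ℝ → ℝ} (hf : ContDiff ℝ 1 f) {A : ℝ} (hA : 0 ≤ A) :
    ∃ K : ℝ≥0, LipschitzWith K fun y => f (clamp A y) := by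
  obtain ⟨G, hG⟩ := (isCompact_Icc (a := -A) (b := A)).exists_bound_of_continuousOn
    (f := deriv f) (hf.continuous_deriv le_rfl).continuousOn
  have hl : LipschitzOnWith (Real.toNNReal (max G 0)) f (Set.Icc (-A) A) :=
    (convex_Icc _ _).lipschitzOnWith_of_nnnorm_deriv_le
      (fun x _ => (hf.differentiable one_ne_zero) x) fun x hx => by
        rw [← NNReal.coe_le_coe, coe_nnnorm, Real.coe_toNNReal _ (le_max_right _ _)]
        exact (hG x hx).trans (le_max_left _ _)
  refine ⟨Real.toNNReal (max G 0) * 1, ?_⟩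
  have := hl.comp ((lipschitzWith_clamp A).lipschitzOnWith (s := Set.univ))
    (fun y _ => abs_le.1 (abs_clamp_le hA y))
  exact lipschitzOnWith_univ.1 this

/-- The nonlinearity, truncated at the height `A`. -/
lemma exists_trunc {f : ℝ → ℝ} (hf : ContDiff ℝ 1 f) (hf0 : f 0 = 0) {A : ℝ} (hA : 0 ≤ A) :
    ∃ (K : ℝ≥0) (N : L2 → L2), LipschitzWith K N ∧ N 0 = 0 ∧
      (∀ u : L2, ∀ᵐ x, N u x = f (clamp A (u x))) ∧
      ∀ u : L2, eLpNorm u ⊤ volume ≤ ENNReal.ofReal A → ∀ᵐ x, N u x = f (u x) := by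
  obtain ⟨K, hK⟩ := exists_lipschitz_clamp hf hA
  have h0 : f (clamp A 0) = 0 := by rw [clamp_eq (by simpa using hA), hf0]
  have hN : ∀ u : L2, ∀ᵐ x, hK.compLp h0 u x = f (clamp A (u x)) := fun u => hK.coeFn_compLp h0 u
  refine ⟨K, hK.compLp h0, hK.lipschitzWith_compLp h0, hK.compLp_zero h0, hN, fun u hu => ?_⟩
  filter_upwards [hN u, abs_le_of_eLpNorm_top hA hu] with x h1 h2
  rw [h1, clamp_eq h2]

variable {α κ : ℝ}

/-- Global existence of small decaying solutions of `u' = P z`, `z' = P u + S (f u)`. -/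
theorem Par.exists_global (h : Par α κ) {s q C A₀ B C₁ : ℝ} {f : ℝ → ℝ} (hs : 1 / 2 < s)
    (hf : ContDiff ℝ 1 f) (hf0 : f 0 = 0) (hN : SmallNonlin h s f q C A₀) (hA₀ : A₀ ≤ 1)
    (hq : 0 < q) (hqν : 1 < q * decay (min s 2)) (hB : 0 ≤ B)
    (hL : ∀ A, 0 < A → A ≤ 1 → ∀ u w : L2, eLpNorm u ⊤ volume ≤ ENNReal.ofReal A →
      (∀ᵐ x, w x = f (u x)) → eLpNorm w 1 volume ≤ ENNReal.ofReal (B * A ^ q) * ‖u‖ₑ ^ 2)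
    (hC₁ : 0 < C₁) : ∃ C₂ δ₀ : ℝ, 0 < C₂ ∧ 0 < δ₀ ∧ ∀ δ, 0 < δ → δ ≤ δ₀ → ∀ a₀ b₀ : L2,
      hNorm s a₀ ≤ ENNReal.ofReal (C₁ * δ) → hNorm s b₀ ≤ ENNReal.ofReal (C₁ * δ) →
      (∀ t, eLpNorm (h.U t a₀) ⊤ volume
        ≤ ENNReal.ofReal (C₁ * δ * (1 + |t|) ^ (-decay (min s 2)))) →
      (∀ t, eLpNorm (h.U t b₀) ⊤ volume
        ≤ ENNReal.ofReal (C₁ * δ * (1 + |t|) ^ (-decay (min s 2)))) →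
      ∃ u z w : ℝ → L2, Continuous w ∧ u 0 = (1 / 2 : ℝ) • (a₀ + b₀) ∧
        z 0 = (1 / 2 : ℝ) • (a₀ - b₀) ∧
        (∀ t, HasDerivAt u (h.P (z t)) t) ∧ (∀ t, HasDerivAt z (h.P (u t) + h.S (w t)) t) ∧
        ∀ t, 0 ≤ t → eLpNorm (u t) ⊤ volume
            ≤ ENNReal.ofReal (C₂ * δ * (1 + t) ^ (-decay (min s 2))) ∧
          hNorm s (u t) ≤ ENNReal.ofReal (C₂ * δ) ∧ hNorm s (z t) ≤ ENNReal.ofReal (C₂ * δ) ∧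
          ∀ᵐ x, w t x = f (u t x) := by
  set ν := decay (min s 2) with hν
  have hν0 : 0 < ν := by
    by_contra hc
    push Not at hc
    nlinarith
  have hν1 : ν ≤ 1 := by
    have h1 : 1 / 2 < min s 2 := lt_min hs (by norm_num)
    rw [hν, decay, div_le_one (by linarith)]; linarith
  obtain ⟨Cd, hCd, hdec⟩ := h.exists_decay hs
  set r := q * ν with hr
  have hνr : ν ≤ r := by linarith
  have hr1 : 0 < r - 1 := by linarith
  have hCp := hN.pos_C
  have hAp := hN.pos_A
  -- It dominates the time integrals of the Duhamel term in both norms, so its size is at most `C₃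
  -- ρ^q · ρ`. With `ρ = 2 C₁ δ` the data take up half of the ball, and the smallness `C₃ ρ^q ≤ 1/2`
  -- leaves the other half to the nonlinearity.
  set C₃ := (Cd * (B + C) * 4 + C) / (r - 1) with hC₃
  have hC₃p : 0 < C₃ := by positivity
  refine ⟨2 * C₁, min A₀ ((1 / (2 * C₃)) ^ (1 / q)) / (2 * C₁), by positivity, by positivity,
    fun δ hδ hδ' a₀ b₀ ha hb haU hbU => ?_⟩
  set ρ := 2 * C₁ * δ with hρ
  have hρ0 : 0 < ρ := by positivity
  have hρm : ρ ≤ min A₀ ((1 / (2 * C₃)) ^ (1 / q)) := by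
    rw [le_div_iff₀ (by positivity)] at hδ'; linarith
  have hρA : ρ ≤ A₀ := hρm.trans (min_le_left _ _)
  have hρq : C₃ * ρ ^ q ≤ 1 / 2 := by
    have h1 : ρ ^ q ≤ ((1 / (2 * C₃)) ^ (1 / q)) ^ q := by
      gcongr; exact hρm.trans (min_le_right _ _)
    rw [← Real.rpow_mul (by positivity), one_div_mul_cancel hq.ne', Real.rpow_one] at h1
    calc C₃ * ρ ^ q ≤ C₃ * (1 / (2 * C₃)) := by gcongr
      _ = 1 / 2 := by field_simp
  have hCδ : C₁ * δ = ρ / 2 := by rw [hρ]; ring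
  rw [hCδ] at ha hb haU hbU
  -- The truncation makes the nonlinearity globally Lipschitz on `L²`. It is invisible on the
  -- invariant set, where `‖u‖_∞ ≤ A₀`.
  obtain ⟨K, N, hNL, hN0, -, hNf⟩ := exists_trunc hf hf0 hAp.le
  set g : (ℝ → L2) → ℝ → L2 := fun u τ => h.S (N (u τ)) with hg
  have hgc : ∀ u, Continuous u → Continuous (g u) := fun u hu =>
    h.S.continuous.comp (hNL.continuous.comp hu)
  set St : ℝ → Set L2 := fun t => {v | eLpNorm v ⊤ volume ≤ ENNReal.ofReal (ρ * (1 + t) ^ (-ν))} ∩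
    {v | hNorm s v ≤ ENNReal.ofReal ρ} with hSt
  have hamp : ∀ t : ℝ, 0 ≤ t → 0 < ρ * (1 + t) ^ (-ν) ∧ ρ * (1 + t) ^ (-ν) ≤ A₀ := fun t ht => by
    have h1 : (1 + t) ^ (-ν) ≤ 1 := Real.rpow_le_one_of_one_le_of_nonpos (by linarith) (by linarith)
    exact ⟨by positivity, (mul_le_of_le_one_right hρ0.le h1).trans hρA⟩
  have hNu : ∀ t, 0 ≤ t → ∀ v ∈ St t, (∀ᵐ x, N v x = f (v x)) := fun t ht v hv =>
    hNf v (hv.1.trans (ENNReal.ofReal_le_ofReal (hamp t ht).2))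
  have hbd : ∀ t, 0 ≤ t → ∀ v ∈ St t,
      eLpNorm (N v) 1 volume ≤ ENNReal.ofReal (B * (ρ ^ q * (1 + t) ^ (-r)) * ρ) ∧
      hNorm s (h.S (N v)) ≤ ENNReal.ofReal (C * (ρ ^ q * (1 + t) ^ (-r)) * ρ) := fun t ht v hv => by
    have e : (ρ * (1 + t) ^ (-ν)) ^ q = ρ ^ q * (1 + t) ^ (-r) := by
      rw [Real.mul_rpow hρ0.le (by positivity), ← Real.rpow_mul (by positivity)]
      congr 2; rw [hr]; ring
    have h1 := hL _ (hamp t ht).1 ((hamp t ht).2.trans hA₀) v (N v) hv.1 (hNu t ht v hv)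
    have h2 := hN.bound _ (hamp t ht).1 (hamp t ht).2 v (N v) hv.1 (hNu t ht v hv)
    have h3 : ‖v‖ₑ ≤ ENNReal.ofReal ρ := (enorm_le_hNorm (by linarith) v).trans hv.2
    rw [e] at h1 h2
    constructor
    · refine h1.trans ?_
      rw [ENNReal.ofReal_mul (q := ρ) (by positivity)]
      gcongr
      calc ‖v‖ₑ ^ 2 ≤ ENNReal.ofReal ρ ^ 2 := by gcongr
        _ = ENNReal.ofReal (ρ ^ 2) := (ENNReal.ofReal_pow hρ0.le 2).symm
        _ ≤ _ := ENNReal.ofReal_le_ofReal (by nlinarith)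
    · refine h2.trans ?_
      rw [ENNReal.ofReal_mul (q := ρ) (by positivity)]
      gcongr
      exact hv.2
  have bound : ∀ (σ : ℝ), |σ| = 1 → ∀ (c : L2), hNorm s c ≤ ENNReal.ofReal (ρ / 2) →
      (∀ t, eLpNorm (h.U t c) ⊤ volume ≤ ENNReal.ofReal (ρ / 2 * (1 + |t|) ^ (-ν))) →
      ∀ u, Continuous u → (∀ t, 0 ≤ t → u t ∈ St t) → ∀ t, 0 ≤ t →
        h.duhamel c σ (g u) t ∈ St t := by
    intro σ hσ c hc hcU u hu huS t ht
    constructor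
    · have := h.ballNorm_duhamel_le ballNorm_top (a₀ := c) (hgc u hu) hσ ht
        (k := fun τ => Cd * (B + C) * (ρ ^ q * ρ)
          * (2 * (1 + t) ^ (-ν) * ((1 + τ) ^ (-r) + (1 + (t - τ)) ^ (-r))))
        (by
          refine ContinuousOn.mul (by fun_prop) (ContinuousOn.mul (by fun_prop) (ContinuousOn.add ?_ ?_))
          · exact ContinuousOn.rpow_const (by fun_prop) fun x hx => Or.inl (by linarith [hx.1])
          · exact ContinuousOn.rpow_const (by fun_prop) fun x hx => Or.inl (by linarith [hx.2]))
        (fun τ hτ => by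
          have h1 := hτ.1
          have h2 : 0 ≤ t - τ := by linarith [hτ.2]
          positivity)
        (fun τ hτ => by
          have h1 := hτ.1
          have h2 : 0 ≤ t - τ := by linarith [hτ.2]
          -- The dispersive estimate is used for `S` applied to `f(u)`, so it requires `f(u)`, not
          -- `S f(u)`, in `L¹`.
          refine (hdec (σ * (t - τ)) (N (u τ))).2.2.trans ?_
          obtain ⟨h3, h4⟩ := hbd τ h1 _ (huS τ h1)
          refine (mul_le_mul_right (add_le_add h3 h4) _).trans ?_
          rw [← ENNReal.ofReal_add (by positivity) (by positivity), ← ENNReal.ofReal_mul (by positivity),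
            abs_mul, hσ, one_mul, abs_of_nonneg h2]
          refine ENNReal.ofReal_le_ofReal ?_
          have h5 := rpow_mul_rpow_le hν0 hν1 hνr h1 hτ.2
          calc _ = Cd * (B + C) * (ρ ^ q * ρ) * ((1 + (t - τ)) ^ (-ν) * (1 + τ) ^ (-r)) := by ring
            _ ≤ _ := by gcongr)
      refine this.trans ?_
      have h1 := hcU (σ * t)
      rw [abs_mul, hσ, one_mul, abs_of_nonneg ht] at h1
      rw [intervalIntegral.integral_const_mul]
      have h2 := integral_conv_le (ν := ν) (r := r) (by linarith) ht
      refine (add_le_add h1 (ENNReal.ofReal_le_ofReal (mul_le_mul_of_nonneg_left h2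
        (by positivity)))).trans ?_
      rw [← ENNReal.ofReal_add (by positivity) (by positivity)]
      refine ENNReal.ofReal_le_ofReal ?_
      have h3 : Cd * (B + C) * 4 / (r - 1) ≤ C₃ := by rw [hC₃]; gcongr; linarith
      have h4 : Cd * (B + C) * 4 / (r - 1) * ρ ^ q ≤ 1 / 2 :=
        (mul_le_mul_of_nonneg_right h3 (by positivity)).trans hρq
      calc _ = ρ / 2 * (1 + t) ^ (-ν) + (Cd * (B + C) * 4 / (r - 1) * ρ ^ q) * (ρ * (1 + t) ^ (-ν)) := by
            ring
        _ ≤ ρ / 2 * (1 + t) ^ (-ν) + 1 / 2 * (ρ * (1 + t) ^ (-ν)) := by gcongr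
        _ = _ := by ring
    · have := h.ballNorm_duhamel_le (ballNorm_hNorm s) (a₀ := c) (hgc u hu) hσ ht
        (k := fun τ => C * (ρ ^ q * ρ) * (1 + τ) ^ (-r))
        (by
          refine ContinuousOn.mul (by fun_prop) ?_
          exact ContinuousOn.rpow_const (by fun_prop) fun x hx => Or.inl (by linarith [hx.1]))
        (fun τ hτ => by
          have h1 := hτ.1
          positivity)
        (fun τ hτ => by
          refine (h.hNorm_U_le _ _ _).trans ((hbd τ hτ.1 _ (huS τ hτ.1)).2.trans ?_)
          exact ENNReal.ofReal_le_ofReal (le_of_eq (by ring)))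
      refine this.trans ?_
      rw [intervalIntegral.integral_const_mul]
      have h2 := integral_rpow_neg_le (r := r) (by linarith) ht
      refine (add_le_add ((h.hNorm_U_le _ _ _).trans hc) (ENNReal.ofReal_le_ofReal
        (mul_le_mul_of_nonneg_left h2 (by positivity)))).trans ?_
      rw [← ENNReal.ofReal_add (by positivity) (by positivity)]
      refine ENNReal.ofReal_le_ofReal ?_
      have h3 : C / (r - 1) ≤ C₃ := by
        rw [hC₃]; gcongr
        have : 0 ≤ Cd * (B + C) * 4 := by positivity
        linarith
      have h4 : C / (r - 1) * ρ ^ q ≤ 1 / 2 :=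
        (mul_le_mul_of_nonneg_right h3 (by positivity)).trans hρq
      calc _ = ρ / 2 + (C / (r - 1) * ρ ^ q) * ρ := by ring
        _ ≤ ρ / 2 + 1 / 2 * ρ := by gcongr
        _ = _ := by ring
  have half : ∀ {N' : L2 → ℝ≥0∞}, BallNorm N' → ∀ {a b : L2} {M : ℝ≥0∞}, N' a ≤ M → N' b ≤ M →
      N' ((1 / 2 : ℝ) • (a + b)) ≤ M ∧ N' ((1 / 2 : ℝ) • (a - b)) ≤ M := by
    intro N' hN' a b M h1 h2
    have e : ‖(1 / 2 : ℝ)‖ₑ = 2⁻¹ := by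
      rw [← ofReal_norm, Real.norm_of_nonneg (by norm_num), one_div, ENNReal.ofReal_inv_of_pos two_pos]
      norm_num
    have e2 : 2⁻¹ * (M + M) = M := by
      rw [← two_mul, ← mul_assoc, ENNReal.inv_mul_cancel (by norm_num) (by norm_num), one_mul]
    constructor
    · rw [hN'.smul, e, ← e2]
      exact mul_le_mul_right ((hN'.add_le _ _).trans (add_le_add h1 h2)) _
    · rw [hN'.smul, e, ← e2]
      exact mul_le_mul_right ((hN'.sub_le _ _).trans (add_le_add h1 h2)) _
  have hdc : ∀ c σ u, Continuous u → Continuous (h.duhamel c σ (g u)) := fun c σ u hu =>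
    continuous_iff_continuousAt.2 fun t => (h.hasDerivAt_duhamel (hgc u hu) t).continuousAt
  set Φ : (ℝ → L2) → ℝ → L2 := fun u t =>
    (1 / 2 : ℝ) • (h.duhamel a₀ 1 (g u) t + h.duhamel b₀ (-1) (g u) t) with hΦ
  have habs : |(-1 : ℝ)| = 1 := by simp
  obtain ⟨u, hu, huS, hfix⟩ := exists_fixed_curve Φ St (K := ‖h.S‖ * K) (K' := ‖a₀‖ + ‖b₀‖)
    (by positivity) (fun u hu => by
      exact ((hdc a₀ 1 u hu).add (hdc b₀ (-1) u hu)).const_smul (1 / 2 : ℝ))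
    (fun u w hu hw t ht => by
      have h1 := h.norm_duhamel_sub_le (a₀ := a₀) (σ := 1) (hgc u hu) (hgc w hw) (by simp) ht
      have h2 := h.norm_duhamel_sub_le (a₀ := b₀) (σ := -1) (hgc u hu) (hgc w hw) habs ht
      have h3 : ∫ τ in (0 : ℝ)..t, ‖g u τ - g w τ‖ ≤ ∫ τ in (0 : ℝ)..t, ‖h.S‖ * K * ‖u τ - w τ‖ := by
        refine intervalIntegral.integral_mono_on ht
          (((hgc u hu).sub (hgc w hw)).norm.intervalIntegrable _ _)
          (((hu.sub hw).norm.const_mul _).intervalIntegrable _ _) fun τ _ => ?_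
        change ‖h.S (N (u τ)) - h.S (N (w τ))‖ ≤ _
        rw [← map_sub, mul_assoc]
        exact (h.S.le_opNorm _).trans (by gcongr; exact hNL.norm_sub_le _ _)
      rw [intervalIntegral.integral_const_mul] at h3
      change ‖(1 / 2 : ℝ) • _ - (1 / 2 : ℝ) • _‖ ≤ _
      rw [← smul_sub, norm_smul, add_sub_add_comm]
      have h4 := norm_add_le (h.duhamel a₀ 1 (g u) t - h.duhamel a₀ 1 (g w) t)
        (h.duhamel b₀ (-1) (g u) t - h.duhamel b₀ (-1) (g w) t)
      norm_num
      linarith)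
    (fun t ht => by
      have e0 : g 0 = fun _ => 0 := by ext1 τ; simp [hg, hN0]
      have h1 : ∀ c σ, ‖h.duhamel c σ (g 0) t‖ ≤ ‖c‖ := fun c σ => by
        rw [e0, Par.duhamel]; simp only [map_zero, intervalIntegral.integral_zero, smul_zero, add_zero]
        exact h.norm_U_apply_le _ _
      change ‖(1 / 2 : ℝ) • _‖ ≤ _
      rw [norm_smul]
      have h4 := norm_add_le (h.duhamel a₀ 1 (g 0) t) (h.duhamel b₀ (-1) (g 0) t)
      have h5 := h1 a₀ 1
      have h6 := h1 b₀ (-1)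
      have h7 := norm_nonneg a₀
      have h8 := norm_nonneg b₀
      norm_num
      linarith)
    (fun t _ => (ballNorm_top.closed _).inter ((ballNorm_hNorm s).closed _))
    (fun t _ => ⟨by
      rw [Set.mem_ofPred_eq, eLpNorm_congr_ae (Lp.coeFn_zero ℝ 2 volume)]; simp, by
      rw [Set.mem_ofPred_eq, hNorm_zero_right]; exact zero_le⟩)
    (fun u hu huS t ht => by
      have h1 := bound 1 (by simp) a₀ ha haU u hu huS t ht
      have h2 := bound (-1) habs b₀ hb hbU u hu huS t ht
      exact ⟨(half ballNorm_top h1.1 h2.1).1, (half (ballNorm_hNorm s) h1.2 h2.2).1⟩)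
  have ha' := fun t => h.hasDerivAt_duhamel (a₀ := a₀) (σ := 1) (hgc u hu) t
  have hb' := fun t => h.hasDerivAt_duhamel (a₀ := b₀) (σ := -1) (hgc u hu) t
  -- `Φ u` is chosen instead of the fixed point `u`: they agree for `t ≥ 0`, but only `Φ u` is known
  -- to be differentiable on the whole line.
  refine ⟨Φ u, fun t => (1 / 2 : ℝ) • (h.duhamel a₀ 1 (g u) t - h.duhamel b₀ (-1) (g u) t),
    fun t => N (u t), hNL.continuous.comp hu, ?_, ?_, fun t => ?_, fun t => ?_, fun t ht => ?_⟩
  · simp only [hΦ, Par.duhamel_zero]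
  · simp only [Par.duhamel_zero]
  · refine (((ha' t).add (hb' t)).const_smul (1 / 2 : ℝ)).congr_deriv ?_
    simp only [map_smul, map_sub]
    congr 1
    simp only [one_smul, neg_smul]
    abel
  · refine (((ha' t).sub (hb' t)).const_smul (1 / 2 : ℝ)).congr_deriv ?_
    simp only [hΦ, map_smul, map_add, one_smul, neg_smul]
    change _ = _ + g u t
    module
  · rw [hfix t ht]
    have h1 := bound 1 (by simp) a₀ ha haU u hu huS t ht
    have h2 := bound (-1) habs b₀ hb hbU u hu huS t ht
    exact ⟨(huS t ht).1, (huS t ht).2, (half (ballNorm_hNorm s) h1.2 h2.2).2, hNu t ht _ (huS t ht)⟩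
end

section
open scoped NNReal

/-! ### Regularity of solutions -/

section
variable {N : L2 → ℝ≥0∞} {y G : ℝ → L2}

lemma BallNorm.sub_le_of_hasDerivAt (hN : BallNorm N) (hG : Continuous G)
    (hy : ∀ t, HasDerivAt y (G t) t) {a b M : ℝ} (hab : a ≤ b) (hM : 0 < M)
    (hle : ∀ t ∈ Set.Icc a b, N (G t) ≤ ENNReal.ofReal M) :
    N (y b - y a) ≤ ENNReal.ofReal (M * (b - a)) := by
  rw [← intervalIntegral.integral_eq_sub_of_hasDerivAt (fun t _ => hy t) (hG.intervalIntegrable _ _)]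
  refine (hN.integral_le hab (hG.intervalIntegrable _ _) (h := fun _ => M) continuousOn_const
    (fun _ _ => hM) hle).trans (le_of_eq ?_)
  rw [intervalIntegral.integral_const, smul_eq_mul, mul_comm]

lemma BallNorm.sub_le_abs_of_hasDerivAt (hN : BallNorm N) (hG : Continuous G)
    (hy : ∀ t, HasDerivAt y (G t) t) {M : ℝ} (hM : 0 < M) {S : Set ℝ} (hS : S.OrdConnected)
    (hle : ∀ t ∈ S, N (G t) ≤ ENNReal.ofReal M) {a b : ℝ} (ha : a ∈ S) (hb : b ∈ S) :
    N (y b - y a) ≤ ENNReal.ofReal (M * |b - a|) := by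
  rcases le_total a b with hab | hab
  · rw [abs_of_nonneg (by linarith)]
    exact hN.sub_le_of_hasDerivAt hG hy hab hM fun t ht => hle t (hS.out ha hb ht)
  · rw [abs_of_nonpos (by linarith), hN.sub_comm, neg_sub]
    exact hN.sub_le_of_hasDerivAt hG hy hab hM fun t ht => hle t (hS.out hb ha ht)

/-- A curve which is Lipschitz continuous for `N` is continuous for `N`. -/
lemma BallNorm.tendsto_sub (hN : BallNorm N) (hG : Continuous G)
    (hy : ∀ t, HasDerivAt y (G t) t) {M : ℝ} (hM : 0 < M)
    (hle : ∀ t, 0 ≤ t → N (G t) ≤ ENNReal.ofReal M) {t : ℝ} (ht : 0 ≤ t) :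
    Tendsto (fun τ => N (y τ - y t)) (𝓝[Set.Ici 0] t) (𝓝 0) := by
  have h1 : Tendsto (fun τ => ENNReal.ofReal (M * |τ - t|)) (𝓝[Set.Ici 0] t) (𝓝 0) := by
    have : Continuous fun τ => ENNReal.ofReal (M * |τ - t|) :=
      ENNReal.continuous_ofReal.comp (by fun_prop)
    simpa using (this.tendsto t).mono_left nhdsWithin_le_nhds
  refine tendsto_of_tendsto_of_tendsto_of_le_of_le' tendsto_const_nhds h1
    (Eventually.of_forall fun _ => zero_le) ?_
  filter_upwards [self_mem_nhdsWithin] with τ hτ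
  exact hN.sub_le_abs_of_hasDerivAt hG hy hM (Set.ordConnected_Ici (a := 0)) hle ht hτ

/-- The curve is differentiable in `L²` only; the mean value inequality for `y(r) - (r - t) G(t)`
upgrades this to the norm `N` as soon as the derivative is continuous for `N`. -/
lemma BallNorm.tendsto_slope (hN : BallNorm N) (hG : Continuous G)
    (hy : ∀ t, HasDerivAt y (G t) t) {t : ℝ} (ht : 0 ≤ t)
    (hcont : Tendsto (fun τ => N (G τ - G t)) (𝓝[Set.Ici 0] t) (𝓝 0)) :
    Tendsto (fun τ => N ((τ - t)⁻¹ • (y τ - y t) - G t)) (𝓝[Set.Ici 0 \ {t}] t) (𝓝 0) := by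
  rw [ENNReal.tendsto_nhds_zero]
  intro ε hε
  obtain ⟨e, he, heε⟩ : ∃ e : ℝ, 0 < e ∧ ENNReal.ofReal e ≤ ε := by
    rcases eq_or_ne ε ⊤ with rfl | hne
    · exact ⟨1, one_pos, le_top⟩
    · exact ⟨ε.toReal, ENNReal.toReal_pos hε.ne' hne, ENNReal.ofReal_toReal_le⟩
  have h1 := ENNReal.tendsto_nhds_zero.1 hcont _ (ENNReal.ofReal_pos.2 he)
  rw [eventually_nhdsWithin_iff, Metric.eventually_nhds_iff_ball] at h1
  obtain ⟨d, hd, h1⟩ := h1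
  filter_upwards [self_mem_nhdsWithin, nhdsWithin_le_nhds (Metric.ball_mem_nhds t hd)] with τ hτ hτd
  have hne : τ - t ≠ 0 := sub_ne_zero.2 hτ.2
  have hS : (Metric.ball t d ∩ Set.Ici 0).OrdConnected :=
    Set.OrdConnected.inter (by rw [Real.ball_eq_Ioo]; exact Set.ordConnected_Ioo)
      Set.ordConnected_Ici
  have h2 := hN.sub_le_abs_of_hasDerivAt (y := fun r => y r - (r - t) • G t)
    (G := fun r => G r - G t) (hG.sub continuous_const)
    (fun r => by
      have := (hy r).sub (((hasDerivAt_id r).sub_const t).smul_const (G t))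
      simpa using! this) he hS (fun r hr => h1 r hr.1 hr.2) ⟨Metric.mem_ball_self hd, ht⟩ ⟨hτd, hτ.1⟩
  have e1 : (τ - t)⁻¹ • (y τ - y t) - G t
      = (τ - t)⁻¹ • ((y τ - (τ - t) • G t) - (y t - (t - t) • G t)) := by
    rw [sub_self, zero_smul, sub_zero, sub_right_comm, smul_sub (τ - t)⁻¹ (y τ - y t), smul_smul,
      inv_mul_cancel₀ hne, one_smul]
  rw [e1, hN.smul]
  refine (mul_le_mul_right h2 _).trans (le_trans (le_of_eq ?_) heε)
  rw [← ofReal_norm, norm_inv, Real.norm_eq_abs, ← ENNReal.ofReal_mul (by positivity)]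
  congr 1
  have := abs_pos.2 hne
  field_simp

end

variable {α κ s : ℝ} {f : ℝ → ℝ}

/-- Sequential continuity is applied along `max τ 0`, since nothing is assumed at negative times. -/
lemma CompCont.tendsto_curve (hf : CompCont s f) {u w : ℝ → L2}
    (hu : ∀ t, 0 ≤ t → hNorm s (u t) < ⊤) (hw : ∀ t, 0 ≤ t → ∀ᵐ x, w t x = f (u t x)) {t : ℝ}
    (ht : 0 ≤ t) (hc : Tendsto (fun τ => hNorm s (u τ - u t)) (𝓝[Set.Ici 0] t) (𝓝 0)) :
    Tendsto (fun τ => hNorm s (w τ - w t)) (𝓝[Set.Ici 0] t) (𝓝 0) := by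
  have h1 : Tendsto (fun τ : ℝ => max τ 0) (𝓝 t) (𝓝[Set.Ici 0] t) := by
    refine tendsto_nhdsWithin_iff.2 ⟨?_, Eventually.of_forall fun τ => Set.mem_Ici.2 (le_max_right _ _)⟩
    have : Continuous fun τ : ℝ => max τ 0 := by fun_prop
    simpa [max_eq_left ht] using this.tendsto t
  have h2 : Tendsto (fun τ => hNorm s (w (max τ 0) - w t)) (𝓝 t) (𝓝 0) := by
    refine tendsto_of_seq_tendsto fun x hx => ?_
    exact hf.tendsto (u t) (w t) (fun n => u (max (x n) 0)) (fun n => w (max (x n) 0)) (hu t ht)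
      (fun n => hu _ (le_max_right _ _)) (hw t ht) (fun n => hw _ (le_max_right _ _))
      (hc.comp (h1.comp hx))
  refine (h2.mono_left nhdsWithin_le_nhds).congr' ?_
  filter_upwards [self_mem_nhdsWithin] with τ hτ
  rw [max_eq_left hτ]

/-- Solutions of `u' = P z`, `z' = P u + S (f u)` which are bounded in `H^s`. -/
structure IsFlow (h : Par α κ) (s : ℝ) (f : ℝ → ℝ) (M : ℝ) (u z w : ℝ → L2) : Prop where
  pos : 0 < M
  cont : Continuous w
  deriv_u : ∀ t, HasDerivAt u (h.P (z t)) t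
  deriv_z : ∀ t, HasDerivAt z (h.P (u t) + h.S (w t)) t
  le_u : ∀ t, 0 ≤ t → hNorm s (u t) ≤ ENNReal.ofReal M
  le_z : ∀ t, 0 ≤ t → hNorm s (z t) ≤ ENNReal.ofReal M
  le_w : ∀ t, 0 ≤ t → hNorm s (h.S (w t)) ≤ ENNReal.ofReal M
  comp : ∀ t, 0 ≤ t → ∀ᵐ x, w t x = f (u t x)

namespace IsFlow
variable {h : Par α κ} {M : ℝ} {u z w : ℝ → L2}

lemma cont_u (H : IsFlow h s f M u z w) : Continuous u :=
  continuous_iff_continuousAt.2 fun t => (H.deriv_u t).continuousAt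
lemma cont_z (H : IsFlow h s f M u z w) : Continuous z :=
  continuous_iff_continuousAt.2 fun t => (H.deriv_z t).continuousAt
lemma cont_Pz (H : IsFlow h s f M u z w) : Continuous fun t => h.P (z t) :=
  h.P.continuous.comp H.cont_z
lemma cont_Pu (H : IsFlow h s f M u z w) : Continuous fun t => h.P (u t) + h.S (w t) :=
  (h.P.continuous.comp H.cont_u).add (h.S.continuous.comp H.cont)

/-- The regularity in time of the flow. -/
lemma tendsto (H : IsFlow h s f M u z w) (hf : CompCont s f) {t : ℝ} (ht : 0 ≤ t) :
    Tendsto (fun τ => hNorm s (h.P (z τ) - h.P (z t))) (𝓝[Set.Ici 0] t) (𝓝 0) ∧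
    Tendsto (fun τ => hNorm s ((h.P (u τ) + h.S (w τ)) - (h.P (u t) + h.S (w t))))
      (𝓝[Set.Ici 0] t) (𝓝 0) := by
  obtain ⟨C, hC, HP⟩ := h.exists_hNorm_P_le s
  have hM := H.pos
  have bn := ballNorm_hNorm s
  have hPz : ∀ t, 0 ≤ t → hNorm s (h.P (z t)) ≤ ENNReal.ofReal (C * M) := fun t ht => by
    rw [ENNReal.ofReal_mul hC.le]
    exact (HP _).trans (mul_le_mul_right (H.le_z t ht) _)
  have hPu : ∀ t, 0 ≤ t → hNorm s (h.P (u t) + h.S (w t)) ≤ ENNReal.ofReal (C * M + M) :=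
    fun t ht => by
      rw [ENNReal.ofReal_add (by positivity) hM.le, ENNReal.ofReal_mul hC.le]
      exact (bn.add_le _ _).trans (add_le_add ((HP _).trans (mul_le_mul_right (H.le_u t ht) _))
        (H.le_w t ht))
  have tu := bn.tendsto_sub H.cont_Pz H.deriv_u (by positivity) hPz ht
  have tz := bn.tendsto_sub H.cont_Pu H.deriv_z (by positivity) hPu ht
  have tw := hf.tendsto_curve (fun t ht => (H.le_u t ht).trans_lt ENNReal.ofReal_lt_top) H.comp ht tu
  have tP : ∀ {y : ℝ → L2}, Tendsto (fun τ => hNorm s (y τ - y t)) (𝓝[Set.Ici 0] t) (𝓝 0) →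
      Tendsto (fun τ => hNorm s (h.P (y τ) - h.P (y t))) (𝓝[Set.Ici 0] t) (𝓝 0) := fun hy => by
    have h1 := ENNReal.Tendsto.const_mul (a := ENNReal.ofReal C) hy (Or.inr (by simp))
    rw [mul_zero] at h1
    refine tendsto_of_tendsto_of_tendsto_of_le_of_le tendsto_const_nhds h1
      (fun _ => zero_le) fun τ => ?_
    rw [← map_sub]; exact HP _
  refine ⟨tP tz, ?_⟩
  have h1 := (tP tu).add tw
  rw [add_zero] at h1
  refine tendsto_of_tendsto_of_tendsto_of_le_of_le tendsto_const_nhds h1 (fun _ => zero_le)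
    fun τ => ?_
  rw [add_sub_add_comm, ← map_sub h.S]
  exact (bn.add_le _ _).trans (add_le_add_right (h.hNorm_S_le s _) _)

theorem isC1 (H : IsFlow h s f M u z w) (hf : CompCont s f) :
    IsC1 s u (fun t => h.T (z t)) (fun t => h.P (z t)) (fun t => h.T (h.P (u t) + h.S (w t))) := by
  obtain ⟨C, hC, HP⟩ := h.exists_hNorm_P_le s
  obtain ⟨C', hC', HT⟩ := h.exists_hNorm_T_le
  have bn := ballNorm_hNorm s
  have fin : ∀ {g : L2} {c : ℝ}, hNorm s g ≤ ENNReal.ofReal c → hNorm s g < ⊤ :=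
    fun hg => hg.trans_lt ENNReal.ofReal_lt_top
  have finT : ∀ {g : L2}, hNorm s g < ⊤ → hNorm (s + 1) (h.T g) < ⊤ := fun hg =>
    (HT s _).trans_lt (ENNReal.mul_lt_top (by simp) hg)
  have finP : ∀ {g : L2}, hNorm s g < ⊤ → hNorm s (h.P g) < ⊤ := fun hg =>
    (HP _).trans_lt (ENNReal.mul_lt_top (by simp) hg)
  have limT : ∀ {l : Filter ℝ} {y : ℝ → L2}, Tendsto (fun τ => hNorm s (y τ)) l (𝓝 0) →
      Tendsto (fun τ => hNorm (s + 1) (h.T (y τ))) l (𝓝 0) := fun hy => by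
    have h1 := ENNReal.Tendsto.const_mul (a := ENNReal.ofReal C') hy (Or.inr (by simp))
    rw [mul_zero] at h1
    exact tendsto_of_tendsto_of_tendsto_of_le_of_le tendsto_const_nhds h1
      (fun _ => zero_le) fun τ => HT s _
  refine ⟨fun t ht => ?_, fun t ht => ?_, fun t ht => ?_, fun t ht => ?_⟩
  · exact ENNReal.add_lt_top.2 ⟨fin (H.le_u t ht), finT (fin (H.le_z t ht))⟩
  · refine ENNReal.add_lt_top.2 ⟨finP (fin (H.le_z t ht)), finT ?_⟩
    exact (bn.add_le _ _).trans_lt (ENNReal.add_lt_top.2 ⟨finP (fin (H.le_u t ht)),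
      fin (H.le_w t ht)⟩)
  · obtain ⟨h1, h2⟩ := H.tendsto hf ht
    have h3 := bn.tendsto_slope H.cont_Pz H.deriv_u ht h1
    have h4 := limT (bn.tendsto_slope H.cont_Pu H.deriv_z ht h2)
    simpa [xNorm] using! h3.add h4
  · obtain ⟨h1, h2⟩ := H.tendsto hf ht
    have h4 := limT h2
    simpa [xNorm] using! h1.add h4

end IsFlow

lemma Par.isDx (h : Par α κ) (z : L2) : IsDx (h.T z) (h.P z) := by
  filter_upwards [h.ft_P z, h.ft_T z] with ξ h1 h2
  rw [h1, h2, phi, omg]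
  push_cast; ring

lemma Par.isForce (h : Par α κ) (u w : L2) : IsForce α κ u w (h.T (h.P u + h.S w)) := by
  filter_upwards [h.ft_T (h.P u + h.S w), ft_add_ae (h.P u) (h.S w), h.ft_P u, h.ft_S w]
    with ξ h1 h2 h3 h4
  rw [h1, h2, h3, h4, ← rD_sq h.nonneg.1, ← rR_sq h.nonneg.2, phi, omg, sig]
  have e1 : (rD α (2 * Real.pi * ξ) : ℂ) ≠ 0 := by exact_mod_cast (rD_pos h.nonneg.1 _).ne'
  have e2 : (rR κ (2 * Real.pi * ξ) : ℂ) ≠ 0 := by exact_mod_cast (rR_pos h.nonneg.2 _).ne'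
  push_cast
  field_simp

/-- A flow in the variables `(u, z)` is a solution in the variables `(u, v)`. -/
theorem IsFlow.isSolution {h : Par α κ} {M : ℝ} {u z w : ℝ → L2} (H : IsFlow h s f M u z w)
    (hf : CompCont s f) : IsSolution α κ f s (u 0) (h.T (z 0)) u (fun t => h.T (z t)) :=
  ⟨rfl, rfl, _, _, H.isC1 hf, fun t ht => ⟨h.isDx (z t), w t, H.comp t ht, h.isForce (u t) (w t)⟩⟩
end

section
open scoped NNReal

/-! ### Uniqueness -/

lemma hasDerivWithinAt_of_enorm {y : ℝ → L2} {y' : L2} {S : Set ℝ} {t : ℝ} {E : ℝ → ℝ≥0∞}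
    (hle : ∀ τ, ‖(τ - t)⁻¹ • (y τ - y t) - y'‖ₑ ≤ E τ) (hE : Tendsto E (𝓝[S \ {t}] t) (𝓝 0)) :
    HasDerivWithinAt y y' S t := by
  rw [hasDerivWithinAt_iff_tendsto_slope, tendsto_iff_edist_tendsto_0]
  refine tendsto_of_tendsto_of_tendsto_of_le_of_le tendsto_const_nhds hE (fun _ => zero_le)
    fun τ => ?_
  rw [edist_eq_enorm_sub]
  exact hle τ

/-- A difference quotient that converges for `N` bounds the curve near `t`. -/
lemma BallNorm.eventually_le {N : L2 → ℝ≥0∞} (hN : BallNorm N) {y : ℝ → L2} {y' : L2} {t : ℝ}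
    {S : Set ℝ} (hy : N (y t) < ⊤) (hy' : N y' < ⊤)
    (hd : Tendsto (fun τ => N ((τ - t)⁻¹ • (y τ - y t) - y')) (𝓝[S \ {t}] t) (𝓝 0)) :
    ∃ M : ℝ, ∀ᶠ τ in 𝓝[S] t, N (y τ) ≤ ENNReal.ofReal M := by
  have hfin : N (y t) + (1 + N y') ≠ ⊤ :=
    (ENNReal.add_lt_top.2 ⟨hy, ENNReal.add_lt_top.2 ⟨ENNReal.one_lt_top, hy'⟩⟩).ne
  refine ⟨(N (y t) + (1 + N y')).toReal, ?_⟩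
  rw [ENNReal.ofReal_toReal hfin]
  have h1 := hd.eventually_le_const (zero_lt_one (α := ℝ≥0∞))
  rw [eventually_nhdsWithin_iff] at h1 ⊢
  filter_upwards [h1, Metric.ball_mem_nhds t one_pos] with τ hτ hb hS
  rcases eq_or_ne τ t with rfl | hne
  · exact le_self_add
  have h2 := hτ ⟨hS, hne⟩
  have h3 : y τ = y t + (τ - t) • (((τ - t)⁻¹ • (y τ - y t) - y') + y') := by
    rw [sub_add_cancel, smul_smul, mul_inv_cancel₀ (sub_ne_zero.2 hne), one_smul, add_sub_cancel]
  rw [h3]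
  refine (hN.add_le _ _).trans (add_le_add_right ?_ _)
  rw [hN.smul]
  have h4 : ‖τ - t‖ₑ ≤ 1 := by
    rw [← ofReal_norm, ← ENNReal.ofReal_one]
    exact ENNReal.ofReal_le_ofReal (by rw [← dist_eq_norm]; exact (Metric.mem_ball.1 hb).le)
  calc _ ≤ 1 * (1 + N y') := by
        gcongr
        exact (hN.add_le _ _).trans (by gcongr)
    _ = _ := one_mul _

variable {α κ s : ℝ} {f : ℝ → ℝ} {u₀ v₀ : L2} {u v : ℝ → L2}

/-- Solutions of the system in terms of the variables `u` and `z = T⁻¹ v`. -/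
lemma IsSolution.exists_flow (h : Par α κ) (hs : 0 ≤ s) (H : IsSolution α κ f s u₀ v₀ u v) :
    ∃ z w : ℝ → L2, ∀ t, 0 ≤ t → h.T (z t) = v t ∧ (∀ᵐ x, w t x = f (u t x)) ∧
      HasDerivWithinAt u (h.P (z t)) (Set.Ici 0) t ∧
      HasDerivWithinAt z (h.P (u t) + h.S (w t)) (Set.Ici 0) t := by
  obtain ⟨-, -, u', v', hC, hE⟩ := H
  obtain ⟨C, hC0, HT⟩ := h.exists_inv_T
  have h1 : ∀ t, 0 ≤ t → hNorm 1 (v t) < ⊤ := fun t ht =>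
    (hNorm_mono (by linarith) _).trans_lt (ENNReal.add_lt_top.1 (hC.mem t ht)).2
  have h1' : ∀ t, 0 ≤ t → hNorm 1 (v' t) < ⊤ := fun t ht =>
    (hNorm_mono (by linarith) _).trans_lt (ENNReal.add_lt_top.1 (hC.mem_deriv t ht)).2
  choose! z hz using fun t (ht : 0 ≤ t) => (HT (v t) (h1 t ht)).imp fun z hz => hz.1
  choose! w hw using fun t (ht : 0 ≤ t) => (hE t ht).2
  refine ⟨z, w, fun t ht => ⟨hz t ht, (hw t ht).1, ?_, ?_⟩⟩
  · have e : u' t = h.P (z t) := ft_ext (by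
      have h2 := h.isDx (z t)
      rw [hz t ht] at h2
      filter_upwards [(hE t ht).1, h2] with ξ e1 e2
      rw [e1, e2])
    rw [← e]
    exact hasDerivWithinAt_of_enorm (fun τ => (enorm_le_hNorm hs _).trans le_self_add)
      (hC.hasDeriv t ht)
  · have e : h.T (h.P (u t) + h.S (w t)) = v' t := ft_ext (by
      filter_upwards [h.isForce (u t) (w t), (hw t ht).2] with ξ e1 e2
      rw [e1, e2])
    have hE' : Tendsto (fun τ => ENNReal.ofReal C
        * hNorm (s + 1) ((τ - t)⁻¹ • (v τ - v t) - v' t)) (𝓝[Set.Ici 0 \ {t}] t) (𝓝 0) := by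
      have h2 := ENNReal.Tendsto.const_mul (a := ENNReal.ofReal C)
        (tendsto_of_tendsto_of_tendsto_of_le_of_le tendsto_const_nhds (hC.hasDeriv t ht)
          (fun _ => zero_le) fun τ => le_add_self) (Or.inr (by simp))
      rwa [mul_zero] at h2
    rw [hasDerivWithinAt_iff_tendsto_slope, tendsto_iff_edist_tendsto_0]
    refine tendsto_of_tendsto_of_tendsto_of_le_of_le' tendsto_const_nhds hE'
      (Eventually.of_forall fun _ => zero_le) ?_
    filter_upwards [self_mem_nhdsWithin] with τ hτ
    rw [edist_eq_enorm_sub]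
    change ‖(τ - t)⁻¹ • (z τ - z t) - _‖ₑ ≤ _
    set Z := (τ - t)⁻¹ • (z τ - z t) - (h.P (u t) + h.S (w t)) with hZ
    have e2 : h.T Z = (τ - t)⁻¹ • (v τ - v t) - v' t := by
      rw [hZ, map_sub, map_smul, map_sub, hz τ hτ.1, hz t ht, e]
    have h3 : hNorm 1 ((τ - t)⁻¹ • (v τ - v t) - v' t) < ⊤ := by
      have bn := ballNorm_hNorm 1
      refine (bn.sub_le _ _).trans_lt (ENNReal.add_lt_top.2 ⟨?_, h1' t ht⟩)
      rw [bn.smul]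
      exact ENNReal.mul_lt_top (by simp) ((bn.sub_le _ _).trans_lt
        (ENNReal.add_lt_top.2 ⟨h1 τ hτ.1, h1 t ht⟩))
    obtain ⟨Z', hZ', hle⟩ := HT _ h3
    have e3 : Z' = Z := h.T_injective (hZ'.trans e2.symm)
    rw [← e3]
    exact (enorm_le_hNorm hs _).trans (hle s)

/-- Local bounds in `H^s` are glued by compactness of `[0, b]`. They allow an arbitrary solution to
be compared with the truncated equation, without any smallness. -/
lemma IsSolution.exists_bound (hs : 1 / 2 < s) (H : IsSolution α κ f s u₀ v₀ u v) (b : ℝ) :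
    ∃ A : ℝ, ∀ t ∈ Set.Icc 0 b, eLpNorm (u t) ⊤ volume ≤ ENNReal.ofReal A := by
  obtain ⟨-, -, u', v', hC, -⟩ := H
  obtain ⟨C, hC0, HS⟩ := exists_sobolev hs
  have hlim := fun t ht => tendsto_of_tendsto_of_tendsto_of_le_of_le tendsto_const_nhds
    (hC.hasDeriv t ht) (fun _ => zero_le)
    (fun τ => (le_self_add : hNorm s ((τ - t)⁻¹ • (u τ - u t) - u' t) ≤ _))
  obtain ⟨M, hM⟩ : ∃ M : ℝ, ∀ t ∈ Set.Icc 0 b, hNorm s (u t) ≤ ENNReal.ofReal M := by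
    refine isCompact_Icc.induction_on (p := fun S => ∃ M : ℝ, ∀ t ∈ S, hNorm s (u t) ≤ ENNReal.ofReal M)
      ⟨0, fun t ht => ht.elim⟩ (fun S S' hSS ⟨M, hM⟩ => ⟨M, fun t ht => hM t (hSS ht)⟩)
      (fun S S' ⟨M, hM⟩ ⟨M', hM'⟩ => ⟨max M M', fun t ht => ?_⟩) fun t ht => ?_
    · rcases ht with ht | ht
      · exact (hM t ht).trans (ENNReal.ofReal_le_ofReal (le_max_left _ _))
      · exact (hM' t ht).trans (ENNReal.ofReal_le_ofReal (le_max_right _ _))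
    · obtain ⟨M, hM⟩ := (ballNorm_hNorm s).eventually_le
        (ENNReal.add_lt_top.1 (hC.mem t ht.1)).1 (ENNReal.add_lt_top.1 (hC.mem_deriv t ht.1)).1
        (hlim t ht.1)
      exact ⟨_, nhdsWithin_mono t Set.Icc_subset_Ici_self hM, M, fun τ hτ => hτ⟩
  refine ⟨C * M, fun t ht => (HS _).trans ?_⟩
  rw [ENNReal.ofReal_mul hC0.le]
  exact mul_le_mul_right (hM t ht) _

/-- Solutions are determined by their initial values. -/
theorem IsSolution.unique (h : Par α κ) (hs : 1 / 2 < s) (hf : ContDiff ℝ 1 f) (hf0 : f 0 = 0)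
    {u₁ v₁ u₂ v₂ : ℝ → L2} (H₁ : IsSolution α κ f s u₀ v₀ u₁ v₁)
    (H₂ : IsSolution α κ f s u₀ v₀ u₂ v₂) {t : ℝ} (ht : 0 ≤ t) : u₁ t = u₂ t ∧ v₁ t = v₂ t := by
  obtain ⟨z₁, w₁, F₁⟩ := H₁.exists_flow h (by linarith)
  obtain ⟨z₂, w₂, F₂⟩ := H₂.exists_flow h (by linarith)
  obtain ⟨A₁, hA₁⟩ := H₁.exists_bound hs t
  obtain ⟨A₂, hA₂⟩ := H₂.exists_bound hs t
  set A := max 0 (max A₁ A₂) with hA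
  obtain ⟨K, N, hNL, -, -, hN⟩ := exists_trunc hf hf0 (le_max_left 0 (max A₁ A₂))
  have hAle : ∀ {B}, B ≤ max A₁ A₂ → ENNReal.ofReal B ≤ ENNReal.ofReal A := fun hB =>
    ENNReal.ofReal_le_ofReal (hB.trans (le_max_right _ _))
  -- Truncating above both solutions gives a globally Lipschitz vector field on `L² × L²` that both
  -- follow on `[0, t]`.
  let V : L2 × L2 → L2 × L2 := fun y => (h.P y.2, h.P y.1 + h.S (N y.1))
  obtain ⟨L, hV⟩ : ∃ L, LipschitzWith L V := by
    have l1 : LipschitzWith _ fun y : L2 × L2 => h.P y.2 := h.P.lipschitz.comp LipschitzWith.prod_snd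
    have l2 : LipschitzWith _ fun y : L2 × L2 => h.P y.1 := h.P.lipschitz.comp LipschitzWith.prod_fst
    have l3 : LipschitzWith _ fun y : L2 × L2 => h.S (N y.1) :=
      h.S.lipschitz.comp (hNL.comp LipschitzWith.prod_fst)
    exact ⟨_, l1.prodMk (l2.add l3)⟩
  have key : ∀ {u z w : ℝ → L2}, (∀ τ ∈ Set.Icc 0 t, eLpNorm (u τ) ⊤ volume ≤ ENNReal.ofReal A) →
      (∀ τ, 0 ≤ τ → (∀ᵐ x, w τ x = f (u τ x)) ∧
      HasDerivWithinAt u (h.P (z τ)) (Set.Ici 0) τ ∧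
      HasDerivWithinAt z (h.P (u τ) + h.S (w τ)) (Set.Ici 0) τ) →
      (∀ τ ∈ Set.Icc 0 t, HasDerivWithinAt (fun τ => (u τ, z τ)) (V (u τ, z τ)) (Set.Ici 0) τ) := by
    intro u z w hu F τ hτ
    obtain ⟨F1, F2, F3⟩ := F τ hτ.1
    have e : N (u τ) = w τ := ae_unique (hN _ (hu τ hτ)) F1
    have := F2.prodMk F3
    rwa [← e] at this
  have k₁ := key (fun τ hτ => (hA₁ τ hτ).trans (hAle (le_max_left _ _))) fun τ hτ => (F₁ τ hτ).2
  have k₂ := key (fun τ hτ => (hA₂ τ hτ).trans (hAle (le_max_right _ _))) fun τ hτ => (F₂ τ hτ).2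
  have e0 : z₁ 0 = z₂ 0 := h.T_injective (by
    rw [(F₁ 0 le_rfl).1, (F₂ 0 le_rfl).1, H₁.2.1, H₂.2.1])
  have := ODE_solution_unique (v := fun _ => V) (K := L) (a := 0) (b := t) (fun _ => hV)
    (fun τ hτ => (k₁ τ hτ).continuousWithinAt.mono Set.Icc_subset_Ici_self)
    (fun τ hτ => (k₁ τ (Set.Ico_subset_Icc_self hτ)).mono (Set.Ici_subset_Ici.2 hτ.1))
    (fun τ hτ => (k₂ τ hτ).continuousWithinAt.mono Set.Icc_subset_Ici_self)
    (fun τ hτ => (k₂ τ (Set.Ico_subset_Icc_self hτ)).mono (Set.Ici_subset_Ici.2 hτ.1))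
    (by rw [H₁.1, H₂.1, e0]) ⟨ht, le_rfl⟩
  have e1 : u₁ t = u₂ t := congrArg Prod.fst this
  have e2 : z₁ t = z₂ t := congrArg Prod.snd this
  exact ⟨e1, by rw [← (F₁ t ht).1, ← (F₂ t ht).1, e2]⟩
end

section
open scoped NNReal ComplexConjugate

/-! ### Conservation of the energy -/

/-- Plancherel's formula in the form used for symmetry relations of multipliers; `ε = -1` encodes
skew-adjointness. -/
lemma inner_eq_of_ft {a b c d : L2} (ε : ℝ)
    (H : ∀ᵐ ξ, conj (ft a ξ) * ft b ξ = ε * (conj (ft c ξ) * ft d ξ)) :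
    inner ℝ a b = ε * inner ℝ c d := by
  have h1 := inner_ft a b
  have h2 := inner_ft c d
  rw [L2.inner_def] at h1 h2
  have h3 : ∫ ξ, inner ℂ (ft a ξ) (ft b ξ) = ε * ∫ ξ, inner ℂ (ft c ξ) (ft d ξ) := by
    rw [← integral_const_mul]
    refine integral_congr_ae ?_
    filter_upwards [H] with ξ hξ
    simp only [RCLike.inner_apply']
    exact hξ
  rw [h1, h2] at h3
  exact_mod_cast h3

/-- The indicator function of `[-n, n]`. -/
def window (n : ℕ) (ζ : ℝ) : ℝ := if |ζ| ≤ n then 1 else 0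

lemma window_neg (n : ℕ) (ζ : ℝ) : window n (-ζ) = window n ζ := by simp [window]
lemma window_nonneg (n : ℕ) (ζ : ℝ) : 0 ≤ window n ζ := by unfold window; split_ifs <;> norm_num
lemma window_le_one (n : ℕ) (ζ : ℝ) : window n ζ ≤ 1 := by unfold window; split_ifs <;> norm_num
lemma window_sq (n : ℕ) (ζ : ℝ) : window n ζ * window n ζ = window n ζ := by
  unfold window; split_ifs <;> norm_num
lemma measurable_window (n : ℕ) : Measurable (window n) :=
  Measurable.ite (measurableSet_le (by fun_prop) measurable_const) measurable_const measurable_const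
lemma window_eventually (ζ : ℝ) : ∀ᶠ n : ℕ in atTop, window n ζ = 1 := by
  obtain ⟨N, hN⟩ := exists_nat_gt |ζ|
  filter_upwards [eventually_ge_atTop N] with n hn
  have : (N : ℝ) ≤ n := by exact_mod_cast hn
  rw [window, if_pos (by linarith)]
lemma window_mono (ζ : ℝ) : Monotone fun n => window n ζ := by
  intro a b hab
  have : (a : ℝ) ≤ b := by exact_mod_cast hab
  simp only [window]
  split_ifs <;> norm_num
  linarith

/-- The sharp frequency cut-off. -/
def windowOp (n : ℕ) : L2 →L[ℝ] L2 :=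
  (BSym.ofEven (window n) (measurable_window n) (window_neg n) ⟨1, fun ζ => by
    rw [abs_of_nonneg (window_nonneg n ζ)]; exact window_le_one n ζ⟩).op

lemma ft_windowOp (n : ℕ) (g : L2) :
    ∀ᵐ ξ, ft (windowOp n g) ξ = (window n (2 * Real.pi * ξ) : ℝ) * ft g ξ := BSym.ft_op _ g

lemma norm_windowOp_le (n : ℕ) (g : L2) : ‖windowOp n g‖ ≤ ‖g‖ := by
  have := norm_le_of_ft (w := windowOp n g) (g := g) zero_le_one (by
    filter_upwards [ft_windowOp n g] with ξ hξ
    rw [hξ, norm_mul, Complex.norm_real, Real.norm_of_nonneg (window_nonneg _ _)]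
    gcongr
    exact window_le_one _ _)
  rwa [one_mul] at this

lemma tendsto_windowOp (g : L2) : Tendsto (fun n => windowOp n g) atTop (𝓝 g) := by
  rw [tendsto_iff_edist_tendsto_0]
  have h1 : ∀ n, edist (windowOp n g) g ^ 2
      = ∫⁻ ξ, ‖(window n (2 * Real.pi * ξ) - 1 : ℝ)‖ₑ ^ 2 * ‖ft g ξ‖ₑ ^ 2 := fun n => by
    rw [edist_eq_enorm_sub, enorm_sq_eq]
    refine lintegral_congr_ae ?_
    filter_upwards [ft_sub_ae (windowOp n g) g, ft_windowOp n g] with ξ e1 e2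
    have e3 : ft (windowOp n g - g) ξ = ((window n (2 * Real.pi * ξ) - 1 : ℝ) : ℂ) * ft g ξ := by
      rw [e1, e2]; push_cast; ring
    rw [e3, enorm_mul, mul_pow]
    simp only [← ofReal_norm, Complex.norm_real]
  have h2 := tendsto_lintegral_of_dominated_convergence (μ := volume)
    (F := fun (n : ℕ) (ξ : ℝ) => ‖(window n (2 * Real.pi * ξ) - 1 : ℝ)‖ₑ ^ 2 * ‖ft g ξ‖ₑ ^ 2)
    (f := fun _ => 0) (fun ξ => ‖ft g ξ‖ₑ ^ 2)
    (fun n => ((((measurable_window n).comp (measurable_const_mul _)).sub_const 1).enorm.pow_const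
      2).mul (measurable_ft_sq g))
    (fun n => Eventually.of_forall fun ξ => by
      refine mul_le_of_le_one_left zero_le (pow_le_one₀ zero_le ?_)
      rw [← ofReal_norm, ← ENNReal.ofReal_one]
      refine ENNReal.ofReal_le_ofReal (abs_le.2 ?_)
      have := window_nonneg n (2 * Real.pi * ξ)
      have := window_le_one n (2 * Real.pi * ξ)
      constructor <;> linarith)
    (by rw [← enorm_sq_eq]; finiteness)
    (Eventually.of_forall fun ξ => by
      refine tendsto_const_nhds.congr' ?_
      filter_upwards [window_eventually (2 * Real.pi * ξ)] with n hn
      rw [hn]; simp)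
  rw [lintegral_zero] at h2
  simp_rw [← h1] at h2
  have h5 := h2.ennrpow_const (1 / 2)
  simp only [← ENNReal.rpow_natCast, ← ENNReal.rpow_mul] at h5
  norm_num at h5
  exact h5

section
variable {f : ℝ → ℝ} {K : ℝ≥0}

lemma abs_primitive_sub_le (hf : LipschitzWith K f) (a b : ℝ) :
    |primitive f b - primitive f a - f a * (b - a)| ≤ K * |b - a| ^ 2 := by
  have hi : ∀ a b, IntervalIntegrable f volume a b := fun a b => hf.continuous.intervalIntegrable a b
  have e : primitive f b - primitive f a - f a * (b - a) = ∫ τ in a..b, (f τ - f a) := by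
    rw [intervalIntegral.integral_sub (hi a b) intervalIntegrable_const,
      intervalIntegral.integral_const, smul_eq_mul, primitive, primitive,
      intervalIntegral.integral_interval_sub_left (hi _ _) (hi _ _)]
    ring
  rw [e, sq, ← mul_assoc]
  refine intervalIntegral.norm_integral_le_of_norm_le_const (E := ℝ) fun τ hτ => ?_
  refine (hf.norm_sub_le τ a).trans (mul_le_mul_of_nonneg_left ?_ K.2)
  rw [Real.norm_eq_abs]
  exact Set.abs_sub_left_of_mem_uIcc (Set.uIoc_subset_uIcc hτ)

lemma abs_primitive_le (hf : LipschitzWith K f) (h0 : f 0 = 0) (b : ℝ) :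
    |primitive f b| ≤ K * |b| ^ 2 := by
  have := abs_primitive_sub_le hf 0 b
  simpa [h0, primitive] using! this

lemma continuous_primitive (hf : Continuous f) : Continuous (primitive f) :=
  intervalIntegral.continuous_primitive (fun a b => hf.intervalIntegrable a b) 0

lemma integrable_sq (u : L2) : Integrable fun x => |u x| ^ 2 := by
  simpa using (Lp.memLp u).integrable_sq

lemma integrable_primitive (hf : LipschitzWith K f) (h0 : f 0 = 0) (u : L2) :
    Integrable fun x => primitive f (u x) := by
  refine ((integrable_sq u).const_mul (K : ℝ)).mono'
    ((continuous_primitive hf.continuous).comp_aestronglyMeasurable (Lp.aestronglyMeasurable u))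
    (Eventually.of_forall fun x => abs_primitive_le hf h0 _)

lemma inner_eq_integral (a b : L2) : inner ℝ a b = ∫ x, a x * b x := by
  rw [L2.inner_def]
  simp only [RCLike.inner_apply', conj_trivial]

lemma integrable_mul (a b : L2) : Integrable fun x => a x * b x :=
  (Lp.memLp a).integrable_mul (Lp.memLp b)

lemma norm_sq_eq_integral (a : L2) : ‖a‖ ^ 2 = ∫ x, |a x| ^ 2 := by
  rw [← real_inner_self_eq_norm_sq, inner_eq_integral]
  simp only [sq, abs_mul_abs_self]

/-- The derivative of `u ↦ ∫ F(u)`. -/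
lemma hasFDerivAt_integral_primitive (hf : LipschitzWith K f) (h0 : f 0 = 0) (u : L2) :
    HasFDerivAt (fun u : L2 => ∫ x, primitive f (u x)) (innerSL ℝ (hf.compLp h0 u)) u := by
  rw [hasFDerivAt_iff_isLittleO_nhds_zero]
  have hO : (fun g : L2 => (∫ x, primitive f ((u + g) x)) - (∫ x, primitive f (u x))
      - innerSL ℝ (hf.compLp h0 u) g) =O[𝓝 0] fun g : L2 => ‖g‖ ^ 2 := by
    refine Asymptotics.IsBigO.of_bound K (Eventually.of_forall fun g => ?_)
    have i1 := integrable_primitive hf h0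
    have e : (∫ x, primitive f ((u + g) x)) - (∫ x, primitive f (u x))
        - ∫ x, hf.compLp h0 u x * g x
        = ∫ x, (primitive f ((u + g) x) - primitive f (u x) - hf.compLp h0 u x * g x) := by
      rw [integral_sub (f := fun x => primitive f ((u + g) x) - primitive f (u x))
        ((i1 _).sub (i1 _)) (integrable_mul _ _), integral_sub (i1 _) (i1 _)]
    rw [innerSL_apply_apply, inner_eq_integral, e, norm_pow, norm_norm, norm_sq_eq_integral, ← integral_const_mul]
    refine norm_integral_le_of_norm_le ((integrable_sq g).const_mul _) ?_
    filter_upwards [Lp.coeFn_add u g, hf.coeFn_compLp h0 u] with x h1 h2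
    have := abs_primitive_sub_le hf (u x) (u x + g x)
    rw [add_sub_cancel_left] at this
    rw [h1, h2, Pi.add_apply]
    exact this
  refine hO.trans_isLittleO ?_
  have := (Asymptotics.isLittleO_pow_id (𝕜 := ℝ) one_lt_two).comp_tendsto
    (tendsto_norm_zero (E := L2))
  exact this.norm_right.congr (fun _ => rfl) (fun g => by simp) |>.of_norm_right

end

section
variable {α κ : ℝ} (h : Par α κ)

/-- The square root of the truncated energy density. -/
def Par.enOp (n : ℕ) : L2 →L[ℝ] L2 :=
  (BSym.ofEven (fun ζ => window n ζ * rD α ζ)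
    ((measurable_window n).mul continuous_rD.measurable)
    (fun ζ => by rw [window_neg, rD_neg]) ⟨rD α n, fun ζ => by
      have := rD_pos h.nonneg.1 n
      unfold window
      split_ifs with hz
      · rw [one_mul, abs_of_pos (rD_pos h.nonneg.1 ζ)]
        refine Real.sqrt_le_sqrt ?_
        have := h.nonneg.1
        have : ζ ^ 2 ≤ (n : ℝ) ^ 2 := sq_le_sq' (by linarith [(abs_le.1 hz).1]) (abs_le.1 hz).2
        gcongr
      · rw [zero_mul, abs_zero]; exact this.le⟩).op

lemma Par.ft_enOp (n : ℕ) (g : L2) : ∀ᵐ ξ, ft (h.enOp n g) ξ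
    = (window n (2 * Real.pi * ξ) * rD α (2 * Real.pi * ξ) : ℝ) * ft g ξ := BSym.ft_op _ g

/-- The symbol of `P` is purely imaginary, so `P` is skew-adjoint, and it commutes with the real
multiplier `enOp`. -/
lemma Par.inner_enOp_P (n : ℕ) (a b : L2) :
    inner ℝ (h.enOp n a) (h.enOp n (h.P b)) = - inner ℝ (h.enOp n b) (h.enOp n (h.P a)) := by
  rw [real_inner_comm (h.enOp n (h.P a))]
  have := inner_eq_of_ft (a := h.enOp n a) (b := h.enOp n (h.P b)) (c := h.enOp n (h.P a))
    (d := h.enOp n b) (-1) (by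
    filter_upwards [h.ft_enOp n a, h.ft_enOp n b, h.ft_enOp n (h.P a), h.ft_enOp n (h.P b),
      h.ft_P a, h.ft_P b] with ξ h1 h2 h3 h4 h5 h6
    rw [h1, h2, h3, h4, h5, h6]
    simp only [map_mul, Complex.conj_ofReal, Complex.conj_I]
    push_cast; ring)
  rw [this]; ring

/-- The product `rD² sig` equals `phi`: after weighting with `L_D`, the forcing operator becomes
`P`, that is, the nonlinearity is paired with `u'`. -/
lemma Par.inner_enOp_S (n : ℕ) (a b : L2) :
    inner ℝ (h.enOp n a) (h.enOp n (h.S b)) = - inner ℝ b (windowOp n (h.P a)) := by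
  rw [real_inner_comm (windowOp n (h.P a))]
  have := inner_eq_of_ft (a := h.enOp n a) (b := h.enOp n (h.S b)) (c := windowOp n (h.P a))
    (d := b) (-1) (by
    filter_upwards [h.ft_enOp n a, h.ft_enOp n (h.S b), ft_windowOp n (h.P a), h.ft_S b,
      h.ft_P a] with ξ h1 h2 h3 h4 h5
    rw [h1, h2, h3, h4, h5]
    simp only [map_mul, Complex.conj_ofReal, Complex.conj_I]
    have e1 : (rD α (2 * Real.pi * ξ) : ℂ) ≠ 0 := by exact_mod_cast (rD_pos h.nonneg.1 _).ne'
    have e2 : (rR κ (2 * Real.pi * ξ) : ℂ) ≠ 0 := by exact_mod_cast (rR_pos h.nonneg.2 _).ne'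
    have e3 : (window n (2 * Real.pi * ξ) : ℂ) * window n (2 * Real.pi * ξ)
        = window n (2 * Real.pi * ξ) := by exact_mod_cast window_sq n _
    rw [phi, sig]
    push_cast
    field_simp
    linear_combination conj (ft a ξ) * ξ * ft b ξ * e3)
  rw [this]; ring

/-- The quadratic part of the energy. -/
def kinetic (α : ℝ) (u z : L2) : ℝ≥0∞ :=
  ∫⁻ ξ, ENNReal.ofReal (1 + α * (2 * Real.pi * ξ) ^ 2) * (‖ft u ξ‖ₑ ^ 2 + ‖ft z ξ‖ₑ ^ 2)

lemma Par.tendsto_enOp (u z : L2) :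
    Tendsto (fun n => ENNReal.ofReal (‖h.enOp n u‖ ^ 2 + ‖h.enOp n z‖ ^ 2)) atTop
      (𝓝 (kinetic α u z)) := by
  have e : ∀ n, ENNReal.ofReal (‖h.enOp n u‖ ^ 2 + ‖h.enOp n z‖ ^ 2)
      = ∫⁻ ξ, ENNReal.ofReal (window n (2 * Real.pi * ξ)) * (ENNReal.ofReal (1 + α * (2 * Real.pi * ξ) ^ 2)
        * (‖ft u ξ‖ₑ ^ 2 + ‖ft z ξ‖ₑ ^ 2)) := fun n => by
    rw [ENNReal.ofReal_add (by positivity) (by positivity), ENNReal.ofReal_pow (norm_nonneg _),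
      ENNReal.ofReal_pow (norm_nonneg _), ofReal_norm, ofReal_norm, enorm_sq_eq, enorm_sq_eq,
      ← lintegral_add_left (measurable_ft_sq _)]
    refine lintegral_congr_ae ?_
    filter_upwards [h.ft_enOp n u, h.ft_enOp n z] with ξ h1 h2
    have h3 : ‖((window n (2 * Real.pi * ξ) * rD α (2 * Real.pi * ξ) : ℝ) : ℂ)‖ₑ ^ 2
        = ENNReal.ofReal (window n (2 * Real.pi * ξ))
          * ENNReal.ofReal (1 + α * (2 * Real.pi * ξ) ^ 2) := by
      rw [← ofReal_norm, Complex.norm_real, ← ENNReal.ofReal_pow (norm_nonneg _), Real.norm_eq_abs,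
        sq_abs, mul_pow, rD_sq h.nonneg.1, sq, window_sq, ENNReal.ofReal_mul (window_nonneg _ _)]
    rw [h1, h2, enorm_mul, enorm_mul, mul_pow, mul_pow, h3]
    ring
  simp_rw [e]
  refine lintegral_tendsto_of_tendsto_of_monotone (fun n => ?_) (Eventually.of_forall fun ξ a b hab => ?_)
    (Eventually.of_forall fun ξ => ?_)
  · exact (ENNReal.measurable_ofReal.comp ((measurable_window n).comp
      (measurable_const_mul _))).aemeasurable.mul (((Measurable.ennreal_ofReal (by fun_prop)).mul
        ((measurable_ft_sq u).add (measurable_ft_sq z))).aemeasurable)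
  · exact mul_le_mul_left (ENNReal.ofReal_le_ofReal (window_mono _ hab)) _
  · refine tendsto_const_nhds.congr' ?_
    filter_upwards [window_eventually (2 * Real.pi * ξ)] with n hn
    rw [hn, ENNReal.ofReal_one, one_mul]

/-- Since `L_R T² = L_D`, the part of the energy in `v` is the `L_D`-weighted norm of `z`, and the
quadratic energy is symmetric in `u` and `z`. -/
lemma Par.kinetic_eq (u z : L2) : derivSq 0 (h.T z) + derivSq 1 (h.T z)
    + ENNReal.ofReal κ * derivSq 2 (h.T z) + derivSq 0 u + ENNReal.ofReal α * derivSq 1 u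
      = kinetic α u z := by
  have hα := h.nonneg.1
  have hκ := h.nonneg.2
  have meas : ∀ (k : ℕ) (g : L2), Measurable fun ξ : ℝ =>
      ENNReal.ofReal ((2 * Real.pi * ξ) ^ (2 * k)) * ‖ft g ξ‖ₑ ^ 2 := fun k g =>
    (Measurable.ennreal_ofReal (by fun_prop)).mul (measurable_ft_sq g)
  simp only [derivSq]
  rw [← lintegral_const_mul _ (meas 2 _), ← lintegral_const_mul _ (meas 1 _),
    ← lintegral_add_right _ (meas 1 _), ← lintegral_add_right _ ((meas 2 _).const_mul _),
    ← lintegral_add_right _ (meas 0 _), ← lintegral_add_right _ ((meas 1 _).const_mul _), kinetic]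
  refine lintegral_congr_ae ?_
  filter_upwards [h.ft_T z] with ξ h1
  have e : ∀ g : ℂ, ‖g‖ₑ ^ 2 = ENNReal.ofReal (‖g‖ ^ 2) := fun g => by
    rw [ENNReal.ofReal_pow (norm_nonneg _), ofReal_norm]
  have p0 : ∀ k, 0 ≤ (2 * Real.pi * ξ) ^ (2 * k) := fun k => (even_two_mul k).pow_nonneg _
  have p1 := p0 1
  have p2 := p0 2
  rw [h1, e, e, e, norm_mul, Complex.norm_real, Real.norm_eq_abs,
    mul_pow |omg α κ (2 * Real.pi * ξ)|, sq_abs]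
  simp only [mul_zero, pow_zero, mul_one] at p1 p2 ⊢
  have e3 : omg α κ (2 * Real.pi * ξ) ^ 2 * (1 + (2 * Real.pi * ξ) ^ 2 + κ * (2 * Real.pi * ξ) ^ 4)
      = 1 + α * (2 * Real.pi * ξ) ^ 2 := by
    rw [omg, div_pow, ← rR_sq hκ, ← rD_sq hα, div_mul_cancel₀]
    exact pow_ne_zero _ (rR_pos hκ _).ne'
  have hη : 0 ≤ 1 + α * (2 * Real.pi * ξ) ^ 2 := by positivity
  rw [← ENNReal.ofReal_mul zero_le_one, ← ENNReal.ofReal_mul p1, ← ENNReal.ofReal_mul p2,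
    ← ENNReal.ofReal_mul hκ, ← ENNReal.ofReal_mul zero_le_one, ← ENNReal.ofReal_mul p1,
    ← ENNReal.ofReal_mul hα, ← ENNReal.ofReal_add (by positivity) (by positivity),
    ← ENNReal.ofReal_add (by positivity) (by positivity),
    ← ENNReal.ofReal_add (by positivity) (by positivity),
    ← ENNReal.ofReal_add (by positivity) (by positivity),
    ← ENNReal.ofReal_add (by positivity) (by positivity), ← ENNReal.ofReal_mul hη]
  congr 1
  norm_num
  linear_combination ‖ft z ξ‖ ^ 2 * e3

end
end

/-! ### The energy identity along the flow -/

section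
open scoped NNReal

variable {α κ s M : ℝ} {h : Par α κ} {f : ℝ → ℝ} {u z w : ℝ → L2}

lemma primitive_clamp {A y : ℝ} (hy : |y| ≤ A) :
    primitive (fun y => f (clamp A y)) y = primitive f y := by
  refine intervalIntegral.integral_congr fun τ hτ => ?_
  have : |τ| ≤ |y| := by simpa using! Set.abs_sub_left_of_mem_uIcc hτ
  simp only [clamp_eq (this.trans hy)]

/-- The truncated energy identity. -/
lemma IsFlow.hasDerivAt_enOp (H : IsFlow h s f M u z w) (n : ℕ) (t : ℝ) :
    HasDerivAt (fun τ => ‖h.enOp n (u τ)‖ ^ 2 + ‖h.enOp n (z τ)‖ ^ 2)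
      (-2 * inner ℝ (w t) (windowOp n (h.P (z t)))) t := by
  have h1 := ((h.enOp n).hasFDerivAt.comp_hasDerivAt t (H.deriv_u t)).norm_sq
  have h2 := ((h.enOp n).hasFDerivAt.comp_hasDerivAt t (H.deriv_z t)).norm_sq
  refine (h1.add h2).congr_deriv ?_
  have e1 := h.inner_enOp_P n (u t) (z t)
  have e2 := h.inner_enOp_S n (z t) (w t)
  simp only [Function.comp_apply, map_add, inner_add_right]
  linarith

/-- The derivative of the truncated energy is the pairing of `f(u)` with the high frequencies of `P
z`. It tends to zero pointwise in time and is dominated on `[0, t]`. Only the difference of two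
truncated energies is considered, because the energy itself may be infinite. -/
theorem IsFlow.tendsto_energy (H : IsFlow h s f M u z w) (hf : ContDiff ℝ 1 f) (hf0 : f 0 = 0)
    {A : ℝ} (hA : 0 ≤ A) (hu : ∀ t, 0 ≤ t → eLpNorm (u t) ⊤ volume ≤ ENNReal.ofReal A) {t : ℝ}
    (ht : 0 ≤ t) : (∀ t, 0 ≤ t → Integrable fun x => primitive f (u t x)) ∧
    Tendsto (fun n => ((‖h.enOp n (u t)‖ ^ 2 + ‖h.enOp n (z t)‖ ^ 2) / 2
        + ∫ x, primitive f (u t x)) - ((‖h.enOp n (u 0)‖ ^ 2 + ‖h.enOp n (z 0)‖ ^ 2) / 2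
        + ∫ x, primitive f (u 0 x))) atTop (𝓝 0) := by
  obtain ⟨K, hK⟩ := exists_lipschitz_clamp hf hA
  have h0 : f (clamp A 0) = 0 := by rw [clamp_eq (by simpa using hA), hf0]
  have hNw : ∀ t, 0 ≤ t → hK.compLp h0 (u t) = w t := fun t ht => ae_unique (F := fun x => f (u t x))
    (by
      filter_upwards [hK.coeFn_compLp h0 (u t), abs_le_of_eLpNorm_top hA (hu t ht)] with x h1 h2
      rw [h1, Function.comp_apply, clamp_eq h2]) (H.comp t ht)
  have hF : ∀ t, 0 ≤ t →
      (fun x => primitive (fun y => f (clamp A y)) (u t x)) =ᵐ[volume] fun x => primitive f (u t x) :=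
    fun t ht => by
      filter_upwards [abs_le_of_eLpNorm_top hA (hu t ht)] with x h2
      exact primitive_clamp h2
  refine ⟨fun t ht => (integrable_primitive hK h0 (u t)).congr (hF t ht), ?_⟩
  rw [← integral_congr_ae (hF t ht), ← integral_congr_ae (hF 0 le_rfl)]
  have hd : ∀ τ, HasDerivAt (fun τ => ∫ x, primitive (fun y => f (clamp A y)) (u τ x))
      (inner ℝ (hK.compLp h0 (u τ)) (h.P (z τ))) τ := fun τ =>
    (hasFDerivAt_integral_primitive hK h0 (u τ)).comp_hasDerivAt τ (H.deriv_u τ)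
  have hcw := H.cont
  have hcz := H.cont_Pz
  have key : ∀ n : ℕ, ((‖h.enOp n (u t)‖ ^ 2 + ‖h.enOp n (z t)‖ ^ 2) / 2
        + ∫ x, primitive (fun y => f (clamp A y)) (u t x))
        - ((‖h.enOp n (u 0)‖ ^ 2 + ‖h.enOp n (z 0)‖ ^ 2) / 2
        + ∫ x, primitive (fun y => f (clamp A y)) (u 0 x))
      = ∫ τ in (0 : ℝ)..t, inner ℝ (w τ) (h.P (z τ) - windowOp n (h.P (z τ))) := fun n => by
    symm
    refine intervalIntegral.integral_eq_sub_of_hasDerivAt (f := fun τ =>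
      (‖h.enOp n (u τ)‖ ^ 2 + ‖h.enOp n (z τ)‖ ^ 2) / 2
        + ∫ x, primitive (fun y => f (clamp A y)) (u τ x)) (fun τ hτ => ?_) ?_
    · rw [Set.uIcc_of_le ht] at hτ
      refine (((H.hasDerivAt_enOp n τ).div_const 2).add (hd τ)).congr_deriv ?_
      rw [hNw τ hτ.1, inner_sub_right]; ring
    · exact (hcw.inner (hcz.sub ((windowOp n).continuous.comp hcz))).intervalIntegrable _ _
  simp_rw [key]
  have := intervalIntegral.tendsto_integral_filter_of_dominated_convergence (μ := volume) (a := 0)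
    (b := t) (l := atTop) (F := fun (n : ℕ) τ => inner ℝ (w τ) (h.P (z τ) - windowOp n (h.P (z τ))))
    (f := fun _ => (0 : ℝ)) (fun τ => ‖w τ‖ * (‖h.P (z τ)‖ + ‖h.P (z τ)‖))
    (Eventually.of_forall fun n => Continuous.aestronglyMeasurable
      (hcw.inner (hcz.sub ((windowOp n).continuous.comp hcz))))
    (Eventually.of_forall fun n => Eventually.of_forall fun τ _ => by
      refine (norm_inner_le_norm _ _).trans ?_
      gcongr
      exact (norm_sub_le _ _).trans (by gcongr; exact norm_windowOp_le _ _))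
    ((hcw.norm.mul (hcz.norm.add hcz.norm)).intervalIntegrable _ _)
    (Eventually.of_forall fun τ _ => by
      have h1 := (tendsto_windowOp (h.P (z τ))).const_sub (h.P (z τ))
      rw [sub_self] at h1
      have h2 := (tendsto_const_nhds (x := w τ)).inner h1 (𝕜 := ℝ)
      rwa [inner_zero_right] at h2)
  simpa using this

/-- Conservation of the energy. -/
theorem IsFlow.energy_eq (H : IsFlow h s f M u z w) (hf : ContDiff ℝ 1 f) (hf0 : f 0 = 0)
    {A : ℝ} (hA : 0 ≤ A) (hu : ∀ t, 0 ≤ t → eLpNorm (u t) ⊤ volume ≤ ENNReal.ofReal A) {t : ℝ}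
    (ht : 0 ≤ t) : energy α κ f (u t) (h.T (z t)) = energy α κ f (u 0) (h.T (z 0)) := by
  have hlim := (H.tendsto_energy hf hf0 hA hu ht).2
  -- The truncated energies increase to the full one in the extended reals. As their difference
  -- between two times vanishes in the limit, the limits agree, whether finite or not.
  have key : ∀ τ, Tendsto (fun n => (((‖h.enOp n (u τ)‖ ^ 2 + ‖h.enOp n (z τ)‖ ^ 2) / 2
        + ∫ x, primitive f (u τ x) : ℝ) : EReal)) atTop (𝓝 (energy α κ f (u τ) (h.T (z τ)))) := by
    intro τ
    rw [energy, h.kinetic_eq]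
    have h1 := ENNReal.Tendsto.div_const (h.tendsto_enOp (u τ) (z τ)) (b := 2) (Or.inr (by norm_num))
    have h2 := (continuous_coe_ennreal_ereal.tendsto _).comp h1
    have h3 := (EReal.continuousAt_add (p := (((kinetic α (u τ) (z τ) / 2 : ℝ≥0∞) : EReal),
      ((∫ x, primitive f (u τ x) : ℝ) : EReal))) (Or.inr (EReal.coe_ne_bot _))
      (Or.inr (EReal.coe_ne_top _))).tendsto.comp
      (h2.prodMk_nhds (tendsto_const_nhds (x := ((∫ x, primitive f (u τ x) : ℝ) : EReal))))
    refine h3.congr fun n => ?_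
    simp only [Function.comp_apply]
    have e2 : ∀ x : ℝ, ENNReal.ofReal x / 2 = ENNReal.ofReal (x / 2) := fun x => by
      rw [ENNReal.ofReal_div_of_pos two_pos, ENNReal.ofReal_ofNat]
    rw [EReal.coe_add, e2, EReal.coe_ennreal_ofReal, max_eq_left (by positivity)]
  have h1 := key t
  have h2 := (EReal.continuousAt_add (p := (energy α κ f (u 0) (h.T (z 0)), ((0 : ℝ) : EReal)))
    (Or.inr (EReal.coe_ne_bot _)) (Or.inr (EReal.coe_ne_top _))).tendsto.comp
      ((key 0).prodMk_nhds ((continuous_coe_real_ereal.tendsto _).comp hlim))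
  simp only [EReal.coe_zero, add_zero] at h2
  refine tendsto_nhds_unique h1 (h2.congr fun n => ?_)
  simp only [Function.comp_apply]
  rw [← EReal.coe_add, add_sub_cancel]
end

section
open scoped NNReal ComplexConjugate

/-! ### Conservation of the momentum -/

variable {α κ s : ℝ} {f : ℝ → ℝ}

/-- On the support of the cutoff `|2πξ| ≤ 4πL`; of the one derivative, the part `1 - s` is paid with
powers of `L` and the part `s` with the Sobolev norm. -/
lemma hNorm_zero_cut_le {L : ℝ} (hL : 0 < L) (hs : 0 ≤ s) (hs1 : s ≤ 1) (u : L2) :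
    ‖(cutSym L hL 1).op u‖ₑ ≤ ENNReal.ofReal ((4 * Real.pi * L) ^ (1 - s)) * hNorm s u := by
  rw [← hNorm_zero]
  refine BSym.hNorm_op_le _ (by positivity) (fun ξ => ?_) u
  have hj := jw_pos ξ
  rw [zero_div, Real.rpow_zero, one_mul]
  rcases le_or_gt (2 * L) |ξ| with h2 | h2
  · rw [cutSym_zero_of_le hL 1 h2, norm_zero]; positivity
  have e : ‖cutSym L hL 1 ξ‖ ≤ |2 * Real.pi * ξ| := by
    rw [cutSym_apply, pow_one, norm_mul, Complex.norm_real, Real.norm_of_nonneg (chi_mem _).1]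
    refine (mul_le_of_le_one_right (norm_nonneg _) (chi_mem _).2).trans (le_of_eq ?_)
    simp [abs_mul]
  refine e.trans ?_
  have h3 : |2 * Real.pi * ξ| ≤ 4 * Real.pi * L := by
    rw [abs_mul, abs_of_pos (by positivity)]
    nlinarith [Real.pi_pos]
  have h4 : |2 * Real.pi * ξ| ≤ jw ξ ^ (1 / 2 : ℝ) := by
    rw [← Real.sqrt_eq_rpow]
    exact Real.abs_le_sqrt (by unfold jw; linarith)
  rcases eq_or_ne (2 * Real.pi * ξ) 0 with h0 | h0
  · rw [h0, abs_zero]; positivity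
  have hp := abs_pos.2 h0
  calc |2 * Real.pi * ξ| = |2 * Real.pi * ξ| ^ (1 - s) * |2 * Real.pi * ξ| ^ s := by
        rw [← Real.rpow_add hp]; simp
    _ ≤ (4 * Real.pi * L) ^ (1 - s) * (jw ξ ^ (1 / 2 : ℝ)) ^ s := by
        gcongr
    _ = _ := by rw [← Real.rpow_mul hj.le]; congr 2; ring

lemma enorm_sub_cut_le {L : ℝ} (hL : 0 < L) (hs : 0 ≤ s) (u : L2) :
    ‖u - (cutSym L hL 0).op u‖ₑ ≤ ENNReal.ofReal (L ^ (-s)) * hNorm s u := by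
  rw [← hNorm_zero]
  refine hNorm_le_of_ae (by positivity) ?_
  filter_upwards [ft_sub_ae u ((cutSym L hL 0).op u), (cutSym L hL 0).ft_op u] with ξ h1 h2
  have hj := jw_pos ξ
  have e : ft u ξ - cutSym L hL 0 ξ * ft u ξ = ((1 - chi (ξ / L) : ℝ) : ℂ) * ft u ξ := by
    rw [cutSym_apply]; push_cast; ring
  rw [h1, h2, e, norm_mul, Complex.norm_real, zero_div, Real.rpow_zero, one_mul, ← mul_assoc,
    Real.norm_of_nonneg (by linarith [(chi_mem (ξ / L)).2])]
  refine mul_le_mul_of_nonneg_right ?_ (norm_nonneg _)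
  rcases le_or_gt |ξ| L with h3 | h3
  · rw [chi_one (by rw [abs_div, abs_of_pos hL, div_le_one hL]; exact h3), sub_self]; positivity
  · have h4 : L ≤ jw ξ ^ (1 / 2 : ℝ) := by
      rw [← Real.sqrt_eq_rpow]
      refine h3.le.trans (Real.abs_le_sqrt ?_)
      unfold jw
      have := Real.pi_gt_three
      have h6 : 1 ≤ (2 * Real.pi) ^ 2 := by nlinarith
      rw [mul_pow]
      nlinarith [sq_nonneg ξ]
    have h5 : L ^ s ≤ jw ξ ^ (s / 2) := by
      calc L ^ s ≤ (jw ξ ^ (1 / 2 : ℝ)) ^ s := by gcongr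
        _ = _ := by rw [← Real.rpow_mul hj.le]; congr 1; ring
    calc 1 - chi (ξ / L) ≤ 1 := by linarith [(chi_mem (ξ / L)).1]
      _ = L ^ (-s) * L ^ s := by rw [← Real.rpow_add hL]; simp
      _ ≤ _ := by gcongr

/-- The integrand is the derivative of the integrable function `F(W)`. -/
lemma integral_deriv_mul_comp {K : ℝ≥0} (hf : LipschitzWith K f) (h0 : f 0 = 0) {W : ℕ → ℝ → ℝ}
    (hW : Tower W) : ∫ x, W 1 x * f (W 0 x) = 0 := by
  have hm : MemLp (fun x => f (W 0 x)) 2 volume := hf.comp_memLp h0 (hW.memLp 0)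
  refine integral_eq_zero_of_hasDerivAt_of_integrable (f := fun x => primitive f (W 0 x))
    (fun x => ?_) ((hW.memLp 1).integrable_mul hm) ?_
  · have h1 : HasDerivAt (primitive f) (f (W 0 x)) (W 0 x) :=
      (hf.continuous.integral_hasStrictDerivAt 0 (W 0 x)).hasDerivAt
    have := h1.comp x (hW.deriv 0 x)
    rwa [mul_comm] at this
  · refine ((hW.memLp 0).integrable_sq.const_mul (K : ℝ)).mono'
      ((continuous_primitive hf.continuous).comp_aestronglyMeasurable (hW.memLp 0).1)
      (Eventually.of_forall fun x => ?_)
    simpa using abs_primitive_le hf h0 (W 0 x)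

/-- The nonlinearity does not contribute to the momentum. -/
lemma exists_inner_cut_le (hs : 0 ≤ s) (hs1 : s ≤ 1) (hf : ContDiff ℝ 1 f) (hf0 : f 0 = 0) {A M : ℝ}
    (hA : 0 ≤ A) (hM : 0 ≤ M) : ∃ C : ℝ, 0 ≤ C ∧ ∀ (L : ℝ) (hL : 0 < L) (u w : L2),
      eLpNorm u ⊤ volume ≤ ENNReal.ofReal A → hNorm s u ≤ ENNReal.ofReal M →
      (∀ᵐ x, w x = f (u x)) → |inner ℝ ((cutSym L hL 1).op u) w| ≤ C * L ^ (1 - 2 * s) := by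
  obtain ⟨K, hK⟩ := exists_lipschitz_clamp hf hA
  have h0 : f (clamp A 0) = 0 := by rw [clamp_eq (by simpa using hA), hf0]
  refine ⟨(4 * Real.pi) ^ (1 - s) * M * (K * M), by positivity, fun L hL u w hu hs' hw => ?_⟩
  have e1 : w = hK.compLp h0 u := ae_unique hw (by
    filter_upwards [hK.coeFn_compLp h0 u, abs_le_of_eLpNorm_top hA hu] with x h1 h2
    rw [h1, Function.comp_apply, clamp_eq h2])
  have e2 : inner ℝ ((cutSym L hL 1).op u) (hK.compLp h0 ((cutSym L hL 0).op u)) = 0 := by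
    rw [inner_eq_integral, ← integral_deriv_mul_comp hK h0 (tower_cutFun hL u)]
    refine integral_congr_ae ?_
    filter_upwards [cutFun_ae hL u 1, hK.coeFn_compLp h0 ((cutSym L hL 0).op u), cutFun_ae hL u 0]
      with x h1 h2 h3
    rw [h1, h2, Function.comp_apply, h3]
  have toReal : ∀ {a : L2} {c : ℝ}, 0 ≤ c → ‖a‖ₑ ≤ ENNReal.ofReal c → ‖a‖ ≤ c := fun hc ha => by
    rw [← ofReal_norm] at ha
    exact (ENNReal.ofReal_le_ofReal_iff hc).1 ha
  have n1 : ‖(cutSym L hL 1).op u‖ ≤ (4 * Real.pi * L) ^ (1 - s) * M := toReal (by positivity) (by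
    rw [ENNReal.ofReal_mul (by positivity)]
    exact (hNorm_zero_cut_le hL hs hs1 u).trans (mul_le_mul_right hs' _))
  have n2 : ‖u - (cutSym L hL 0).op u‖ ≤ L ^ (-s) * M := toReal (by positivity) (by
    rw [ENNReal.ofReal_mul (by positivity)]
    exact (enorm_sub_cut_le hL hs u).trans (mul_le_mul_right hs' _))
  -- Subtracting the vanishing pairing leaves `f(u)` minus `f` of the cutoff of `u`, which is
  -- `O(L^{-s})` in `L²`. With `O(L^{1-s})` for the derivative this gives the rate.
  rw [e1, ← sub_zero (inner ℝ _ _), ← e2, ← inner_sub_right]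
  refine (abs_real_inner_le_norm _ _).trans ?_
  calc _ ≤ ((4 * Real.pi * L) ^ (1 - s) * M) * (K * (L ^ (-s) * M)) := by
        gcongr
        exact (hK.norm_compLp_sub_le h0 _ _).trans (by gcongr)
    _ = (4 * Real.pi) ^ (1 - s) * M * (K * M) * (L ^ (1 - s) * L ^ (-s)) := by
        rw [Real.mul_rpow (by positivity) hL.le]; ring
    _ = _ := by rw [← Real.rpow_add hL]; congr 2; ring

/-- The truncated momentum density. -/
def moOp (α κ L : ℝ) (hL : 0 < L) : L2 →L[ℝ] L2 :=
  (BSym.ofEven (fun ζ => chi (ζ / (2 * Real.pi * L)) * (rD α ζ * rR κ ζ))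
    (Continuous.measurable (by
      have := chi_contDiff.continuous
      have := continuous_rD (α := α)
      have := continuous_rR (κ := κ)
      fun_prop))
    (fun ζ => by rw [neg_div, chi_neg, rD_neg, rR_neg])
    (by
      have h0 := chi_contDiff.continuous
      have h1 := continuous_rD (α := α)
      have h2 := continuous_rR (κ := κ)
      exact (chi_scaled_supp (by positivity : 0 < 2 * Real.pi * L)).mul_right.exists_bound_of_continuous
        (by fun_prop))).op

lemma ft_moOp (L : ℝ) (hL : 0 < L) (g : L2) : ∀ᵐ ξ, ft (moOp α κ L hL g) ξ
    = (chi (ξ / L) * (rD α (2 * Real.pi * ξ) * rR κ (2 * Real.pi * ξ)) : ℝ) * ft g ξ := by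
  filter_upwards [BSym.ft_op (BSym.ofEven (fun ζ => chi (ζ / (2 * Real.pi * L)) * (rD α ζ * rR κ ζ))
    _ _ _) g] with ξ hξ
  refine hξ.trans ?_
  change ((chi (2 * Real.pi * ξ / (2 * Real.pi * L)) * _ : ℝ) : ℂ) * _ = _
  rw [mul_div_mul_left _ _ (by positivity)]

section
variable (h : Par α κ)

lemma Par.inner_moOp_P (L : ℝ) (hL : 0 < L) (a : L2) : inner ℝ (moOp α κ L hL a) (h.P a) = 0 := by
  have := inner_eq_of_ft (a := moOp α κ L hL a) (b := h.P a) (c := h.P a) (d := moOp α κ L hL a) (-1) (by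
    filter_upwards [ft_moOp L hL a, h.ft_P a] with ξ h1 h2
    rw [h1, h2]
    simp only [map_mul, Complex.conj_ofReal, Complex.conj_I]
    push_cast; ring)
  rw [real_inner_comm (moOp α κ L hL a)] at this
  linarith

lemma Par.inner_moOp_P_left (L : ℝ) (hL : 0 < L) (a : L2) :
    inner ℝ (moOp α κ L hL (h.P a)) a = 0 := by
  have := inner_eq_of_ft (a := moOp α κ L hL (h.P a)) (b := a) (c := a) (d := moOp α κ L hL (h.P a)) (-1)
    (by
      filter_upwards [ft_moOp L hL (h.P a), h.ft_P a] with ξ h1 h2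
      rw [h1, h2]
      simp only [map_mul, Complex.conj_ofReal, Complex.conj_I]
      push_cast; ring)
  have hc := real_inner_comm a (moOp α κ L hL (h.P a))
  linarith

/-- The product `rD rR sig` is `ζ`, so weighting by the momentum density turns `S` into the
truncated derivative `∂ₓ`. -/
lemma Par.inner_moOp_S (L : ℝ) (hL : 0 < L) (a b : L2) :
    inner ℝ (moOp α κ L hL a) (h.S b) = - inner ℝ ((cutSym L hL 1).op a) b := by
  have := inner_eq_of_ft (a := moOp α κ L hL a) (b := h.S b) (c := (cutSym L hL 1).op a) (d := b) (-1)
    (by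
      filter_upwards [ft_moOp L hL a, h.ft_S b, (cutSym L hL 1).ft_op a] with ξ h1 h2 h3
      rw [h1, h2, h3, cutSym_apply, sig]
      simp only [map_mul, Complex.conj_ofReal, Complex.conj_I, pow_one, map_ofNat]
      have e1 : (rD α (2 * Real.pi * ξ) : ℂ) ≠ 0 := by exact_mod_cast (rD_pos h.nonneg.1 _).ne'
      have e2 : (rR κ (2 * Real.pi * ξ) : ℂ) ≠ 0 := by exact_mod_cast (rR_pos h.nonneg.2 _).ne'
      generalize rD α (2 * Real.pi * ξ) = x at *
      generalize rR κ (2 * Real.pi * ξ) = y at *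
      push_cast
      field_simp)
  rw [this]; ring

lemma Par.momentumDensity_ae (u z : L2) : ∀ᵐ ξ, momentumDensity κ u (h.T z) ξ
    = rD α (2 * Real.pi * ξ) * rR κ (2 * Real.pi * ξ) * (conj (ft u ξ) * ft z ξ).re := by
  filter_upwards [h.ft_T z] with ξ h1
  rw [momentumDensity, h1, ← rR_sq h.nonneg.2, omg]
  have e2 := (rR_pos h.nonneg.2 (2 * Real.pi * ξ)).ne'
  rw [map_mul, Complex.conj_ofReal, mul_left_comm, Complex.re_ofReal_mul, ← mul_assoc]
  congr 1
  · field_simp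
  · simp only [Complex.mul_re, Complex.conj_re, Complex.conj_im]; ring

/-- In terms of `u` and `z` the density has the weight `rD rR`, so half of it goes to each factor in
Cauchy–Schwarz. This determines the regularity `r`: `3/2` in general and `1/2` for `α = κ = 0`. -/
lemma Par.integrable_momentumDensity {r C : ℝ} (hC : ∀ ξ, rD α (2 * Real.pi * ξ)
    * rR κ (2 * Real.pi * ξ) ≤ C * jw ξ ^ r) {u z : L2} (hu : hNorm r u < ⊤) (hz : hNorm r z < ⊤) :
    Integrable (momentumDensity κ u (h.T z)) := by
  have hm : ∀ {g : L2}, hNorm r g < ⊤ →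
      MemLp (fun ξ => ((jw ξ ^ (r / 2) : ℝ) : ℂ) * ft g ξ) 2 volume := fun {g} hg =>
    ⟨aesm_weight r g, by rw [← hNorm_eq]; exact hg⟩
  have hi := (hm hu).norm.integrable_mul (hm hz).norm
  have c1 := continuous_rD (α := α)
  have c2 := continuous_rR (κ := κ)
  have hmeas : AEStronglyMeasurable (fun ξ : ℝ => rD α (2 * Real.pi * ξ) * rR κ (2 * Real.pi * ξ)
      * (conj (ft u ξ) * ft z ξ).re) volume := by
    refine AEStronglyMeasurable.mul (Continuous.aestronglyMeasurable (by fun_prop)) ?_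
    exact Complex.continuous_re.comp_aestronglyMeasurable
      ((Complex.continuous_conj.comp_aestronglyMeasurable (aesm_ft u)).mul (aesm_ft z))
  refine Integrable.congr ((hi.const_mul C).mono' hmeas (Eventually.of_forall fun ξ => ?_))
    ((h.momentumDensity_ae u z).mono fun ξ hξ => hξ.symm)
  have hj := jw_pos ξ
  have p1 := rD_pos h.nonneg.1 (2 * Real.pi * ξ)
  have p2 := rR_pos h.nonneg.2 (2 * Real.pi * ξ)
  rw [Real.norm_eq_abs, abs_mul, abs_of_pos (by positivity), Pi.mul_apply, norm_mul, norm_mul,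
    Complex.norm_real, Real.norm_of_nonneg (by positivity)]
  have e1 : jw ξ ^ r = jw ξ ^ (r / 2) * jw ξ ^ (r / 2) := by rw [← Real.rpow_add hj]; congr 1; ring
  have e2 : |(conj (ft u ξ) * ft z ξ).re| ≤ ‖ft u ξ‖ * ‖ft z ξ‖ := by
    refine (Complex.abs_re_le_norm _).trans (le_of_eq ?_)
    rw [norm_mul, RCLike.norm_conj]
  calc _ ≤ C * jw ξ ^ r * (‖ft u ξ‖ * ‖ft z ξ‖) := by
        exact mul_le_mul (hC ξ) e2 (abs_nonneg _)
          ((mul_pos p1 p2).le.trans (hC ξ))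
    _ = _ := by rw [e1]; ring

lemma Par.tendsto_moOp {u z : L2} (hi : Integrable (momentumDensity κ u (h.T z))) :
    Tendsto (fun n : ℕ => inner ℝ (moOp α κ (n + 1) (by positivity) u) z) atTop
      (𝓝 (momentum κ u (h.T z))) := by
  have e : ∀ n : ℕ, inner ℝ (moOp α κ (n + 1) (by positivity) u) z
      = ∫ ξ, chi (ξ / (n + 1)) * momentumDensity κ u (h.T z) ξ := fun n => by
    have h1 := inner_ft (moOp α κ (n + 1) (by positivity) u) z
    rw [L2.inner_def] at h1
    have hint := L2.integrable_inner (𝕜 := ℂ) (ft (moOp α κ (n + 1) (by positivity) u)) (ft z)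
    have h2 := integral_re hint
    rw [h1] at h2
    refine Eq.trans ?_ (h2.symm.trans ?_)
    · simp
    · refine integral_congr_ae ?_
      filter_upwards [ft_moOp (n + 1) (by positivity) u, h.momentumDensity_ae u z] with ξ e1 e2
      rw [e2, RCLike.inner_apply', e1]
      change (conj (_ * _) * _ : ℂ).re = _
      rw [map_mul, Complex.conj_ofReal, mul_assoc, Complex.re_ofReal_mul]; ring
  simp_rw [e, momentum]
  have c0 := chi_contDiff.continuous
  refine tendsto_integral_of_dominated_convergence (fun ξ => ‖momentumDensity κ u (h.T z) ξ‖)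
    (fun n => (Continuous.aestronglyMeasurable (by fun_prop)).mul hi.1) hi.norm
    (fun n => Eventually.of_forall fun ξ => ?_) (Eventually.of_forall fun ξ => ?_)
  · rw [norm_mul, Real.norm_of_nonneg (chi_mem _).1]
    exact mul_le_of_le_one_left (norm_nonneg _) (chi_mem _).2
  · refine tendsto_const_nhds.congr' ?_
    obtain ⟨N, hN⟩ := exists_nat_gt |ξ|
    filter_upwards [eventually_ge_atTop N] with n hn
    have : (N : ℝ) ≤ n := by exact_mod_cast hn
    rw [chi_one, one_mul]
    rw [abs_div, abs_of_pos (by positivity : (0 : ℝ) < n + 1), div_le_one (by positivity)]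
    linarith

end

variable {M : ℝ} {h : Par α κ} {u z w : ℝ → L2}

/-- Conservation of the momentum. -/
theorem IsFlow.momentum_eq (H : IsFlow h s f M u z w) (hs : 1 / 2 < s) (hf : ContDiff ℝ 1 f)
    (hf0 : f 0 = 0) {A : ℝ} (hA : 0 ≤ A)
    (hu : ∀ t, 0 ≤ t → eLpNorm (u t) ⊤ volume ≤ ENNReal.ofReal A)
    (hi : ∀ t, 0 ≤ t → Integrable (momentumDensity κ (u t) (h.T (z t)))) {t : ℝ} (ht : 0 ≤ t) :
    momentum κ (u t) (h.T (z t)) = momentum κ (u 0) (h.T (z 0)) := by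
  -- The commutator estimate is limited to regularity at most one; all that matters is `1 - 2 s₁ <
  -- 0`.
  set s₁ := min s 1 with hs₁
  have hs₁' : 1 / 2 < s₁ := lt_min hs (by norm_num)
  obtain ⟨C, hC, HC⟩ := exists_inner_cut_le (s := s₁) (by linarith) (min_le_right _ _) hf hf0 hA
    H.pos.le
  have hd : ∀ (L : ℝ) (hL : 0 < L) (τ : ℝ), HasDerivAt (fun τ => inner ℝ (moOp α κ L hL (u τ)) (z τ))
      (-inner ℝ ((cutSym L hL 1).op (u τ)) (w τ)) τ := fun L hL τ => by
    have h1 := ((moOp α κ L hL).hasFDerivAt.comp_hasDerivAt τ (H.deriv_u τ)).inner ℝ (H.deriv_z τ)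
    refine h1.congr_deriv ?_
    rw [Function.comp_apply, inner_add_right, h.inner_moOp_P, h.inner_moOp_P_left, h.inner_moOp_S]
    ring
  have hb : ∀ (L : ℝ) (hL : 0 < L), |inner ℝ (moOp α κ L hL (u t)) (z t)
      - inner ℝ (moOp α κ L hL (u 0)) (z 0)| ≤ C * L ^ (1 - 2 * s₁) * t := fun L hL => by
    have := (convex_Icc 0 t).norm_image_sub_le_of_norm_hasDerivWithin_le
      (f := fun τ => inner ℝ (moOp α κ L hL (u τ)) (z τ)) (C := C * L ^ (1 - 2 * s₁))
      (fun τ _ => (hd L hL τ).hasDerivWithinAt) (fun τ hτ => by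
        rw [norm_neg]
        exact HC L hL (u τ) (w τ) (hu τ hτ.1) ((hNorm_mono (min_le_left _ _) _).trans (H.le_u τ hτ.1))
          (H.comp τ hτ.1)) ⟨le_rfl, ht⟩ ⟨ht, le_rfl⟩
    simpa [abs_of_nonneg ht] using! this
  have h1 := (h.tendsto_moOp (hi t ht)).sub (h.tendsto_moOp (hi 0 le_rfl))
  have h2 : Tendsto (fun n : ℕ => C * ((n : ℝ) + 1) ^ (1 - 2 * s₁) * t) atTop (𝓝 0) := by
    have h3 := (tendsto_rpow_neg_atTop (y := 2 * s₁ - 1) (by linarith)).comp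
      (tendsto_atTop_add_const_right _ (1 : ℝ) tendsto_natCast_atTop_atTop)
    have h4 := (h3.const_mul C).mul_const t
    rw [mul_zero, zero_mul] at h4
    refine h4.congr fun n => ?_
    simp only [Function.comp_apply, neg_sub]
  have h3 : Tendsto (fun n : ℕ => inner ℝ (moOp α κ (n + 1) (by positivity) (u t)) (z t)
      - inner ℝ (moOp α κ (n + 1) (by positivity) (u 0)) (z 0)) atTop (𝓝 0) :=
    squeeze_zero_norm (fun n => hb _ _) h2
  exact sub_eq_zero.1 (tendsto_nhds_unique h1 h3)

/-- Persistence of regularity when the forcing is smoothing. -/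
theorem IsFlow.hNorm_lt_top (H : IsFlow h s f M u z w) (hα : 0 < α) (hκ : 0 < κ) {r : ℝ} (hr : r ≤ 2)
    (hu0 : hNorm r (u 0) < ⊤) (hz0 : hNorm r (z 0) < ⊤) {t : ℝ} (ht : 0 ≤ t) :
    hNorm r (u t) < ⊤ ∧ hNorm r (z t) < ⊤ := by
  obtain ⟨C, hC, HS⟩ := h.exists_hNorm_S_le_of_pos hα hκ
  have bn := ballNorm_hNorm r
  obtain ⟨D, hD⟩ := (isCompact_Icc (a := (0 : ℝ)) (b := t)).exists_bound_of_continuousOn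
    H.cont.continuousOn
  have hS : ∀ τ ∈ Set.Icc 0 t, hNorm r (h.S (w τ)) ≤ ENNReal.ofReal (C * (|D| + 1)) := fun τ hτ => by
    rw [ENNReal.ofReal_mul hC.le]
    refine (HS r _).trans (mul_le_mul_right ?_ _)
    refine (hNorm_mono (by linarith) _).trans ((hNorm_zero _).le.trans ?_)
    rw [← ofReal_norm]
    exact ENNReal.ofReal_le_ofReal ((hD τ hτ).trans ((le_abs_self D).trans (by linarith)))
  -- Conjugation with the group leaves only the forcing as derivative. Since `r ≤ 2` and `S` gains
  -- two derivatives, the forcing is bounded in `H^r` by the mere `L²` norm of `w`.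
  have key : ∀ (σ : ℝ), |σ| = 1 → ∀ c : ℝ → L2,
      (∀ τ, HasDerivAt c (σ • (h.P (c τ) + h.S (w τ))) τ) → hNorm r (c 0) < ⊤ →
      hNorm r (c t) < ⊤ := by
    intro σ hσ c hc hc0
    have hd : ∀ τ, HasDerivAt (fun τ => h.U (-(σ * τ)) (c τ)) (σ • h.U (-(σ * τ)) (h.S (w τ))) τ := by
      intro τ
      have h2 : HasDerivAt (fun τ => h.U (-(σ * τ))) (-σ • (h.P ∘L h.U (-(σ * τ)))) τ := by
        have := (h.hasDerivAt_U (-(σ * τ))).scomp τ ((hasDerivAt_id τ).const_mul σ).neg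
        simpa using! this
      refine (h2.clm_apply (hc τ)).congr_deriv ?_
      change -σ • h.P (h.U (-(σ * τ)) (c τ)) + h.U (-(σ * τ)) (σ • (h.P (c τ) + h.S (w τ))) = _
      rw [h.P_U, map_smul, map_add]
      module
    have hcont : Continuous fun τ => σ • h.U (-(σ * τ)) (h.S (w τ)) :=
      (h.continuous_U_apply (h.S.continuous.comp H.cont)).const_smul σ
    have hle := bn.sub_le_of_hasDerivAt hcont hd ht (M := C * (|D| + 1)) (by positivity)
      (fun τ hτ => by
        rw [bn.smul, ← ofReal_norm, Real.norm_eq_abs, hσ, ENNReal.ofReal_one, one_mul]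
        exact (h.hNorm_U_le _ _ _).trans (hS τ hτ))
    have e : c t = h.U (σ * t) ((h.U (-(σ * t)) (c t) - h.U (-(σ * 0)) (c 0)) + c 0) := by
      rw [mul_zero, neg_zero, h.U_zero, sub_add_cancel, ← h.U_add, add_neg_cancel, h.U_zero]
    rw [e]
    refine (h.hNorm_U_le _ _ _).trans_lt ((bn.add_le _ _).trans_lt (ENNReal.add_lt_top.2 ⟨?_, hc0⟩))
    exact hle.trans_lt ENNReal.ofReal_lt_top
  have ha := key 1 (by simp) (fun τ => u τ + z τ) (fun τ => by
    refine ((H.deriv_u τ).add (H.deriv_z τ)).congr_deriv ?_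
    rw [one_smul, map_add]; abel) ((bn.add_le _ _).trans_lt (ENNReal.add_lt_top.2 ⟨hu0, hz0⟩))
  have hb := key (-1) (by simp) (fun τ => u τ - z τ) (fun τ => by
    refine ((H.deriv_u τ).sub (H.deriv_z τ)).congr_deriv ?_
    rw [map_sub]; module) ((bn.sub_le _ _).trans_lt (ENNReal.add_lt_top.2 ⟨hu0, hz0⟩))
  have eu : u t = (1 / 2 : ℝ) • ((u t + z t) + (u t - z t)) := by module
  have ez : z t = (1 / 2 : ℝ) • ((u t + z t) - (u t - z t)) := by module
  constructor
  · rw [eu, bn.smul]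
    exact ENNReal.mul_lt_top (by simp) ((bn.add_le _ _).trans_lt (ENNReal.add_lt_top.2 ⟨ha, hb⟩))
  · rw [ez, bn.smul]
    exact ENNReal.mul_lt_top (by simp) ((bn.sub_le _ _).trans_lt (ENNReal.add_lt_top.2 ⟨ha, hb⟩))
end

section
/-! ### Initial data -/

variable {α κ s : ℝ}

/-- The variable `z = T⁻¹ v` for initial data `v` with integrable `Λ v`. -/
lemma Par.exists_initial (h : Par α κ) (hs : 1 / 2 < s) : ∃ C C₁ : ℝ, 0 < C ∧ 0 < C₁ ∧
    ∀ δ : ℝ, 0 < δ → ∀ u₀ v₀ : L2,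
      xNorm s u₀ v₀ + eLpNorm u₀ 1 volume + h11Norm v₀ < ENNReal.ofReal δ →
      ∃ z₀ : L2, h.T z₀ = v₀ ∧ (∀ r, hNorm r z₀ ≤ ENNReal.ofReal C * hNorm (r + 1) v₀) ∧
        hNorm s (u₀ + z₀) ≤ ENNReal.ofReal (C₁ * δ) ∧ hNorm s (u₀ - z₀) ≤ ENNReal.ofReal (C₁ * δ) ∧
        (∀ t, eLpNorm (h.U t (u₀ + z₀)) ⊤ volume
          ≤ ENNReal.ofReal (C₁ * δ * (1 + |t|) ^ (-decay (min s 2)))) ∧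
        ∀ t, eLpNorm (h.U t (u₀ - z₀)) ⊤ volume
          ≤ ENNReal.ofReal (C₁ * δ * (1 + |t|) ^ (-decay (min s 2))) := by
  obtain ⟨C, hC, HT⟩ := h.exists_inv_T
  obtain ⟨Cd, hCd, hdec⟩ := h.exists_decay hs
  refine ⟨C, Cd * (3 + C) + (1 + C), hC, by positivity, fun δ hδ u₀ v₀ hlt => ?_⟩
  have hx : xNorm s u₀ v₀ ≤ ENNReal.ofReal δ := (le_self_add.trans le_self_add).trans hlt.le
  have hu : hNorm s u₀ ≤ ENNReal.ofReal δ := le_self_add.trans hx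
  have hv : hNorm (s + 1) v₀ ≤ ENNReal.ofReal δ := le_add_self.trans hx
  have hu1 : eLpNorm u₀ 1 volume ≤ ENNReal.ofReal δ := (le_add_self.trans le_self_add).trans hlt.le
  have h11 : h11Norm v₀ < ENNReal.ofReal δ := lt_of_le_of_lt le_add_self hlt
  simp only [h11Norm, iInf_lt_iff] at h11
  obtain ⟨w₀, hw₀, hw1⟩ := h11
  obtain ⟨z₀, hz, hzr⟩ := HT v₀ ((hNorm_mono (by linarith) _).trans_lt
    (hv.trans_lt ENNReal.ofReal_lt_top))
  have hzs : hNorm s z₀ ≤ ENNReal.ofReal (C * δ) := by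
    rw [ENNReal.ofReal_mul hC.le]
    exact (hzr s).trans (mul_le_mul_right hv _)
  -- With `w₀ = Λ v₀` in `L¹`, this exhibits `z₀` as an amplitude of bounded variation applied to an
  -- integrable function, so the dispersive estimate applies. The inverse of `T` alone has an
  -- unbounded symbol.
  have hM : h.M w₀ = z₀ := h.T_injective (by
    rw [hz]
    refine ft_ext ?_
    filter_upwards [h.ft_T (h.M w₀), h.ft_M w₀, hw₀] with ξ h1 h2 h3
    have e : omg α κ (2 * Real.pi * ξ) * (ampV α κ (2 * Real.pi * ξ)
        * √(1 + (2 * Real.pi * ξ) ^ 2)) = 1 := by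
      have p1 := (rD_pos h.nonneg.1 (2 * Real.pi * ξ)).ne'
      have p2 := (rR_pos h.nonneg.2 (2 * Real.pi * ξ)).ne'
      have p3 : √(1 + (2 * Real.pi * ξ) ^ 2) ≠ 0 := by positivity
      rw [omg, ampV]
      generalize rD α (2 * Real.pi * ξ) = x at *
      generalize rR κ (2 * Real.pi * ξ) = y at *
      generalize √(1 + (2 * Real.pi * ξ) ^ 2) = r at *
      field_simp
    rw [h1, h2, h3, ← mul_assoc (ampV _ _ _ : ℂ), ← mul_assoc, ← Complex.ofReal_mul,
      ← Complex.ofReal_mul, e, Complex.ofReal_one, one_mul])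
  have bn := ballNorm_hNorm s
  have bt := ballNorm_top
  have hsum : hNorm s u₀ + hNorm s z₀ ≤ ENNReal.ofReal ((Cd * (3 + C) + (1 + C)) * δ) := by
    refine (add_le_add hu hzs).trans ?_
    rw [← ENNReal.ofReal_add hδ.le (by positivity)]
    refine ENNReal.ofReal_le_ofReal ?_
    have : 0 ≤ Cd * (3 + C) * δ := by positivity
    linarith
  have htop : ∀ t, eLpNorm (h.U t u₀) ⊤ volume + eLpNorm (h.U t z₀) ⊤ volume
      ≤ ENNReal.ofReal ((Cd * (3 + C) + (1 + C)) * δ * (1 + |t|) ^ (-decay (min s 2))) := fun t => by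
    have h1 := (hdec t u₀).1.trans (mul_le_mul_right (add_le_add hu1 hu) _)
    have h2 := (hdec t w₀).2.1
    rw [hM] at h2
    have h3 := h2.trans (mul_le_mul_right (add_le_add hw1.le hzs) _)
    refine (add_le_add h1 h3).trans ?_
    rw [← mul_add, ← ENNReal.ofReal_add (by positivity) (by positivity),
      ← ENNReal.ofReal_add (by positivity) (by positivity),
      ← ENNReal.ofReal_add (by positivity) (by positivity), ← ENNReal.ofReal_mul (by positivity)]
    refine ENNReal.ofReal_le_ofReal ?_
    have : 0 ≤ (1 + C) * δ * (1 + |t|) ^ (-decay (min s 2)) := by positivity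
    nlinarith
  refine ⟨z₀, hz, hzr, (bn.add_le _ _).trans hsum, (bn.sub_le _ _).trans hsum, fun t => ?_,
    fun t => ?_⟩
  · rw [map_add]; exact (bt.add_le _ _).trans (htop t)
  · rw [map_sub]; exact (bt.sub_le _ _).trans (htop t)

lemma exists_rD_mul_rR_le (α κ : ℝ) (hα : 0 ≤ α) (hκ : 0 ≤ κ) :
    ∃ C : ℝ, ∀ ξ, rD α (2 * Real.pi * ξ) * rR κ (2 * Real.pi * ξ) ≤ C * jw ξ ^ (3 / 2 : ℝ) := by
  refine ⟨√(1 + α) * √(1 + κ), fun ξ => ?_⟩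
  have hj := jw_pos ξ
  have h1 : rD α (2 * Real.pi * ξ) ≤ √(1 + α) * jw ξ ^ (1 / 2 : ℝ) := by
    rw [← Real.sqrt_eq_rpow, ← Real.sqrt_mul (by positivity)]
    refine Real.sqrt_le_sqrt ?_
    unfold jw
    nlinarith [sq_nonneg (2 * Real.pi * ξ)]
  have h2 : rR κ (2 * Real.pi * ξ) ≤ √(1 + κ) * jw ξ := by
    nth_rw 1 [← Real.sqrt_sq hj.le]
    rw [← Real.sqrt_mul (by positivity)]
    refine Real.sqrt_le_sqrt ?_
    unfold jw
    have : 0 ≤ (2 * Real.pi * ξ) ^ 2 := sq_nonneg _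
    nlinarith [mul_nonneg hκ this, mul_nonneg this this]
  calc _ ≤ (√(1 + α) * jw ξ ^ (1 / 2 : ℝ)) * (√(1 + κ) * jw ξ) :=
        mul_le_mul h1 h2 (rR_pos hκ _).le (by positivity)
    _ = √(1 + α) * √(1 + κ) * (jw ξ ^ (1 / 2 : ℝ) * jw ξ ^ (1 : ℝ)) := by rw [Real.rpow_one]; ring
    _ = _ := by rw [← Real.rpow_add hj]; norm_num

/-- The momentum is defined for solutions which are regular enough. -/
lemma IsFlow.integrable_momentumDensity {h : Par α κ} {M : ℝ} {f : ℝ → ℝ} {u z w : ℝ → L2}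
    (H : IsFlow h s f M u z w) (hs : 1 / 2 < s)
    (hreg : κ = 0 ∨ hNorm (3 / 2) (u 0) < ⊤ ∧ hNorm (3 / 2) (z 0) < ⊤) {t : ℝ} (ht : 0 ≤ t) :
    Integrable (momentumDensity κ (u t) (h.T (z t))) := by
  rcases eq_or_ne κ 0 with hκ | hκ
  · have hα : α = 0 := by
      rcases h with h | h
      · exact absurd hκ h.2.ne'
      · exact h.1
    refine h.integrable_momentumDensity (r := 1 / 2) (C := 1) (fun ξ => ?_)
      ((hNorm_mono hs.le _).trans_lt ((H.le_u t ht).trans_lt ENNReal.ofReal_lt_top))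
      ((hNorm_mono hs.le _).trans_lt ((H.le_z t ht).trans_lt ENNReal.ofReal_lt_top))
    rw [hα, hκ, rD, rR, ← Real.sqrt_eq_rpow]
    simp [jw]
  · have hpos : 0 < α ∧ 0 < κ := by
      rcases h with h | h
      · exact h
      · exact absurd h.2 hκ
    obtain ⟨hu0, hz0⟩ := hreg.resolve_left hκ
    obtain ⟨C, hC⟩ := exists_rD_mul_rR_le α κ hpos.1.le hpos.2.le
    obtain ⟨h1, h2⟩ := H.hNorm_lt_top hpos.1 hpos.2 (by norm_num) hu0 hz0 ht
    exact h.integrable_momentumDensity hC h1 h2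
end

end GBq

end

/-! ### The main theorem -/

open GBq

theorem theorem4p5 (α κ p s B : ℝ) (m : ℕ) (f : ℝ → ℝ)
    (hs : 1 / 2 < s) (hsm : s ≤ m) (hf : ContDiff ℝ m f)
    (hfp : ∀ y : ℝ, |f y| ≤ B * |y| ^ (p + 1))
    (hμ : 1 < p * GBq.mu α κ s)
    (hpar : (0 < α ∧ 0 < κ) ∨
      (α = 0 ∧ κ = 0 ∧ ∀ j : ℕ, 1 ≤ j → j ≤ ⌈s⌉₊ →
        (iteratedDeriv j f) =O[𝓝 0] (fun y : ℝ => |y| ^ (p + 1 - j)))) :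
    ∃ C δ₀ : ℝ, 0 < C ∧ 0 < δ₀ ∧ ∀ δ : ℝ, 0 < δ → δ ≤ δ₀ → ∀ u₀ v₀ : GBq.L2,
      GBq.xNorm s u₀ v₀ + eLpNorm u₀ 1 volume + GBq.h11Norm v₀ < ENNReal.ofReal δ →
      ∃ u v : ℝ → GBq.L2,
        -- existence and uniqueness of the global solution
        GBq.IsSolution α κ f s u₀ v₀ u v ∧
        (∀ w z : ℝ → GBq.L2, GBq.IsSolution α κ f s u₀ v₀ w z →
          ∀ t : ℝ, 0 ≤ t → w t = u t ∧ z t = v t) ∧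
        -- the bound
        (∀ t : ℝ, 0 ≤ t →
          ENNReal.ofReal ((1 + t) ^ GBq.mu α κ s) * eLpNorm (u t) ⊤ volume
            + GBq.xNorm s (u t) (v t) ≤ ENNReal.ofReal (C * δ)) ∧
        -- conservation of the energy
        (∀ t : ℝ, 0 ≤ t → Integrable (fun x : ℝ => GBq.primitive f (u t x)) ∧
          GBq.energy α κ f (u t) (v t) = GBq.energy α κ f u₀ v₀) ∧
        -- conservation of the momentum
        ((κ = 0 ∨ GBq.xNorm (3 / 2) u₀ v₀ < ⊤) →
          ∀ t : ℝ, 0 ≤ t → Integrable (GBq.momentumDensity κ (u t) (v t)) ∧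
            GBq.momentum κ (u t) (v t) = GBq.momentum κ u₀ v₀) := by
  have h : Par α κ := hpar.imp id fun hp => ⟨hp.1, hp.2.1⟩
  obtain ⟨-, hp6, -, hμν, -, -⟩ := mu_facts hs hμ
  have hB := nonneg_of_abs_le hfp
  have hf0 : f 0 = 0 := map_zero_of_abs_le (by linarith) hfp
  have hm1 : 1 ≤ m := by
    have : (0 : ℝ) < m := by linarith
    exact_mod_cast this
  have hf1 : ContDiff ℝ 1 f := hf.of_le (by exact_mod_cast hm1)
  have hcc : CompCont s f := compCont_of_contDiff hs hsm hf hf0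
  obtain ⟨q, Cn, A₀, hq, hqp, hqν, hA₀, hN⟩ := exists_smallNonlin h hs hsm hf hfp hμ hpar
  obtain ⟨Cz, C₁, hCz, hC₁, hinit⟩ := h.exists_initial hs
  obtain ⟨CT, hCT, HT⟩ := h.exists_hNorm_T_le
  obtain ⟨C₂, δ₀, hC₂, hδ₀, hglob⟩ := h.exists_global hs hf1 hf0 hN hA₀ hq hqν hB
    (fun A hA hA1 u w hu hw => eLpNorm_one_comp_le (by linarith) hqp hfp hA hA1 hu hw) hC₁
  have hAp := hN.pos_A
  have hCn := hN.pos_C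
  -- The sup norm and the `H^s` norm of `u` account for `2`, the norm of `v = T z` for `CT`. The
  -- bound `A₀ / C₂` keeps `u` below the amplitude `A₀` up to which the nonlinear estimate is valid.
  refine ⟨C₂ * (2 + CT), min δ₀ (A₀ / C₂), by positivity, by positivity,
    fun δ hδ hδ' u₀ v₀ hlt => ?_⟩
  obtain ⟨z₀, hz₀, hzr, ha, hb, haU, hbU⟩ := hinit δ hδ u₀ v₀ hlt
  obtain ⟨u, z, w, hw, hu0, hz0, hdu, hdz, hest⟩ :=
    hglob δ hδ (hδ'.trans (min_le_left _ _)) _ _ ha hb haU hbU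
  have hu0' : u 0 = u₀ := by rw [hu0]; module
  have hz0' : z 0 = z₀ := by rw [hz0]; module
  have hρ : 0 < C₂ * δ := by positivity
  have hρA : C₂ * δ ≤ A₀ := by
    have := hδ'.trans (min_le_right _ _)
    rw [le_div_iff₀ hC₂] at this
    linarith
  have htop : ∀ t, 0 ≤ t → eLpNorm (u t) ⊤ volume ≤ ENNReal.ofReal (C₂ * δ) := fun t ht => by
    refine (hest t ht).1.trans (ENNReal.ofReal_le_ofReal (mul_le_of_le_one_right hρ.le ?_))
    refine Real.rpow_le_one_of_one_le_of_nonpos (by linarith) ?_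
    have : 0 < decay (min s 2) := by
      by_contra hc
      push Not at hc
      nlinarith
    linarith
  have H : IsFlow h s f (C₂ * δ + Cn * (C₂ * δ) ^ q * (C₂ * δ)) u z w :=
    { pos := by positivity
      cont := hw
      deriv_u := hdu
      deriv_z := hdz
      le_u := fun t ht => (hest t ht).2.1.trans
        (ENNReal.ofReal_le_ofReal (le_add_of_nonneg_right (by positivity)))
      le_z := fun t ht => (hest t ht).2.2.1.trans
        (ENNReal.ofReal_le_ofReal (le_add_of_nonneg_right (by positivity)))
      le_w := fun t ht => by
        refine (hN.bound _ hρ hρA (u t) (w t) (htop t ht) (hest t ht).2.2.2).trans ?_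
        refine (mul_le_mul_right (hest t ht).2.1 _).trans ?_
        rw [← ENNReal.ofReal_mul (by positivity)]
        exact ENNReal.ofReal_le_ofReal (le_add_of_nonneg_left hρ.le)
      comp := fun t ht => (hest t ht).2.2.2 }
  have hsol : IsSolution α κ f s u₀ v₀ u (fun t => h.T (z t)) := by
    have := H.isSolution hcc
    rwa [hu0', hz0', hz₀] at this
  refine ⟨u, fun t => h.T (z t), hsol, fun u' v' hsol' t ht => hsol'.unique h hs hf1 hf0 hsol ht,
    fun t ht => ?_, fun t ht => ?_, fun hreg t ht => ?_⟩
  · have h1 : ENNReal.ofReal ((1 + t) ^ mu α κ s) * eLpNorm (u t) ⊤ volume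
        ≤ ENNReal.ofReal (C₂ * δ) := by
      refine (mul_le_mul_right (hest t ht).1 _).trans ?_
      rw [← ENNReal.ofReal_mul (by positivity)]
      refine ENNReal.ofReal_le_ofReal ?_
      -- The rate obtained for the flow is at least `μ`.
      have e : (1 + t) ^ mu α κ s * (1 + t) ^ (-decay (min s 2)) ≤ 1 := by
        rw [← Real.rpow_add (by linarith)]
        exact Real.rpow_le_one_of_one_le_of_nonpos (by linarith) (by linarith)
      calc _ = C₂ * δ * ((1 + t) ^ mu α κ s * (1 + t) ^ (-decay (min s 2))) := by ring
        _ ≤ _ := mul_le_of_le_one_right hρ.le e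
    have h2 : hNorm (s + 1) (h.T (z t)) ≤ ENNReal.ofReal (CT * (C₂ * δ)) := by
      rw [ENNReal.ofReal_mul hCT.le]
      exact (HT s _).trans (mul_le_mul_right (hest t ht).2.2.1 _)
    refine (add_le_add h1 (add_le_add (hest t ht).2.1 h2)).trans ?_
    rw [← ENNReal.ofReal_add (by positivity) (by positivity),
      ← ENNReal.ofReal_add (by positivity) (by positivity)]
    exact ENNReal.ofReal_le_ofReal (le_of_eq (by ring))
  · refine ⟨(H.tendsto_energy hf1 hf0 hρ.le htop ht).1 t ht, ?_⟩
    have := H.energy_eq hf1 hf0 hρ.le htop ht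
    rwa [hu0', hz0', hz₀] at this
  · have hreg' : κ = 0 ∨ hNorm (3 / 2) (u 0) < ⊤ ∧ hNorm (3 / 2) (z 0) < ⊤ := by
      refine hreg.imp id fun hx => ?_
      obtain ⟨x1, x2⟩ := ENNReal.add_lt_top.1 hx
      rw [hu0', hz0']
      exact ⟨x1, (hzr _).trans_lt (ENNReal.mul_lt_top ENNReal.ofReal_lt_top x2)⟩
    have hi := fun t ht => H.integrable_momentumDensity hs hreg' (t := t) ht
    refine ⟨hi t ht, ?_⟩
    have := H.momentum_eq hs hf1 hf0 hρ.le htop hi ht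
    rwa [hu0', hz0', hz₀] at this
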